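/- Fix an integer $r\ge 0$, a finite set $P\subset\mathbb C$, complex numbers $\mu^p_k$ ($p\in P$, $1\le k\le r$) and complex numbers $\xi_k,\mu^\infty_k$ ($1\le k\le r$), and put $D=P\cup\{\infty\}\subset\mathbb{CP}^1$. Assume that these parameters are resonance-free: for $p\in P$ and all $k,m$ with $\mu^p_k\ne0\ne\mu^p_m$ one has $\Re\mu^p_k\notin\mathbb Z$ and $\mu^p_k-\mu^p_m\notin\mathbb Z\setminus\{0\}$; for all $k$ one has $\Re\mu^\infty_k\notin\mathbb Z$, and $\mu^\infty_k-\mu^\infty_m\notin\mathbb Z\setminus\{0\}$ whenever $\xi_k=\xi_m$. At a point $x\in D$ let $z$ be the local coordinate ($z=x-p$ at $p$, $z=1/x$ at $\infty$), and write $(\xi_k,\alpha_k)=(0,\mu^p_k)$ at $p\in P$ and $(\xi_k,\alpha_k)=(\xi_k,-\mu^\infty_k)$ at $\infty$. The category $\mathrm{HP}$. Its objects are holomorphic vector bundles $E$ of rank $r$ on $\mathbb{CP}^1$ with a meromorphic connection $\nabla$ with poles in $D$ such that in suitable local holomorphic frames $$\nabla=d+\operatorname{diag}(\mu^p_k)\frac{dx}{x-p}+\text{holomorphic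 terms near }p\in P,\qquad \nabla=d+\Bigl(A+\frac Cx+O(x^{-2})\Bigr)dx\ \text{ near }\infty,$$ with $A=\operatorname{diag}(\xi_k)$, $C=\operatorname{diag}(\mu^\infty_k)$, together with a decreasing exhaustive filtration $E_x^\bullet$ of each fibre $E_x$, $x\in D$, with weights in $[0,1[$, such that: every $E_x^\beta$ is the sum of its intersections with the eigenspaces of the residue (at $\infty$: with the common eigenspaces of $A$ and $C$); if $\mu_k\neq0$, then $\mu_k$ is not a weight of the filtration on the eigenspace of index $k$; and (admissibility) for $p\in P$ the kernel of the residue injects into $\operatorname{gr}^0E_p$. Morphisms are holomorphic bundle maps compatible with the connections and the filtrations. The category $\mathrm{DMP}$. Its objects are meromorphic bundles with integrable connection $\mathcal M$ (locally free $\mathcal O(*D)$-modules with connection) that admit a lattice of the above type, i.e. $\mathcal M\cong E(*D)$ for some $(E,\nabla)$ with the above singularities, together with a parabolic structure: for $x\in D$ and for each value $\xi$ of the $\xi_k$ at $x$, let $\psi^{\xi,\alpha}_x$ be the generalised $\alpha$-eigenspace of $z\partial_z+\xi/z$ on the formal completion of $\mathcal M$ at $x$ (for $x\in P$, where $\xi=0$,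 it is identified with the generalised eigenspace of the residue on a logarithmic lattice). For all $\alpha\in\mathbb C$ there is given a decreasing exhaustive filtration $\psi_x^{\xi,\alpha,\bullet}$ of $\psi_x^{\xi,\alpha}$ with weights in an interval $[k,k+1[$, $k\in\mathbb Z$, such that $z^N$ maps $\psi_x^{\xi,\alpha,\beta}$ isomorphically onto $\psi_x^{\xi,\alpha+N,\beta+N}$ for $N\in\mathbb Z$; the weights on $\psi_x^{\xi_k,\alpha_k}$ lie in $[0,1[$ and do not include $\mu_k$ if $\mu_k\ne0$; and (admissibility) $\psi^{0,0}_p$ injects into $\operatorname{gr}^0$ for $p\in P$. Morphisms are homomorphisms of $\mathcal D$-modules compatible with the filtrations. Parabolic degrees are $$\operatorname{pdeg}E=\deg E+\sum_{x\in D}\sum_{\beta\in[0,1[}\beta\dim\operatorname{gr}^\beta E_x,\qquad \operatorname{pdeg}\mathcal M=\sum_{x\in D}\sum_\xi\sum_{\alpha}\sum_{\beta\in[0,1[}(\beta-\alpha)\dim\operatorname{gr}^\beta\psi^{\xi,\alpha}_x ,$$ and an object is stable if every $\nabla$-invariant sub-bundle, neither $0$ nor everything, with the induced filtrations has strictly smaller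 slope $\operatorname{pdeg}/\operatorname{rank}$. Then the functor $(E,\nabla)\mapsto E(*D)$, where $E(*D)$ carries the parabolic structure induced by that of $E$ (an element of $\psi_x^{\xi_k,\alpha_k}$ has value at $x$ in the eigenspace of index $k$ of $E_x$, and is filtered according to this value), is an equivalence of categories $\mathrm{HP}\simeq\mathrm{DMP}$, and it restricts to an equivalence between the full subcategories $\mathrm{HP}^{st}_0$ and $\mathrm{DMP}^{st}_0$ of stable objects of parabolic degree $0$. -/

import Mathlib

noncomputable section

namespace ParConn

open Filter Topology CategoryTheory TensorProduct

/-! ### The Riemann sphere -/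

/-- The Riemann sphere `ℂ ∪ {∞}`. -/
abbrev Sphere : Type := OnePoint ℂ

/-- The standard coordinate `x` of a finite point (junk value `0` at `∞`). -/
def aff (y : Sphere) : ℂ := y.elim 0 id

/-- The local coordinate `z` centred at `x`: it is `y - a` at a finite point `a`, and `1 / y` at
`∞`. -/
def coord (x y : Sphere) : ℂ := x.elim (aff y)⁻¹ (fun a => aff y - a)

/-- The factor `c` such that `z ∂_z = c ∂_x` for the local coordinate `z` at `x`: it is `y - a` at
a finite point `a`, and `- y` at `∞`. -/
def eulerFactor (x y : Sphere) : ℂ := x.elim (-(aff y)) (fun a => aff y - a)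

/-- The points of the sphere outside `D`. -/
abbrev Off (D : Set Sphere) : Type := {y : Sphere // y ∉ D}

/-- The neighbourhoods of `x` in the sphere, intersected with the complement of `D`. -/
def near (D : Set Sphere) (x : Sphere) : Filter (Off D) := comap Subtype.val (𝓝 x)

theorem tendsto_coord (x : Sphere) : Tendsto (coord x) (𝓝 x) (𝓝 0) := by
  induction x using OnePoint.rec with
  | infty =>
    rw [OnePoint.nhds_infty_eq, tendsto_sup, tendsto_map'_iff, tendsto_pure_left]
    refine ⟨?_, fun s hs => ?_⟩
    · rw [coclosedCompact_eq_cocompact, ← Metric.cobounded_eq_cocompact]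
      exact tendsto_inv₀_cobounded
    · simpa [coord, aff] using mem_of_mem_nhds hs
  | coe a =>
    rw [OnePoint.nhds_coe_eq, tendsto_map'_iff]
    have : Tendsto (fun y : ℂ => y - a) (𝓝 a) (𝓝 (a - a)) :=
      (continuous_id.sub continuous_const).tendsto a
    rw [sub_self] at this
    exact this

theorem eventually_coord_ne (x : Sphere) : ∀ᶠ y in 𝓝 x, y ≠ x → coord x y ≠ 0 := by
  induction x using OnePoint.rec with
  | infty =>
    rw [OnePoint.nhds_infty_eq, eventually_sup, eventually_map, eventually_pure]
    refine ⟨?_, fun h => (h rfl).elim⟩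
    rw [coclosedCompact_eq_cocompact, ← Metric.cobounded_eq_cocompact]
    filter_upwards [Bornology.eventually_ne_cobounded (0 : ℂ)] with y hy _
    simpa [coord, aff] using hy
  | coe a =>
    rw [OnePoint.nhds_coe_eq, eventually_map]
    refine Eventually.of_forall fun y hy => ?_
    simpa [coord, aff, sub_eq_zero] using hy

theorem tendsto_coord_near (D : Set Sphere) (x : Sphere) :
    Tendsto (fun y : Off D => coord x y) (near D x) (𝓝 0) :=
  (tendsto_coord x).comp tendsto_comap

theorem near_coord_ne {D : Set Sphere} {x : Sphere} (hx : x ∈ D) :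
    ∀ᶠ y : Off D in near D x, coord x y ≠ 0 := by
  filter_upwards [tendsto_comap.eventually (eventually_coord_ne x)] with y hy
  exact hy fun h => y.2 (h ▸ hx)

/-! ### Locally free modules over `𝒪(*D)` -/

/-- The germs at `x`, in the local coordinate, of the functions of `𝒪(*D)`: meromorphic at the
points of `D` and holomorphic elsewhere. -/
def Coef (D : Set Sphere) (x : Sphere) (g : ℂ → ℂ) : Prop :=
  MeromorphicAt g 0 ∧ (x ∉ D → AnalyticAt ℂ g 0)

/-- `e` is a frame near `x₀`: near `x₀` it is a basis of every fibre over the complement of `D`,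
and the sections are the combinations of `e` with coefficients in `𝒪(*D)`. -/
def IsFrame {D : Set Sphere} {r : ℕ} {fib : Off D → Type} [∀ y, AddCommGroup (fib y)]
    [∀ y, Module ℂ (fib y)] (IsSec : (∀ y, fib y) → Sphere → Prop)
    (e : Fin r → ∀ y, fib y) (x₀ : Sphere) : Prop :=
  ∀ᶠ x in 𝓝 x₀,
    (∀ h : x ∉ D, LinearIndependent ℂ (fun i => e i ⟨x, h⟩) ∧
      Submodule.span ℂ (Set.range fun i => e i ⟨x, h⟩) = ⊤) ∧
    ∀ s, IsSec s x ↔ ∃ g : Fin r → ℂ → ℂ, (∀ i, Coef D x (g i)) ∧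
      ∀ᶠ y in near D x, s y = ∑ i, g i (coord x y) • e i y

/-- A locally free sheaf of `𝒪(*D)`-modules of rank `r` on the Riemann sphere. Such a sheaf is
torsion-free and is given here through its sections as functions on the complement of `D`:
`fib y` is the fibre at `y ∉ D`, and `IsSec s x` says that near the point `x` of the sphere (which
may lie in `D`) the function `s` is a section of the sheaf; values far from `x` are irrelevant.
For `D = ∅` this is a holomorphic vector bundle of rank `r` on the Riemann sphere. -/
structure LocFree (D : Set Sphere) (r : ℕ) where
  fib : Off D → Type
  [addCommGroup : ∀ y, AddCommGroup (fib y)]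
  [module : ∀ y, Module ℂ (fib y)]
  IsSec : (∀ y, fib y) → Sphere → Prop
  exists_frame : ∀ x₀, ∃ e : Fin r → ∀ y, fib y, IsFrame IsSec e x₀

attribute [instance] LocFree.addCommGroup LocFree.module

/-- A holomorphic vector bundle of rank `r` on the Riemann sphere. -/
abbrev HolBundle (r : ℕ) : Type 1 := LocFree ∅ r

/-- A point of the sphere, as a point of the base of a holomorphic vector bundle. -/
abbrev pt (x : Sphere) : Off ∅ := ⟨x, Set.notMem_empty x⟩

theorem Coef.add {D : Set Sphere} {x : Sphere} {f g : ℂ → ℂ} (hf : Coef D x f)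
    (hg : Coef D x g) : Coef D x (f + g) :=
  ⟨hf.1.add hg.1, fun h => (hf.2 h).add (hg.2 h)⟩

theorem Coef.mul {D : Set Sphere} {x : Sphere} {f g : ℂ → ℂ} (hf : Coef D x f)
    (hg : Coef D x g) : Coef D x (f * g) :=
  ⟨hf.1.mul hg.1, fun h => (hf.2 h).mul (hg.2 h)⟩

theorem Coef.of_analytic {D : Set Sphere} {x : Sphere} {g : ℂ → ℂ} (hg : AnalyticAt ℂ g 0) :
    Coef D x g := ⟨hg.meromorphicAt, fun _ => hg⟩

namespace LocFree

variable {D : Set Sphere} {r : ℕ} (M : LocFree D r)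

/-- Membership in the sheaf at a single point, through a frame at that point. -/
theorem exists_frame_iff (x : Sphere) : ∃ e : Fin r → ∀ y, M.fib y, ∀ s,
    M.IsSec s x ↔ ∃ g : Fin r → ℂ → ℂ, (∀ i, Coef D x (g i)) ∧
      ∀ᶠ y in near D x, s y = ∑ i, g i (coord x y) • e i y := by
  obtain ⟨e, he⟩ := M.exists_frame x
  exact ⟨e, (Eventually.self_of_nhds he).2⟩

theorem isSec_zero (x : Sphere) : M.IsSec 0 x := by
  obtain ⟨e, he⟩ := M.exists_frame_iff x
  exact (he _).2 ⟨fun _ _ => 0, fun _ => Coef.of_analytic analyticAt_const, by simp⟩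

variable {M}

theorem IsSec.add {s t : ∀ y, M.fib y} {x : Sphere} (hs : M.IsSec s x) (ht : M.IsSec t x) :
    M.IsSec (s + t) x := by
  obtain ⟨e, he⟩ := M.exists_frame_iff x
  obtain ⟨g, hg, hsg⟩ := (he _).1 hs
  obtain ⟨h, hh, hth⟩ := (he _).1 ht
  refine (he _).2 ⟨fun i => g i + h i, fun i => (hg i).add (hh i), ?_⟩
  filter_upwards [hsg, hth] with y h1 h2
  simp [h1, h2, add_smul, Finset.sum_add_distrib]

theorem IsSec.smul {s : ∀ y, M.fib y} {x : Sphere} {f : ℂ → ℂ} (hf : Coef D x f)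
    (hs : M.IsSec s x) : M.IsSec (fun y => f (coord x y) • s y) x := by
  obtain ⟨e, he⟩ := M.exists_frame_iff x
  obtain ⟨g, hg, hsg⟩ := (he _).1 hs
  refine (he _).2 ⟨fun i => f * g i, fun i => hf.mul (hg i), ?_⟩
  filter_upwards [hsg] with y h1
  simp [h1, Finset.smul_sum, mul_smul]

theorem IsSec.congr {s t : ∀ y, M.fib y} {x : Sphere} (hs : M.IsSec s x)
    (h : ∀ᶠ y in near D x, t y = s y) : M.IsSec t x := by
  obtain ⟨e, he⟩ := M.exists_frame_iff x
  obtain ⟨g, hg, hsg⟩ := (he _).1 hs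
  refine (he _).2 ⟨g, hg, ?_⟩
  filter_upwards [hsg, h] with y h1 h2
  rw [h2, h1]

/-- A coefficient near `x` is a coefficient near the neighbouring points. -/
theorem _root_.ParConn.Coef.eventually {D : Set Sphere} {x : Sphere} {g : ℂ → ℂ}
    (hg : Coef D x g) : ∀ᶠ y : Off D in near D x, AnalyticAt ℂ g (coord x y) := by
  by_cases hx : x ∈ D
  · have h := hg.1.eventually_analyticAt
    rw [eventually_nhdsWithin_iff] at h
    filter_upwards [(tendsto_coord_near D x).eventually h, near_coord_ne hx] with y h1 h2
    exact h1 h2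
  · exact (tendsto_coord_near D x).eventually (hg.2 hx).eventually_analyticAt

/-- The sheaf `E(*D)` of meromorphic sections of the holomorphic vector bundle `E` with poles
in `D`: near a point `x` of `D`, a function is a section if its product with some power of the
local coordinate extends to a holomorphic section of `E`. -/
def star (D : Set Sphere) (E : HolBundle r) : LocFree D r where
  fib y := E.fib (pt y)
  IsSec s x := ∃ N : ℕ, (x ∉ D → N = 0) ∧ ∃ s' : ∀ y, E.fib y, E.IsSec s' x ∧
    ∀ᶠ y : Off D in near D x, s' (pt y) = (coord x y) ^ N • s y
  exists_frame x₀ := by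
    obtain ⟨e, he⟩ := E.exists_frame x₀
    refine ⟨fun i y => e i (pt y), ?_⟩
    filter_upwards [he] with x hx
    have hnear : Tendsto (fun y : Off D => pt y) (near D x) (near ∅ x) :=
      tendsto_comap_iff.2 tendsto_comap
    refine ⟨fun h => hx.1 (Set.notMem_empty x), fun s => ⟨?_, ?_⟩⟩
    · rintro ⟨N, hN, s', hs', hss'⟩
      obtain ⟨g, hg, hsg⟩ := (hx.2 s').1 hs'
      have hga : ∀ i, AnalyticAt ℂ (g i) 0 := fun i => (hg i).2 (Set.notMem_empty x)
      refine ⟨fun i => (fun z => (z ^ N)⁻¹) * g i, fun i => ⟨?_, fun h => ?_⟩, ?_⟩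
      · exact ((MeromorphicAt.id 0).pow N).inv.mul (hga i).meromorphicAt
      · rw [hN h]
        simpa using analyticAt_const.mul (hga i)
      · have hne : ∀ᶠ y : Off D in near D x, coord x y ^ N ≠ 0 := by
          by_cases h : x ∈ D
          · filter_upwards [near_coord_ne h] with y hy
            exact pow_ne_zero _ hy
          · simp [hN h]
        filter_upwards [hss', hnear.eventually hsg, hne] with y h1 h2 h3
        have : s y = (coord x y ^ N)⁻¹ • s' (pt y) := by
          rw [h1, smul_smul, inv_mul_cancel₀ h3, one_smul]
        rw [this, h2, Finset.smul_sum]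
        simp [mul_smul]
    · rintro ⟨g, hg, hsg⟩
      by_cases h : x ∈ D
      · choose n hn using fun i => (hg i).1
        refine ⟨∑ i, n i, fun h' => (h' h).elim,
          fun y => ∑ i, (fun z => z ^ (∑ i, n i) * g i z) (coord x y) • e i y, ?_, ?_⟩
        · refine (hx.2 _).2 ⟨fun i z => z ^ (∑ i, n i) * g i z, fun i => ?_,
            Eventually.of_forall fun y => rfl⟩
          apply Coef.of_analytic
          have hi : n i ≤ ∑ i, n i :=
            Finset.single_le_sum (f := n) (fun _ _ => Nat.zero_le _) (Finset.mem_univ i)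
          have : (fun z : ℂ => z ^ (∑ i, n i) * g i z) =
              fun z => z ^ (∑ i, n i - n i) * ((z - 0) ^ n i • g i z) := by
            ext z
            rw [sub_zero, smul_eq_mul, ← mul_assoc, ← pow_add, Nat.sub_add_cancel hi]
          change AnalyticAt ℂ (fun z : ℂ => z ^ (∑ i, n i) * g i z) 0
          rw [this]
          exact (analyticAt_id.pow _).mul (hn i)
        · filter_upwards [hsg] with y hy
          rw [hy, Finset.smul_sum]
          simp [mul_smul]
      · refine ⟨0, fun _ => rfl, fun y => ∑ i, g i (coord x y) • e i y, ?_, ?_⟩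
        · exact (hx.2 _).2 ⟨g, fun i => Coef.of_analytic ((hg i).2 h),
            Eventually.of_forall fun y => rfl⟩
        · filter_upwards [hsg] with y hy
          simp [hy]

/-- The restriction of a function on the sphere to the complement of `D`. -/
def restrict (D : Set Sphere) {E : HolBundle r} (s : ∀ y, E.fib y) : ∀ y, (E.star D).fib y :=
  fun y => s (pt y)

theorem isSec_restrict (D : Set Sphere) {E : HolBundle r} {s : ∀ y, E.fib y} {x : Sphere}
    (hs : E.IsSec s x) : (E.star D).IsSec (restrict D s) x :=
  ⟨0, fun _ => rfl, s, hs, Eventually.of_forall fun y => by simp [restrict]⟩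

/-- A homomorphism of locally free `𝒪(*D)`-modules. -/
@[ext]
structure Hom (M N : LocFree D r) where
  app : ∀ y, M.fib y →ₗ[ℂ] N.fib y
  isSec : ∀ s x, M.IsSec s x → N.IsSec (fun y => app y (s y)) x

/-- The homomorphism `E(*D) → F(*D)` induced by a map of holomorphic bundles `E → F`. -/
def Hom.star (D : Set Sphere) {E F : HolBundle r} (f : Hom E F) : Hom (E.star D) (F.star D) where
  app y := f.app (pt y)
  isSec := by
    rintro s x ⟨N, hN, s', hs', h⟩
    refine ⟨N, hN, _, f.isSec s' x hs', ?_⟩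
    filter_upwards [h] with y hy
    rw [hy]
    exact (f.app (pt y)).map_smul _ _

/-! ### Stalks and formal completions -/

end LocFree

/-- The ring of functions of the local coordinate that are holomorphic near `0`. -/
def analyticSubring : Subring (ℂ → ℂ) where
  carrier := {g | AnalyticAt ℂ g 0}
  mul_mem' := fun h k => h.mul k
  one_mem' := analyticAt_const
  add_mem' := fun h k => h.add k
  zero_mem' := analyticAt_const
  neg_mem' := fun h => h.neg

/-- The ring of functions of the local coordinate that are holomorphic near `0`. -/
def Hol0 : Type := analyticSubring

instance : CommRing Hol0 := inferInstanceAs (CommRing analyticSubring)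

instance : CoeFun Hol0 (fun _ => ℂ → ℂ) := ⟨fun g => g.1⟩

theorem Hol0.analyticAt (g : Hol0) : AnalyticAt ℂ (g : ℂ → ℂ) 0 := g.2

/-- The Taylor series at `0`. -/
def taylor : Hol0 →+* PowerSeries ℂ where
  toFun g := PowerSeries.mk fun n => iteratedDeriv n g 0 / (n.factorial : ℂ)
  map_one' := by
    ext n
    have : (fun _ : ℂ => (1 : ℂ)) = ((1 : Hol0) : ℂ → ℂ) := rfl
    rw [← this]
    simp only [PowerSeries.coeff_mk, iteratedDeriv_const, PowerSeries.coeff_one]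
    split_ifs with h <;> simp [h]
  map_zero' := by
    ext n
    have : (fun _ : ℂ => (0 : ℂ)) = ((0 : Hol0) : ℂ → ℂ) := rfl
    rw [← this]
    simp
  map_add' f g := by
    ext n
    have : ((f : ℂ → ℂ) + (g : ℂ → ℂ)) = ((f + g : Hol0) : ℂ → ℂ) := rfl
    rw [← this]
    simp only [PowerSeries.coeff_mk, map_add]
    rw [iteratedDeriv_add f.analyticAt.contDiffAt g.analyticAt.contDiffAt, add_div]
  map_mul' f g := by
    ext n
    have : ((f : ℂ → ℂ) * (g : ℂ → ℂ)) = ((f * g : Hol0) : ℂ → ℂ) := rfl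
    rw [← this]
    simp only [PowerSeries.coeff_mk, PowerSeries.coeff_mul]
    rw [iteratedDeriv_mul f.analyticAt.contDiffAt g.analyticAt.contDiffAt, Finset.sum_div,
      Finset.Nat.sum_antidiagonal_eq_sum_range_succ_mk]
    refine Finset.sum_congr rfl fun i hi => ?_
    have hi' : i ≤ n := Nat.lt_succ_iff.1 (Finset.mem_range.1 hi)
    rw [Nat.cast_choose ℂ hi']
    have h1 : (n.factorial : ℂ) ≠ 0 := by exact_mod_cast n.factorial_ne_zero
    have h2 : (i.factorial : ℂ) ≠ 0 := by exact_mod_cast i.factorial_ne_zero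
    have h3 : ((n - i).factorial : ℂ) ≠ 0 := by exact_mod_cast (n - i).factorial_ne_zero
    field_simp

theorem coeff_taylor (g : Hol0) (n : ℕ) :
    PowerSeries.coeff n (taylor g) = iteratedDeriv n g 0 / (n.factorial : ℂ) :=
  PowerSeries.coeff_mk n fun n => iteratedDeriv n g 0 / (n.factorial : ℂ)

instance : Algebra Hol0 (LaurentSeries ℂ) :=
  ((HahnSeries.ofPowerSeries ℤ ℂ).comp taylor).toAlgebra

/-- `z d/dz` on formal Laurent series in `z`. -/
def eulerSeries : LaurentSeries ℂ →+ LaurentSeries ℂ where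
  toFun f := ⟨fun n => (n : ℂ) * f.coeff n,
    f.isPWO_support.mono (fun n hn h => hn (by simp [h]))⟩
  map_zero' := by ext n; simp
  map_add' f g := by ext n; simp [mul_add]

theorem eulerSeries_mul (f g : LaurentSeries ℂ) :
    eulerSeries (f * g) = eulerSeries f * g + f * eulerSeries g := by
  ext n
  have hf : (eulerSeries f).support ⊆ f.support := fun n hn h => hn (by simp [eulerSeries, h])
  have hg : (eulerSeries g).support ⊆ g.support := fun n hn h => hn (by simp [eulerSeries, h])
  rw [HahnSeries.coeff_add, HahnSeries.coeff_mul_left' f.isPWO_support hf,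
    HahnSeries.coeff_mul_right' g.isPWO_support hg]
  change (n : ℂ) * (f * g).coeff n = _
  rw [HahnSeries.coeff_mul, Finset.mul_sum, ← Finset.sum_add_distrib]
  refine Finset.sum_congr rfl fun ij h => ?_
  have : ij.1 + ij.2 = n := (Finset.mem_antidiagonal.1 h).2.2
  simp only [eulerSeries, AddMonoidHom.coe_mk, ZeroHom.coe_mk]
  rw [← this]; push_cast; ring

/-- `z d/dz` on holomorphic functions. -/
def Hol0.euler (g : Hol0) : Hol0 := ⟨fun z => z * deriv g z, analyticAt_id.mul g.2.deriv⟩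

theorem taylor_euler (g : Hol0) (n : ℕ) :
    PowerSeries.coeff n (taylor g.euler) = (n : ℂ) * PowerSeries.coeff n (taylor g) := by
  let Z : Hol0 := ⟨fun z => z, analyticAt_id⟩
  let G : Hol0 := ⟨deriv g, g.2.deriv⟩
  have hZ : taylor Z = PowerSeries.X := by
    ext n
    rw [coeff_taylor, PowerSeries.coeff_X]
    change iteratedDeriv n (fun z : ℂ => z) 0 / (n.factorial : ℂ) = _
    rcases n with _ | _ | n
    · simp
    · simp
    · have h1 : deriv (fun z : ℂ => z) = fun _ => 1 := by ext z; simp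
      rw [iteratedDeriv_succ', h1, iteratedDeriv_const]
      simp
  have : g.euler = Z * G := rfl
  rw [this, map_mul, hZ]
  rcases n with _ | n
  · simp
  · rw [PowerSeries.coeff_succ_X_mul]
    rw [coeff_taylor, coeff_taylor]
    change iteratedDeriv n (deriv g) 0 / (n.factorial : ℂ) =
      ((n + 1 : ℕ) : ℂ) * (iteratedDeriv (n + 1) g 0 / ((n + 1).factorial : ℂ))
    rw [iteratedDeriv_succ', Nat.factorial_succ]
    have h1 : (n.factorial : ℂ) ≠ 0 := by exact_mod_cast n.factorial_ne_zero
    have h2 : ((n + 1 : ℕ) : ℂ) ≠ 0 := by exact_mod_cast n.succ_ne_zero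
    push_cast at h2 ⊢
    field_simp

theorem eulerSeries_algebraMap (g : Hol0) :
    eulerSeries (algebraMap Hol0 (LaurentSeries ℂ) g) =
      algebraMap Hol0 (LaurentSeries ℂ) g.euler := by
  ext n
  change (n : ℂ) * (HahnSeries.ofPowerSeries ℤ ℂ (taylor g)).coeff n =
    (HahnSeries.ofPowerSeries ℤ ℂ (taylor g.euler)).coeff n
  rcases n with n | n
  · have h := taylor_euler g n
    rw [Int.ofNat_eq_natCast, HahnSeries.ofPowerSeries_apply_coeff,
      HahnSeries.ofPowerSeries_apply_coeff, h]
    simp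
  · have key : ∀ f : PowerSeries ℂ,
        (HahnSeries.ofPowerSeries ℤ ℂ f).coeff (Int.negSucc n) = 0 := by
      intro f
      rw [HahnSeries.ofPowerSeries_apply]
      apply HahnSeries.embDomain_of_notMem_range
      simp
    rw [key, key, mul_zero]

namespace LocFree

variable {D : Set Sphere} {r : ℕ} (M : LocFree D r)

/-- Functions on the complement of `D` with values in the fibres, on which a holomorphic function
`g` of the local coordinate at `x` acts by multiplication. -/
def Fields (_x : Sphere) : Type := ∀ y, M.fib y

instance (x : Sphere) : AddCommGroup (M.Fields x) := inferInstanceAs (AddCommGroup (∀ y, M.fib y))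

instance (x : Sphere) : Module Hol0 (M.Fields x) where
  smul g s := fun y => g (coord x y) • s y
  one_smul s := funext fun y => one_smul ℂ (s y)
  mul_smul g h s := funext fun y => mul_smul (g (coord x y)) (h (coord x y)) (s y)
  smul_zero g := funext fun y => smul_zero (g (coord x y))
  smul_add g s t := funext fun y => smul_add (g (coord x y)) (s y) (t y)
  add_smul g h s := funext fun y => add_smul (g (coord x y)) (h (coord x y)) (s y)
  zero_smul s := funext fun y => zero_smul ℂ (s y)

/-- The functions that are sections of the sheaf near `x`. -/
def secAt (x : Sphere) : Submodule Hol0 (M.Fields x) where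
  carrier := {s | M.IsSec s x}
  add_mem' hs ht := IsSec.add hs ht
  zero_mem' := M.isSec_zero x
  smul_mem' g _ hs := IsSec.smul (Coef.of_analytic g.analyticAt) hs

/-- The functions that vanish near `x`. -/
def nullAt (x : Sphere) : Submodule Hol0 (M.secAt x) where
  carrier := {s | ∀ᶠ y in near D x, s.1 y = 0}
  add_mem' {s t} hs ht := by
    have h : ∀ᶠ y in near D x, s.1 y + t.1 y = 0 := by
      have hs' : ∀ᶠ y in near D x, s.1 y = 0 := hs
      have ht' : ∀ᶠ y in near D x, t.1 y = 0 := ht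
      filter_upwards [hs', ht'] with y h1 h2
      rw [h1, h2, add_zero]
    exact h
  zero_mem' := by
    have h : ∀ᶠ y in near D x, (0 : ∀ y, M.fib y) y = 0 := Eventually.of_forall fun _ => rfl
    exact h
  smul_mem' g s hs := by
    have h : ∀ᶠ y : Off D in near D x, g (coord x y) • s.1 y = 0 := by
      have hs' : ∀ᶠ y in near D x, s.1 y = 0 := hs
      filter_upwards [hs'] with y h1
      rw [h1, smul_zero]
    exact h

/-- The stalk of the sheaf at `x`: the module of germs of sections. -/
abbrev Stalk (x : Sphere) : Type := M.secAt x ⧸ M.nullAt x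

variable {M} in
/-- The germ of a section. -/
def germ {x : Sphere} (s : ∀ y, M.fib y) (hs : M.IsSec s x) : M.Stalk x :=
  (M.nullAt x).mkQ ⟨s, hs⟩

/-- The formal completion of the sheaf at `x`, a vector space over the field of formal Laurent
series in the local coordinate `z`. -/
def Hat (x : Sphere) : Type := LaurentSeries ℂ ⊗[Hol0] M.Stalk x

instance (x : Sphere) : AddCommGroup (M.Hat x) :=
  inferInstanceAs (AddCommGroup (LaurentSeries ℂ ⊗[Hol0] M.Stalk x))

instance (x : Sphere) : Module (LaurentSeries ℂ) (M.Hat x) :=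
  inferInstanceAs (Module (LaurentSeries ℂ) (LaurentSeries ℂ ⊗[Hol0] M.Stalk x))

instance (x : Sphere) : Module ℂ (M.Hat x) :=
  Module.compHom (M.Hat x) (HahnSeries.C : ℂ →+* LaurentSeries ℂ)

variable {M} in
/-- The element `f ⊗ m` of the formal completion. -/
def tmul {x : Sphere} (f : LaurentSeries ℂ) (m : M.Stalk x) : M.Hat x := f ⊗ₜ[Hol0] m

/-- Multiplication by `z ^ N` on the formal completion. -/
def zpow (x : Sphere) (N : ℤ) : Module.End ℂ (M.Hat x) where
  toFun m := (HahnSeries.single N (1 : ℂ) : LaurentSeries ℂ) • m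
  map_add' m n := smul_add _ m n
  map_smul' c m := smul_comm (HahnSeries.single N (1 : ℂ) : LaurentSeries ℂ)
    (HahnSeries.C c : LaurentSeries ℂ) m

variable {M} {N : LocFree D r}

/-- The map of stalks induced by a homomorphism. -/
def Hom.stalk (f : Hom M N) (x : Sphere) : M.Stalk x →ₗ[Hol0] N.Stalk x :=
  Submodule.mapQ _ _
    { toFun := fun s => (⟨fun y => f.app y (s.1 y), f.isSec s.1 x s.2⟩ : N.secAt x)
      map_add' := fun s t => Subtype.ext (funext fun y => (f.app y).map_add (s.1 y) (t.1 y))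
      map_smul' := fun g s =>
        Subtype.ext (funext fun y => (f.app y).map_smul (g (coord x y)) (s.1 y)) }
    (by
      intro s hs
      change ∀ᶠ y in near D x, f.app y (s.1 y) = 0
      filter_upwards [show ∀ᶠ y in near D x, s.1 y = 0 from hs] with y h
      rw [h, map_zero])

/-- The map of formal completions induced by a homomorphism. -/
def Hom.hat (f : Hom M N) (x : Sphere) : M.Hat x →ₗ[ℂ] N.Hat x where
  toFun := AlgebraTensorModule.lTensor (LaurentSeries ℂ) (LaurentSeries ℂ) (f.stalk x)
  map_add' m n := map_add
    (AlgebraTensorModule.lTensor (LaurentSeries ℂ) (LaurentSeries ℂ) (f.stalk x)) m n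
  map_smul' c m := map_smul
    (AlgebraTensorModule.lTensor (LaurentSeries ℂ) (LaurentSeries ℂ) (f.stalk x))
    (HahnSeries.C c : LaurentSeries ℂ) m

/-- The identity homomorphism. -/
def Hom.id (M : LocFree D r) : Hom M M := ⟨fun _ => LinearMap.id, fun _ _ h => h⟩

/-- The composition of homomorphisms, first `f`, then `g`. -/
def Hom.comp {L : LocFree D r} (f : Hom L M) (g : Hom M N) : Hom L N :=
  ⟨fun y => (g.app y).comp (f.app y), fun _ x h => g.isSec _ x (f.isSec _ x h)⟩

theorem Hom.hat_id (M : LocFree D r) (x : Sphere) : (Hom.id M).hat x = LinearMap.id := by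
  refine LinearMap.ext fun m => ?_
  have h : (Hom.id M).stalk x = LinearMap.id := by
    refine LinearMap.ext fun s => ?_
    obtain ⟨s, rfl⟩ := Submodule.mkQ_surjective _ s
    rfl
  change AlgebraTensorModule.lTensor (LaurentSeries ℂ) (LaurentSeries ℂ)
    ((Hom.id M).stalk x) m = m
  rw [h, AlgebraTensorModule.lTensor_id]
  rfl

theorem Hom.hat_comp {L : LocFree D r} (f : Hom L M) (g : Hom M N) (x : Sphere) :
    (f.comp g).hat x = (g.hat x).comp (f.hat x) := by
  refine LinearMap.ext fun m => ?_
  have h : (f.comp g).stalk x = (g.stalk x).comp (f.stalk x) := by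
    refine LinearMap.ext fun s => ?_
    obtain ⟨s, rfl⟩ := Submodule.mkQ_surjective _ s
    rfl
  change AlgebraTensorModule.lTensor (LaurentSeries ℂ) (LaurentSeries ℂ)
    ((f.comp g).stalk x) m = _
  rw [h, AlgebraTensorModule.lTensor_comp]
  rfl

/-! ### Sub-bundles and degree -/

/-- A frame near `x₀` of the family of subspaces `W`: sections with values in `W` that are a basis
of `W y` for all `y` near `x₀`. -/
def IsSubframe (M : LocFree D r) {s : ℕ} (W : ∀ y, Submodule ℂ (M.fib y))
    (f : Fin s → ∀ y, W y) (x₀ : Sphere) : Prop :=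
  (∀ i, M.IsSec (fun y => (f i y : M.fib y)) x₀) ∧
  ∀ᶠ y in near D x₀, LinearIndependent ℂ (fun i => f i y) ∧
    Submodule.span ℂ (Set.range fun i => f i y) = ⊤

/-- The family of subspaces `W` is a sub-bundle of rank `s`. -/
def IsSubbundle (M : LocFree D r) (s : ℕ) (W : ∀ y, Submodule ℂ (M.fib y)) : Prop :=
  ∀ x₀, ∃ f : Fin s → ∀ y, W y, M.IsSubframe W f x₀

/-- `d` is the degree of the holomorphic sub-bundle `W` of rank `s` of `E`: there is a meromorphic
section `ω`, not identically zero, of the dual of the line bundle `det W = Λˢ W`, with zeros and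
poles given by the divisor `v`, and `d` is minus the degree of `v`. -/
def IsDegree (E : HolBundle r) (s : ℕ) (W : ∀ y, Submodule ℂ (E.fib y)) (d : ℤ) : Prop :=
  ∃ (ω : ∀ y, (W y) [⋀^Fin s]→ₗ[ℂ] ℂ) (v : Sphere →₀ ℤ),
    (∀ x, ∃ f : Fin s → ∀ y, W y, E.IsSubframe W f x ∧ ∃ h : ℂ → ℂ, MeromorphicAt h 0 ∧
      meromorphicOrderAt h 0 = (v x : WithTop ℤ) ∧
      ∀ᶠ y in 𝓝[≠] x, ω (pt y) (fun i => f i (pt y)) = h (coord x y)) ∧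
    d = - v.sum fun _ k => k

open Classical in
/-- The degree of the holomorphic sub-bundle `W` of rank `s` of `E`, that is, the degree of its
determinant line bundle. -/
def degree (E : HolBundle r) (s : ℕ) (W : ∀ y, Submodule ℂ (E.fib y)) : ℤ :=
  if h : ∃ d, E.IsDegree s W d then h.choose else 0

end LocFree

/-! ### Filtrations -/

/-- `F` is a decreasing exhaustive filtration of `V` (a subspace of an ambient space) with weights
in the interval `[k, k + 1[`. The filtration is continued to all real indices as usual: it is
constant between the weights, and continuous from the left. -/
structure IsFiltration {U : Type} [AddCommGroup U] [Module ℂ U] (V : Submodule ℂ U) (k : ℤ)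
    (F : ℝ → Submodule ℂ U) : Prop where
  antitone : Antitone F
  leftCont : ∀ β, F β = ⨅ γ < β, F γ
  eq_top : ∀ β : ℝ, β ≤ k → F β = V
  eq_bot : ∀ β : ℝ, k + 1 ≤ β → F β = ⊥

/-- The dimension of the graded piece `gr^β = F^β / F^{>β}`. -/
def grDim {U : Type} [AddCommGroup U] [Module ℂ U] (F : ℝ → Submodule ℂ U) (β : ℝ) : ℕ :=
  Module.finrank ℂ (F β ⧸ (⨆ γ > β, F γ).submoduleOf (F β))

/-! ### Singularity parameters and connections -/

/-- The parameters of the singularities: the rank `r`, the set `P` of logarithmic singularities at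
finite distance, the eigenvalues `μ p k` of the residue at `p ∈ P`, and the diagonal entries `ξ k`
and `μ∞ k` of the matrices `A` and `C` of the polar part at infinity. -/
structure SingData where
  r : ℕ
  P : Finset ℂ
  μ : ℂ → Fin r → ℂ
  ξ : Fin r → ℂ
  μinf : Fin r → ℂ

namespace SingData

variable (S : SingData)

/-- The singular set `P ∪ {∞}`. -/
def D : Set Sphere := {x | x = OnePoint.infty ∨ ∃ p ∈ S.P, x = (p : Sphere)}

/-- The parameters `μ` at a singular point. -/
def mu (x : Sphere) : Fin S.r → ℂ := x.elim S.μinf S.μ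

/-- The parameters `ξ` at a singular point: zero at finite distance. -/
def fac (x : Sphere) : Fin S.r → ℂ := x.elim S.ξ (fun _ _ => 0)

/-- The eigenvalues of the residue with respect to the local coordinate `z` at a singular point.
At infinity `C dx / x = - C dz / z`. -/
def expn (x : Sphere) : Fin S.r → ℂ := x.elim (fun k => - S.μinf k) S.μ

/-- The distinct values `ξ_l` at a singular point. -/
def facs (x : Sphere) : Finset ℂ := Finset.univ.image (S.fac x)

/-- The resonance-freeness conditions on the parameters. (The remaining condition, which involves
the parabolic weights, is part of the definition of the categories.) -/
structure ResonanceFree : Prop where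
  re_fin : ∀ p ∈ S.P, ∀ k, S.μ p k ≠ 0 → ∀ n : ℤ, (S.μ p k).re ≠ n
  sub_fin : ∀ p ∈ S.P, ∀ k m, S.μ p k ≠ 0 → S.μ p m ≠ 0 → ∀ n : ℤ, n ≠ 0 →
    S.μ p k - S.μ p m ≠ n
  re_inf : ∀ k, ∀ n : ℤ, (S.μinf k).re ≠ n
  sub_inf : ∀ k m, S.ξ k = S.ξ m → ∀ n : ℤ, n ≠ 0 → S.μinf k - S.μinf m ≠ n

theorem infty_mem : OnePoint.infty ∈ S.D := Or.inl rfl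

theorem coe_aff (y : Off S.D) : ((aff y : ℂ) : Sphere) = y := by
  obtain ⟨y, hy⟩ := y
  induction y using OnePoint.rec with
  | infty => exact (hy S.infty_mem).elim
  | coe a => rfl

end SingData

/-- A connection on a locally free `𝒪(*D)`-module, where `D` contains `∞`, given by the action
`del` of `∂_x` on local sections. -/
structure Conn {D : Set Sphere} {r : ℕ} (M : LocFree D r) where
  del : (∀ y, M.fib y) → ∀ y, M.fib y
  add : ∀ (y : Off D) (s t : ∀ y, M.fib y), M.IsSec s y → M.IsSec t y →
    del (s + t) y = del s y + del t y
  leibniz : ∀ (y : Off D) (g : ℂ → ℂ) (s : ∀ y, M.fib y), AnalyticAt ℂ g 0 → M.IsSec s y →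
    del (fun y' => g (coord y y') • s y') y = deriv g 0 • s y + g 0 • del s y
  isSec : ∀ (x : Sphere) (s : ∀ y, M.fib y), M.IsSec s x → M.IsSec (del s) x

/-- A meromorphic bundle with (integrable) connection, with poles in `P ∪ {∞}`. -/
structure Flat (S : SingData) where
  bdl : LocFree S.D S.r
  conn : Conn bdl

/-- A morphism of meromorphic bundles with connection: a homomorphism of sheaves of modules over
the differential operators, that is, an `𝒪(*D)`-linear one that commutes with `∂_x`. -/
@[ext]
structure FlatHom {S : SingData} (M N : Flat S) extends LocFree.Hom M.bdl N.bdl where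
  comm : ∀ (y : Off S.D) (s : ∀ y, M.bdl.fib y), M.bdl.IsSec s y →
    N.conn.del (fun y => app y (s y)) y = app y (M.conn.del s y)

instance (S : SingData) : Category (Flat S) where
  Hom M N := FlatHom M N
  id M := { LocFree.Hom.id M.bdl with comm := fun _ _ _ => rfl }
  comp {L M N} f g :=
    { LocFree.Hom.comp f.toHom g.toHom with
      comm := fun y s hs =>
        (g.comm y _ (f.isSec s y hs)).trans (congrArg (g.app y) (f.comm y s hs)) }

theorem eventually_near_near {D : Set Sphere} {x : Sphere} {p : Off D → Prop}
    (h : ∀ᶠ y in near D x, p y) : ∀ᶠ y : Off D in near D x, ∀ᶠ y' in near D y, p y' := by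
  rw [near, eventually_comap] at h
  filter_upwards [tendsto_comap.eventually (eventually_eventually_nhds.2 h)] with y hy
  rw [near, eventually_comap]
  exact hy

/-- The coordinate at `x` as a function of the coordinate at the finite point `y`. -/
def shift (x y : Sphere) (w : ℂ) : ℂ := coord x ((aff y + w : ℂ) : Sphere)

theorem coord_eq_shift {S : SingData} (x : Sphere) (y y' : Off S.D) :
    coord x y' = shift x y (coord y y') := by
  have h : coord (y : Sphere) y' = aff y' - aff y := by
    conv_lhs => rw [← S.coe_aff y]
    rfl
  rw [shift, h, add_sub_cancel, S.coe_aff]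

theorem shift_zero {S : SingData} (x : Sphere) (y : Off S.D) : shift x y 0 = coord x y := by
  rw [shift, add_zero, S.coe_aff]

theorem hasDerivAt_shift {S : SingData} (x : Sphere) :
    ∀ᶠ y : Off S.D in near S.D x, AnalyticAt ℂ (shift x y) 0 ∧
      eulerFactor x y * deriv (shift x y) 0 = coord x y := by
  induction x using OnePoint.rec with
  | infty =>
    filter_upwards [near_coord_ne S.infty_mem] with y hy
    have hy' : aff y ≠ 0 := by simpa [coord] using hy
    have h1 : HasDerivAt (fun w : ℂ => aff y + w) 1 0 := (hasDerivAt_id 0).const_add _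
    have h2 : HasDerivAt (fun w : ℂ => (aff y + w)⁻¹) (-1 / (aff y + 0) ^ 2) 0 :=
      h1.fun_inv (by simpa using hy')
    have h3 : shift OnePoint.infty y = fun w : ℂ => (aff y + w)⁻¹ := rfl
    rw [h3, h2.deriv]
    refine ⟨(analyticAt_const.add analyticAt_id).inv (by simpa using hy'), ?_⟩
    change -(aff y) * (-1 / (aff y + 0) ^ 2) = (aff y)⁻¹
    rw [add_zero]
    field_simp
  | coe a =>
    refine Eventually.of_forall fun y => ?_
    have h3 : shift (a : Sphere) y = fun w : ℂ => aff y + w - a := rfl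
    have h1 : HasDerivAt (fun w : ℂ => aff y + w - a) 1 0 :=
      ((hasDerivAt_id 0).const_add _).sub_const _
    rw [h3, h1.deriv]
    exact ⟨(analyticAt_const.add analyticAt_id).sub analyticAt_const, mul_one _⟩

/-- A section near `x` is a section near the neighbouring points. -/
theorem isSec_eventually {S : SingData} {M : LocFree S.D S.r} {s : ∀ y, M.fib y}
    {x : Sphere} (hs : M.IsSec s x) : ∀ᶠ y : Off S.D in near S.D x, M.IsSec s y := by
  obtain ⟨e, he⟩ := M.exists_frame x
  obtain ⟨g, hg, hsg⟩ := ((Eventually.self_of_nhds he).2 s).1 hs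
  have hga : ∀ᶠ y : Off S.D in near S.D x, ∀ i, AnalyticAt ℂ (g i) (coord x y) :=
    eventually_all.2 fun i => (hg i).eventually
  filter_upwards [tendsto_comap.eventually he, eventually_near_near hsg, hga,
    hasDerivAt_shift x] with y h1 h2 h3 h4
  refine (h1.2 s).2 ⟨fun i => g i ∘ shift x y, fun i => Coef.of_analytic ?_, ?_⟩
  · refine AnalyticAt.comp ?_ h4.1
    rw [shift_zero]
    exact h3 i
  · filter_upwards [h2] with y' h
    rw [h]
    simp only [Function.comp, ← coord_eq_shift]

namespace Flat

variable {S : SingData} (M : Flat S)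

theorem del_zero (y : Off S.D) {s : ∀ y, M.bdl.fib y} (h : ∀ᶠ y' in near S.D y, s y' = 0) :
    M.conn.del s y = 0 := by
  classical
  have hs : M.bdl.IsSec s y := (M.bdl.isSec_zero y).congr h
  let g : ℂ → ℂ := fun w =>
    if ∀ h : ((aff y + w : ℂ) : Sphere) ∉ S.D, s ⟨_, h⟩ = 0 then 0 else 1
  have hc : ∀ y' : Off S.D, (aff y + coord (y : Sphere) y' : ℂ) = aff y' := by
    intro y'
    have h : coord (y : Sphere) y' = aff y' - aff y := by
      conv_lhs => rw [← S.coe_aff y]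
      rfl
    rw [h, add_sub_cancel]
  have hg : ∀ᶠ w in 𝓝 (0 : ℂ), g w = 0 := by
    have ht : Tendsto (fun w : ℂ => ((aff y + w : ℂ) : Sphere)) (𝓝 0) (𝓝 (y : Sphere)) := by
      have : Continuous fun w : ℂ => ((aff y + w : ℂ) : Sphere) :=
        OnePoint.continuous_coe.comp (continuous_const.add continuous_id)
      have h0 := this.tendsto 0
      rwa [add_zero, S.coe_aff] at h0
    rw [near, eventually_comap] at h
    filter_upwards [ht.eventually h] with w hw
    exact if_pos fun h' => hw ⟨_, h'⟩ rfl
  have hga : AnalyticAt ℂ g 0 :=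
    (analyticAt_const (v := (0 : ℂ))).congr (by filter_upwards [hg] with w hw; exact hw.symm)
  have hgs : (fun y' : Off S.D => g (coord y y') • s y') = s := by
    funext y'
    by_cases h0 : s y' = 0
    · rw [h0, smul_zero]
    · have : g (coord y y') = 1 := by
        refine if_neg fun hall => h0 ?_
        have key : ∀ (z : Sphere) (hz : z = y') (h : z ∉ S.D), s ⟨z, h⟩ = 0 → s y' = 0 := by
          rintro z rfl h hz
          exact hz
        have hz : ((aff y + coord (y : Sphere) y' : ℂ) : Sphere) = y' := by
          rw [hc, S.coe_aff]
        have hD : ((aff y + coord (y : Sphere) y' : ℂ) : Sphere) ∉ S.D := by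
          rw [hz]; exact y'.2
        exact key _ hz hD (hall hD)
      rw [this, one_smul]
  have h1 := M.conn.leibniz y g s hga hs
  have h2 : deriv g 0 = 0 := by
    have : g =ᶠ[𝓝 0] fun _ => 0 := hg
    rw [this.deriv_eq, deriv_const]
  rw [hgs, h2, hg.self_of_nhds, zero_smul, zero_smul, add_zero] at h1
  exact h1

theorem coef_eulerFactor (x : Sphere) : ∃ g : ℂ → ℂ, Coef S.D x g ∧
    ∀ y : Off S.D, eulerFactor x y = g (coord x y) := by
  induction x using OnePoint.rec with
  | infty =>
    refine ⟨fun z => -z⁻¹, ⟨(MeromorphicAt.id 0).inv.neg, fun h => (h S.infty_mem).elim⟩,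
      fun y => ?_⟩
    change -(aff y) = -((aff y)⁻¹)⁻¹
    rw [inv_inv]
  | coe a => exact ⟨fun z => z, Coef.of_analytic analyticAt_id, fun y => rfl⟩

/-- The action of `z ∂_z` on functions, where `z` is the local coordinate at `x`. -/
def eulerField (x : Sphere) (s : ∀ y, M.bdl.fib y) : ∀ y, M.bdl.fib y :=
  fun y => eulerFactor x y • M.conn.del s y

theorem isSec_eulerField {x : Sphere} {s : ∀ y, M.bdl.fib y} (hs : M.bdl.IsSec s x) :
    M.bdl.IsSec (M.eulerField x s) x := by
  obtain ⟨g, hg, h⟩ := coef_eulerFactor (S := S) x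
  refine ((M.conn.isSec x s hs).smul hg).congr (Eventually.of_forall fun y => ?_)
  rw [eulerField, h]

theorem germ_eq {x : Sphere} {s t : ∀ y, M.bdl.fib y} (hs : M.bdl.IsSec s x)
    (ht : M.bdl.IsSec t x) (h : ∀ᶠ y in near S.D x, s y = t y) :
    LocFree.germ s hs = LocFree.germ t ht := by
  refine (Submodule.Quotient.eq _).2 ?_
  have h' : ∀ᶠ y in near S.D x, s y - t y = 0 := by
    filter_upwards [h] with y hy
    rw [hy, sub_self]
  exact h'

/-- The action of `z ∂_z` on the germs at `x`, where `z` is the local coordinate. -/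
def stalkEuler (x : Sphere) : M.bdl.Stalk x →+ M.bdl.Stalk x :=
  QuotientAddGroup.lift (M.bdl.nullAt x).toAddSubgroup
    (AddMonoidHom.mk' (fun s : M.bdl.secAt x =>
        LocFree.germ (M.eulerField x s.1) (M.isSec_eulerField s.2)) (by
      intro s t
      refine (M.germ_eq _ ((M.isSec_eulerField s.2).add (M.isSec_eulerField t.2)) ?_).trans rfl
      filter_upwards [isSec_eventually s.2, isSec_eventually t.2] with y h1 h2
      have := M.conn.add y s.1 t.1 h1 h2
      change eulerFactor x y • M.conn.del (s.1 + t.1) y =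
        eulerFactor x y • M.conn.del s.1 y + eulerFactor x y • M.conn.del t.1 y
      rw [← smul_add]
      exact congrArg _ this))
    (by
      intro s hs
      have hs' : ∀ᶠ y in near S.D x, s.1 y = 0 := hs
      refine (M.germ_eq (M.isSec_eulerField s.2) (M.bdl.isSec_zero x) ?_).trans rfl
      filter_upwards [eventually_near_near hs'] with y h
      change eulerFactor x y • M.conn.del s.1 y = 0
      rw [M.del_zero y h, smul_zero])

theorem stalkEuler_smul (x : Sphere) (g : Hol0) (m : M.bdl.Stalk x) :
    M.stalkEuler x (g • m) = g.euler • m + g • M.stalkEuler x m := by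
  obtain ⟨s, rfl⟩ := Submodule.mkQ_surjective _ m
  refine (M.germ_eq (M.isSec_eulerField (g • s).2)
    ((s.2.smul (Coef.of_analytic g.euler.analyticAt)).add
      ((M.isSec_eulerField s.2).smul (Coef.of_analytic g.analyticAt))) ?_).trans rfl
  have hga : ∀ᶠ y : Off S.D in near S.D x, AnalyticAt ℂ g (coord x y) :=
    (Coef.of_analytic g.analyticAt).eventually
  filter_upwards [isSec_eventually s.2, hga, hasDerivAt_shift x] with y h1 h2 h3
  have h2' : AnalyticAt ℂ g (shift x y 0) := by rwa [shift_zero]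
  have h4 := M.conn.leibniz y (fun w => g (shift x y w)) s.1 (h2'.comp h3.1) h1
  have h5 : deriv (fun w => g (shift x y w)) 0 = deriv g (coord x y) * deriv (shift x y) 0 := by
    have := deriv_comp (h₂ := (g : ℂ → ℂ)) (h := shift x y) (0 : ℂ) h2'.differentiableAt
      h3.1.differentiableAt
    rw [shift_zero] at this
    exact this
  have h6 : (fun y' : Off S.D => g (shift x y (coord y y')) • s.1 y') = (g • s).1 := by
    funext y'
    rw [← coord_eq_shift]
    rfl
  rw [h6, h5, shift_zero] at h4
  change eulerFactor x y • M.conn.del (g • s).1 y =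
    (coord x y * deriv g (coord x y)) • s.1 y + g (coord x y) • (eulerFactor x y • M.conn.del s.1 y)
  rw [h4, smul_add, smul_smul, smul_comm (eulerFactor x y) (g (coord x y)), ← h3.2]
  congr 2
  ring

/-- The action of `z ∂_z` on the formal completion at `x`. -/
def hatEuler (x : Sphere) : Module.End ℂ (M.bdl.Hat x) :=
  let Φ : LaurentSeries ℂ ⊗[Hol0] M.bdl.Stalk x →+ LaurentSeries ℂ ⊗[Hol0] M.bdl.Stalk x :=
    TensorProduct.liftAddHom
      (AddMonoidHom.mk' (fun f => AddMonoidHom.mk'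
          (fun m => eulerSeries f ⊗ₜ[Hol0] m + f ⊗ₜ[Hol0] M.stalkEuler x m)
          (fun m n => by rw [map_add, tmul_add, tmul_add]; abel))
        (fun f g => by
          ext m
          simp only [AddMonoidHom.mk'_apply, AddMonoidHom.add_apply]
          rw [map_add, add_tmul, add_tmul]; abel))
      (fun g f m => by
        simp only [AddMonoidHom.mk'_apply]
        rw [Algebra.smul_def, eulerSeries_mul, eulerSeries_algebraMap, stalkEuler_smul, add_tmul,
          tmul_add, ← Algebra.smul_def, ← Algebra.smul_def, ← Algebra.smul_def,
          TensorProduct.smul_tmul g.euler f m, TensorProduct.smul_tmul g (eulerSeries f) m,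
          TensorProduct.smul_tmul g f (M.stalkEuler x m)]
        abel)
  { toFun := Φ
    map_add' := fun m n => Φ.map_add m n
    map_smul' := fun c m => by
      change Φ ((HahnSeries.C c : LaurentSeries ℂ) • m) = (HahnSeries.C c : LaurentSeries ℂ) • Φ m
      have hC : eulerSeries (HahnSeries.C c : LaurentSeries ℂ) = 0 := by
        ext n
        change (n : ℂ) * (HahnSeries.C c : LaurentSeries ℂ).coeff n = 0
        by_cases hn : n = 0
        · simp [hn]
        · rw [HahnSeries.C_apply, HahnSeries.coeff_single_of_ne hn, mul_zero]
      refine TensorProduct.induction_on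
        (motive := fun m => Φ ((HahnSeries.C c : LaurentSeries ℂ) • m) =
          (HahnSeries.C c : LaurentSeries ℂ) • Φ m) m ?_ ?_ ?_
      · simp
      · intro f m
        change eulerSeries (HahnSeries.C c * f) ⊗ₜ[Hol0] m +
          (HahnSeries.C c * f) ⊗ₜ[Hol0] M.stalkEuler x m =
          (HahnSeries.C c : LaurentSeries ℂ) • (eulerSeries f ⊗ₜ[Hol0] m +
            f ⊗ₜ[Hol0] M.stalkEuler x m)
        rw [eulerSeries_mul, hC, zero_mul, zero_add, smul_add]
        rfl
      · intro m n hm hn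
        rw [smul_add, map_add, map_add, hm, hn, smul_add] }

/-- The space `ψ^α` at the singular point `x`, for the summand of the formal connection with
exponential factor given by `ξ`: the generalised `α`-eigenspace of `z ∂_z + ξ / z` on the formal
completion. At infinity, where `x = 1 / z`, this operator is the action of `z ∂_z` for the
connection `∇ - ξ dx`. At a regular singularity one has `ξ = 0`, and `ψ^α` is mapped isomorphically
onto the generalised `α`-eigenspace of the residue on every logarithmic lattice on which no two
eigenvalues of the residue differ by a non-zero integer and `α` is one of them. -/
def psi (x : Sphere) (ξ α : ℂ) : Submodule ℂ (M.bdl.Hat x) :=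
  Module.End.maxGenEigenspace (M.hatEuler x + ξ • M.bdl.zpow x (-1)) α

/-- The family of subspaces `W` is invariant under the connection. -/
def Invariant (W : ∀ y, Submodule ℂ (M.bdl.fib y)) : Prop :=
  ∀ (y : Off S.D) (s : ∀ y, M.bdl.fib y), M.bdl.IsSec s y →
    (∀ᶠ y' in near S.D y, s y' ∈ W y') → M.conn.del s y ∈ W y

/-- The formal completion at `x` of a sub-bundle, as a subspace of the one of `M`. -/
def subHat (W : ∀ y, Submodule ℂ (M.bdl.fib y)) (x : Sphere) : Submodule ℂ (M.bdl.Hat x) :=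
  Submodule.span ℂ {m | ∃ (f : LaurentSeries ℂ) (s : ∀ y, M.bdl.fib y) (hs : M.bdl.IsSec s x),
    (∀ᶠ y in near S.D x, s y ∈ W y) ∧ m = LocFree.tmul f (LocFree.germ s hs)}

end Flat

/-! ### Holomorphic bundles with meromorphic connection -/

/-- A holomorphic vector bundle `E` on the Riemann sphere with a meromorphic connection with poles
in `P ∪ {∞}`, that is, a connection on `E(*D)`. -/
structure HolConn (S : SingData) where
  bdl : HolBundle S.r
  conn : Conn (bdl.star S.D)

namespace HolConn

variable {S : SingData} (E : HolConn S)

/-- The associated meromorphic bundle with connection `E(*D)`. -/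
def toFlat : Flat S := ⟨E.bdl.star S.D, E.conn⟩

/-- The action of `∂_x` on a holomorphic section `s`, outside the singular set. -/
def del (s : ∀ y, E.bdl.fib y) (y : Off S.D) : E.bdl.fib (pt y) :=
  E.conn.del (LocFree.restrict S.D s) y

/-- The singularities of the connection are those prescribed by the parameters: near `p ∈ P` it is
`d + A dx / (x - p) + holomorphic terms` in some holomorphic frame, with `A = diag (μ p k)`, and
near `∞` it is `d + (A + C / x + O(x⁻²)) dx` in some holomorphic frame, with `A = diag (ξ k)` and
`C = diag (μ∞ k)`. -/
structure HasType : Prop where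
  log : ∀ p ∈ S.P, ∃ e : Fin S.r → ∀ y, E.bdl.fib y, IsFrame E.bdl.IsSec e (p : Sphere) ∧
    ∃ G : Fin S.r → Fin S.r → ℂ → ℂ, (∀ i k, AnalyticAt ℂ (G i k) 0) ∧
      ∀ k, ∀ᶠ y : Off S.D in near S.D (p : Sphere), E.del (e k) y =
        (S.μ p k / (aff y - p)) • e k (pt y) + ∑ i, G i k (aff y - p) • e i (pt y)
  inf : ∃ e : Fin S.r → ∀ y, E.bdl.fib y, IsFrame E.bdl.IsSec e OnePoint.infty ∧
    ∃ G : Fin S.r → Fin S.r → ℂ → ℂ, (∀ i k, AnalyticAt ℂ (G i k) 0) ∧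
      ∀ k, ∀ᶠ y : Off S.D in near S.D OnePoint.infty, E.del (e k) y =
        (S.ξ k + S.μinf k / aff y) • e k (pt y) +
          ∑ i, ((aff y ^ 2)⁻¹ * G i k (aff y)⁻¹) • e i (pt y)

/-- The operator `z ∂_z + ξ / z` on holomorphic sections, outside the singular set. -/
def twist (x : Sphere) (ξ : ℂ) (s : ∀ y, E.bdl.fib y) (y : Off S.D) : E.bdl.fib (pt y) :=
  eulerFactor x y • E.del s y + (ξ / coord x y) • s (pt y)

/-- The eigenspaces of the polar part of the connection on the fibre `E_x`: the vectors `v` with a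
holomorphic extension `s` such that `(z ∂_z + ξ / z) s` is a holomorphic section with value `α v`
at `x`. At a point of `P` and for `ξ = 0` this is the `α`-eigenspace of the residue. At infinity it
is the space of the common eigenvectors of the diagonal matrices `A` and `C` for the eigenvalues
`ξ` and `- α`. -/
def eigen (x : Sphere) (ξ α : ℂ) : Submodule ℂ (E.bdl.fib (pt x)) where
  carrier := {v | ∃ s u : ∀ y, E.bdl.fib y, E.bdl.IsSec s x ∧ E.bdl.IsSec u x ∧ s (pt x) = v ∧
    u (pt x) = α • v ∧ ∀ᶠ y : Off S.D in near S.D x, u (pt y) = E.twist x ξ s y}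
  add_mem' := by
    rintro v w ⟨s, u, hs, hu, hv, huv, h⟩ ⟨t, q, ht, hq, hw, hqw, k⟩
    refine ⟨s + t, u + q, hs.add ht, hu.add hq, ?_, ?_, ?_⟩
    · rw [Pi.add_apply, hv, hw]
    · rw [Pi.add_apply, huv, hqw, smul_add]
    · filter_upwards [h, k, isSec_eventually (LocFree.isSec_restrict S.D hs),
        isSec_eventually (LocFree.isSec_restrict S.D ht)] with y h1 h2 h3 h4
      have h5 : E.del (s + t) y = E.del s y + E.del t y := E.conn.add y _ _ h3 h4
      rw [Pi.add_apply, h1, h2, twist, twist, twist, h5, Pi.add_apply, smul_add, smul_add]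
      abel
  zero_mem' := by
    refine ⟨0, 0, E.bdl.isSec_zero x, E.bdl.isSec_zero x, rfl, (smul_zero _).symm, ?_⟩
    refine Eventually.of_forall fun y => ?_
    have h5 : E.del 0 y = 0 := E.toFlat.del_zero y (Eventually.of_forall fun _ => rfl)
    rw [twist, h5, smul_zero, Pi.zero_apply, smul_zero, add_zero]
  smul_mem' := by
    rintro c v ⟨s, u, hs, hu, hv, huv, h⟩
    have hc : Coef ∅ x (fun _ => c) := Coef.of_analytic analyticAt_const
    refine ⟨fun y => c • s y, fun y => c • u y, hs.smul hc, hu.smul hc, ?_, ?_, ?_⟩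
    · exact congrArg (c • ·) hv
    · exact (congrArg (c • ·) huv).trans (smul_comm c α v)
    · filter_upwards [h, isSec_eventually (LocFree.isSec_restrict S.D hs)] with y h1 h3
      have h5 : E.del (fun y => c • s y) y = c • E.del s y := by
        have := E.conn.leibniz y (fun _ => c) _ analyticAt_const h3
        rw [deriv_const, zero_smul, zero_add] at this
        exact this
      rw [h1, twist, twist, h5, smul_add, smul_comm c (eulerFactor x y), smul_comm c (ξ / _)]

/-- The germ at `x` of a holomorphic section, in the stalk of `E(*D)`. -/
def germ {x : Sphere} (s : ∀ y, E.bdl.fib y) (hs : E.bdl.IsSec s x) : E.toFlat.bdl.Stalk x :=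
  LocFree.germ (M := E.bdl.star S.D) _ (LocFree.isSec_restrict S.D hs)

/-- `z Ê`, where `Ê` is the formal completion of the lattice `E` at `x`. -/
def hatIdeal (x : Sphere) : Submodule ℂ (E.toFlat.bdl.Hat x) :=
  Submodule.span ℂ {m | ∃ (f : PowerSeries ℂ) (s : ∀ y, E.bdl.fib y) (hs : E.bdl.IsSec s x),
    m = LocFree.tmul (HahnSeries.ofPowerSeries ℤ ℂ (PowerSeries.X * f)) (E.germ s hs)}

end HolConn

/-! ### The category `HP` -/

/-- The objects of `HP`: holomorphic bundles with a meromorphic connection with the prescribed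
singularities, with an admissible parabolic structure at all singular points, subject to the
resonance-freeness condition `μ_k ≠ β_k`. -/
structure HP (S : SingData) extends HolConn S where
  hasType : toHolConn.HasType
  /-- The parabolic filtration of the fibre at a singular point. -/
  fil : ∀ x : S.D, ℝ → Submodule ℂ (bdl.fib (pt x))
  isFiltration : ∀ x, IsFiltration ⊤ 0 (fil x)
  /-- The filtration is compatible with the polar part of the connection. -/
  compatible : ∀ x β, fil x β =
    ⨆ k, fil x β ⊓ toHolConn.eigen x (S.fac x k) (S.expn x k)
  /-- The weights `β` on the eigenspace for a non-zero `μ_k` are different from `μ_k`. -/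
  weight_ne : ∀ (x : S.D) k, S.mu x k ≠ 0 → ∀ β : ℝ, (β : ℂ) = S.mu x k →
    grDim (fun γ => fil x γ ⊓ toHolConn.eigen x (S.fac x k) (S.expn x k)) β = 0
  /-- At finite distance, the kernel of the residue injects into `gr^0`. -/
  admissible : ∀ x : S.D, (x : Sphere) ≠ OnePoint.infty → ∀ β > 0,
    fil x β ⊓ toHolConn.eigen x 0 0 = ⊥

/-- Morphisms of `HP`: holomorphic bundle maps compatible with the connections and the parabolic
structures. -/
@[ext]
structure HPHom {S : SingData} (X Y : HP S) extends LocFree.Hom X.bdl Y.bdl where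
  comm : ∀ (y : Off S.D) (s : ∀ y, (X.bdl.star S.D).fib y), (X.bdl.star S.D).IsSec s y →
    Y.conn.del (fun y => app (pt y) (s y)) y = app (pt y) (X.conn.del s y)
  fil : ∀ x β, (X.fil x β).map (app (pt x)) ≤ Y.fil x β

instance (S : SingData) : Category (HP S) where
  Hom X Y := HPHom X Y
  id X := { LocFree.Hom.id X.bdl with
    comm := fun _ _ _ => rfl
    fil := fun x β => (Submodule.map_id (X.fil x β)).le }
  comp {X Y Z} f g := { LocFree.Hom.comp f.toHom g.toHom with
    comm := fun y s hs => (g.comm y _ ((f.toHom.star S.D).isSec s y hs)).trans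
      (congrArg (g.app (pt y)) (f.comm y s hs))
    fil := fun x β => by
      change (X.fil x β).map ((g.app (pt x)).comp (f.app (pt x))) ≤ _
      rw [Submodule.map_comp]
      exact (Submodule.map_mono (f.fil x β)).trans (g.fil x β) }

namespace HP

variable {S : SingData}

/-- The functor that sends `(E, ∇)` to the meromorphic bundle with connection `E(*D)`. -/
def toFlatFunctor (S : SingData) : HP S ⥤ Flat S where
  obj X := X.toFlat
  map {X Y} f :=
    (show FlatHom X.toFlat Y.toFlat from { LocFree.Hom.star S.D f.toHom with comm := f.comm })

variable (X : HP S)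

/-- The parabolic degree of the sub-bundle `W` of rank `s`, with the induced parabolic structure. -/
def pdeg (s : ℕ) (W : ∀ y, Submodule ℂ (X.bdl.fib y)) : ℝ :=
  (X.bdl.degree s W : ℝ) + ∑ᶠ x : S.D, ∑ᶠ β ∈ Set.Ico (0 : ℝ) 1,
    β * grDim (fun γ => X.fil x γ ⊓ W (pt x)) β

/-- Parabolic stability: the non-trivial invariant holomorphic sub-bundles have smaller parabolic
slope. -/
def Stable : Prop :=
  ∀ (s : ℕ) (W : ∀ y, Submodule ℂ (X.bdl.fib y)), X.bdl.IsSubbundle s W →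
    X.toFlat.Invariant (fun y => W (pt y)) → 0 < s → s < S.r →
    X.pdeg s W / s < X.pdeg S.r (fun _ => ⊤) / S.r

end HP

/-- The stable objects of parabolic degree `0` of `HP`. -/
def stableHP (S : SingData) : ObjectProperty (HP S) :=
  fun X => X.Stable ∧ X.pdeg S.r (fun _ => ⊤) = 0

/-! ### The category `DMP` -/

/-- The objects of `DMP`: meromorphic bundles with integrable connection that admit a lattice with
the prescribed singularities, with an admissible parabolic structure at all singular points, subject
to the resonance-freeness condition `μ_k ≠ β_k`. -/
structure DMP (S : SingData) extends Flat S where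
  /-- There is a lattice, that is, a holomorphic bundle `E` with `E(*D)` equal to the given
  meromorphic bundle, on which the connection has the prescribed singularities. -/
  exists_lattice : ∃ E : HolConn S, E.HasType ∧ Nonempty (E.toFlat ≅ toFlat)
  /-- The parabolic filtration of `ψ^α` at a singular point (at infinity: for each of the
  regular singular summands of the formal connection, which correspond to the values of `ξ`). -/
  par : ∀ (x : S.D) (_ξ _α : ℂ), ℝ → Submodule ℂ (bdl.Hat x)
  isFiltration : ∀ (x : S.D), ∀ ξ ∈ S.facs x, ∀ α, ∃ k : ℤ,
    IsFiltration (toFlat.psi x ξ α) k (par x ξ α)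
  /-- `z ^ N` maps `ψ^{α,β}` isomorphically onto `ψ^{α+N,β+N}`. -/
  map_zpow : ∀ (x : S.D), ∀ ξ ∈ S.facs x, ∀ (α : ℂ) (β : ℝ) (N : ℤ),
    (par x ξ α β).map (bdl.zpow x N) = par x ξ (α + N) (β + N)
  /-- The weights on `ψ^α` are in `[0, 1[` if `α` is an eigenvalue of the residue on the lattice,
  hence in `[N, N + 1[` if `α - N` is one. -/
  normalized : ∀ (x : S.D) k,
    IsFiltration (toFlat.psi x (S.fac x k) (S.expn x k)) 0 (par x (S.fac x k) (S.expn x k))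
  /-- The weights `β` on the eigenspace for a non-zero `μ_k` are different from `μ_k`. -/
  weight_ne : ∀ (x : S.D) k, S.mu x k ≠ 0 → ∀ β : ℝ, (β : ℂ) = S.mu x k →
    grDim (par x (S.fac x k) (S.expn x k)) β = 0
  /-- At finite distance, `ψ^0` injects into `gr^0`. -/
  admissible : ∀ x : S.D, (x : Sphere) ≠ OnePoint.infty → ∀ β > 0, par x 0 0 β = ⊥

/-- Morphisms of `DMP`: homomorphisms of modules over the differential operators compatible with
the parabolic structures. -/
@[ext]
structure DMPHom {S : SingData} (M N : DMP S) extends FlatHom M.toFlat N.toFlat where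
  par : ∀ (x : S.D), ∀ ξ ∈ S.facs x, ∀ α β, (M.par x ξ α β).map (toHom.hat x) ≤ N.par x ξ α β

instance (S : SingData) : Category (DMP S) where
  Hom M N := DMPHom M N
  id M := { (show FlatHom M.toFlat M.toFlat from 𝟙 M.toFlat) with
    par := fun x ξ _ α β => by
      change (M.par x ξ α β).map ((LocFree.Hom.id M.bdl).hat x) ≤ _
      rw [LocFree.Hom.hat_id, Submodule.map_id] }
  comp {L M N} f g := { (show FlatHom L.toFlat N.toFlat from
      CategoryStruct.comp (Y := M.toFlat) f.toFlatHom g.toFlatHom) with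
    par := fun x ξ hξ α β => by
      change (L.par x ξ α β).map ((LocFree.Hom.comp f.toHom g.toHom).hat x) ≤ _
      rw [LocFree.Hom.hat_comp, Submodule.map_comp]
      exact (Submodule.map_mono (f.par x ξ hξ α β)).trans (g.par x ξ hξ α β) }

namespace DMP

variable {S : SingData}

/-- The functor that forgets the parabolic structure. -/
def forget (S : SingData) : DMP S ⥤ Flat S where
  obj M := M.toFlat
  map f := f.toFlatHom

variable (M : DMP S)

/-- The induced parabolic structure on a sub-bundle. -/
def subPar (W : ∀ y, Submodule ℂ (M.bdl.fib y)) (x : S.D) (ξ α : ℂ) (β : ℝ) :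
    Submodule ℂ (M.bdl.Hat x) :=
  M.par x ξ α β ⊓ M.subHat W x

/-- The degree of the sub-bundle `W`. -/
def degree (W : ∀ y, Submodule ℂ (M.bdl.fib y)) : ℂ :=
  - ∑ᶠ x : S.D, ∑ ξ ∈ S.facs x, ∑ᶠ α : ℂ, ∑ᶠ β ∈ Set.Ico (0 : ℝ) 1,
    α * grDim (M.subPar W x ξ α) β

/-- The parabolic degree of the sub-bundle `W`, with the induced parabolic structure. (It is a real
number for the sub-bundles that are invariant under the connection.) -/
def pdeg (W : ∀ y, Submodule ℂ (M.bdl.fib y)) : ℂ :=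
  M.degree W + ∑ᶠ x : S.D, ∑ ξ ∈ S.facs x, ∑ᶠ α : ℂ, ∑ᶠ β ∈ Set.Ico (0 : ℝ) 1,
    (β : ℂ) * grDim (M.subPar W x ξ α) β

/-- Parabolic stability: the non-trivial integrable sub-bundles have smaller parabolic slope. -/
def Stable : Prop :=
  ∀ (s : ℕ) (W : ∀ y, Submodule ℂ (M.bdl.fib y)), M.bdl.IsSubbundle s W → M.Invariant W →
    0 < s → s < S.r → (M.pdeg W).re / s < (M.pdeg fun _ => ⊤).re / S.r

end DMP

/-- The stable objects of parabolic degree `0` of `DMP`. -/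
def stableDMP (S : SingData) : ObjectProperty (DMP S) :=
  fun M => M.Stable ∧ (M.pdeg fun _ => ⊤) = 0

/-- Under the isomorphism `φ` from `E(*D)` to a meromorphic bundle `M`, the parabolic structure of
`M` is the one induced by the parabolic structure of `E`: an element `m` of `ψ^α` with
`α` an eigenvalue of the residue, which has the same value at `x` as the holomorphic section `s` of
`E`, is in the step `β` of the filtration if and only if the value of `s` at `x` is. -/
def IsInduced {S : SingData} (X : HP S) (M : DMP S) (φ : X.toFlat ≅ M.toFlat) : Prop :=
  ∀ (x : S.D) (k : Fin S.r) (β : ℝ) (s : ∀ y, X.bdl.fib y) (hs : X.bdl.IsSec s x),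
    ∀ m ∈ X.toFlat.psi x (S.fac x k) (S.expn x k),
      m - LocFree.tmul 1 (X.germ s hs) ∈ X.hatIdeal x →
      ((show FlatHom X.toFlat M.toFlat from φ.hom).toHom.hat x m ∈
        M.par x (S.fac x k) (S.expn x k) β ↔ s (pt x) ∈ X.fil x β)

end ParConn

end

noncomputable section

namespace ParConn

open Filter Topology CategoryTheory TensorProduct

/-! ### Neighbourhoods in the local coordinate -/

/-! Everything rests on a formal normal form at the points of `D`. In a suitable frame of the
lattice the operator z∂_z is diag(-ξ_k/z + α_k) + zG with G holomorphic. No two exponents with the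
same ξ differ by a non-zero integer, so a recursion on coefficients yields a formal gauge
transformation, equal to 1 modulo z, that removes zG (`exists_gauge`). The resulting `FormalChart`
still sees the lattice: holomorphic sections are those whose coordinates have no polar part, and
values at x are constant terms. It also makes ψ^{ξ,α} explicit: only monomials z^n in coordinates k
with ξ_k = ξ and α_k + n = α occur (`FormalChart.mem_psi`). By non-resonance ψ^{ξ_k,α_k} consists of
constant vectors and is identified with the eigenspace of index k in E_x, while ψ^{ξ_k,α_k+N} is its
multiple by z^N. A filtration of E_x compatible with the eigenspaces is therefore the same datum as
a parabolic structure on E(*D).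

The functor is fully faithful because a flat map sends ψ to ψ, so its matrix in formal charts is
constant (`FormalChart.exists_matrix`). Such a matrix creates no poles, hence the map extends to the
lattices, and its value on E_x is read off from the formal map. Essential surjectivity uses the
lattice that an object of `DMP` has by definition, with the filtration carried over from the ψ
spaces (`DMP.latticeHP`).

For stability, invariant sub-bundles of E restrict to E(*D), and those of E(*D) extend over `D`: a
minor of smallest order yields a holomorphic frame with an identity block (`exists_normal_columns`).
At a singular point, an invariant W has a fibre spanned by eigenvectors (`exists_localBasis`), so
the weights on W_x and on the ψ spaces agree. It remains to prove that deg W is minus the sum of the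
exponents of W, a residue theorem for det W (`exists_isDegree`). Subtracting from the trace of the
connection a rational function with the same polar parts at P and the same irregular term at
infinity leaves a rank one equation that is regular over ℂ. Its local solutions glue over growing
discs (`IsLocalMultiple.exists_univ`) to a volume form on W without zeros on ℂ. At infinity this
form satisfies a regular singular equation whose exponent is the sum of all exponents of W, and
single-valuedness makes this sum an integer, equal to the order of the form there
(`order_of_regular_singular`). The degree does not depend on the form, since the divisor of a
meromorphic function on the sphere has degree zero (`HasDivisor.sum_eq_zero`). -/

theorem eventually_near_iff {D : Set Sphere} {x : Sphere} {p : Off D → Prop} :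
    (∀ᶠ y in near D x, p y) ↔ ∀ᶠ y in 𝓝 x, ∀ h : y ∉ D, p ⟨y, h⟩ := by
  rw [near, eventually_comap]
  refine eventually_congr (Eventually.of_forall fun y => ⟨fun h h' => h _ rfl, ?_⟩)
  rintro h a rfl
  exact h a.2

theorem eventually_near_empty_iff {x : Sphere} {p : Off ∅ → Prop} :
    (∀ᶠ y in near ∅ x, p y) ↔ ∀ᶠ y in 𝓝 x, p (pt y) := by
  rw [eventually_near_iff]
  exact eventually_congr (Eventually.of_forall fun y => ⟨fun h => h _, fun h _ => h⟩)

/-- The point with local coordinate `z` at `x`. -/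
def param (x : Sphere) (z : ℂ) : Sphere :=
  x.elim (if z = 0 then OnePoint.infty else ((z⁻¹ : ℂ) : Sphere)) fun a => ((a + z : ℂ) : Sphere)

theorem coord_param (x : Sphere) (z : ℂ) : coord x (param x z) = z := by
  induction x using OnePoint.rec with
  | infty =>
    change (aff (if z = 0 then OnePoint.infty else ((z⁻¹ : ℂ) : Sphere)))⁻¹ = z
    split_ifs with h
    · change (0 : ℂ)⁻¹ = z
      rw [h, inv_zero]
    · exact inv_inv z
  | coe a =>
    change (a + z) - a = z
    ring

theorem param_zero (x : Sphere) : param x 0 = x := by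
  induction x using OnePoint.rec with
  | infty => exact if_pos rfl
  | coe a => exact congrArg _ (add_zero a)

theorem coord_self (x : Sphere) : coord x x = 0 := by
  conv_lhs => rw [← param_zero x]
  rw [param_zero x]
  conv_lhs => arg 2; rw [← param_zero x]
  exact coord_param x 0

theorem tendsto_param (x : Sphere) : Tendsto (param x) (𝓝 0) (𝓝 x) := by
  induction x using OnePoint.rec with
  | infty =>
    have h1 : Tendsto (fun z : ℂ => ((z⁻¹ : ℂ) : Sphere)) (𝓝[≠] 0) (𝓝 OnePoint.infty) := by
      have h := (OnePoint.tendsto_coe_infty (X := ℂ))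
      rw [coclosedCompact_eq_cocompact, ← Metric.cobounded_eq_cocompact] at h
      exact h.comp tendsto_inv₀_nhdsNE_zero
    rw [← pure_sup_nhdsNE, tendsto_sup]
    constructor
    · rw [tendsto_pure_left]
      intro s hs
      rw [param_zero]
      exact mem_of_mem_nhds hs
    · refine h1.congr' ?_
      filter_upwards [self_mem_nhdsWithin] with z hz
      exact (if_neg hz).symm
  | coe a =>
    have : Continuous fun w : ℂ => ((a + w : ℂ) : Sphere) :=
      OnePoint.continuous_coe.comp (continuous_const.add continuous_id)
    have h0 := this.tendsto 0
    rwa [add_zero] at h0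

theorem eventually_param_coord (x : Sphere) : ∀ᶠ y in 𝓝 x, param x (coord x y) = y := by
  induction x using OnePoint.rec with
  | infty =>
    -- The point 0 has junk coordinate 0⁻¹ = 0 at infinity and would be sent to ∞ instead of to
    -- itself.
    have h0 : ∀ᶠ y in 𝓝 (OnePoint.infty : Sphere), y ≠ ((0 : ℂ) : Sphere) :=
      isOpen_ne.mem_nhds (OnePoint.infty_ne_coe 0)
    filter_upwards [h0] with y hy
    induction y using OnePoint.rec with
    | infty => exact if_pos inv_zero
    | coe b =>
      have hb : b ≠ 0 := fun h => hy (by rw [h])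
      change (if b⁻¹ = 0 then OnePoint.infty else ((b⁻¹⁻¹ : ℂ) : Sphere)) = b
      rw [if_neg (inv_ne_zero hb), inv_inv]
  | coe a =>
    filter_upwards [OnePoint.isOpen_range_coe.mem_nhds ⟨a, rfl⟩] with y hy
    obtain ⟨b, rfl⟩ := hy
    change ((a + (b - a) : ℂ) : Sphere) = b
    rw [add_sub_cancel]

theorem eventually_nhds_iff_param {x : Sphere} {p : Sphere → Prop} :
    (∀ᶠ y in 𝓝 x, p y) ↔ ∀ᶠ z in 𝓝 0, p (param x z) := by
  refine ⟨fun h => (tendsto_param x).eventually h, fun h => ?_⟩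
  filter_upwards [(tendsto_coord x).eventually h, eventually_param_coord x] with y h1 h2
  rwa [h2] at h1

theorem eventually_nhds_coord_iff {x : Sphere} {p : ℂ → Prop} :
    (∀ᶠ y in 𝓝 x, p (coord x y)) ↔ ∀ᶠ z in 𝓝 0, p z := by
  rw [eventually_nhds_iff_param]
  simp only [coord_param]

theorem param_eq_self_iff {x : Sphere} {z : ℂ} : param x z = x ↔ z = 0 := by
  refine ⟨fun h => ?_, fun h => by rw [h, param_zero]⟩
  rw [← coord_param x z, h, coord_self]

theorem eventually_nhdsNE_iff_param {x : Sphere} {p : Sphere → Prop} :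
    (∀ᶠ y in 𝓝[≠] x, p y) ↔ ∀ᶠ z in 𝓝[≠] 0, p (param x z) := by
  rw [eventually_nhdsWithin_iff, eventually_nhdsWithin_iff, eventually_nhds_iff_param]
  refine eventually_congr (Eventually.of_forall fun z => ?_)
  simp [param_eq_self_iff]

theorem eventually_nhdsNE_coord_iff {x : Sphere} {p : ℂ → Prop} :
    (∀ᶠ y in 𝓝[≠] x, p (coord x y)) ↔ ∀ᶠ z in 𝓝[≠] 0, p z := by
  rw [eventually_nhdsNE_iff_param]
  simp only [coord_param]

/-! ### Punctured neighbourhoods of the singular points -/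

namespace SingData

variable (S : SingData)

theorem finite_D : S.D.Finite := by
  have : S.D ⊆ insert OnePoint.infty ((fun p : ℂ => (p : Sphere)) '' (S.P : Set ℂ)) := by
    rintro x (rfl | ⟨p, hp, rfl⟩)
    · exact Set.mem_insert _ _
    · exact Set.mem_insert_of_mem _ ⟨p, hp, rfl⟩
  exact ((S.P.finite_toSet.image _).insert _).subset this

instance : Finite S.D := S.finite_D.to_subtype

theorem coe_mem {p : ℂ} (hp : p ∈ S.P) : (p : Sphere) ∈ S.D := Or.inr ⟨p, hp, rfl⟩

theorem coe_mem_iff {p : ℂ} : (p : Sphere) ∈ S.D ↔ p ∈ S.P := by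
  refine ⟨?_, S.coe_mem⟩
  rintro (h | ⟨q, hq, h⟩)
  · exact (OnePoint.coe_ne_infty p h).elim
  · rwa [OnePoint.coe_injective h]

theorem eventually_notMem {x : Sphere} (hx : x ∉ S.D) : ∀ᶠ y in 𝓝 x, y ∉ S.D :=
  S.finite_D.isClosed.isOpen_compl.mem_nhds hx

theorem eventually_notMem' (x : Sphere) : ∀ᶠ y in 𝓝[≠] x, y ∉ S.D := by
  rw [eventually_nhdsWithin_iff]
  have : ∀ᶠ y in 𝓝 x, y ∉ S.D \ {x} :=
    (S.finite_D.subset Set.sdiff_subset).isClosed.isOpen_compl.mem_nhds (by simp)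
  filter_upwards [this] with y h1 h2 h3
  exact h1 ⟨h3, h2⟩

variable {S}

theorem eventually_near_mem_iff {x : Sphere} (hx : x ∈ S.D) {p : Off S.D → Prop} :
    (∀ᶠ y in near S.D x, p y) ↔ ∀ᶠ y in 𝓝[≠] x, ∀ h : y ∉ S.D, p ⟨y, h⟩ := by
  rw [eventually_near_iff, eventually_nhdsWithin_iff]
  refine eventually_congr (Eventually.of_forall fun y => ⟨fun h _ => h, fun h h' => h ?_ h'⟩)
  rintro rfl
  exact h' hx

theorem eventually_near_coord_iff {x : Sphere} (hx : x ∈ S.D) {p : ℂ → Prop} :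
    (∀ᶠ y : Off S.D in near S.D x, p (coord x y)) ↔ ∀ᶠ z in 𝓝[≠] 0, p z := by
  rw [eventually_near_mem_iff hx, ← eventually_nhdsNE_coord_iff (x := x)]
  refine ⟨fun h => ?_, fun h => ?_⟩
  · filter_upwards [h, S.eventually_notMem' x] with y h1 h2
    exact h1 h2
  · filter_upwards [h] with y h1 _
    exact h1

theorem near_of_near_empty {x : Sphere} {p : Off ∅ → Prop} (h : ∀ᶠ y in near ∅ x, p y) :
    ∀ᶠ y : Off S.D in near S.D x, p (pt y) := by
  rw [eventually_near_empty_iff] at h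
  rw [eventually_near_iff]
  filter_upwards [h] with y hy _
  exact hy

theorem near_empty_of_near {x : Sphere} (hx : x ∉ S.D) {p : Off ∅ → Prop}
    (h : ∀ᶠ y : Off S.D in near S.D x, p (pt y)) : ∀ᶠ y in near ∅ x, p y := by
  rw [eventually_near_iff] at h
  rw [eventually_near_empty_iff]
  filter_upwards [h, S.eventually_notMem hx] with y hy h'
  exact hy h'

theorem near_empty_of_near_of_self {x : Sphere} (hx : x ∈ S.D) {p : Off ∅ → Prop}
    (h : ∀ᶠ y : Off S.D in near S.D x, p (pt y)) (hp : p (pt x)) : ∀ᶠ y in near ∅ x, p y := by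
  rw [eventually_near_mem_iff hx] at h
  rw [eventually_near_empty_iff, ← pure_sup_nhdsNE, eventually_sup, eventually_pure]
  refine ⟨hp, ?_⟩
  filter_upwards [h, S.eventually_notMem' x] with y hy h'
  exact hy h'

end SingData

/-! ### Laurent expansions -/

theorem Hol0.add_apply (A B : Hol0) (z : ℂ) : (A + B : Hol0) z = A z + B z := rfl
theorem Hol0.mul_apply (A B : Hol0) (z : ℂ) : (A * B : Hol0) z = A z * B z := rfl

theorem algebraMap_coeff_natCast (A : Hol0) (n : ℕ) :
    (algebraMap Hol0 (LaurentSeries ℂ) A).coeff n = PowerSeries.coeff n (taylor A) :=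
  HahnSeries.ofPowerSeries_apply_coeff _ _

theorem ofPowerSeries_coeff_neg (f : PowerSeries ℂ) {n : ℤ} (hn : n < 0) :
    (HahnSeries.ofPowerSeries ℤ ℂ f).coeff n = 0 := by
  rw [HahnSeries.ofPowerSeries_apply]
  apply HahnSeries.embDomain_of_notMem_range
  rintro ⟨m, hm⟩
  simp at hm
  omega

theorem algebraMap_coeff_neg (A : Hol0) {n : ℤ} (hn : n < 0) :
    (algebraMap Hol0 (LaurentSeries ℂ) A).coeff n = 0 :=
  ofPowerSeries_coeff_neg _ hn

theorem algebraMap_coeff_zero (A : Hol0) :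
    (algebraMap Hol0 (LaurentSeries ℂ) A).coeff 0 = A 0 := by
  have := algebraMap_coeff_natCast A 0
  rw [coeff_taylor] at this
  simpa using this

theorem eventually_nhds_of_nhdsNE {A B : ℂ → ℂ} (hA : ContinuousAt A 0) (hB : ContinuousAt B 0)
    (h : ∀ᶠ z in 𝓝[≠] 0, A z = B z) : ∀ᶠ z in 𝓝 0, A z = B z :=
  (hA.eventuallyEq_nhds_iff_eventuallyEq_nhdsNE hB).1 h

theorem algebraMap_congr {A B : Hol0} (h : ∀ᶠ z in 𝓝[≠] 0, A z = B z) :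
    algebraMap Hol0 (LaurentSeries ℂ) A = algebraMap Hol0 (LaurentSeries ℂ) B := by
  have h' : (A : ℂ → ℂ) =ᶠ[𝓝 0] B :=
    eventually_nhds_of_nhdsNE A.analyticAt.continuousAt B.analyticAt.continuousAt h
  change HahnSeries.ofPowerSeries ℤ ℂ (taylor A) = HahnSeries.ofPowerSeries ℤ ℂ (taylor B)
  congr 1
  ext n
  rw [coeff_taylor, coeff_taylor, h'.iteratedDeriv_eq]

/-- The coordinate function. -/
def zHol : Hol0 := ⟨fun z => z, analyticAt_id⟩

theorem algebraMap_zHol : algebraMap Hol0 (LaurentSeries ℂ) zHol = HahnSeries.single 1 1 := by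
  have hZ : taylor zHol = PowerSeries.X := by
    ext n
    rw [coeff_taylor, PowerSeries.coeff_X]
    change iteratedDeriv n (fun z : ℂ => z) 0 / (n.factorial : ℂ) = _
    rcases n with _ | _ | n
    · simp
    · simp
    · have h1 : deriv (fun z : ℂ => z) = fun _ => 1 := by ext z; simp
      rw [iteratedDeriv_succ', h1, iteratedDeriv_const]
      simp
  change HahnSeries.ofPowerSeries ℤ ℂ (taylor zHol) = _
  rw [hZ, HahnSeries.ofPowerSeries_X]

theorem algebraMap_zHol_pow (n : ℕ) :
    algebraMap Hol0 (LaurentSeries ℂ) (zHol ^ n) = HahnSeries.single (n : ℤ) 1 := by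
  rw [map_pow, algebraMap_zHol, HahnSeries.single_pow]
  simp

theorem zHol_pow_apply (n : ℕ) (z : ℂ) : (zHol ^ n : Hol0) z = z ^ n := by
  induction n with
  | zero => rfl
  | succ n ih => rw [pow_succ, Hol0.mul_apply, ih, pow_succ]; rfl

/-- The constant function. -/
def cHol (c : ℂ) : Hol0 := ⟨fun _ => c, analyticAt_const⟩

theorem algebraMap_cHol (c : ℂ) : algebraMap Hol0 (LaurentSeries ℂ) (cHol c) = HahnSeries.C c := by
  change HahnSeries.ofPowerSeries ℤ ℂ (taylor (cHol c)) = _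
  rw [← HahnSeries.ofPowerSeries_C]
  congr 1
  ext n
  rw [coeff_taylor, PowerSeries.coeff_C]
  change iteratedDeriv n (fun _ : ℂ => c) 0 / (n.factorial : ℂ) = _
  rw [iteratedDeriv_const]
  split_ifs with h <;> simp [h]

theorem single_mul_single_neg (n : ℤ) :
    (HahnSeries.single n 1 : LaurentSeries ℂ) * HahnSeries.single (-n) 1 = 1 := by
  rw [HahnSeries.single_mul_single]
  simp

open Classical in
/-- The Laurent expansion at `0` of a meromorphic function. -/
def laurent (g : ℂ → ℂ) : LaurentSeries ℂ :=
  if h : MeromorphicAt g 0 then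
    HahnSeries.single (-(h.choose : ℤ)) 1 *
      algebraMap Hol0 (LaurentSeries ℂ) ⟨fun z => (z - 0) ^ h.choose • g z, h.choose_spec⟩
  else 0

theorem meromorphicAt_of_pow_mul {g : ℂ → ℂ} {n : ℕ} {A : Hol0}
    (h : ∀ᶠ z in 𝓝[≠] 0, z ^ n * g z = A z) : MeromorphicAt g 0 := by
  have h1 : MeromorphicAt (fun z : ℂ => (z ^ n)⁻¹ * A z) 0 :=
    ((MeromorphicAt.id 0).pow n).inv.mul A.analyticAt.meromorphicAt
  refine h1.congr ?_
  filter_upwards [h, self_mem_nhdsWithin] with z hz h0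
  rw [← hz, inv_mul_cancel_left₀ (pow_ne_zero _ h0)]

/-- Two presentations z^n g = A and z^m g = B give z^m A = z^n B, and powers of z are invertible
among Laurent series. Hence the pole bound chosen in the definition of `laurent` is irrelevant. -/
theorem laurent_eq {g : ℂ → ℂ} {n : ℕ} {A : Hol0} (h : ∀ᶠ z in 𝓝[≠] 0, z ^ n * g z = A z) :
    laurent g = HahnSeries.single (-(n : ℤ)) 1 * algebraMap Hol0 (LaurentSeries ℂ) A := by
  have hg := meromorphicAt_of_pow_mul h
  rw [laurent, dif_pos hg]
  set m := hg.choose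
  set B : Hol0 := ⟨fun z => (z - 0) ^ m • g z, hg.choose_spec⟩
  have h1 : algebraMap Hol0 (LaurentSeries ℂ) (zHol ^ m * A) =
      algebraMap Hol0 (LaurentSeries ℂ) (zHol ^ n * B) := by
    refine algebraMap_congr ?_
    filter_upwards [h] with z hz
    rw [Hol0.mul_apply, Hol0.mul_apply, zHol_pow_apply, zHol_pow_apply, ← hz]
    change _ = z ^ n * ((z - 0) ^ m * g z)
    rw [sub_zero]
    ring
  rw [map_mul, map_mul, algebraMap_zHol_pow, algebraMap_zHol_pow] at h1
  have hm := single_mul_single_neg m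
  have hn := single_mul_single_neg n
  linear_combination (HahnSeries.single (-(m : ℤ)) 1 : LaurentSeries ℂ) *
    (HahnSeries.single (-(n : ℤ)) 1) * (-h1) +
    (HahnSeries.single (-(n : ℤ)) 1 : LaurentSeries ℂ) *
      algebraMap Hol0 (LaurentSeries ℂ) A * hm -
    (HahnSeries.single (-(m : ℤ)) 1 : LaurentSeries ℂ) *
      algebraMap Hol0 (LaurentSeries ℂ) B * hn

theorem exists_pow_mul {g : ℂ → ℂ} (hg : MeromorphicAt g 0) :
    ∃ (n : ℕ) (A : Hol0), ∀ z, z ^ n * g z = A z := by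
  obtain ⟨n, hn⟩ := hg
  refine ⟨n, ⟨_, hn⟩, fun z => ?_⟩
  change _ = (z - 0) ^ n • g z
  rw [sub_zero, smul_eq_mul]

theorem exists_common_pow_mul {ι : Type*} [Fintype ι] {g : ι → ℂ → ℂ}
    (hg : ∀ i, MeromorphicAt (g i) 0) :
    ∃ (n : ℕ) (A : ι → Hol0), ∀ i z, z ^ n * g i z = A i z := by
  choose n A h using fun i => exists_pow_mul (hg i)
  refine ⟨∑ i, n i, fun i => zHol ^ (∑ j, n j - n i) * A i, fun i z => ?_⟩
  have hi : n i ≤ ∑ j, n j :=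
    Finset.single_le_sum (f := n) (fun _ _ => Nat.zero_le _) (Finset.mem_univ i)
  rw [Hol0.mul_apply, zHol_pow_apply, ← h, ← mul_assoc, ← pow_add, Nat.sub_add_cancel hi]

theorem laurent_hol (A : Hol0) : laurent A = algebraMap Hol0 (LaurentSeries ℂ) A := by
  rw [laurent_eq (n := 0) (A := A) (Eventually.of_forall fun z => by simp)]
  simp

theorem laurent_congr {f g : ℂ → ℂ} (hf : MeromorphicAt f 0) (h : ∀ᶠ z in 𝓝[≠] 0, f z = g z) :
    laurent f = laurent g := by
  obtain ⟨n, A, hA⟩ := exists_pow_mul hf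
  rw [laurent_eq (Eventually.of_forall hA), laurent_eq (n := n) (A := A)]
  filter_upwards [h] with z hz
  rw [← hz, hA]

theorem laurent_add {f g : ℂ → ℂ} (hf : MeromorphicAt f 0) (hg : MeromorphicAt g 0) :
    laurent (fun z => f z + g z) = laurent f + laurent g := by
  obtain ⟨n, A, hA⟩ := exists_pow_mul hf
  obtain ⟨m, B, hB⟩ := exists_pow_mul hg
  rw [laurent_eq (n := n + m) (A := zHol ^ m * A + zHol ^ n * B),
    laurent_eq (n := n + m) (A := zHol ^ m * A), laurent_eq (n := n + m) (A := zHol ^ n * B),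
    map_add, mul_add]
  · refine Eventually.of_forall fun z => ?_
    rw [Hol0.mul_apply, zHol_pow_apply, ← hB]; ring
  · refine Eventually.of_forall fun z => ?_
    rw [Hol0.mul_apply, zHol_pow_apply, ← hA]; ring
  · refine Eventually.of_forall fun z => ?_
    rw [Hol0.add_apply, Hol0.mul_apply, Hol0.mul_apply, zHol_pow_apply, zHol_pow_apply, ← hA, ← hB]
    ring

theorem laurent_mul {f g : ℂ → ℂ} (hf : MeromorphicAt f 0) (hg : MeromorphicAt g 0) :
    laurent (fun z => f z * g z) = laurent f * laurent g := by
  obtain ⟨n, A, hA⟩ := exists_pow_mul hf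
  obtain ⟨m, B, hB⟩ := exists_pow_mul hg
  rw [laurent_eq (n := n + m) (A := A * B), laurent_eq (Eventually.of_forall hA),
    laurent_eq (Eventually.of_forall hB), map_mul]
  · have : (HahnSeries.single (-((n + m : ℕ) : ℤ)) 1 : LaurentSeries ℂ) =
        HahnSeries.single (-(n : ℤ)) 1 * HahnSeries.single (-(m : ℤ)) 1 := by
      rw [HahnSeries.single_mul_single, mul_one]
      congr 2
      push_cast; ring
    rw [this]
    ring
  · refine Eventually.of_forall fun z => ?_
    rw [Hol0.mul_apply, ← hA, ← hB]; ring

theorem laurent_const (c : ℂ) : laurent (fun _ => c) = HahnSeries.C c := by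
  rw [← algebraMap_cHol, ← laurent_hol]; rfl

theorem laurent_zero : laurent (fun _ => 0) = 0 := by
  rw [laurent_const, map_zero]

theorem laurent_id : laurent (fun z => z) = HahnSeries.single 1 1 := by
  rw [← algebraMap_zHol, ← laurent_hol]; rfl

theorem laurent_inv_id : laurent (fun z => z⁻¹) = HahnSeries.single (-1) 1 := by
  rw [laurent_eq (n := 1) (A := 1)]
  · simp
  · filter_upwards [self_mem_nhdsWithin] with z hz
    rw [pow_one, mul_inv_cancel₀ hz]; rfl

theorem meromorphicAt_sum {ι : Type*} (s : Finset ι) {f : ι → ℂ → ℂ}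
    (hf : ∀ i ∈ s, MeromorphicAt (f i) 0) : MeromorphicAt (fun z => ∑ i ∈ s, f i z) 0 := by
  classical
  induction s using Finset.induction_on with
  | empty => simp
  | insert i s hi ih =>
    simp only [Finset.sum_insert hi]
    exact (hf i (Finset.mem_insert_self i s)).add
      (ih fun j hj => hf j (Finset.mem_insert_of_mem hj))

theorem laurent_sum {ι : Type*} (s : Finset ι) {f : ι → ℂ → ℂ}
    (hf : ∀ i ∈ s, MeromorphicAt (f i) 0) :
    laurent (fun z => ∑ i ∈ s, f i z) = ∑ i ∈ s, laurent (f i) := by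
  classical
  induction s using Finset.induction_on with
  | empty => simpa using laurent_zero
  | insert i s hi ih =>
    have h1 : ∀ j ∈ s, MeromorphicAt (f j) 0 := fun j hj => hf j (Finset.mem_insert_of_mem hj)
    simp only [Finset.sum_insert hi]
    rw [laurent_add (hf i (Finset.mem_insert_self i s)) (meromorphicAt_sum s h1), ih h1]

theorem single_mul_coeff (m n : ℤ) (f : LaurentSeries ℂ) :
    ((HahnSeries.single m 1 : LaurentSeries ℂ) * f).coeff n = f.coeff (n - m) := by
  have := HahnSeries.coeff_single_mul_add (r := (1 : ℂ)) (x := f) (a := n - m) (b := m)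
  rwa [sub_add_cancel, one_mul] at this

/-- A meromorphic function with a Taylor expansion is holomorphic, up to its value at `0`. -/
theorem exists_hol_of_laurent {g : ℂ → ℂ} (hg : MeromorphicAt g 0)
    (h : ∀ n < 0, (laurent g).coeff n = 0) : ∃ A : Hol0, ∀ᶠ z in 𝓝[≠] 0, g z = A z := by
  obtain ⟨n, A, hA⟩ := exists_pow_mul hg
  replace hA : ∀ᶠ z in 𝓝[≠] 0, z ^ n * g z = A z := Eventually.of_forall hA
  clear hg
  induction n generalizing A with
  | zero =>
    refine ⟨A, ?_⟩
    filter_upwards [hA] with z hz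
    rw [← hz, pow_zero, one_mul]
  | succ n ih =>
    -- The coefficient of z^{-(n+1)} in g is A(0). It vanishes, so one factor z of A cancels and the
    -- pole bound drops by one.
    have hA0 : A 0 = 0 := by
      have h1 := h (-((n + 1 : ℕ) : ℤ)) (by omega)
      rw [laurent_eq hA, single_mul_coeff, sub_self, algebraMap_coeff_zero] at h1
      exact h1
    obtain ⟨B, hB⟩ : ∃ B : Hol0, ∀ z, A z = z * B z := by
      have hd : AnalyticAt ℂ (dslope A 0) 0 := by
        obtain ⟨p, hp⟩ := A.analyticAt
        exact hp.has_fpower_series_dslope_fslope.analyticAt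
      refine ⟨⟨_, hd⟩, fun z => ?_⟩
      have := sub_smul_dslope (A : ℂ → ℂ) 0 z
      rw [sub_zero, hA0, sub_zero] at this
      exact this.symm
    refine ih B ?_
    filter_upwards [hA, self_mem_nhdsWithin] with z hz h0
    rw [hB, pow_succ'] at hz
    exact mul_left_cancel₀ h0 (by rw [← hz]; ring)

theorem coeff_C_mul (a : ℂ) (f : LaurentSeries ℂ) (n : ℤ) :
    ((HahnSeries.C a : LaurentSeries ℂ) * f).coeff n = a * f.coeff n := by
  rw [HahnSeries.C_mul_eq_smul, HahnSeries.coeff_smul, smul_eq_mul]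

/-! ### Coordinates on the formal completion -/

section Frame

variable {D : Set Sphere} {r : ℕ} {M : LocFree D r} {x : Sphere} {e : Fin r → ∀ y, M.fib y}

theorem IsFrame.isSec_iff (he : IsFrame M.IsSec e x) (s : ∀ y, M.fib y) :
    M.IsSec s x ↔ ∃ g : Fin r → ℂ → ℂ, (∀ i, Coef D x (g i)) ∧
      ∀ᶠ y in near D x, s y = ∑ i, g i (coord x y) • e i y :=
  (Eventually.self_of_nhds he).2 s

theorem IsFrame.basis_near (he : IsFrame M.IsSec e x) :
    ∀ᶠ y : Off D in near D x, LinearIndependent ℂ (fun i => e i y) ∧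
      Submodule.span ℂ (Set.range fun i => e i y) = ⊤ := by
  rw [eventually_near_iff]
  filter_upwards [he] with y hy h
  exact hy.1 h

theorem sum_pi_single_smul {ι : Type*} [Fintype ι] [DecidableEq ι] {V : Type*} [AddCommGroup V]
    [Module ℂ V] (v : ι → V) (k : ι) : ∑ i, (Pi.single k (1 : ℂ) : ι → ℂ) i • v i = v k := by
  rw [Finset.sum_eq_single k]
  · simp
  · intro i _ hi
    simp [hi]
  · simp

theorem IsFrame.isSec (he : IsFrame M.IsSec e x) (k : Fin r) : M.IsSec (e k) x := by
  refine (he.isSec_iff _).2 ⟨fun i _ => (Pi.single k (1 : ℂ) : Fin r → ℂ) i,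
    fun i => Coef.of_analytic analyticAt_const, Eventually.of_forall fun y => ?_⟩
  rw [sum_pi_single_smul (fun i => e i y) k]

end Frame

section HatCoord

variable {S : SingData} {M : LocFree S.D S.r} {x : Sphere} {e : Fin S.r → ∀ y, M.fib y}

theorem IsFrame.coef_unique (hx : x ∈ S.D) (he : IsFrame M.IsSec e x) {g h : Fin S.r → ℂ → ℂ}
    (H : ∀ᶠ y : Off S.D in near S.D x,
      ∑ i, g i (coord x y) • e i y = ∑ i, h i (coord x y) • e i y) (i : Fin S.r) :
    ∀ᶠ z in 𝓝[≠] 0, g i z = h i z := by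
  rw [← SingData.eventually_near_coord_iff hx (p := fun z => g i z = h i z)]
  filter_upwards [H, he.basis_near] with y h1 h2
  have h3 : ∑ i, (g i (coord x y) - h i (coord x y)) • e i y = 0 := by
    simp only [sub_smul, Finset.sum_sub_distrib]
    rw [h1, sub_self]
  exact sub_eq_zero.1 (Fintype.linearIndependent_iff.1 h2.1 _ h3 i)

/-- The coefficients of a section with respect to a frame. -/
def IsFrame.coef (he : IsFrame M.IsSec e x) (s : M.secAt x) : Fin S.r → ℂ → ℂ :=
  ((he.isSec_iff s.1).1 s.2).choose

theorem IsFrame.coef_mero (he : IsFrame M.IsSec e x) (s : M.secAt x) (i : Fin S.r) :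
    MeromorphicAt (he.coef s i) 0 :=
  (((he.isSec_iff s.1).1 s.2).choose_spec.1 i).1

theorem IsFrame.coef_spec (he : IsFrame M.IsSec e x) (s : M.secAt x) :
    ∀ᶠ y : Off S.D in near S.D x, s.1 y = ∑ i, he.coef s i (coord x y) • e i y :=
  ((he.isSec_iff s.1).1 s.2).choose_spec.2

theorem IsFrame.laurent_coef (hx : x ∈ S.D) (he : IsFrame M.IsSec e x) (s : M.secAt x)
    {g : Fin S.r → ℂ → ℂ}
    (H : ∀ᶠ y : Off S.D in near S.D x, s.1 y = ∑ i, g i (coord x y) • e i y) (i : Fin S.r) :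
    laurent (he.coef s i) = laurent (g i) := by
  refine laurent_congr (he.coef_mero s i) (he.coef_unique hx ?_ i)
  filter_upwards [H, he.coef_spec s] with y h1 h2
  rw [← h1, ← h2]

/-- The Laurent expansions of the coefficients of a section. -/
def IsFrame.secCoord (hx : x ∈ S.D) (he : IsFrame M.IsSec e x) :
    M.secAt x →ₗ[Hol0] (Fin S.r → LaurentSeries ℂ) where
  toFun s i := laurent (he.coef s i)
  map_add' s t := by
    funext i
    rw [Pi.add_apply, ← laurent_add (he.coef_mero s i) (he.coef_mero t i)]
    refine he.laurent_coef hx _ (g := fun i z => he.coef s i z + he.coef t i z) ?_ i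
    filter_upwards [he.coef_spec s, he.coef_spec t] with y h1 h2
    change s.1 y + t.1 y = _
    rw [h1, h2, ← Finset.sum_add_distrib]
    simp only [add_smul]
  map_smul' A s := by
    funext i
    rw [Pi.smul_apply, RingHom.id_apply, Algebra.smul_def, ← laurent_hol,
      ← laurent_mul A.analyticAt.meromorphicAt (he.coef_mero s i)]
    refine he.laurent_coef hx _ (g := fun i z => A z * he.coef s i z) ?_ i
    filter_upwards [he.coef_spec s] with y h1
    change A (coord x y) • s.1 y = _
    rw [h1, Finset.smul_sum]
    simp only [mul_smul]

/-- The Laurent expansions of the coefficients of a germ. -/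
def IsFrame.stalkCoord (hx : x ∈ S.D) (he : IsFrame M.IsSec e x) :
    M.Stalk x →ₗ[Hol0] (Fin S.r → LaurentSeries ℂ) :=
  Submodule.liftQ _ (he.secCoord hx) (by
    intro s hs
    rw [LinearMap.mem_ker]
    funext i
    change laurent (he.coef s i) = 0
    rw [← laurent_zero]
    refine he.laurent_coef hx s (g := fun _ _ => 0) ?_ i
    filter_upwards [show ∀ᶠ y in near S.D x, s.1 y = 0 from hs] with y h
    simp [h])

theorem hat_induction {p : M.Hat x → Prop} (m : M.Hat x) (zero : p 0)
    (tmul : ∀ f s (hs : M.IsSec s x), p (LocFree.tmul f (LocFree.germ s hs)))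
    (add : ∀ m n, p m → p n → p (m + n)) : p m := by
  refine TensorProduct.induction_on (motive := p) m zero (fun f m => ?_) add
  obtain ⟨s, rfl⟩ := Submodule.mkQ_surjective _ m
  exact tmul f s.1 s.2

theorem tmul_zero_left (m : M.Stalk x) : LocFree.tmul 0 m = 0 := zero_tmul _ m

theorem smul_tmul' (f g : LaurentSeries ℂ) (m : M.Stalk x) :
    f • LocFree.tmul g m = LocFree.tmul (f * g) m := rfl

theorem tmul_hol_smul (f : LaurentSeries ℂ) (A : Hol0) (m : M.Stalk x) :
    LocFree.tmul f (A • m) = LocFree.tmul (f * algebraMap Hol0 (LaurentSeries ℂ) A) m := by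
  change f ⊗ₜ[Hol0] (A • m) = (f * algebraMap Hol0 (LaurentSeries ℂ) A) ⊗ₜ[Hol0] m
  rw [← TensorProduct.smul_tmul, Algebra.smul_def, mul_comm]

theorem tmul_sum (f : LaurentSeries ℂ) {ι : Type*} (s : Finset ι) (m : ι → M.Stalk x) :
    LocFree.tmul f (∑ i ∈ s, m i) = ∑ i ∈ s, LocFree.tmul f (m i) :=
  TensorProduct.tmul_sum f s m

theorem germ_hol_smul (A : Hol0) {s : ∀ y, M.fib y} (hs : M.IsSec s x) :
    A • LocFree.germ s hs =
      LocFree.germ _ (hs.smul (Coef.of_analytic (D := S.D) (x := x) A.analyticAt)) := rfl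

theorem germ_congr {s t : ∀ y, M.fib y} (hs : M.IsSec s x) (ht : M.IsSec t x)
    (h : ∀ᶠ y in near S.D x, s y = t y) : LocFree.germ s hs = LocFree.germ t ht := by
  refine (Submodule.Quotient.eq _).2 ?_
  have h' : ∀ᶠ y in near S.D x, s y - t y = 0 := by
    filter_upwards [h] with y hy
    rw [hy, sub_self]
  exact h'

theorem sum_germ {ι : Type*} [Fintype ι] {t : ι → ∀ y, M.fib y} (ht : ∀ i, M.IsSec (t i) x)
    (hs : M.IsSec (fun y => ∑ i, t i y) x) :
    ∑ i, LocFree.germ (t i) (ht i) = LocFree.germ _ hs := by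
  change ∑ i, (M.nullAt x).mkQ ⟨t i, ht i⟩ = (M.nullAt x).mkQ ⟨_, hs⟩
  rw [← map_sum]
  congr 1
  apply Subtype.ext
  rw [AddSubmonoidClass.coe_finsetSum]
  funext y
  exact Finset.sum_apply y Finset.univ t

/-- A linear relation between sections, on the formal completion. -/
theorem tmul_germ_eq_sum {ι : Type*} [Fintype ι] {s : ∀ y, M.fib y}
    (hs : M.IsSec s x) {t : ι → ∀ y, M.fib y} (ht : ∀ i, M.IsSec (t i) x) {g : ι → ℂ → ℂ}
    (hg : ∀ i, MeromorphicAt (g i) 0)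
    (H : ∀ᶠ y : Off S.D in near S.D x, s y = ∑ i, g i (coord x y) • t i y)
    (f : LaurentSeries ℂ) :
    LocFree.tmul f (LocFree.germ s hs) =
      ∑ i, (f * laurent (g i)) • LocFree.tmul 1 (LocFree.germ (t i) (ht i)) := by
  -- The tensor product is over holomorphic germs, so denominators are cleared first: the relation
  -- is multiplied by z^n, moved across the tensor sign, and divided by z^n on the Laurent side.
  obtain ⟨n, A, hA⟩ := exists_common_pow_mul hg
  have hsum : M.IsSec (fun y => ∑ i, A i (coord x y) • t i y) x := by
    refine (hs.smul (Coef.of_analytic (zHol ^ n : Hol0).analyticAt)).congr ?_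
    filter_upwards [H] with y h
    rw [h, Finset.smul_sum]
    refine Finset.sum_congr rfl fun i _ => ?_
    rw [smul_smul, zHol_pow_apply, hA]
  have h1 : (zHol ^ n : Hol0) • LocFree.germ s hs = ∑ i, A i • LocFree.germ (t i) (ht i) := by
    simp only [germ_hol_smul]
    rw [sum_germ (fun i => (ht i).smul (Coef.of_analytic (A i).analyticAt)) hsum]
    refine germ_congr _ _ ?_
    filter_upwards [H] with y h
    rw [h, Finset.smul_sum]
    refine Finset.sum_congr rfl fun i _ => ?_
    rw [smul_smul, zHol_pow_apply, hA]
  have h2 : f = (f * HahnSeries.single (-(n : ℤ)) 1) * algebraMap Hol0 _ (zHol ^ n) := by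
    rw [algebraMap_zHol_pow]
    have := single_mul_single_neg n
    linear_combination - f * this
  conv_lhs => rw [h2, ← tmul_hol_smul, h1, tmul_sum]
  refine Finset.sum_congr rfl fun i _ => ?_
  rw [tmul_hol_smul, smul_tmul', mul_one, laurent_eq (Eventually.of_forall (hA i)), mul_assoc]

/-- The coordinates on the formal completion with respect to a frame. -/
def IsFrame.hatCoordMap (hx : x ∈ S.D) (he : IsFrame M.IsSec e x) :
    M.Hat x →ₗ[LaurentSeries ℂ] (Fin S.r → LaurentSeries ℂ) :=
  (he.stalkCoord hx).liftBaseChange (LaurentSeries ℂ)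

theorem IsFrame.hatCoordMap_tmul (hx : x ∈ S.D) (he : IsFrame M.IsSec e x)
    (f : LaurentSeries ℂ) {s : ∀ y, M.fib y} (hs : M.IsSec s x) {g : Fin S.r → ℂ → ℂ}
    (H : ∀ᶠ y : Off S.D in near S.D x, s y = ∑ i, g i (coord x y) • e i y) (i : Fin S.r) :
    he.hatCoordMap hx (LocFree.tmul f (LocFree.germ s hs)) i = f * laurent (g i) := by
  have h1 : he.hatCoordMap hx (LocFree.tmul f (LocFree.germ s hs)) =
      f • he.stalkCoord hx (LocFree.germ s hs) :=
    LinearMap.liftBaseChange_tmul _ _ _ _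
  rw [h1, Pi.smul_apply, smul_eq_mul]
  congr 1
  exact he.laurent_coef hx ⟨s, hs⟩ H i

theorem IsFrame.hatCoordMap_frame (hx : x ∈ S.D) (he : IsFrame M.IsSec e x) (k : Fin S.r) :
    he.hatCoordMap hx (LocFree.tmul 1 (LocFree.germ (e k) (he.isSec k))) = Pi.single k 1 := by
  funext i
  rw [he.hatCoordMap_tmul hx 1 (he.isSec k)
    (g := fun i _ => (Pi.single k (1 : ℂ) : Fin S.r → ℂ) i), laurent_const, one_mul]
  · by_cases h : i = k
    · subst h; simp
    · simp [h]
  · refine Eventually.of_forall fun y => ?_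
    rw [sum_pi_single_smul (fun i => e i y) k]

/-- The coordinates on the formal completion with respect to a frame. -/
def IsFrame.hatCoord (hx : x ∈ S.D) (he : IsFrame M.IsSec e x) :
    M.Hat x ≃ₗ[LaurentSeries ℂ] (Fin S.r → LaurentSeries ℂ) :=
  LinearEquiv.ofLinearMap (he.hatCoordMap hx)
    (Fintype.linearCombination (LaurentSeries ℂ)
      (fun k => LocFree.tmul 1 (LocFree.germ (e k) (he.isSec k)) : Fin S.r → M.Hat x))
    (by
      refine LinearMap.pi_ext' fun k => LinearMap.ext_ring ?_
      rw [LinearMap.comp_apply, LinearMap.comp_apply, LinearMap.single_apply,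
        Fintype.linearCombination_apply_single, one_smul, he.hatCoordMap_frame hx k]
      rfl)
    (by
      refine LinearMap.ext fun m => ?_
      induction m using hat_induction with
      | zero => exact map_zero _
      | tmul f s hs =>
        rw [LinearMap.comp_apply, Fintype.linearCombination_apply]
        refine Eq.trans (Finset.sum_congr rfl fun i _ => ?_)
          (tmul_germ_eq_sum hs (fun i => he.isSec i) (fun i => he.coef_mero ⟨s, hs⟩ i)
            (he.coef_spec ⟨s, hs⟩) f).symm
        rw [he.hatCoordMap_tmul hx f hs (he.coef_spec ⟨s, hs⟩) i]
      | add m n hm hn => rw [map_add, map_add, hm, hn])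

theorem IsFrame.hatCoord_tmul (hx : x ∈ S.D) (he : IsFrame M.IsSec e x)
    (f : LaurentSeries ℂ) {s : ∀ y, M.fib y} (hs : M.IsSec s x) {g : Fin S.r → ℂ → ℂ}
    (H : ∀ᶠ y : Off S.D in near S.D x, s y = ∑ i, g i (coord x y) • e i y) (i : Fin S.r) :
    he.hatCoord hx (LocFree.tmul f (LocFree.germ s hs)) i = f * laurent (g i) :=
  he.hatCoordMap_tmul hx f hs H i

theorem IsFrame.hatCoord_symm (hx : x ∈ S.D) (he : IsFrame M.IsSec e x)
    (v : Fin S.r → LaurentSeries ℂ) :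
    (he.hatCoord hx).symm v = ∑ k, v k • LocFree.tmul 1 (LocFree.germ (e k) (he.isSec k)) :=
  Fintype.linearCombination_apply _ _ _

end HatCoord

/-! ### Formal normal forms -/

/-- Course-of-values recursion: since Φ at n reads only the entries below n, the iterates of Φ
stabilise at place l after l + 1 steps, whatever the starting sequence. -/
theorem exists_recursive {V : Type*} [Inhabited V] (Φ : (ℕ → V) → ℕ → V)
    (hΦ : ∀ n t t', (∀ l < n, t l = t' l) → Φ t n = Φ t' n) : ∃ t, ∀ n, t n = Φ t n := by
  let u : ℕ → ℕ → V := fun n => Nat.rec (fun _ => default) (fun _ w => Φ w) n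
  have hu : ∀ n, u (n + 1) = Φ (u n) := fun n => rfl
  have key : ∀ n m l, l < n → l < m → u n l = u m l := by
    intro n
    induction n with
    | zero => intro m l h; omega
    | succ n ih =>
      intro m l h1 h2
      obtain ⟨m, rfl⟩ : ∃ k, m = k + 1 := ⟨m - 1, by omega⟩
      rw [hu, hu]
      exact hΦ l _ _ fun j hj => ih m j (by omega) (by omega)
  refine ⟨fun n => u (n + 1) n, fun n => ?_⟩
  change u (n + 1) n = _
  rw [hu]
  exact hΦ n _ _ fun l hl => key n (l + 1) l hl (Nat.lt_succ_self l)

/-- The action of `z d/dz` on the generator of a formal connection of rank one. -/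
def diagEntry (ξ α : ℂ) : LaurentSeries ℂ := HahnSeries.single (-1) (-ξ) + HahnSeries.C α

theorem single_eq_C_mul (n : ℤ) (a : ℂ) :
    (HahnSeries.single n a : LaurentSeries ℂ) = HahnSeries.C a * HahnSeries.single n 1 := by
  rw [HahnSeries.C_apply, HahnSeries.single_mul_single, zero_add, mul_one]

theorem diagEntry_mul_coeff (ξ α : ℂ) (f : LaurentSeries ℂ) (n : ℤ) :
    (diagEntry ξ α * f).coeff n = -ξ * f.coeff (n + 1) + α * f.coeff n := by
  rw [diagEntry, add_mul, HahnSeries.coeff_add, coeff_C_mul, single_eq_C_mul, mul_assoc,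
    coeff_C_mul, single_mul_coeff, sub_neg_eq_add]

theorem eulerSeries_coeff (f : LaurentSeries ℂ) (n : ℤ) :
    (eulerSeries f).coeff n = n * f.coeff n := rfl

/-- No two exponents with the same exponential factor differ by a non-zero integer. -/
def NonResonant {ι : Type*} (ξ α : ι → ℂ) : Prop :=
  ∀ i k, ξ i = ξ k → ∀ n : ℤ, α i = α k + n → n = 0

theorem ofPowerSeries_coeff_natCast (f : PowerSeries ℂ) (n : ℕ) :
    (HahnSeries.ofPowerSeries ℤ ℂ f).coeff n = PowerSeries.coeff n f :=
  HahnSeries.ofPowerSeries_apply_coeff _ _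

/-- A column of the formal gauge transformation to the normal form. -/
theorem exists_gauge_column {r : ℕ} {ξ α : Fin r → ℂ} (h : NonResonant ξ α)
    (G : Fin r → Fin r → PowerSeries ℂ) (k : Fin r) :
    ∃ T : Fin r → PowerSeries ℂ, (∀ i, PowerSeries.coeff 0 (T i) = (Pi.single k 1 : Fin r → ℂ) i) ∧
      ∀ i, eulerSeries (HahnSeries.ofPowerSeries ℤ ℂ (T i)) +
        diagEntry (ξ i) (α i) * HahnSeries.ofPowerSeries ℤ ℂ (T i) +
        ∑ j, HahnSeries.single 1 1 * HahnSeries.ofPowerSeries ℤ ℂ (G i j * T j) =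
        diagEntry (ξ k) (α k) * HahnSeries.ofPowerSeries ℤ ℂ (T i) := by
  classical
  -- `R t n` is the coefficient of z^n in z·G·t. The factor z makes it depend only on the entries of
  -- t below n.
  let R : (ℕ → Fin r → ℂ) → ℕ → Fin r → ℂ := fun t n i => match n with
    | 0 => 0
    | p + 1 => ∑ j, ∑ q ∈ Finset.HasAntidiagonal.antidiagonal p, PowerSeries.coeff q.1 (G i j) * t q.2 j
  have hR : ∀ n t t', (∀ l < n, t l = t' l) → R t n = R t' n := by
    intro n t t' htt
    funext i
    rcases n with _ | p
    · rfl
    · refine Finset.sum_congr rfl fun j _ => Finset.sum_congr rfl fun q hq => ?_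
      rw [htt q.2 (by have := Finset.HasAntidiagonal.mem_antidiagonal.1 hq; omega)]
  -- The coefficient of z^n in the gauge equation is (n + α_i - α_k) t_n + (ξ_k - ξ_i) t_{n+1} + R_n
  -- = 0. If ξ_i = ξ_k, it is solved for t_n, whose factor is non-zero for n ≥ 1 by non-resonance.
  -- If ξ_i ≠ ξ_k, the equation of order n is solved for t_{n+1}.
  let Φ : (ℕ → Fin r → ℂ) → ℕ → Fin r → ℂ := fun t n => match n with
    | 0 => Pi.single k 1
    | m + 1 => fun i => if ξ i = ξ k then - R t (m + 1) i / (((m + 1 : ℕ) : ℂ) + α i - α k) else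
        - ((m + α i - α k) * t m i + R t m i) / (ξ k - ξ i)
  obtain ⟨t, ht⟩ := exists_recursive Φ (by
    intro n t t' htt
    rcases n with _ | m
    · rfl
    · funext i
      change (if _ then _ else _) = (if _ then _ else _)
      rw [hR _ t t' htt, hR m t t' fun l hl => htt l (by omega), htt m (by omega)])
  have key : ∀ (n : ℕ) i, ((n : ℂ) + α i - α k) * t n i + (ξ k - ξ i) * t (n + 1) i + R t n i = 0 := by
    intro n i
    by_cases hi : ξ i = ξ k
    · rw [hi, sub_self, zero_mul, add_zero]
      rcases n with _ | m
      · change _ + (0 : ℂ) = 0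
        rw [ht 0]
        change (((0 : ℕ) : ℂ) + α i - α k) * (Pi.single k 1 : Fin r → ℂ) i + 0 = 0
        by_cases hik : i = k
        · subst hik; simp
        · simp [hik]
      · have hne : ((m + 1 : ℕ) : ℂ) + α i - α k ≠ 0 := by
          intro h0
          have := h i k hi (-((m + 1 : ℕ) : ℤ)) (by push_cast at h0 ⊢; linear_combination h0)
          omega
        have h1 : t (m + 1) i = - R t (m + 1) i / (((m + 1 : ℕ) : ℂ) + α i - α k) := by
          conv_lhs => rw [ht (m + 1)]
          exact if_pos hi
        rw [h1]
        field_simp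
        ring
    · have hne : ξ k - ξ i ≠ 0 := sub_ne_zero.2 fun h => hi h.symm
      have h1 : t (n + 1) i = - ((n + α i - α k) * t n i + R t n i) / (ξ k - ξ i) := by
        conv_lhs => rw [ht (n + 1)]
        exact if_neg hi
      rw [h1]
      field_simp
      ring
  refine ⟨fun i => PowerSeries.mk fun n => t n i, fun i => ?_, fun i => ?_⟩
  · rw [PowerSeries.coeff_mk, ht 0]
  · ext n
    simp only [HahnSeries.coeff_add, HahnSeries.coeff_sum, diagEntry_mul_coeff, eulerSeries_coeff,
      single_mul_coeff]
    -- Below order -1 all terms vanish. Order -1 only says that ξ_i = ξ_k where the constant term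
    -- t_0 = e_k is non-zero. From order 0 on it is the recursion.
    rcases lt_trichotomy n (-1) with hn | rfl | hn
    · rw [ofPowerSeries_coeff_neg _ (by omega : n < 0),
        ofPowerSeries_coeff_neg _ (by omega : n + 1 < 0),
        Finset.sum_eq_zero fun j _ => ofPowerSeries_coeff_neg _ (by omega : n - 1 < 0)]
      simp
    · rw [ofPowerSeries_coeff_neg _ (by omega : (-1 : ℤ) < 0)]
      have h0 : ∀ f : PowerSeries ℂ, (HahnSeries.ofPowerSeries ℤ ℂ f).coeff (-1 + 1) =
          PowerSeries.coeff 0 f := fun f => ofPowerSeries_coeff_natCast f 0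
      rw [h0, PowerSeries.coeff_mk, ht 0,
        Finset.sum_eq_zero fun j _ => ofPowerSeries_coeff_neg _ (by omega : (-1 : ℤ) - 1 < 0)]
      have : ξ i * (Pi.single k 1 : Fin r → ℂ) i = ξ k * (Pi.single k 1 : Fin r → ℂ) i := by
        by_cases hik : i = k
        · rw [hik]
        · simp [hik]
      linear_combination -this
    · obtain ⟨m, rfl⟩ := Int.eq_ofNat_of_zero_le (by omega : 0 ≤ n)
      have h1 : ∀ f : PowerSeries ℂ, (HahnSeries.ofPowerSeries ℤ ℂ f).coeff ((m : ℤ) + 1) =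
          PowerSeries.coeff (m + 1) f := fun f => ofPowerSeries_coeff_natCast f (m + 1)
      rw [h1, ofPowerSeries_coeff_natCast, PowerSeries.coeff_mk, PowerSeries.coeff_mk]
      have h2 : ∑ j, (HahnSeries.ofPowerSeries ℤ ℂ
          (G i j * PowerSeries.mk fun n => t n j)).coeff ((m : ℤ) - 1) = R t m i := by
        rcases m with _ | p
        · exact Finset.sum_eq_zero fun j _ => ofPowerSeries_coeff_neg _ (by simp)
        · refine Finset.sum_congr rfl fun j _ => ?_
          have : ((p + 1 : ℕ) : ℤ) - 1 = (p : ℤ) := by push_cast; ring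
          rw [this, ofPowerSeries_coeff_natCast, PowerSeries.coeff_mul]
          simp only [PowerSeries.coeff_mk]
      rw [h2]
      have := key m i
      push_cast
      linear_combination this

/-- The formal gauge transformation to the normal form. -/
theorem exists_gauge {r : ℕ} {ξ α : Fin r → ℂ} (h : NonResonant ξ α)
    (G : Fin r → Fin r → PowerSeries ℂ) :
    ∃ T T' : Matrix (Fin r) (Fin r) (PowerSeries ℂ), T * T' = 1 ∧ T' * T = 1 ∧
      T.map (PowerSeries.constantCoeff) = 1 ∧ T'.map (PowerSeries.constantCoeff) = 1 ∧
      ∀ i k, eulerSeries (HahnSeries.ofPowerSeries ℤ ℂ (T i k)) +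
        diagEntry (ξ i) (α i) * HahnSeries.ofPowerSeries ℤ ℂ (T i k) +
        ∑ j, HahnSeries.single 1 1 * HahnSeries.ofPowerSeries ℤ ℂ (G i j * T j k) =
        diagEntry (ξ k) (α k) * HahnSeries.ofPowerSeries ℤ ℂ (T i k) := by
  choose T hT0 hT using exists_gauge_column h G
  let U : Matrix (Fin r) (Fin r) (PowerSeries ℂ) := Matrix.of fun i k => T k i
  have hU : U.map (PowerSeries.constantCoeff) = 1 := by
    ext i k
    change PowerSeries.constantCoeff (T k i) = _
    rw [← PowerSeries.coeff_zero_eq_constantCoeff_apply, hT0, Matrix.one_apply, Pi.single_apply]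
  -- A matrix of power series is invertible when its constant term is, and here that is the
  -- identity.
  have hdet : IsUnit U.det := by
    rw [PowerSeries.isUnit_iff_constantCoeff, RingHom.map_det]
    have : (PowerSeries.constantCoeff (R := ℂ)).mapMatrix U = 1 := hU
    rw [this, Matrix.det_one]
    exact isUnit_one
  refine ⟨U, U⁻¹, Matrix.mul_nonsing_inv _ hdet, Matrix.nonsing_inv_mul _ hdet, hU, ?_,
    fun i k => hT k i⟩
  have h1 : (PowerSeries.constantCoeff (R := ℂ)).mapMatrix (U * U⁻¹) = 1 := by
    rw [Matrix.mul_nonsing_inv _ hdet, map_one]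
  rw [map_mul] at h1
  have h2 : (PowerSeries.constantCoeff (R := ℂ)).mapMatrix U = 1 := hU
  rw [h2, one_mul] at h1
  exact h1

/-! ### Formal differential operators of rank one -/

/-- The operator `z d/dz + c / z + a` on Laurent series. -/
def rankOne (c a : ℂ) (f : LaurentSeries ℂ) : LaurentSeries ℂ :=
  eulerSeries f + diagEntry (-c) a * f

theorem rankOne_coeff (c a : ℂ) (f : LaurentSeries ℂ) (n : ℤ) :
    (rankOne c a f).coeff n = (n + a) * f.coeff n + c * f.coeff (n + 1) := by
  rw [rankOne, HahnSeries.coeff_add, eulerSeries_coeff, diagEntry_mul_coeff]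
  ring

/-- The term c/z lowers the order by one, so the coefficient just below the order of f is c times
the leading coefficient of f. -/
theorem rankOne_eq_zero {c a : ℂ} (hc : c ≠ 0) {f : LaurentSeries ℂ} (h : rankOne c a f = 0) :
    f = 0 := by
  by_contra hf
  have h1 := rankOne_coeff c a f (f.order - 1)
  rw [h, HahnSeries.coeff_zero, HahnSeries.coeff_eq_zero_of_lt_order (by omega), mul_zero,
    zero_add, sub_add_cancel] at h1
  exact mul_ne_zero hc (HahnSeries.coeff_order_eq_zero.not.2 hf) h1.symm

theorem rankOne_iterate_eq_zero {c a : ℂ} (hc : c ≠ 0) {f : LaurentSeries ℂ} {N : ℕ}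
    (h : (rankOne c a)^[N] f = 0) : f = 0 := by
  induction N with
  | zero => exact h
  | succ N ih =>
    rw [Function.iterate_succ_apply'] at h
    exact ih (rankOne_eq_zero hc h)

theorem rankOne_zero_iterate_coeff {a : ℂ} {f : LaurentSeries ℂ} (N : ℕ) (n : ℤ) :
    ((rankOne 0 a)^[N] f).coeff n = (n + a) ^ N * f.coeff n := by
  induction N with
  | zero => simp
  | succ N ih =>
    rw [Function.iterate_succ_apply', rankOne_coeff, ih]
    ring

/-! ### Formal charts at the singular points -/

/-- At infinity this is `sub_inf`. At a finite point zero exponents have to be compared with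
non-zero ones as well: these do not differ by an integer because non-zero exponents have
non-integral real part. -/
theorem SingData.ResonanceFree.nonResonant {S : SingData} (hS : S.ResonanceFree) {x : Sphere}
    (hx : x ∈ S.D) : NonResonant (S.fac x) (S.expn x) := by
  intro i k hik n hn
  by_contra h0
  rcases hx with rfl | ⟨p, hp, rfl⟩
  · refine hS.sub_inf i k hik (-n) (by simpa using h0) ?_
    change -S.μinf i = -S.μinf k + n at hn
    push_cast
    linear_combination -hn
  · change S.μ p i = S.μ p k + n at hn
    by_cases hi : S.μ p i = 0
    · by_cases hk : S.μ p k = 0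
      · rw [hi, hk, zero_add] at hn
        exact h0 (by exact_mod_cast hn.symm)
      · refine hS.re_fin p hp k hk (-n) ?_
        have : S.μ p k = ((-n : ℤ) : ℂ) := by rw [hi] at hn; push_cast; linear_combination -hn
        rw [this, Complex.intCast_re]
    · by_cases hk : S.μ p k = 0
      · refine hS.re_fin p hp i hi n ?_
        rw [hn, hk, zero_add, Complex.intCast_re]
      · exact hS.sub_fin p hp i k hi hk n h0 (by rw [hn]; ring)

/-- A frame of a holomorphic bundle is a frame of the meromorphic bundle. -/
theorem IsFrame.star {r : ℕ} (D : Set Sphere) {E : HolBundle r} {e : Fin r → ∀ y, E.fib y}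
    {x₀ : Sphere} (he : IsFrame E.IsSec e x₀) :
    IsFrame (E.star D).IsSec (fun i => LocFree.restrict D (e i)) x₀ := by
  filter_upwards [he] with x hx
  have hnear : Tendsto (fun y : Off D => pt y) (near D x) (near ∅ x) :=
    tendsto_comap_iff.2 tendsto_comap
  refine ⟨fun h => hx.1 (Set.notMem_empty x), fun (s : ∀ y : Off D, E.fib (pt y)) => ⟨?_, ?_⟩⟩
  · rintro ⟨N, hN, s', hs', hss'⟩
    replace hss' : ∀ᶠ y : Off D in near D x, s' (pt y) = (coord x y) ^ N • s y := hss'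
    obtain ⟨g, hg, hsg⟩ := (hx.2 s').1 hs'
    have hga : ∀ i, AnalyticAt ℂ (g i) 0 := fun i => (hg i).2 (Set.notMem_empty x)
    refine ⟨fun i => (fun z => (z ^ N)⁻¹) * g i, fun i => ⟨?_, fun h => ?_⟩, ?_⟩
    · exact ((MeromorphicAt.id 0).pow N).inv.mul (hga i).meromorphicAt
    · rw [hN h]
      simpa using analyticAt_const.mul (hga i)
    · have hne : ∀ᶠ y : Off D in near D x, coord x y ^ N ≠ 0 := by
        by_cases h : x ∈ D
        · filter_upwards [near_coord_ne h] with y hy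
          exact pow_ne_zero _ hy
        · simp [hN h]
      filter_upwards [hss', hnear.eventually hsg, hne] with y h1 h2 h3
      have : s y = (coord x y ^ N)⁻¹ • s' (pt y) := by
        rw [h1, smul_smul, inv_mul_cancel₀ h3, one_smul]
      rw [this, h2, Finset.smul_sum]
      simp only [Pi.mul_apply, mul_smul]
      rfl
  · rintro ⟨g, hg, hsg⟩
    replace hsg : ∀ᶠ y : Off D in near D x, s y = ∑ i, g i (coord x y) • e i (pt y) := hsg
    by_cases h : x ∈ D
    · obtain ⟨n, A, hA⟩ := exists_common_pow_mul fun i => (hg i).1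
      refine ⟨n, fun h' => (h' h).elim, fun y => ∑ i, A i (coord x y) • e i y, ?_, ?_⟩
      · exact (hx.2 _).2 ⟨fun i => A i, fun i => Coef.of_analytic (A i).analyticAt,
          Eventually.of_forall fun y => rfl⟩
      · filter_upwards [hsg] with y hy
        rw [hy, Finset.smul_sum]
        refine Finset.sum_congr rfl fun i _ => ?_
        rw [smul_smul, hA]
    · refine ⟨0, fun _ => rfl, fun y => ∑ i, g i (coord x y) • e i y, ?_, ?_⟩
      · exact (hx.2 _).2 ⟨g, fun i => Coef.of_analytic ((hg i).2 h),
          Eventually.of_forall fun y => rfl⟩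
      · filter_upwards [hsg] with y hy
        rw [hy, pow_zero, one_smul]

namespace Flat

variable {S : SingData} (M : Flat S) {x : Sphere}

theorem hatEuler_tmul (f : LaurentSeries ℂ) {s : ∀ y, M.bdl.fib y} (hs : M.bdl.IsSec s x) :
    M.hatEuler x (LocFree.tmul f (LocFree.germ s hs)) =
      LocFree.tmul (eulerSeries f) (LocFree.germ s hs) +
        LocFree.tmul f (LocFree.germ (M.eulerField x s) (M.isSec_eulerField hs)) := rfl

theorem hatEuler_smul (f : LaurentSeries ℂ) (m : M.bdl.Hat x) :
    M.hatEuler x (f • m) = eulerSeries f • m + f • M.hatEuler x m := by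
  induction m using hat_induction with
  | zero => simp
  | tmul g s hs =>
    rw [smul_tmul', hatEuler_tmul, hatEuler_tmul, smul_add, smul_tmul', smul_tmul', smul_tmul',
      eulerSeries_mul]
    rw [show LocFree.tmul (eulerSeries f * g + f * eulerSeries g) (LocFree.germ s hs) =
      LocFree.tmul (eulerSeries f * g) (LocFree.germ s hs) +
        LocFree.tmul (f * eulerSeries g) (LocFree.germ s hs) from TensorProduct.add_tmul _ _ _]
    abel
  | add m n hm hn =>
    rw [smul_add, map_add, hm, hn, smul_add, map_add, smul_add]
    abel

end Flat

/-- Near a singular point, the action of `z ∂_z` on a suitable frame. -/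
theorem HolConn.HasType.exists_model {S : SingData} {E : HolConn S} (hE : E.HasType)
    {x : Sphere} (hx : x ∈ S.D) :
    ∃ e : Fin S.r → ∀ y, E.bdl.fib y, IsFrame E.bdl.IsSec e x ∧
      ∃ G : Fin S.r → Fin S.r → Hol0, ∀ k, ∀ᶠ y : Off S.D in near S.D x,
        eulerFactor x y • E.del (e k) y =
          (-S.fac x k * (coord x y)⁻¹ + S.expn x k) • e k (pt y) +
            ∑ i, (coord x y * G i k (coord x y)) • e i (pt y) := by
  rcases hx with rfl | ⟨p, hp, rfl⟩
  · obtain ⟨e, he, G, hG, h⟩ := hE.inf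
    -- At infinity z∂_z = -x∂_x. This changes the sign of the remainder and of the exponents, and
    -- turns the factor x⁻² into z.
    refine ⟨e, he, fun i k => - ⟨G i k, hG i k⟩, fun k => ?_⟩
    filter_upwards [h k, near_coord_ne S.infty_mem] with y h1 hy
    have hy' : aff y ≠ 0 := by simpa [coord] using hy
    rw [h1, smul_add, smul_smul, Finset.smul_sum]
    congr 1
    · congr 1
      change -(aff y) * _ = -S.ξ k * ((aff y)⁻¹)⁻¹ + -S.μinf k
      rw [inv_inv]
      field_simp
      ring
    · refine Finset.sum_congr rfl fun i _ => ?_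
      rw [smul_smul]
      congr 1
      change -(aff y) * ((aff y ^ 2)⁻¹ * G i k (aff y)⁻¹) = (aff y)⁻¹ * -(G i k (aff y)⁻¹)
      field_simp
  · obtain ⟨e, he, G, hG, h⟩ := hE.log p hp
    refine ⟨e, he, fun i k => ⟨G i k, hG i k⟩, fun k => ?_⟩
    filter_upwards [h k, near_coord_ne (S.coe_mem hp)] with y h1 hy
    have hy' : aff y - p ≠ 0 := hy
    rw [h1, smul_add, smul_smul, Finset.smul_sum]
    congr 1
    · congr 1
      change (aff y - p) * _ = -0 * (aff y - p)⁻¹ + S.μ p k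
      field_simp
      ring
    · refine Finset.sum_congr rfl fun i _ => ?_
      rw [smul_smul]
      rfl

/-- Formal coordinates at a singular point in which the connection is diagonal, and which extend
coordinates on the fibre of the bundle. -/
structure FormalChart {S : SingData} (E : HolConn S) (x : Sphere) where
  hat : E.toFlat.bdl.Hat x ≃ₗ[LaurentSeries ℂ] (Fin S.r → LaurentSeries ℂ)
  fib : E.bdl.fib (pt x) ≃ₗ[ℂ] (Fin S.r → ℂ)
  hat_euler : ∀ m k, hat (E.toFlat.hatEuler x m) k =
    eulerSeries (hat m k) + diagEntry (S.fac x k) (S.expn x k) * hat m k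
  coeff_neg : ∀ s (hs : E.bdl.IsSec s x) k, ∀ n < 0,
    (hat (LocFree.tmul 1 (E.germ s hs)) k).coeff n = 0
  coeff_zero : ∀ s (hs : E.bdl.IsSec s x) k,
    (hat (LocFree.tmul 1 (E.germ s hs)) k).coeff 0 = fib (s (pt x)) k
  -- This field lets formal information decide holomorphy: a section of E(*D) whose formal
  -- coordinates have no polar part extends to the lattice.
  lift : ∀ s (hs : (E.bdl.star S.D).IsSec s x),
    (∀ k, ∀ n < 0, (hat (LocFree.tmul 1 (LocFree.germ s hs)) k).coeff n = 0) →
      ∃ s', E.bdl.IsSec s' x ∧ ∀ᶠ y : Off S.D in near S.D x, s' (pt y) = s y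
  surj : ∀ v, ∃ s, E.bdl.IsSec s x ∧ s (pt x) = v
  mem_hatIdeal : ∀ m, m ∈ E.hatIdeal x ↔ ∀ k, ∀ n ≤ 0, (hat m k).coeff n = 0
  mem_eigen : ∀ v ξ α, v ∈ E.eigen x ξ α ↔ ∀ k, fib v k ≠ 0 → S.fac x k = ξ ∧ S.expn x k = α

/-- The Laurent series without polar part. -/
theorem exists_powerSeries {f : LaurentSeries ℂ} (h : ∀ n < 0, f.coeff n = 0) :
    ∃ g : PowerSeries ℂ, f = HahnSeries.ofPowerSeries ℤ ℂ g := by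
  refine ⟨PowerSeries.mk fun n => f.coeff n, ?_⟩
  ext n
  rcases lt_or_ge n 0 with hn | hn
  · rw [h n hn, ofPowerSeries_coeff_neg _ hn]
  · obtain ⟨m, rfl⟩ := Int.eq_ofNat_of_zero_le hn
    rw [ofPowerSeries_coeff_natCast, PowerSeries.coeff_mk]

theorem ofPowerSeries_coeff_zero (f : PowerSeries ℂ) :
    (HahnSeries.ofPowerSeries ℤ ℂ f).coeff 0 = PowerSeries.constantCoeff f := by
  rw [← PowerSeries.coeff_zero_eq_constantCoeff_apply]
  exact ofPowerSeries_coeff_natCast f 0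

/-- The matrix of Laurent series of a matrix of power series. -/
def laurentMatrix {ι κ : Type*} (T : Matrix ι κ (PowerSeries ℂ)) :
    Matrix ι κ (LaurentSeries ℂ) := T.map (HahnSeries.ofPowerSeries ℤ ℂ)

section LaurentMatrix

variable {r : ℕ} {T : Matrix (Fin r) (Fin r) (PowerSeries ℂ)}

theorem laurentMatrix_mulVec_coeff_neg {v : Fin r → LaurentSeries ℂ}
    (hv : ∀ k, ∀ n < 0, (v k).coeff n = 0) (k : Fin r) {n : ℤ} (hn : n < 0) :
    ((laurentMatrix T).mulVec v k).coeff n = 0 := by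
  choose g hg using fun k => exists_powerSeries (hv k)
  have : (laurentMatrix T).mulVec v k = HahnSeries.ofPowerSeries ℤ ℂ (T.mulVec g k) := by
    simp only [Matrix.mulVec, dotProduct, map_sum, map_mul, hg]
    rfl
  rw [this, ofPowerSeries_coeff_neg _ hn]

theorem laurentMatrix_mulVec_coeff_zero (hT : T.map PowerSeries.constantCoeff = 1)
    {v : Fin r → LaurentSeries ℂ} (hv : ∀ k, ∀ n < 0, (v k).coeff n = 0) (k : Fin r) :
    ((laurentMatrix T).mulVec v k).coeff 0 = (v k).coeff 0 := by
  choose g hg using fun k => exists_powerSeries (hv k)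
  have : (laurentMatrix T).mulVec v k = HahnSeries.ofPowerSeries ℤ ℂ (T.mulVec g k) := by
    simp only [Matrix.mulVec, dotProduct, map_sum, map_mul, hg]
    rfl
  rw [this, ofPowerSeries_coeff_zero, hg, ofPowerSeries_coeff_zero]
  have h1 : PowerSeries.constantCoeff (T.mulVec g k) =
      (T.map PowerSeries.constantCoeff).mulVec (fun j => PowerSeries.constantCoeff (g j)) k := by
    simp only [Matrix.mulVec, dotProduct, map_sum, map_mul]
    rfl
  rw [h1, hT, Matrix.one_mulVec]

end LaurentMatrix

/-! ### Locality and the Leibniz rule for several sections -/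

theorem LocFree.IsSec.sum {D : Set Sphere} {r : ℕ} {M : LocFree D r} {x : Sphere} {ι : Type*}
    (J : Finset ι) {t : ι → ∀ y, M.fib y} (ht : ∀ i ∈ J, M.IsSec (t i) x) :
    M.IsSec (fun y => ∑ i ∈ J, t i y) x := by
  classical
  induction J using Finset.induction_on with
  | empty => exact M.isSec_zero x
  | insert i J hi ih =>
    simp only [Finset.sum_insert hi]
    exact (ht i (Finset.mem_insert_self i J)).add
      (ih fun j hj => ht j (Finset.mem_insert_of_mem hj))

namespace Flat

variable {S : SingData} (M : Flat S)

/-- The difference of the two functions vanishes near y, so `del_zero` applies to it: ∂_x is a local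
operator. -/
theorem del_congr {y : Off S.D} {s t : ∀ y, M.bdl.fib y} (hs : M.bdl.IsSec s y)
    (h : ∀ᶠ y' in near S.D y, t y' = s y') : M.conn.del t y = M.conn.del s y := by
  have h0 : ∀ᶠ y' in near S.D y, (t - s) y' = 0 := by
    filter_upwards [h] with y' h'
    rw [Pi.sub_apply, h', sub_self]
  have h1 := M.conn.add y s (t - s) hs ((M.bdl.isSec_zero y).congr h0)
  rw [M.del_zero y h0, add_zero, add_sub_cancel] at h1
  exact h1

theorem del_sum_smul {ι : Type*} (J : Finset ι) {y : Off S.D} {t : ι → ∀ y, M.bdl.fib y}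
    (ht : ∀ i ∈ J, M.bdl.IsSec (t i) y) {g : ι → ℂ → ℂ} (hg : ∀ i ∈ J, AnalyticAt ℂ (g i) 0) :
    M.conn.del (fun y' => ∑ i ∈ J, g i (coord y y') • t i y') y =
      ∑ i ∈ J, (deriv (g i) 0 • t i y + g i 0 • M.conn.del (t i) y) := by
  classical
  induction J using Finset.induction_on with
  | empty => simpa using M.del_zero y (s := fun _ => 0) (Eventually.of_forall fun _ => rfl)
  | insert i J hi ih =>
    have h1 : ∀ j ∈ J, M.bdl.IsSec (t j) y := fun j hj => ht j (Finset.mem_insert_of_mem hj)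
    have h2 : ∀ j ∈ J, AnalyticAt ℂ (g j) 0 := fun j hj => hg j (Finset.mem_insert_of_mem hj)
    have hi1 := ht i (Finset.mem_insert_self i J)
    have hi2 := hg i (Finset.mem_insert_self i J)
    simp only [Finset.sum_insert hi]
    rw [← ih h1 h2, ← M.conn.leibniz y (g i) (t i) hi2 hi1]
    exact M.conn.add y (fun y' => g i (coord y y') • t i y')
      (fun y' => ∑ j ∈ J, g j (coord y y') • t j y')
      (hi1.smul (Coef.of_analytic hi2))
      (LocFree.IsSec.sum J fun j hj => (h1 j hj).smul (Coef.of_analytic (h2 j hj)))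

end Flat

theorem meromorphicAt_inv : MeromorphicAt (fun z : ℂ => z⁻¹) 0 := (MeromorphicAt.id 0).inv

theorem meromorphicAt_const_mul_inv (a : ℂ) : MeromorphicAt (fun z : ℂ => a * z⁻¹) 0 :=
  (MeromorphicAt.const a 0).mul meromorphicAt_inv

theorem laurent_const_mul_inv (a : ℂ) :
    laurent (fun z : ℂ => a * z⁻¹) = HahnSeries.single (-1) a := by
  rw [laurent_mul (MeromorphicAt.const a 0) meromorphicAt_inv, laurent_const, laurent_inv_id,
    ← single_eq_C_mul]

/-- The basis of the fibre given by a frame of a holomorphic bundle. -/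
def IsFrame.basisAt {r : ℕ} {E : HolBundle r} {e : Fin r → ∀ y, E.fib y} {x : Sphere}
    (he : IsFrame E.IsSec e x) : Module.Basis (Fin r) ℂ (E.fib (pt x)) :=
  Module.Basis.mk ((Eventually.self_of_nhds he).1 (Set.notMem_empty x)).1
    ((Eventually.self_of_nhds he).1 (Set.notMem_empty x)).2.ge

theorem IsFrame.basisAt_apply {r : ℕ} {E : HolBundle r} {e : Fin r → ∀ y, E.fib y} {x : Sphere}
    (he : IsFrame E.IsSec e x) (i : Fin r) : he.basisAt i = e i (pt x) :=
  Module.Basis.mk_apply _ _ _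

/-- The holomorphic coefficients of a holomorphic section. -/
theorem IsFrame.exists_hol {r : ℕ} {E : HolBundle r} {e : Fin r → ∀ y, E.fib y} {x : Sphere}
    (he : IsFrame E.IsSec e x) {s : ∀ y, E.fib y} (hs : E.IsSec s x) :
    ∃ A : Fin r → Hol0, (∀ᶠ y in near ∅ x, s y = ∑ i, A i (coord x y) • e i y) ∧
      s (pt x) = ∑ i, A i 0 • e i (pt x) := by
  obtain ⟨g, hg, h⟩ := (he.isSec_iff s).1 hs
  refine ⟨fun i => ⟨g i, (hg i).2 (Set.notMem_empty x)⟩, h, ?_⟩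
  have := (eventually_near_empty_iff.1 h).self_of_nhds
  rw [coord_self] at this
  exact this

theorem IsFrame.isSec_of_hol {r : ℕ} {E : HolBundle r} {e : Fin r → ∀ y, E.fib y} {x : Sphere}
    (he : IsFrame E.IsSec e x) (A : Fin r → Hol0) :
    E.IsSec (fun y => ∑ i, A i (coord x y) • e i y) x :=
  (he.isSec_iff _).2 ⟨fun i => A i, fun i => Coef.of_analytic (A i).analyticAt,
    Eventually.of_forall fun _ => rfl⟩

theorem eulerSeries_C (a : ℂ) : eulerSeries (HahnSeries.C a) = 0 := by
  ext n
  rw [eulerSeries_coeff]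
  by_cases hn : n = 0
  · simp [hn]
  · rw [HahnSeries.C_apply, HahnSeries.coeff_single_of_ne hn, mul_zero, HahnSeries.coeff_zero]

theorem eulerSeries_one : eulerSeries 1 = 0 := by
  rw [← map_one (HahnSeries.C : ℂ →+* LaurentSeries ℂ), eulerSeries_C]

theorem hat_C_smul {S : SingData} {M : LocFree S.D S.r} {x : Sphere} (a : ℂ) (m : M.Hat x) :
    a • m = (HahnSeries.C a : LaurentSeries ℂ) • m := rfl

namespace HolConn

variable {S : SingData} (E : HolConn S) {x : Sphere}

/-- The restriction of a section of the lattice to the complement of the singularities. -/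
def res (s : ∀ y, E.bdl.fib y) : ∀ y, E.toFlat.bdl.fib y := LocFree.restrict S.D s

theorem isSec_res {s : ∀ y, E.bdl.fib y} (hs : E.bdl.IsSec s x) :
    E.toFlat.bdl.IsSec (E.res s) x := LocFree.isSec_restrict S.D hs

theorem germ_eq_res {s : ∀ y, E.bdl.fib y} (hs : E.bdl.IsSec s x) :
    E.germ s hs = LocFree.germ (E.res s) (E.isSec_res hs) := rfl

end HolConn

/-- The operator `z ∂_z + ξ / z` on sections and on the formal completion. -/
theorem HolConn.tmul_germ_of_twist {S : SingData} {E : HolConn S} {x : Sphere} {ξ : ℂ}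
    {s u : ∀ y, E.bdl.fib y} (hs : E.bdl.IsSec s x) (hu : E.bdl.IsSec u x)
    (h : ∀ᶠ y : Off S.D in near S.D x, u (pt y) = E.twist x ξ s y) :
    LocFree.tmul 1 (E.germ u hu) = E.toFlat.hatEuler x (LocFree.tmul 1 (E.germ s hs)) +
      (HahnSeries.single (-1) ξ : LaurentSeries ℂ) • LocFree.tmul 1 (E.germ s hs) := by
  let t : Fin 2 → ∀ y, E.toFlat.bdl.fib y :=
    ![E.toFlat.eulerField x (E.res s), E.res s]
  have hs' : E.toFlat.bdl.IsSec (E.res s) x := E.isSec_res hs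
  have ht : ∀ i, E.toFlat.bdl.IsSec (t i) x := by
    intro i
    fin_cases i
    · exact E.toFlat.isSec_eulerField hs'
    · exact hs'
  have h1 := tmul_germ_eq_sum (M := E.toFlat.bdl) (E.isSec_res hu) ht
    (g := ![fun _ => 1, fun z => ξ * z⁻¹])
    (by
      intro i
      fin_cases i
      · exact MeromorphicAt.const 1 0
      · exact meromorphicAt_const_mul_inv ξ)
    (by
      filter_upwards [h] with y hy
      rw [Fin.sum_univ_two]
      change u (pt y) = (1 : ℂ) • (eulerFactor x y • E.del s y) + (ξ * (coord x y)⁻¹) • s (pt y)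
      rw [hy, one_smul]
      rfl) 1
  refine h1.trans ?_
  rw [Fin.sum_univ_two]
  have h2 : E.toFlat.hatEuler x (LocFree.tmul 1 (E.germ s hs)) =
      LocFree.tmul 1 (LocFree.germ (t 0) (ht 0)) := by
    refine (E.toFlat.hatEuler_tmul 1 hs').trans ?_
    rw [eulerSeries_one, tmul_zero_left, zero_add]
    rfl
  rw [h2]
  congr 1
  · change (1 * laurent fun _ => 1) • _ = _
    rw [laurent_const, map_one, one_mul, one_smul]
  · change (1 * laurent fun z => ξ * z⁻¹) • _ = _
    rw [laurent_const_mul_inv, one_mul]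
    rfl

section Construction

variable {S : SingData} {E : HolConn S} {x : Sphere}

theorem laurentMatrix_mul {ι κ τ : Type*} [Fintype κ] (T : Matrix ι κ (PowerSeries ℂ))
    (U : Matrix κ τ (PowerSeries ℂ)) :
    laurentMatrix (T * U) = laurentMatrix T * laurentMatrix U :=
  Matrix.map_mul

theorem laurentMatrix_one {ι : Type*} [DecidableEq ι] :
    laurentMatrix (1 : Matrix ι ι (PowerSeries ℂ)) = 1 :=
  Matrix.map_one _ (map_zero _) (map_one _)

/-- The change of coordinates by an invertible matrix of power series. -/
def gaugeEquiv {r : ℕ} (T T' : Matrix (Fin r) (Fin r) (PowerSeries ℂ)) (h : T * T' = 1)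
    (h' : T' * T = 1) :
    (Fin r → LaurentSeries ℂ) ≃ₗ[LaurentSeries ℂ] (Fin r → LaurentSeries ℂ) :=
  LinearEquiv.ofLinearMap (laurentMatrix T').mulVecLin (laurentMatrix T).mulVecLin
    (by rw [← Matrix.mulVecLin_mul, ← laurentMatrix_mul, h', laurentMatrix_one,
      Matrix.mulVecLin_one])
    (by rw [← Matrix.mulVecLin_mul, ← laurentMatrix_mul, h, laurentMatrix_one,
      Matrix.mulVecLin_one])

theorem eulerSeries_sum {ι : Type*} (J : Finset ι) (f : ι → LaurentSeries ℂ) :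
    eulerSeries (∑ i ∈ J, f i) = ∑ i ∈ J, eulerSeries (f i) := map_sum _ _ _

/-- A frame of the lattice as a frame of the meromorphic bundle. -/
theorem IsFrame.toFlat {e : Fin S.r → ∀ y, E.bdl.fib y} (he : IsFrame E.bdl.IsSec e x) :
    IsFrame E.toFlat.bdl.IsSec (fun i => E.res (e i)) x := he.star S.D

/-- On the frame this is the hypothesis `hG`, read through Laurent expansion. The Leibniz rule for
Laurent coefficients extends it to the whole completion. -/
theorem IsFrame.hatCoord_euler (hx : x ∈ S.D) {e : Fin S.r → ∀ y, E.bdl.fib y}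
    (he : IsFrame E.bdl.IsSec e x) {G : Fin S.r → Fin S.r → Hol0}
    (hG : ∀ k, ∀ᶠ y : Off S.D in near S.D x,
      eulerFactor x y • E.del (e k) y = (-S.fac x k * (coord x y)⁻¹ + S.expn x k) • e k (pt y) +
        ∑ i, (coord x y * G i k (coord x y)) • e i (pt y)) (m : E.toFlat.bdl.Hat x) (i : Fin S.r) :
    he.toFlat.hatCoord hx (E.toFlat.hatEuler x m) i =
      eulerSeries (he.toFlat.hatCoord hx m i) +
      diagEntry (S.fac x i) (S.expn x i) * he.toFlat.hatCoord hx m i +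
      ∑ j, HahnSeries.single 1 1 * HahnSeries.ofPowerSeries ℤ ℂ (taylor (G i j)) *
        he.toFlat.hatCoord hx m j := by
  classical
  set H := he.toFlat.hatCoord hx
  have hframe : ∀ k i, H (E.toFlat.hatEuler x (LocFree.tmul 1
      (LocFree.germ (E.res (e k)) (he.toFlat.isSec k)))) i =
      (Pi.single k (diagEntry (S.fac x k) (S.expn x k)) : Fin S.r → LaurentSeries ℂ) i +
      HahnSeries.single 1 1 * HahnSeries.ofPowerSeries ℤ ℂ (taylor (G i k)) := by
    intro k i
    rw [E.toFlat.hatEuler_tmul, eulerSeries_one, tmul_zero_left, zero_add]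
    have h1 : MeromorphicAt (fun z : ℂ => -S.fac x k * z⁻¹ + S.expn x k) 0 :=
      (meromorphicAt_const_mul_inv _).add (MeromorphicAt.const _ 0)
    have h2 : MeromorphicAt (fun z : ℂ => z * G i k z) 0 :=
      (MeromorphicAt.id 0).mul (G i k).analyticAt.meromorphicAt
    have h1' : laurent (fun z : ℂ => -S.fac x k * z⁻¹ + S.expn x k) =
        diagEntry (S.fac x k) (S.expn x k) := by
      rw [laurent_add (meromorphicAt_const_mul_inv _) (MeromorphicAt.const _ 0),
        laurent_const_mul_inv, laurent_const]
      rfl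
    have h2' : laurent (fun z : ℂ => z * G i k z) =
        HahnSeries.single 1 1 * HahnSeries.ofPowerSeries ℤ ℂ (taylor (G i k)) := by
      refine (laurent_mul (f := fun z => z) (MeromorphicAt.id 0)
        (G i k).analyticAt.meromorphicAt).trans ?_
      rw [laurent_id, laurent_hol]
      rfl
    refine (he.toFlat.hatCoord_tmul hx 1 _ (g := fun i z =>
      (if i = k then -S.fac x k * z⁻¹ + S.expn x k else 0) + z * G i k z) ?_ i).trans ?_
    · filter_upwards [hG k] with y hy
      refine hy.trans ?_
      simp only [add_smul, Finset.sum_add_distrib, ite_smul, zero_smul, Finset.sum_ite_eq',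
        Finset.mem_univ, if_true]
      rfl
    · by_cases hik : i = k
      · subst hik
        simp only [if_true, Pi.single_eq_same]
        rw [laurent_add h1 h2, h1', h2', one_mul]
      · simp only [if_neg hik, zero_add, Pi.single_eq_of_ne hik]
        rw [h2', one_mul]
  have hm : m = ∑ k, H m k •
      LocFree.tmul 1 (LocFree.germ (E.res (e k)) (he.toFlat.isSec k)) := by
    rw [← he.toFlat.hatCoord_symm hx]
    exact (H.symm_apply_apply m).symm
  conv_lhs => rw [hm]
  rw [map_sum, map_sum, Finset.sum_apply]
  have h3 : ∀ k, H (E.toFlat.hatEuler x (H m k •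
      LocFree.tmul 1 (LocFree.germ (E.res (e k)) (he.toFlat.isSec k)))) i =
      eulerSeries (H m k) * (Pi.single k 1 : Fin S.r → LaurentSeries ℂ) i + H m k *
        ((Pi.single k (diagEntry (S.fac x k) (S.expn x k)) : Fin S.r → LaurentSeries ℂ) i +
      HahnSeries.single 1 1 * HahnSeries.ofPowerSeries ℤ ℂ (taylor (G i k))) := by
    intro k
    rw [E.toFlat.hatEuler_smul, map_add, map_smul, map_smul, Pi.add_apply, Pi.smul_apply,
      Pi.smul_apply, hframe, smul_eq_mul, smul_eq_mul]
    congr 2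
    exact congrFun (he.toFlat.hatCoordMap_frame hx k) i
  simp only [h3, Finset.sum_add_distrib, mul_add]
  rw [add_assoc]
  congr 1
  · simp [Pi.single_apply]
  · congr 1
    · simp [Pi.single_apply, mul_comm]
    · exact Finset.sum_congr rfl fun k _ => by ring

end Construction

section Construction

variable {S : SingData} {E : HolConn S} {x : Sphere}

theorem hol_sum_apply {ι : Type*} (J : Finset ι) (f : ι → Hol0) (z : ℂ) :
    (∑ i ∈ J, f i : Hol0) z = ∑ i ∈ J, f i z := by
  classical
  induction J using Finset.induction_on with
  | empty => rfl
  | insert i J hi ih => rw [Finset.sum_insert hi, Finset.sum_insert hi, Hol0.add_apply, ih]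

variable (hx : x ∈ S.D) {e : Fin S.r → ∀ y, E.bdl.fib y} (he : IsFrame E.bdl.IsSec e x)

theorem IsFrame.hatCoord_germ {s : ∀ y, E.bdl.fib y} (hs : E.bdl.IsSec s x) {A : Fin S.r → Hol0}
    (hA : ∀ᶠ y in near ∅ x, s y = ∑ i, A i (coord x y) • e i y) (f : LaurentSeries ℂ)
    (i : Fin S.r) :
    he.toFlat.hatCoord hx (LocFree.tmul f (E.germ s hs)) i =
      f * algebraMap Hol0 (LaurentSeries ℂ) (A i) := by
  rw [← laurent_hol, E.germ_eq_res hs]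
  exact he.toFlat.hatCoord_tmul hx f (E.isSec_res hs) (g := fun i => A i)
    (SingData.near_of_near_empty hA) i

/-- A vector that satisfies the combinatorial condition is an eigenvector of the polar part. -/
theorem IsFrame.mem_eigen {e : Fin S.r → ∀ y, E.bdl.fib y} (he : IsFrame E.bdl.IsSec e x)
    {G : Fin S.r → Fin S.r → Hol0}
    (hG : ∀ k, ∀ᶠ y : Off S.D in near S.D x,
      eulerFactor x y • E.del (e k) y = (-S.fac x k * (coord x y)⁻¹ + S.expn x k) • e k (pt y) +
        ∑ i, (coord x y * G i k (coord x y)) • e i (pt y)) {v : Fin S.r → ℂ} {ξ α : ℂ}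
    (hv : ∀ k, v k ≠ 0 → S.fac x k = ξ ∧ S.expn x k = α) :
    ∑ i, v i • e i (pt x) ∈ E.eigen x ξ α := by
  -- The vector is extended with constant coefficients. Where v_k ≠ 0 one has ξ_k = ξ and α_k = α,
  -- so z∂_z + ξ/z loses its polar terms and leaves αv + zGv, whose coefficients are `A`.
  let A : Fin S.r → Hol0 := fun i => cHol (α * v i) + zHol * ∑ k, cHol (v k) * G i k
  have hA : ∀ i z, A i z = α * v i + ∑ k, v k * (z * G i k z) := by
    intro i z
    change α * v i + z * (∑ k, cHol (v k) * G i k : Hol0) z = _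
    rw [hol_sum_apply, Finset.mul_sum]
    congr 1
    refine Finset.sum_congr rfl fun k _ => ?_
    rw [Hol0.mul_apply]
    change z * (v k * _) = _
    ring
  refine ⟨fun y => ∑ i, cHol (v i) (coord x y) • e i y, fun y => ∑ i, A i (coord x y) • e i y,
    he.isSec_of_hol _, he.isSec_of_hol _, rfl, ?_, ?_⟩
  · change ∑ i, A i (coord x x) • e i (pt x) = _
    rw [Finset.smul_sum]
    refine Finset.sum_congr rfl fun i _ => ?_
    rw [hA, coord_self]
    simp [mul_smul]
  · filter_upwards [eventually_all.2 hG, eventually_all.2 fun k => isSec_eventually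
      (E.isSec_res (he.isSec k))] with y h1 h2
    have h3 : E.del (fun y => ∑ i, cHol (v i) (coord x y) • e i y) y = ∑ i, v i • E.del (e i) y := by
      have := E.toFlat.del_sum_smul Finset.univ (y := y) (t := fun i => E.res (e i))
        (fun i _ => h2 i) (g := fun i _ => v i) (fun i _ => analyticAt_const)
      simp only [deriv_const, zero_smul, zero_add] at this
      exact this
    have h4 : ∀ k, v k • (eulerFactor x y • E.del (e k) y) + (v k * (ξ * (coord x y)⁻¹)) • e k (pt y) =
        (α * v k) • e k (pt y) + ∑ i, (v k * (coord x y * G i k (coord x y))) • e i (pt y) := by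
      intro k
      by_cases hk : v k = 0
      · simp [hk]
      · obtain ⟨h5, h6⟩ := hv k hk
        rw [h1 k, h5, h6, smul_add, smul_smul, Finset.smul_sum, add_right_comm, ← add_smul]
        simp only [smul_smul]
        congr 2
        ring
    change ∑ i, A i (coord x y) • e i (pt y) = eulerFactor x y • E.del _ y +
      (ξ / coord x y) • ∑ i, v i • e i (pt y)
    rw [h3, Finset.smul_sum, Finset.smul_sum, ← Finset.sum_add_distrib]
    have h5 : ∀ k, eulerFactor x y • v k • E.del (e k) y + (ξ / coord x y) • v k • e k (pt y) =
        (α * v k) • e k (pt y) + ∑ i, (v k * (coord x y * G i k (coord x y))) • e i (pt y) := by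
      intro k
      rw [← h4 k, smul_comm (eulerFactor x y), smul_smul (ξ / coord x y), div_eq_mul_inv,
        mul_comm (v k)]
    rw [Finset.sum_congr rfl fun k _ => h5 k, Finset.sum_add_distrib, Finset.sum_comm,
      ← Finset.sum_add_distrib]
    refine Finset.sum_congr rfl fun i _ => ?_
    rw [hA, add_smul, Finset.sum_smul]

end Construction

/-- In the situation without resonances, there are formal charts. -/
theorem HolConn.HasType.nonempty_formalChart {S : SingData} {E : HolConn S} (hE : E.HasType)
    (hS : S.ResonanceFree) {x : Sphere} (hx : x ∈ S.D) : Nonempty (FormalChart E x) := by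
  obtain ⟨e, he, G, hG⟩ := hE.exists_model hx
  obtain ⟨T, T', hTT', hT'T, hT, hT', hTG⟩ := exists_gauge (hS.nonResonant hx)
    fun i k => taylor (G i k)
  let H := he.toFlat.hatCoord hx
  -- The frame coordinates are corrected by the inverse gauge matrix. It is a matrix of power series
  -- equal to 1 modulo z, so regularity of coordinates and constant terms on the lattice are
  -- unaffected.
  let c : E.toFlat.bdl.Hat x ≃ₗ[LaurentSeries ℂ] (Fin S.r → LaurentSeries ℂ) :=
    H.trans (gaugeEquiv T T' hTT' hT'T)
  have hc : ∀ m, c m = (laurentMatrix T').mulVec (H m) := fun m => rfl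
  have hHc : ∀ m, H m = (laurentMatrix T).mulVec (c m) := by
    intro m
    rw [hc, Matrix.mulVec_mulVec, ← laurentMatrix_mul, hTT', laurentMatrix_one, Matrix.one_mulVec]
  have hH : ∀ s (hs : E.bdl.IsSec s x), (∀ k, ∀ n < 0,
      (H (LocFree.tmul 1 (E.germ s hs)) k).coeff n = 0) ∧
      ∀ k, (H (LocFree.tmul 1 (E.germ s hs)) k).coeff 0 = he.basisAt.equivFun (s (pt x)) k := by
    intro s hs
    obtain ⟨A, hA, hA0⟩ := he.exists_hol hs
    have h1 := he.hatCoord_germ hx hs hA 1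
    refine ⟨fun k n hn => ?_, fun k => ?_⟩
    · rw [h1, one_mul, algebraMap_coeff_neg _ hn]
    · rw [h1, one_mul, algebraMap_coeff_zero, hA0]
      simp only [← he.basisAt_apply]
      rw [← he.basisAt.equivFun_symm_apply, LinearEquiv.apply_symm_apply]
  have heuler : ∀ m k, c (E.toFlat.hatEuler x m) k =
      eulerSeries (c m k) + diagEntry (S.fac x k) (S.expn x k) * c m k := by
    intro m
    set w := c m with hw
    have h1 : H (E.toFlat.hatEuler x m) = (laurentMatrix T).mulVec fun k =>
        eulerSeries (w k) + diagEntry (S.fac x k) (S.expn x k) * w k := by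
      funext i
      refine (he.hatCoord_euler hx hG m i).trans ?_
      change eulerSeries (H m i) + diagEntry (S.fac x i) (S.expn x i) * H m i +
        ∑ j, _ * H m j = _
      rw [hHc m, ← hw]
      simp only [Matrix.mulVec, dotProduct]
      rw [eulerSeries_sum, Finset.mul_sum]
      simp only [Finset.mul_sum]
      rw [Finset.sum_comm, ← Finset.sum_add_distrib, ← Finset.sum_add_distrib]
      refine Finset.sum_congr rfl fun k _ => ?_
      have h2 := hTG i k
      change eulerSeries (laurentMatrix T i k) + diagEntry (S.fac x i) (S.expn x i) *
        laurentMatrix T i k + _ = diagEntry (S.fac x k) (S.expn x k) * laurentMatrix T i k at h2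
      have h3 : ∑ j, (HahnSeries.single 1 1 : LaurentSeries ℂ) * HahnSeries.ofPowerSeries ℤ ℂ
          (taylor (G i j) * T j k) = ∑ j, (HahnSeries.single 1 1 : LaurentSeries ℂ) *
          HahnSeries.ofPowerSeries ℤ ℂ (taylor (G i j)) * laurentMatrix T j k := by
        refine Finset.sum_congr rfl fun j _ => ?_
        rw [map_mul, ← mul_assoc]
        rfl
      rw [h3] at h2
      rw [eulerSeries_mul]
      have h4 : ∑ j, (HahnSeries.single 1 1 : LaurentSeries ℂ) *
          HahnSeries.ofPowerSeries ℤ ℂ (taylor (G i j)) * (laurentMatrix T j k * w k) =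
          (∑ j, (HahnSeries.single 1 1 : LaurentSeries ℂ) *
          HahnSeries.ofPowerSeries ℤ ℂ (taylor (G i j)) * laurentMatrix T j k) * w k := by
        rw [Finset.sum_mul]
        exact Finset.sum_congr rfl fun j _ => by ring
      rw [h4]
      linear_combination w k * h2
    intro k
    rw [hc, h1, Matrix.mulVec_mulVec, ← laurentMatrix_mul, hT'T, laurentMatrix_one,
      Matrix.one_mulVec]
  have hneg : ∀ s (hs : E.bdl.IsSec s x) k, ∀ n < 0,
      (c (LocFree.tmul 1 (E.germ s hs)) k).coeff n = 0 := by
    intro s hs k n hn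
    rw [hc]
    exact laurentMatrix_mulVec_coeff_neg (hH s hs).1 k hn
  have hzero : ∀ s (hs : E.bdl.IsSec s x) k,
      (c (LocFree.tmul 1 (E.germ s hs)) k).coeff 0 = he.basisAt.equivFun (s (pt x)) k := by
    intro s hs k
    rw [hc, laurentMatrix_mulVec_coeff_zero hT' (hH s hs).1 k, (hH s hs).2]
  refine ⟨⟨c, he.basisAt.equivFun, heuler, hneg, hzero, ?_, ?_, ?_, ?_⟩⟩
  · intro s hs hpow
    obtain ⟨g, hg, hsg⟩ := (he.toFlat.isSec_iff s).1 hs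
    have h1 : ∀ k, ∀ n < 0, (laurent (g k)).coeff n = 0 := by
      intro k n hn
      have h2 : H (LocFree.tmul 1 (LocFree.germ s hs)) k = 1 * laurent (g k) :=
        he.toFlat.hatCoord_tmul hx 1 hs hsg k
      rw [one_mul] at h2
      rw [← h2, hHc]
      exact laurentMatrix_mulVec_coeff_neg hpow k hn
    choose A hA using fun k => exists_hol_of_laurent (hg k).1 (h1 k)
    refine ⟨_, he.isSec_of_hol A, ?_⟩
    filter_upwards [hsg, eventually_all.2 fun k =>
      (SingData.eventually_near_coord_iff hx (p := fun z => g k z = A k z)).2 (hA k)] with y h2 h3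
    refine Eq.trans ?_ h2.symm
    exact Finset.sum_congr rfl fun i _ => by rw [h3]; rfl
  · intro v
    refine ⟨_, he.isSec_of_hol fun i => cHol (he.basisAt.equivFun v i), ?_⟩
    have := he.basisAt.sum_equivFun v
    simp only [he.basisAt_apply] at this
    exact this
  · intro m
    constructor
    · intro hm
      refine Submodule.span_induction ?_ ?_ ?_ ?_ hm
      · rintro _ ⟨f, s, hs, rfl⟩ k n hn
        have h1 : LocFree.tmul (HahnSeries.ofPowerSeries ℤ ℂ (PowerSeries.X * f)) (E.germ s hs) =
            HahnSeries.ofPowerSeries ℤ ℂ (PowerSeries.X * f) • LocFree.tmul 1 (E.germ s hs) := by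
          rw [smul_tmul', mul_one]
        obtain ⟨g, hg⟩ := exists_powerSeries (hneg s hs k)
        rw [h1, map_smul, Pi.smul_apply, hg, smul_eq_mul, ← map_mul, mul_assoc, map_mul,
          HahnSeries.ofPowerSeries_X, single_mul_coeff, ofPowerSeries_coeff_neg _ (by omega)]
      · intro k n _
        rw [map_zero, Pi.zero_apply, HahnSeries.coeff_zero]
      · intro m m' _ _ h1 h2 k n hn
        rw [map_add, Pi.add_apply, HahnSeries.coeff_add, h1 k n hn, h2 k n hn, add_zero]
      · intro a m _ h1 k n hn
        rw [hat_C_smul, map_smul, Pi.smul_apply, smul_eq_mul, coeff_C_mul, h1 k n hn, mul_zero]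
    · intro hm
      have h1 : ∀ k, ∃ g : PowerSeries ℂ, c m k = HahnSeries.ofPowerSeries ℤ ℂ (PowerSeries.X * g) := by
        intro k
        obtain ⟨g, hg⟩ := exists_powerSeries (f := HahnSeries.single (-1) 1 * c m k)
          (fun n hn => by rw [single_mul_coeff]; exact hm k _ (by omega))
        refine ⟨g, ?_⟩
        rw [map_mul, HahnSeries.ofPowerSeries_X, ← hg, ← mul_assoc, single_mul_single_neg, one_mul]
      choose g hg using h1
      have h2 : ∀ i, H m i = HahnSeries.ofPowerSeries ℤ ℂ (PowerSeries.X * T.mulVec g i) := by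
        intro i
        rw [hHc]
        simp only [Matrix.mulVec, dotProduct, Finset.mul_sum, map_sum, hg]
        refine Finset.sum_congr rfl fun k _ => ?_
        rw [mul_left_comm, map_mul _ (T i k)]
        rfl
      have h3 : m = ∑ k, LocFree.tmul (HahnSeries.ofPowerSeries ℤ ℂ
          (PowerSeries.X * T.mulVec g k)) (E.germ (e k) (he.isSec k)) := by
        rw [← H.symm_apply_apply m]
        refine (he.toFlat.hatCoord_symm hx _).trans ?_
        refine Finset.sum_congr rfl fun k _ => ?_
        rw [h2, smul_tmul', mul_one]
        rfl
      rw [h3]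
      exact Submodule.sum_mem _ fun k _ => Submodule.subset_span ⟨_, _, he.isSec k, rfl⟩
  · intro v ξ α
    constructor
    · rintro ⟨s, u, hs, hu, rfl, huv, h⟩ k hk
      have h1 : c (LocFree.tmul 1 (E.germ u hu)) k = eulerSeries (c (LocFree.tmul 1 (E.germ s hs)) k)
          + diagEntry (S.fac x k) (S.expn x k) * c (LocFree.tmul 1 (E.germ s hs)) k +
          HahnSeries.single (-1) ξ * c (LocFree.tmul 1 (E.germ s hs)) k := by
        rw [HolConn.tmul_germ_of_twist hs hu h, map_add, Pi.add_apply, heuler, map_smul]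
        rfl
      have h2 : ∀ n : ℤ, (c (LocFree.tmul 1 (E.germ u hu)) k).coeff n =
          n * (c (LocFree.tmul 1 (E.germ s hs)) k).coeff n +
          (-S.fac x k * (c (LocFree.tmul 1 (E.germ s hs)) k).coeff (n + 1) +
            S.expn x k * (c (LocFree.tmul 1 (E.germ s hs)) k).coeff n) +
          ξ * (c (LocFree.tmul 1 (E.germ s hs)) k).coeff (n + 1) := by
        intro n
        rw [h1, HahnSeries.coeff_add, HahnSeries.coeff_add, eulerSeries_coeff, diagEntry_mul_coeff,
          single_eq_C_mul, mul_assoc, coeff_C_mul, single_mul_coeff, sub_neg_eq_add]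
      -- Since u has no pole, the coefficient of z⁻¹ gives (ξ - ξ_k) v_k = 0. Then the coefficient
      -- of z⁰ gives α_k v_k = α v_k.
      have h3 := h2 (-1)
      rw [hneg u hu k (-1) (by omega), hneg s hs k (-1) (by omega), neg_add_cancel, hzero] at h3
      have h4 : S.fac x k = ξ := by
        have : (ξ - S.fac x k) * he.basisAt.equivFun (s (pt x)) k = 0 := by
          linear_combination -h3
        exact (sub_eq_zero.1 ((mul_eq_zero.1 this).resolve_right hk)).symm
      refine ⟨h4, ?_⟩
      have h5 := h2 0
      rw [hzero, hzero, huv, map_smul, h4, Pi.smul_apply, smul_eq_mul] at h5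
      push_cast at h5
      refine mul_right_cancel₀ hk ?_
      linear_combination -h5
    · intro h
      have h1 := IsFrame.mem_eigen he hG h
      have h2 := he.basisAt.sum_equivFun v
      simp only [he.basisAt_apply] at h2
      rwa [h2] at h1

/-! ### Maps of formal completions -/

namespace LocFree

variable {S : SingData} {M N : LocFree S.D S.r} {x : Sphere}

theorem Hom.hat_tmul (φ : Hom M N) (f : LaurentSeries ℂ) {s : ∀ y, M.fib y} (hs : M.IsSec s x) :
    φ.hat x (tmul f (germ s hs)) = tmul f (germ _ (φ.isSec s x hs)) := rfl

theorem Hom.hat_smul (φ : Hom M N) (f : LaurentSeries ℂ) (m : M.Hat x) :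
    φ.hat x (f • m) = f • φ.hat x m :=
  map_smul (AlgebraTensorModule.lTensor (LaurentSeries ℂ) (LaurentSeries ℂ) (φ.stalk x)) f m

theorem Hom.hat_zpow (φ : Hom M N) (n : ℤ) (m : M.Hat x) :
    φ.hat x (M.zpow x n m) = N.zpow x n (φ.hat x m) := φ.hat_smul _ m

theorem zpow_apply (n : ℤ) (m : M.Hat x) :
    M.zpow x n m = (HahnSeries.single n (1 : ℂ) : LaurentSeries ℂ) • m := rfl

theorem zpow_zpow_neg (n : ℤ) (m : M.Hat x) : M.zpow x n (M.zpow x (-n) m) = m := by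
  rw [zpow_apply, zpow_apply, smul_smul, single_mul_single_neg, one_smul]

end LocFree

namespace FlatHom

variable {S : SingData} {M N : Flat S} {x : Sphere} (φ : FlatHom M N)

theorem hat_hatEuler (m : M.bdl.Hat x) :
    φ.toHom.hat x (M.hatEuler x m) = N.hatEuler x (φ.toHom.hat x m) := by
  induction m using hat_induction with
  | zero => simp
  | tmul f s hs =>
    rw [M.hatEuler_tmul, map_add, LocFree.Hom.hat_tmul, LocFree.Hom.hat_tmul,
      LocFree.Hom.hat_tmul, N.hatEuler_tmul]
    congr 2
    refine germ_congr _ _ ?_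
    filter_upwards [isSec_eventually hs] with y hy
    change φ.app y (eulerFactor x y • M.conn.del s y) = eulerFactor x y • N.conn.del _ y
    rw [map_smul, φ.comm y s hy]
  | add m n hm hn => rw [map_add, map_add, map_add, map_add, hm, hn]

/-- The induced formal map commutes with z∂_z and with multiplication by z⁻¹, hence with all powers
of the operator that defines ψ. -/
theorem hat_mem_psi {ξ α : ℂ} {m : M.bdl.Hat x} (hm : m ∈ M.psi x ξ α) :
    φ.toHom.hat x m ∈ N.psi x ξ α := by
  rw [Flat.psi, Module.End.mem_maxGenEigenspace] at hm ⊢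
  obtain ⟨k, hk⟩ := hm
  refine ⟨k, ?_⟩
  have h : ∀ (k : ℕ) m, φ.toHom.hat x (((M.hatEuler x + ξ • M.bdl.zpow x (-1) - α • 1) ^ k) m) =
      ((N.hatEuler x + ξ • N.bdl.zpow x (-1) - α • 1) ^ k) (φ.toHom.hat x m) := by
    intro k
    induction k with
    | zero => intro m; rfl
    | succ k ih =>
      intro m
      rw [pow_succ, pow_succ, Module.End.mul_apply, Module.End.mul_apply, ih]
      congr 1
      simp only [LinearMap.sub_apply, LinearMap.add_apply, LinearMap.smul_apply, map_sub, map_add,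
        map_smul, Module.End.one_apply, hat_hatEuler, LocFree.Hom.hat_zpow]
  rw [← h, hk, map_zero]

end FlatHom

namespace FormalChart

variable {S : SingData} {E : HolConn S} {x : Sphere} (χ : FormalChart E x)

/-- In the chart, z∂_z + ξ/z - α splits into the rank one operators z d/dz + (ξ - ξ_k)/z + (α_k -
α). If ξ ≠ ξ_k, such an operator and its powers are injective. If ξ = ξ_k, it multiplies the
coefficient of z^n by n + α_k - α. In particular the generalised eigenspace is an eigenspace. -/
theorem mem_psi {ξ α : ℂ} {m : E.toFlat.bdl.Hat x} : m ∈ E.toFlat.psi x ξ α ↔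
    ∀ k n, (χ.hat m k).coeff n ≠ 0 → S.fac x k = ξ ∧ α = S.expn x k + n := by
  have h1 : ∀ m k, χ.hat ((E.toFlat.hatEuler x + ξ • E.toFlat.bdl.zpow x (-1) - α • 1) m) k =
      rankOne (ξ - S.fac x k) (S.expn x k - α) (χ.hat m k) := by
    intro m k
    have : (E.toFlat.hatEuler x + ξ • E.toFlat.bdl.zpow x (-1) - α • 1) m =
        E.toFlat.hatEuler x m + (HahnSeries.C ξ : LaurentSeries ℂ) •
          (HahnSeries.single (-1) (1 : ℂ) : LaurentSeries ℂ) • m -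
          (HahnSeries.C α : LaurentSeries ℂ) • m := rfl
    rw [this, map_sub, map_add, map_smul, map_smul, map_smul, Pi.sub_apply, Pi.add_apply,
      χ.hat_euler]
    ext n
    rw [rankOne_coeff]
    simp only [Pi.smul_apply, smul_eq_mul, HahnSeries.coeff_sub, HahnSeries.coeff_add,
      eulerSeries_coeff, diagEntry_mul_coeff, coeff_C_mul, single_mul_coeff, sub_neg_eq_add]
    ring
  have h2 : ∀ (N : ℕ) m k, χ.hat (((E.toFlat.hatEuler x + ξ • E.toFlat.bdl.zpow x (-1) -
      α • 1) ^ N) m) k = (rankOne (ξ - S.fac x k) (S.expn x k - α))^[N] (χ.hat m k) := by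
    intro N
    induction N with
    | zero => intro m k; rfl
    | succ N ih =>
      intro m k
      rw [pow_succ, Module.End.mul_apply, ih, h1, Function.iterate_succ_apply]
  rw [Flat.psi, Module.End.mem_maxGenEigenspace]
  constructor
  · rintro ⟨N, hN⟩ k n hn
    have h3 : (rankOne (ξ - S.fac x k) (S.expn x k - α))^[N] (χ.hat m k) = 0 := by
      rw [← h2, hN, map_zero, Pi.zero_apply]
    by_cases hk : ξ - S.fac x k = 0
    · refine ⟨(sub_eq_zero.1 hk).symm, ?_⟩
      rw [hk] at h3
      have h4 := rankOne_zero_iterate_coeff (a := S.expn x k - α) (f := χ.hat m k) N n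
      rw [h3, HahnSeries.coeff_zero] at h4
      have h5 := eq_zero_of_pow_eq_zero ((mul_eq_zero.1 h4.symm).resolve_right hn)
      linear_combination -h5
    · rw [rankOne_iterate_eq_zero hk h3] at hn
      exact (hn rfl).elim
  · intro h
    refine ⟨1, χ.hat.injective ?_⟩
    rw [map_zero]
    funext k
    rw [h2, Function.iterate_one, Pi.zero_apply]
    ext n
    rw [rankOne_coeff, HahnSeries.coeff_zero]
    have h3 : ((n : ℂ) + (S.expn x k - α)) * (χ.hat m k).coeff n = 0 := by
      by_cases hn : (χ.hat m k).coeff n = 0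
      · rw [hn, mul_zero]
      · rw [(h k n hn).2]; ring
    have h4 : (ξ - S.fac x k) * (χ.hat m k).coeff (n + 1) = 0 := by
      by_cases hn : (χ.hat m k).coeff (n + 1) = 0
      · rw [hn, mul_zero]
      · rw [(h k _ hn).1]; ring
    rw [h3, h4, add_zero]

/-- The coefficient of `z ^ n`, as an element of the fibre. -/
def lead (n : ℤ) : E.toFlat.bdl.Hat x →ₗ[ℂ] E.bdl.fib (pt x) where
  toFun m := χ.fib.symm fun k => (χ.hat m k).coeff n
  map_add' m m' := by
    rw [← map_add]
    congr 1
    funext k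
    rw [map_add]
    rfl
  map_smul' a m := by
    rw [RingHom.id_apply, ← map_smul]
    congr 1
    funext k
    rw [hat_C_smul, map_smul, Pi.smul_apply, smul_eq_mul, coeff_C_mul]
    rfl

theorem fib_lead (n : ℤ) (m : E.toFlat.bdl.Hat x) (k : Fin S.r) :
    χ.fib (χ.lead n m) k = (χ.hat m k).coeff n := by
  change χ.fib (χ.fib.symm _) k = _
  rw [LinearEquiv.apply_symm_apply]

theorem hat_zpow_coeff (N : ℤ) (m : E.toFlat.bdl.Hat x) (k : Fin S.r) (n : ℤ) :
    (χ.hat (E.toFlat.bdl.zpow x N m) k).coeff n = (χ.hat m k).coeff (n - N) := by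
  rw [LocFree.zpow_apply, map_smul, Pi.smul_apply, smul_eq_mul, single_mul_coeff]

theorem lead_zpow (N n : ℤ) (m : E.toFlat.bdl.Hat x) :
    χ.lead n (E.toFlat.bdl.zpow x N m) = χ.lead (n - N) m := by
  apply χ.fib.injective
  funext k
  rw [fib_lead, fib_lead, hat_zpow_coeff]

theorem zpow_mem_psi (χ : FormalChart E x) {ξ α : ℂ} {m : E.toFlat.bdl.Hat x} (hm : m ∈ E.toFlat.psi x ξ α) (N : ℤ) :
    E.toFlat.bdl.zpow x N m ∈ E.toFlat.psi x ξ (α + N) := by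
  rw [χ.mem_psi] at hm ⊢
  intro k n hn
  rw [hat_zpow_coeff] at hn
  obtain ⟨h1, h2⟩ := hm k _ hn
  refine ⟨h1, ?_⟩
  rw [h2]
  push_cast
  ring

theorem lead_germ {s : ∀ y, E.bdl.fib y} (hs : E.bdl.IsSec s x) :
    χ.lead 0 (LocFree.tmul 1 (E.germ s hs)) = s (pt x) := by
  apply χ.fib.injective
  funext k
  rw [fib_lead, χ.coeff_zero]

theorem lead_of_mem_hatIdeal {m : E.toFlat.bdl.Hat x} (hm : m ∈ E.hatIdeal x) :
    χ.lead 0 m = 0 := by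
  apply χ.fib.injective
  funext k
  rw [fib_lead, (χ.mem_hatIdeal m).1 hm k 0 le_rfl, map_zero, Pi.zero_apply]

/-- An element without polar part has the same value as some section. -/
theorem exists_sub_mem_hatIdeal {m : E.toFlat.bdl.Hat x}
    (hm : ∀ k, ∀ n < 0, (χ.hat m k).coeff n = 0) :
    ∃ s, ∃ hs : E.bdl.IsSec s x, s (pt x) = χ.lead 0 m ∧
      m - LocFree.tmul 1 (E.germ s hs) ∈ E.hatIdeal x := by
  obtain ⟨s, hs, h⟩ := χ.surj (χ.lead 0 m)
  refine ⟨s, hs, h, (χ.mem_hatIdeal _).2 fun k n hn => ?_⟩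
  rw [map_sub, Pi.sub_apply, HahnSeries.coeff_sub]
  rcases hn.lt_or_eq with hn | rfl
  · rw [hm k n hn, χ.coeff_neg s hs k n hn, sub_zero]
  · rw [χ.coeff_zero, h, fib_lead, sub_self]

/-- The element with constant coordinates that has the value `v`. -/
def const : E.bdl.fib (pt x) →ₗ[ℂ] E.toFlat.bdl.Hat x where
  toFun v := χ.hat.symm fun k => HahnSeries.C (χ.fib v k)
  map_add' v w := by
    rw [← map_add]
    congr 1
    funext k
    rw [map_add, Pi.add_apply, map_add]
    rfl
  map_smul' a v := by
    rw [RingHom.id_apply, hat_C_smul, ← map_smul]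
    congr 1
    funext k
    rw [map_smul, Pi.smul_apply, smul_eq_mul, map_mul]
    rfl

theorem hat_const (v : E.bdl.fib (pt x)) (k : Fin S.r) :
    χ.hat (χ.const v) k = HahnSeries.C (χ.fib v k) := by
  change χ.hat (χ.hat.symm _) k = _
  rw [LinearEquiv.apply_symm_apply]

theorem C_coeff_of_ne {a : ℂ} {n : ℤ} (hn : n ≠ 0) :
    (HahnSeries.C a : LaurentSeries ℂ).coeff n = 0 := by
  rw [HahnSeries.C_apply, HahnSeries.coeff_single_of_ne hn]

theorem C_coeff_zero (a : ℂ) : (HahnSeries.C a : LaurentSeries ℂ).coeff 0 = a := by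
  rw [HahnSeries.C_apply, HahnSeries.coeff_single_same]

theorem lead_const (v : E.bdl.fib (pt x)) : χ.lead 0 (χ.const v) = v := by
  apply χ.fib.injective
  funext k
  rw [fib_lead, hat_const, C_coeff_zero]

theorem const_mem_psi {v : E.bdl.fib (pt x)} {ξ α : ℂ} (hv : v ∈ E.eigen x ξ α) :
    χ.const v ∈ E.toFlat.psi x ξ α := by
  rw [χ.mem_psi]
  intro k n hn
  rw [hat_const] at hn
  by_cases h0 : n = 0
  · subst h0
    rw [C_coeff_zero] at hn
    obtain ⟨h1, h2⟩ := (χ.mem_eigen _ _ _).1 hv k hn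
    exact ⟨h1, by simp [h2]⟩
  · exact (hn (C_coeff_of_ne h0)).elim

/-- An element of `ψ^α` has constant coordinates if `α` is an exponent. -/
theorem psi_coeff_eq_zero (hN : NonResonant (S.fac x) (S.expn x)) {k : Fin S.r} {N : ℤ}
    {m : E.toFlat.bdl.Hat x}
    (hm : m ∈ E.toFlat.psi x (S.fac x k) (S.expn x k + N)) (j : Fin S.r) {n : ℤ} (hn : n ≠ N) :
    (χ.hat m j).coeff n = 0 := by
  by_contra h
  obtain ⟨h1, h2⟩ := χ.mem_psi.1 hm j n h
  have := hN j k h1 (N - n) (by push_cast; linear_combination -h2)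
  omega

theorem psi_coeff_eq_zero' (hN : NonResonant (S.fac x) (S.expn x)) {k : Fin S.r}
    {m : E.toFlat.bdl.Hat x}
    (hm : m ∈ E.toFlat.psi x (S.fac x k) (S.expn x k)) (j : Fin S.r) {n : ℤ} (hn : n ≠ 0) :
    (χ.hat m j).coeff n = 0 :=
  χ.psi_coeff_eq_zero hN (N := 0) (by simpa using hm) j hn

theorem eq_zero_of_lead (hN : NonResonant (S.fac x) (S.expn x)) {k : Fin S.r} {N : ℤ}
    {m : E.toFlat.bdl.Hat x}
    (hm : m ∈ E.toFlat.psi x (S.fac x k) (S.expn x k + N)) (h : χ.lead N m = 0) : m = 0 := by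
  apply χ.hat.injective
  rw [map_zero]
  funext j
  ext n
  rw [Pi.zero_apply, HahnSeries.coeff_zero]
  by_cases hn : n = N
  · rw [hn, ← fib_lead, h, map_zero, Pi.zero_apply]
  · exact χ.psi_coeff_eq_zero hN hm j hn

/-- By non-resonance an element of ψ^{ξ_k,α_k} has constant coordinates. With `lead_const`,
`const_mem_psi` and `lead_mem_eigen`, this identifies ψ^{ξ_k,α_k} with the eigenspace of index k in
the fibre. -/
theorem const_lead (hN : NonResonant (S.fac x) (S.expn x)) {k : Fin S.r}
    {m : E.toFlat.bdl.Hat x} (hm : m ∈ E.toFlat.psi x (S.fac x k) (S.expn x k)) :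
    χ.const (χ.lead 0 m) = m := by
  apply χ.hat.injective
  funext j
  rw [hat_const, fib_lead]
  ext n
  by_cases hn : n = 0
  · rw [hn, C_coeff_zero]
  · rw [C_coeff_of_ne hn, χ.psi_coeff_eq_zero' hN hm j hn]

theorem lead_mem_eigen {ξ α : ℂ} {m : E.toFlat.bdl.Hat x} (hm : m ∈ E.toFlat.psi x ξ α) :
    χ.lead 0 m ∈ E.eigen x ξ α := by
  rw [χ.mem_eigen]
  intro j hj
  rw [fib_lead] at hj
  obtain ⟨h1, h2⟩ := χ.mem_psi.1 hm j 0 hj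
  exact ⟨h1, by simpa using h2.symm⟩

theorem psi_eq_bot (χ : FormalChart E x) {ξ α : ℂ} (h : ∀ k (N : ℤ), S.fac x k = ξ → α ≠ S.expn x k + N) :
    E.toFlat.psi x ξ α = ⊥ := by
  rw [eq_bot_iff]
  intro m hm
  rw [Submodule.mem_bot]
  apply χ.hat.injective
  rw [map_zero]
  funext j
  ext n
  by_contra hn
  obtain ⟨h1, h2⟩ := χ.mem_psi.1 hm j n hn
  exact h j n h1 h2

/-! ### Flat maps in formal charts -/

variable {F : HolConn S} (η : FormalChart F x)

/-- A flat map has constant coefficients in formal charts. -/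
theorem exists_matrix (hN : NonResonant (S.fac x) (S.expn x)) (φ : FlatHom E.toFlat F.toFlat) :
    ∃ C : Fin S.r → Fin S.r → ℂ, ∀ m k n, (η.hat (φ.toHom.hat x m) k).coeff n =
      ∑ j, C k j * (χ.hat m j).coeff n := by
  classical
  -- The basis vector `b j` lies in ψ^{ξ_j,α_j}, so its image lies in the corresponding space for
  -- `F`, where coordinates are constant by non-resonance. Linearity over Laurent series then
  -- determines the whole map.
  let b : Fin S.r → E.toFlat.bdl.Hat x := fun j => χ.hat.symm (Pi.single j 1)
  have hb : ∀ j, b j ∈ E.toFlat.psi x (S.fac x j) (S.expn x j) := by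
    intro j
    rw [χ.mem_psi]
    intro k n hn
    change (χ.hat (χ.hat.symm _) k).coeff n ≠ 0 at hn
    rw [LinearEquiv.apply_symm_apply] at hn
    by_cases hk : k = j
    · subst hk
      by_cases h0 : n = 0
      · subst h0; simp
      · rw [Pi.single_eq_same, HahnSeries.coeff_one, if_neg h0] at hn
        exact (hn rfl).elim
    · rw [Pi.single_eq_of_ne hk] at hn
      exact (hn rfl).elim
  have hφb : ∀ j k n, n ≠ 0 → (η.hat (φ.toHom.hat x (b j)) k).coeff n = 0 := fun j k n hn =>
    η.psi_coeff_eq_zero' hN (φ.hat_mem_psi (hb j)) k hn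
  refine ⟨fun k j => (η.hat (φ.toHom.hat x (b j)) k).coeff 0, fun m k n => ?_⟩
  have hm : m = ∑ j, χ.hat m j • b j := by
    apply χ.hat.injective
    rw [map_sum]
    simp only [map_smul]
    funext i
    rw [Finset.sum_apply]
    simp only [Pi.smul_apply, b, LinearEquiv.apply_symm_apply, smul_eq_mul]
    simp [Pi.single_apply]
  have hC : ∀ j k, η.hat (φ.toHom.hat x (b j)) k =
      HahnSeries.C ((η.hat (φ.toHom.hat x (b j)) k).coeff 0) := by
    intro j k
    ext n
    by_cases hn : n = 0
    · rw [hn, C_coeff_zero]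
    · rw [hφb j k n hn, C_coeff_of_ne hn]
  conv_lhs => rw [hm]
  rw [map_sum, map_sum, Finset.sum_apply, HahnSeries.coeff_sum]
  refine Finset.sum_congr rfl fun j _ => ?_
  rw [LocFree.Hom.hat_smul, map_smul, Pi.smul_apply, smul_eq_mul, hC, mul_comm, coeff_C_mul]

/-- Compatibility of a map of lattices with the values at the singular point. -/
theorem lead_hat (g : LocFree.Hom E.bdl F.bdl) (φ : LocFree.Hom E.toFlat.bdl F.toFlat.bdl)
    (hφ : ∀ y, φ.app y = g.app (pt y)) {m : E.toFlat.bdl.Hat x}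
    (hm : ∀ k, ∀ n < 0, (χ.hat m k).coeff n = 0) :
    η.lead 0 (φ.hat x m) = g.app (pt x) (χ.lead 0 m) := by
  obtain ⟨s, hs, h1, h2⟩ := χ.exists_sub_mem_hatIdeal hm
  have h3 : ∀ (f : LaurentSeries ℂ) s (hs : E.bdl.IsSec s x), φ.hat x (LocFree.tmul f (E.germ s hs)) =
      LocFree.tmul f (F.germ _ (g.isSec s x hs)) := by
    intro f s hs
    refine (φ.hat_tmul f (E.isSec_res hs)).trans ?_
    congr 1
    refine germ_congr _ _ (Eventually.of_forall fun y => ?_)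
    rw [hφ]
    rfl
  have h4 : φ.hat x (m - LocFree.tmul 1 (E.germ s hs)) ∈ F.hatIdeal x := by
    refine Submodule.span_induction ?_ ?_ ?_ ?_ h2
    · rintro _ ⟨f, s, hs, rfl⟩
      rw [h3]
      exact Submodule.subset_span ⟨f, _, _, rfl⟩
    · rw [map_zero]; exact zero_mem _
    · intro m n _ _ hm hn
      rw [map_add]; exact add_mem hm hn
    · intro a m _ hm
      rw [map_smul]; exact Submodule.smul_mem _ a hm
  have h5 := η.lead_of_mem_hatIdeal h4
  rw [map_sub, map_sub, sub_eq_zero, h3, η.lead_germ] at h5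
  rw [h5, ← h1]

end FormalChart

/-! ### Graded pieces -/

section GrDim

variable {U U' : Type} [AddCommGroup U] [Module ℂ U] [AddCommGroup U'] [Module ℂ U']

/-- Injectivity of `g` on `V`, which contains the filtration, makes it an isomorphism of each step
onto its image, compatible with the sums of the higher steps. It carries weight conditions between ψ
spaces and fibres. -/
theorem grDim_map (g : U →ₗ[ℂ] U') {F : ℝ → Submodule ℂ U} {V : Submodule ℂ U}
    (hF : ∀ γ, F γ ≤ V) (hg : ∀ u ∈ V, g u = 0 → u = 0) (β : ℝ) :
    grDim (fun γ => (F γ).map g) β = grDim F β := by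
  have hinj : Function.Injective (g.submoduleMap (F β)) := by
    rw [injective_iff_map_eq_zero]
    intro u hu
    exact Subtype.ext (hg u (hF β u.2) (congrArg Subtype.val hu))
  let φ : F β ≃ₗ[ℂ] (F β).map g :=
    LinearEquiv.ofBijective (g.submoduleMap (F β)) ⟨hinj, g.submoduleMap_surjective (F β)⟩
  refine (LinearEquiv.finrank_eq (Submodule.Quotient.equiv _ _ φ ?_)).symm
  have h1 : (⨆ γ > β, (F γ).map g) = (⨆ γ > β, F γ).map g := by
    simp only [Submodule.map_iSup]
  rw [h1]
  have hV : (⨆ γ > β, F γ) ≤ V := iSup₂_le fun γ _ => hF γ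
  ext ⟨u, hu⟩
  change (∃ y ∈ (⨆ γ > β, F γ).submoduleOf (F β), φ y = ⟨u, hu⟩) ↔ u ∈ (⨆ γ > β, F γ).map g
  constructor
  · rintro ⟨⟨a, ha⟩, ha', h⟩
    exact ⟨a, ha', congrArg Subtype.val h⟩
  · rintro ⟨a, ha, h⟩
    obtain ⟨b, hb, h'⟩ := hu
    have hab : a = b := by
      refine sub_eq_zero.1 (hg _ (sub_mem (hV ha) (hF β hb)) ?_)
      rw [map_sub, h', sub_eq_zero]
      exact h
    subst hab
    exact ⟨⟨a, hb⟩, ha, Subtype.ext h⟩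

end GrDim

/-! ### The functor from `HP` to `DMP` -/

namespace HP

variable {S : SingData} (hS : S.ResonanceFree)

/-- A formal chart at a singular point. -/
def chart (X : HP S) (x : S.D) : FormalChart X.toHolConn (x : Sphere) :=
  (X.hasType.nonempty_formalChart hS x.2).some

/-- The parabolic structure on the meromorphic bundle. -/
def par (X : HP S) (x : S.D) (ξ α : ℂ) (β : ℝ) : Submodule ℂ (X.toFlat.bdl.Hat x) :=
  -- The infimum runs over all presentations α = α_k + N. The coefficient of z^N is tested against
  -- the filtration shifted by N, as compatibility with multiplication by z^N demands. If there is
  -- no presentation, ψ is zero.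
  X.toFlat.psi x ξ α ⊓ ⨅ k, ⨅ N : ℤ, ⨅ _ : S.fac x k = ξ ∧ α = S.expn x k + N,
    (X.fil x (β - N)).comap ((X.chart hS x).lead N)

variable {hS} {X : HP S} {x : S.D}

theorem mem_par {ξ α : ℂ} {β : ℝ} {m : X.toFlat.bdl.Hat x} :
    m ∈ X.par hS x ξ α β ↔ m ∈ X.toFlat.psi x ξ α ∧ ∀ k (N : ℤ), S.fac x k = ξ →
      α = S.expn x k + N → (X.chart hS x).lead N m ∈ X.fil x (β - N) := by
  simp only [par, Submodule.mem_inf, Submodule.mem_iInf, Submodule.mem_comap, and_imp]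

/-- Non-resonance makes N unique for given ξ and α, so the infimum in `par` reduces to a single
condition. -/
theorem mem_par_add {k : Fin S.r} {N : ℤ} {β : ℝ} {m : X.toFlat.bdl.Hat x} :
    m ∈ X.par hS x (S.fac x k) (S.expn x k + N) β ↔
      m ∈ X.toFlat.psi x (S.fac x k) (S.expn x k + N) ∧
        (X.chart hS x).lead N m ∈ X.fil x (β - N) := by
  rw [mem_par]
  refine and_congr_right fun _ => ⟨fun h => h k N rfl rfl, fun h j n hj hn => ?_⟩
  have := hS.nonResonant x.2 k j hj.symm (n - N) (by push_cast; linear_combination hn)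
  obtain rfl : n = N := by omega
  exact h

theorem mem_par_expn {k : Fin S.r} {β : ℝ} {m : X.toFlat.bdl.Hat x} :
    m ∈ X.par hS x (S.fac x k) (S.expn x k) β ↔
      m ∈ X.toFlat.psi x (S.fac x k) (S.expn x k) ∧ (X.chart hS x).lead 0 m ∈ X.fil x β := by
  have := mem_par_add (hS := hS) (X := X) (x := x) (k := k) (N := 0) (β := β) (m := m)
  simpa using this

theorem par_le_psi {ξ α : ℂ} {β : ℝ} : X.par hS x ξ α β ≤ X.toFlat.psi x ξ α := inf_le_left

theorem isFiltration_par_add (k : Fin S.r) (N : ℤ) :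
    IsFiltration (X.toFlat.psi x (S.fac x k) (S.expn x k + N)) N
      (X.par hS x (S.fac x k) (S.expn x k + N)) where
  antitone β γ h m hm := by
    rw [mem_par_add] at hm ⊢
    exact ⟨hm.1, (X.isFiltration x).antitone (by linarith) hm.2⟩
  leftCont β := by
    ext m
    simp only [Submodule.mem_iInf, mem_par_add]
    rw [(X.isFiltration x).leftCont]
    simp only [Submodule.mem_iInf]
    constructor
    · rintro ⟨h1, h2⟩ γ hγ
      exact ⟨h1, h2 _ (by linarith)⟩
    · intro h
      refine ⟨(h (β - 1) (by linarith)).1, fun γ hγ => ?_⟩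
      have := (h (γ + N) (by linarith)).2
      rwa [add_sub_cancel_right] at this
  eq_top β hβ := by
    ext m
    rw [mem_par_add, (X.isFiltration x).eq_top _ (by push_cast; linarith)]
    simp
  eq_bot β hβ := by
    rw [eq_bot_iff]
    intro m hm
    rw [mem_par_add, (X.isFiltration x).eq_bot _ (by push_cast; linarith), Submodule.mem_bot] at hm
    exact (X.chart hS x).eq_zero_of_lead (hS.nonResonant x.2) hm.1 hm.2

theorem isFiltration_par_expn (k : Fin S.r) :
    IsFiltration (X.toFlat.psi x (S.fac x k) (S.expn x k)) 0
      (X.par hS x (S.fac x k) (S.expn x k)) := by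
  have := isFiltration_par_add (hS := hS) (X := X) (x := x) k 0
  simpa using this

theorem zpow_mem_par {ξ α : ℂ} {β : ℝ} {m : X.toFlat.bdl.Hat x} (hm : m ∈ X.par hS x ξ α β)
    (N : ℤ) : X.toFlat.bdl.zpow x N m ∈ X.par hS x ξ (α + N) (β + N) := by
  rw [mem_par] at hm ⊢
  refine ⟨(X.chart hS x).zpow_mem_psi hm.1 N, fun k n hk hn => ?_⟩
  have := hm.2 k (n - N) hk (by push_cast; linear_combination hn)
  rw [FormalChart.lead_zpow]
  convert this using 2
  push_cast
  ring

/-- The preimage of an eigenvector v is `const v`. Through this equality the weight and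
admissibility conditions on E_x become those on ψ. -/
theorem map_lead_par (k : Fin S.r) (β : ℝ) :
    (X.par hS x (S.fac x k) (S.expn x k) β).map ((X.chart hS x).lead 0) =
      X.fil x β ⊓ X.eigen x (S.fac x k) (S.expn x k) := by
  ext v
  constructor
  · rintro ⟨m, hm, rfl⟩
    rw [SetLike.mem_coe, mem_par_expn] at hm
    exact ⟨hm.2, (X.chart hS x).lead_mem_eigen hm.1⟩
  · rintro ⟨h1, h2⟩
    refine ⟨(X.chart hS x).const v, mem_par_expn.2 ⟨(X.chart hS x).const_mem_psi h2, ?_⟩,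
      (X.chart hS x).lead_const v⟩
    rwa [(X.chart hS x).lead_const v]

theorem lead_injOn_psi (k : Fin S.r) :
    ∀ m ∈ X.toFlat.psi x (S.fac x k) (S.expn x k), (X.chart hS x).lead 0 m = 0 → m = 0 := by
  intro m hm h
  refine (X.chart hS x).eq_zero_of_lead (hS.nonResonant x.2) (k := k) (N := 0) ?_ h
  simpa using hm

variable (hS) (X)

/-- The meromorphic bundle with the induced parabolic structure. -/
def toDMP : DMP S where
  toFlat := X.toFlat
  exists_lattice := ⟨X.toHolConn, X.hasType, ⟨Iso.refl _⟩⟩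
  par := X.par hS
  isFiltration x ξ _ α := by
    by_cases h : ∃ k, ∃ N : ℤ, S.fac x k = ξ ∧ α = S.expn x k + N
    · obtain ⟨k, N, rfl, rfl⟩ := h
      exact ⟨N, isFiltration_par_add k N⟩
    · push Not at h
      have h1 := (X.chart hS x).psi_eq_bot h
      have h2 : ∀ β, X.par hS x ξ α β = ⊥ := fun β => eq_bot_iff.2 (h1 ▸ par_le_psi)
      refine ⟨0, ⟨fun _ _ _ => by rw [h2, h2], fun β => ?_, fun β _ => by rw [h2, h1],
        fun β _ => h2 β⟩⟩
      rw [h2]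
      refine (eq_bot_iff.2 ?_).symm
      exact (iInf₂_le (β - 1) (by linarith)).trans (h2 _).le
  map_zpow x ξ _ α β N := by
    refine le_antisymm ?_ fun m hm => ?_
    · rintro _ ⟨m, hm, rfl⟩
      exact zpow_mem_par hm N
    · refine ⟨X.toFlat.bdl.zpow x (-N) m, ?_, X.toFlat.bdl.zpow_zpow_neg N m⟩
      have := zpow_mem_par hm (-N)
      push_cast at this
      rwa [add_neg_cancel_right, add_neg_cancel_right] at this
  normalized x k := isFiltration_par_expn k
  weight_ne x k hk β hβ := by
    rw [← X.weight_ne x k hk β hβ, ← grDim_map ((X.chart hS x).lead 0)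
      (fun γ => par_le_psi) (lead_injOn_psi k) β]
    congr 1
    funext γ
    exact map_lead_par k γ
  admissible x hx β hβ := by
    by_cases h : ∃ k, ∃ N : ℤ, S.fac x k = 0 ∧ 0 = S.expn x k + N
    · obtain ⟨k, N, h1, h2⟩ := h
      obtain ⟨p, hp, hxp⟩ := x.2.resolve_left hx
      have h3 : S.expn x k = S.μ p k := by rw [hxp]; rfl
      -- An integral exponent at a finite point is zero, since non-zero exponents have non-integral
      -- real part. So ψ^{0,0} is the space that corresponds to the kernel of the residue.
      have h4 : S.expn x k = 0 := by
        by_contra h0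
        refine hS.re_fin p hp k (by rwa [← h3]) (-N) ?_
        have : S.μ p k = ((-N : ℤ) : ℂ) := by rw [← h3]; push_cast; linear_combination -h2
        rw [this, Complex.intCast_re]
      rw [eq_bot_iff]
      intro m hm
      have hm' : m ∈ X.par hS x (S.fac x k) (S.expn x k) β := by rwa [h1, h4]
      have h5 : (X.chart hS x).lead 0 m ∈ X.fil x β ⊓ X.eigen x (S.fac x k) (S.expn x k) := by
        rw [← map_lead_par (hS := hS)]
        exact ⟨m, hm', rfl⟩
      rw [h1, h4, X.admissible x hx β hβ, Submodule.mem_bot] at h5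
      exact lead_injOn_psi k m (mem_par_expn.1 hm').1 h5
    · push Not at h
      exact eq_bot_iff.2 ((X.chart hS x).psi_eq_bot h ▸ par_le_psi)

variable {hS X}

/-- The map of meromorphic bundles induced by a morphism. -/
def toFlatHom {X Y : HP S} (f : HPHom X Y) : FlatHom X.toFlat Y.toFlat :=
  { LocFree.Hom.star S.D f.toHom with comm := f.comm }

/-- Multiplication by z^{-N} reduces to elements without polar part. On these the formal map acts on
leading values through the fibre map, which respects the filtrations. -/
theorem hat_mem_par {X Y : HP S} (f : HPHom X Y) {ξ α : ℂ} {β : ℝ} {m : X.toFlat.bdl.Hat x}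
    (hm : m ∈ X.par hS x ξ α β) : (toFlatHom f).toHom.hat x m ∈ Y.par hS x ξ α β := by
  have hm' := mem_par.1 hm
  refine mem_par.2 ⟨(toFlatHom f).hat_mem_psi hm'.1, fun k N hk hN => ?_⟩
  have h1 := hm'.2 k N hk hN
  have h2 := (X.chart hS x).lead_hat (Y.chart hS x) f.toHom (toFlatHom f).toHom (fun y => rfl)
    (m := X.toFlat.bdl.zpow x (-N) m) (fun j n hn => by
      have h3 := (X.chart hS x).zpow_mem_psi hm'.1 (-N)
      subst hk hN
      push_cast at h3
      rw [add_neg_cancel_right] at h3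
      exact (X.chart hS x).psi_coeff_eq_zero' (hS.nonResonant x.2) h3 j hn.ne)
  rw [LocFree.Hom.hat_zpow, FormalChart.lead_zpow, FormalChart.lead_zpow, zero_sub, neg_neg] at h2
  rw [h2]
  exact f.fil x _ ⟨_, h1, rfl⟩

variable (hS)

/-- The functor that sends a holomorphic bundle with meromorphic connection and parabolic structure
to its meromorphic bundle. -/
def toDMPFunctor : HP S ⥤ DMP S where
  obj X := X.toDMP hS
  map {X Y} f := (show DMPHom (X.toDMP hS) (Y.toDMP hS) from
    { toFlatHom f with
      par := fun x ξ _ α β => by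
        rintro _ ⟨m, hm, rfl⟩
        exact hat_mem_par f hm })
  map_id X := rfl
  map_comp f g := rfl

end HP

/-! ### Elementary properties of parabolic structures and formal isomorphisms -/

theorem IsFiltration.le {U : Type} [AddCommGroup U] [Module ℂ U] {V : Submodule ℂ U} {k : ℤ}
    {F : ℝ → Submodule ℂ U} (h : IsFiltration V k F) (β : ℝ) : F β ≤ V := by
  rcases le_total β k with hβ | hβ
  · exact (h.eq_top β hβ).le
  · exact (h.antitone hβ).trans (h.eq_top k le_rfl).le

theorem DMP.par_le_psi {S : SingData} (M : DMP S) {x : S.D} {ξ : ℂ} (hξ : ξ ∈ S.facs x) (α : ℂ)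
    (β : ℝ) : M.par x ξ α β ≤ M.toFlat.psi x ξ α := by
  obtain ⟨k, hk⟩ := M.isFiltration x ξ hξ α
  exact hk.le β

theorem SingData.fac_mem_facs (S : SingData) (x : Sphere) (k : Fin S.r) : S.fac x k ∈ S.facs x :=
  Finset.mem_image_of_mem _ (Finset.mem_univ k)

theorem DMP.zpow_mem_par {S : SingData} (M : DMP S) {x : S.D} {ξ : ℂ} (hξ : ξ ∈ S.facs x) {α : ℂ}
    {β : ℝ} {m : M.bdl.Hat x} (hm : m ∈ M.par x ξ α β) (N : ℤ) :
    M.bdl.zpow x N m ∈ M.par x ξ (α + N) (β + N) := by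
  rw [← M.map_zpow x ξ hξ]
  exact ⟨m, hm, rfl⟩

theorem hat_hom_inv {S : SingData} {M N : Flat S} (f : FlatHom M N) (g : FlatHom N M)
    (h : LocFree.Hom.comp f.toHom g.toHom = LocFree.Hom.id M.bdl) {x : Sphere} (m : M.bdl.Hat x) :
    g.toHom.hat x (f.toHom.hat x m) = m := by
  have := LocFree.Hom.hat_comp f.toHom g.toHom x
  rw [h, LocFree.Hom.hat_id] at this
  exact (LinearMap.congr_fun this m).symm

namespace FormalChart

variable {S : SingData} {E F : HolConn S} {x : Sphere} (χ : FormalChart E x) (η : FormalChart F x)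

/-- The image of a section of the lattice under a flat map extends to the singular point. -/
theorem exists_extension (hN : NonResonant (S.fac x) (S.expn x)) (φ : FlatHom E.toFlat F.toFlat)
    {s : ∀ y, E.bdl.fib y} (hs : E.bdl.IsSec s x) :
    ∃ s', F.bdl.IsSec s' x ∧ (∀ᶠ y : Off S.D in near S.D x, s' (pt y) = φ.app y (s (pt y))) ∧
      s' (pt x) = η.lead 0 (φ.toHom.hat x (χ.const (s (pt x)))) := by
  obtain ⟨C, hC⟩ := χ.exists_matrix η hN φ
  -- A constant matrix applied to coordinates without polar part creates none, so the image extends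
  -- to the lattice of `F`.
  have h1 : ∀ k, ∀ n < 0, (η.hat (LocFree.tmul 1 (LocFree.germ _
      (φ.isSec _ x (E.isSec_res hs)))) k).coeff n = 0 := by
    intro k n hn
    have h2 := hC (LocFree.tmul 1 (E.germ s hs)) k n
    rw [Finset.sum_eq_zero fun j _ => by rw [χ.coeff_neg s hs j n hn, mul_zero]] at h2
    exact h2
  obtain ⟨s', hs', h2⟩ := η.lift _ _ h1
  refine ⟨s', hs', h2, ?_⟩
  apply η.fib.injective
  funext k
  rw [fib_lead, ← η.coeff_zero s' hs', hC]
  have h3 : LocFree.tmul 1 (F.germ s' hs') =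
      φ.toHom.hat x (LocFree.tmul 1 (E.germ s hs)) := by
    rw [E.germ_eq_res, LocFree.Hom.hat_tmul, F.germ_eq_res]
    congr 1
    exact germ_congr _ _ h2
  rw [h3, hC]
  refine Finset.sum_congr rfl fun j _ => ?_
  rw [χ.coeff_zero, hat_const, C_coeff_zero]

/-- The projection of the fibre onto an eigenspace of the polar part. -/
def proj (ξ α : ℂ) : E.bdl.fib (pt x) →ₗ[ℂ] E.bdl.fib (pt x) :=
  open Classical in
  χ.fib.symm.toLinearMap ∘ₗ (LinearMap.pi fun k =>
    if S.fac x k = ξ ∧ S.expn x k = α then LinearMap.proj k else 0) ∘ₗ χ.fib.toLinearMap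

open Classical in
theorem fib_proj (ξ α : ℂ) (v : E.bdl.fib (pt x)) (k : Fin S.r) : χ.fib (χ.proj ξ α v) k =
    if S.fac x k = ξ ∧ S.expn x k = α then χ.fib v k else 0 := by
  change χ.fib (χ.fib.symm _) k = _
  rw [LinearEquiv.apply_symm_apply]
  change (if S.fac x k = ξ ∧ S.expn x k = α then LinearMap.proj k else 0 :
    (Fin S.r → ℂ) →ₗ[ℂ] ℂ) (χ.fib v) = _
  split_ifs <;> rfl

theorem proj_mem_eigen (ξ α : ℂ) (v : E.bdl.fib (pt x)) : χ.proj ξ α v ∈ E.eigen x ξ α := by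
  classical
  rw [χ.mem_eigen]
  intro k hk
  rw [fib_proj] at hk
  by_contra h
  exact hk (if_neg h)

theorem proj_eq_self {ξ α : ℂ} {v : E.bdl.fib (pt x)} (hv : v ∈ E.eigen x ξ α) :
    χ.proj ξ α v = v := by
  classical
  apply χ.fib.injective
  funext k
  rw [fib_proj]
  split_ifs with h
  · rfl
  · by_contra h'
    exact h ((χ.mem_eigen _ _ _).1 hv k fun h0 => h' h0.symm)

theorem proj_eq_zero {ξ α ξ' α' : ℂ} {v : E.bdl.fib (pt x)} (hv : v ∈ E.eigen x ξ α)
    (h : ¬ (ξ = ξ' ∧ α = α')) : χ.proj ξ' α' v = 0 := by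
  classical
  apply χ.fib.injective
  funext k
  rw [fib_proj, map_zero, Pi.zero_apply]
  split_ifs with h1
  · by_contra h'
    have h2 := (χ.mem_eigen _ _ _).1 hv k h'
    exact h ⟨h2.1.symm.trans h1.1, h2.2.symm.trans h1.2⟩
  · rfl

open Classical in
/-- The exponential factors and exponents at a point. -/
def _root_.ParConn.SingData.classes (S : SingData) (x : Sphere) : Finset (ℂ × ℂ) :=
  Finset.univ.image fun k => (S.fac x k, S.expn x k)

theorem sum_proj (v : E.bdl.fib (pt x)) : ∑ q ∈ S.classes x, χ.proj q.1 q.2 v = v := by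
  classical
  apply χ.fib.injective
  funext k
  rw [map_sum, Finset.sum_apply]
  simp only [fib_proj]
  rw [Finset.sum_eq_single (S.fac x k, S.expn x k)]
  · exact if_pos ⟨rfl, rfl⟩
  · intro q _ hq
    refine if_neg fun h => hq (Prod.ext h.1.symm h.2.symm)
  · intro h
    exact (h (Finset.mem_image_of_mem _ (Finset.mem_univ k))).elim

end FormalChart

/-! ### Full faithfulness -/

namespace HP

variable {S : SingData} {hS : S.ResonanceFree}

theorem app_eq_lead {X Y : HP S} (f : HPHom X Y) {x : S.D} {s : ∀ y, X.bdl.fib y}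
    (hs : X.bdl.IsSec s x) : f.app (pt x) (s (pt x)) =
      (Y.chart hS x).lead 0 ((toFlatHom f).toHom.hat x (LocFree.tmul 1 (X.germ s hs))) := by
  rw [(X.chart hS x).lead_hat (Y.chart hS x) f.toHom (toFlatHom f).toHom (fun y => rfl)
    ((X.chart hS x).coeff_neg s hs), (X.chart hS x).lead_germ]

/-- Outside `D` the two maps agree by assumption. At x ∈ D every fibre vector is the value of a
section, and the value of a morphism on it is the constant term of the image under the formal map,
by `app_eq_lead`. -/
theorem toFlatHom_injective {X Y : HP S} (hS : S.ResonanceFree) {f g : HPHom X Y}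
    (h : toFlatHom f = toFlatHom g) : f = g := by
  refine HPHom.ext (funext fun y => ?_)
  obtain ⟨y, hy⟩ := y
  by_cases hD : y ∈ S.D
  · refine LinearMap.ext fun v => ?_
    obtain ⟨s, hs, rfl⟩ := (X.chart hS ⟨y, hD⟩).surj v
    have h1 := app_eq_lead (hS := hS) f (x := ⟨y, hD⟩) hs
    rw [h, ← app_eq_lead (hS := hS) g (x := ⟨y, hD⟩) hs] at h1
    exact h1
  · exact congrFun (congrArg (fun φ => φ.toHom.app) h) ⟨y, hD⟩

open Classical in
/-- The extension of a flat map to the fibres at the singular points. -/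
def extendApp {X Y : HP S} (hS : S.ResonanceFree) (φ : FlatHom X.toFlat Y.toFlat) (y : Off ∅) :
    X.bdl.fib y →ₗ[ℂ] Y.bdl.fib y :=
  if h : (y : Sphere) ∈ S.D then
    -- A vector of E_x is lifted to the formal element with constant coordinates; the constant term
    -- of its image is taken.
    (Y.chart hS ⟨y, h⟩).lead 0 ∘ₗ φ.toHom.hat y ∘ₗ (X.chart hS ⟨y, h⟩).const
  else φ.app ⟨y, h⟩

theorem extendApp_mem {X Y : HP S} (φ : FlatHom X.toFlat Y.toFlat) (x : S.D)
    (v : X.bdl.fib (pt x)) : extendApp hS φ (pt x) v =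
      (Y.chart hS x).lead 0 (φ.toHom.hat x ((X.chart hS x).const v)) := by
  exact LinearMap.congr_fun (dif_pos x.2) v

theorem extendApp_off {X Y : HP S} (φ : FlatHom X.toFlat Y.toFlat) (y : Off S.D) :
    extendApp hS φ (pt y) = φ.app y := by
  exact dif_neg y.2

/-- The extension of a flat map to the lattices. -/
def extendHom {X Y : HP S} (hS : S.ResonanceFree) (φ : FlatHom X.toFlat Y.toFlat) :
    LocFree.Hom X.bdl Y.bdl where
  app := extendApp hS φ
  isSec s x hs := by
    by_cases hx : x ∈ S.D
    · obtain ⟨s', hs', h1, h2⟩ := (X.chart hS ⟨x, hx⟩).exists_extension (Y.chart hS ⟨x, hx⟩)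
        (hS.nonResonant hx) φ hs
      refine hs'.congr (SingData.near_empty_of_near_of_self hx ?_ ?_)
      · filter_upwards [h1] with y hy
        rw [hy, extendApp_off φ y]
        rfl
      · rw [h2]
        exact extendApp_mem φ ⟨x, hx⟩ _
    · obtain ⟨N, hN, s', hs', h⟩ := φ.isSec _ x (X.isSec_res hs)
      refine hs'.congr (SingData.near_empty_of_near hx ?_)
      filter_upwards [h] with y hy
      rw [hN hx, pow_zero] at hy
      rw [hy, extendApp_off φ y]
      exact (one_smul ℂ (φ.app y (X.res s y))).symm

/-- By compatibility each step of the filtration is the sum of its intersections with the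
eigenspaces. These are the leading values of the steps on ψ, where the extended map is computed by
the formal map. -/
theorem extendHom_fil {X Y : HP S} (φ : FlatHom X.toFlat Y.toFlat)
    (hφ : ∀ (x : S.D) k β, ∀ m ∈ X.par hS x (S.fac x k) (S.expn x k) β,
      φ.toHom.hat x m ∈ Y.par hS x (S.fac x k) (S.expn x k) β) (x : S.D) (β : ℝ) :
    (X.fil x β).map ((extendHom hS φ).app (pt x)) ≤ Y.fil x β := by
  rw [X.compatible, Submodule.map_iSup]
  refine iSup_le fun k => ?_
  rw [← map_lead_par (hS := hS)]
  rintro _ ⟨_, ⟨m, hm, rfl⟩, rfl⟩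
  have h1 := mem_par_expn.1 hm
  have h2 : (extendHom hS φ).app (pt x) ((X.chart hS x).lead 0 m) =
      (Y.chart hS x).lead 0 (φ.toHom.hat x m) := by
    refine (extendApp_mem φ x _).trans ?_
    rw [(X.chart hS x).const_lead (hS.nonResonant x.2) h1.1]
  rw [h2]
  exact (mem_par_expn.1 (hφ x k β m hm)).2

/-- The extension of a morphism of meromorphic bundles with parabolic structure. -/
def extend {X Y : HP S} (hS : S.ResonanceFree) (φ : DMPHom (X.toDMP hS) (Y.toDMP hS)) :
    HPHom X Y :=
  let φ' : FlatHom X.toFlat Y.toFlat := φ.toFlatHom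
  { extendHom hS φ' with
    comm := by
      intro y s hs
      have h1 := φ'.comm y s hs
      have h2 : (fun y : Off S.D => extendApp hS φ' (pt y) (s y)) = fun y => φ'.app y (s y) :=
        funext fun y => by rw [extendApp_off]; rfl
      change Y.conn.del (fun y : Off S.D => extendApp hS φ' (pt y) (s y)) y =
        extendApp hS φ' (pt y) (X.conn.del s y)
      rw [h2, extendApp_off]
      exact h1
    fil := extendHom_fil φ' fun x k β m hm =>
      φ.par x _ (S.fac_mem_facs x k) _ β ⟨m, hm, rfl⟩ }

theorem toFlatHom_extend {X Y : HP S} (φ : DMPHom (X.toDMP hS) (Y.toDMP hS)) :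
    toFlatHom (extend hS φ) = φ.toFlatHom :=
  FlatHom.ext (funext fun y => extendApp_off _ y)

theorem full_toDMPFunctor (hS : S.ResonanceFree) : (toDMPFunctor hS).Full where
  map_surjective φ := ⟨extend hS φ, DMPHom.ext (congrArg (fun ψ => ψ.toHom.app)
    (toFlatHom_extend φ))⟩

theorem faithful_toDMPFunctor (hS : S.ResonanceFree) : (toDMPFunctor hS).Faithful where
  map_injective {X Y f g} h := toFlatHom_injective hS (congrArg DMPHom.toFlatHom h)

end HP

/-! ### Essential surjectivity -/

section Lattice

variable {S : SingData} {E : HolConn S} (M : DMP S) (χ : ∀ x : S.D, FormalChart E (x : Sphere))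
  (g : FlatHom E.toFlat M.toFlat)

/-- The filtration of the fibre of a lattice induced by a parabolic structure. -/
def latticeFil (x : S.D) (β : ℝ) : Submodule ℂ (E.bdl.fib (pt x)) :=
  -- A vector is split into its components in the eigenspaces; each component is lifted with
  -- constant coordinates to ψ^{ξ_k,α_k} and tested there.
  ⨅ k, (M.par x (S.fac x k) (S.expn x k) β).comap
    (g.toHom.hat x ∘ₗ (χ x).const ∘ₗ (χ x).proj (S.fac x k) (S.expn x k))

variable {M χ g} {x : S.D}

theorem mem_latticeFil {β : ℝ} {v : E.bdl.fib (pt x)} : v ∈ latticeFil M χ g x β ↔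
    ∀ k, g.toHom.hat x ((χ x).const ((χ x).proj (S.fac x k) (S.expn x k) v)) ∈
      M.par x (S.fac x k) (S.expn x k) β := by
  simp only [latticeFil, Submodule.mem_iInf, Submodule.mem_comap, LinearMap.comp_apply]

theorem mem_latticeFil_of_eigen {β : ℝ} {v : E.bdl.fib (pt x)} {k : Fin S.r}
    (hv : v ∈ E.eigen x (S.fac x k) (S.expn x k)) : v ∈ latticeFil M χ g x β ↔
      g.toHom.hat x ((χ x).const v) ∈ M.par x (S.fac x k) (S.expn x k) β := by
  rw [mem_latticeFil]
  refine ⟨fun h => ?_, fun h j => ?_⟩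
  · have := h k
    rwa [(χ x).proj_eq_self hv] at this
  · by_cases hj : S.fac x k = S.fac x j ∧ S.expn x k = S.expn x j
    · rw [← hj.1, ← hj.2, (χ x).proj_eq_self hv]
      exact h
    · rw [(χ x).proj_eq_zero hv hj, map_zero, map_zero]
      exact zero_mem _

theorem hat_const_eq_zero (hg : Function.Injective (g.toHom.hat x)) {v : E.bdl.fib (pt x)}
    (h : g.toHom.hat x ((χ x).const v) = 0) : v = 0 := by
  have h1 : (χ x).const v = 0 := hg (h.trans (map_zero _).symm)
  rw [← (χ x).lead_const v, h1, map_zero]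

theorem isFiltration_latticeFil (hg : Function.Injective (g.toHom.hat x)) :
    IsFiltration ⊤ 0 (latticeFil M χ g x) where
  antitone β γ h v hv := by
    rw [mem_latticeFil] at hv ⊢
    exact fun k => (M.normalized x k).antitone h (hv k)
  leftCont β := by
    ext v
    simp only [Submodule.mem_iInf, mem_latticeFil]
    refine ⟨fun h γ hγ k => (M.normalized x k).antitone hγ.le (h k), fun h k => ?_⟩
    rw [(M.normalized x k).leftCont]
    simp only [Submodule.mem_iInf]
    exact fun γ hγ => h γ hγ k
  eq_top β hβ := by
    rw [eq_top_iff]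
    intro v _
    rw [mem_latticeFil]
    intro k
    rw [(M.normalized x k).eq_top β hβ]
    exact g.hat_mem_psi ((χ x).const_mem_psi ((χ x).proj_mem_eigen _ _ v))
  eq_bot β hβ := by
    rw [eq_bot_iff]
    intro v hv
    rw [mem_latticeFil] at hv
    rw [Submodule.mem_bot, ← (χ x).sum_proj v]
    refine Finset.sum_eq_zero fun q hq => ?_
    obtain ⟨k, -, rfl⟩ := Finset.mem_image.1 hq
    have h := hv k
    rw [(M.normalized x k).eq_bot β hβ, Submodule.mem_bot] at h
    exact hat_const_eq_zero hg h

theorem latticeFil_compatible (β : ℝ) : latticeFil M χ g x β =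
    ⨆ k, latticeFil M χ g x β ⊓ E.eigen x (S.fac x k) (S.expn x k) := by
  refine le_antisymm (fun v hv => ?_) (iSup_le fun k => inf_le_left)
  rw [← (χ x).sum_proj v]
  refine sum_mem fun q hq => ?_
  obtain ⟨k, -, rfl⟩ := Finset.mem_image.1 hq
  refine Submodule.mem_iSup_of_mem k ⟨?_, (χ x).proj_mem_eigen _ _ v⟩
  rw [SetLike.mem_coe, mem_latticeFil_of_eigen ((χ x).proj_mem_eigen _ _ v)]
  exact mem_latticeFil.1 hv k

/-- Pulled back to the lattice, an element of ψ^{ξ_k,α_k} has constant coordinates and is therefore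
recovered from its value at x. -/
theorem map_latticeFil (hN : NonResonant (S.fac x) (S.expn x))
    (h : FlatHom M.toFlat E.toFlat)
    (hgh : LocFree.Hom.comp h.toHom g.toHom = LocFree.Hom.id M.bdl) (k : Fin S.r) (β : ℝ) :
    (latticeFil M χ g x β ⊓ E.eigen x (S.fac x k) (S.expn x k)).map
      (g.toHom.hat x ∘ₗ (χ x).const) = M.par x (S.fac x k) (S.expn x k) β := by
  refine le_antisymm ?_ fun m hm => ?_
  · rintro _ ⟨v, ⟨hv, hv'⟩, rfl⟩
    exact (mem_latticeFil_of_eigen hv').1 hv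
  · have h1 := h.hat_mem_psi (M.par_le_psi (S.fac_mem_facs x k) _ _ hm)
    have h2 : g.toHom.hat x ((χ x).const ((χ x).lead 0 (h.toHom.hat x m))) = m := by
      rw [(χ x).const_lead hN h1]
      exact hat_hom_inv h g hgh m
    refine ⟨(χ x).lead 0 (h.toHom.hat x m), ⟨?_, (χ x).lead_mem_eigen h1⟩, h2⟩
    rw [SetLike.mem_coe, mem_latticeFil_of_eigen ((χ x).lead_mem_eigen h1), h2]
    exact hm

end Lattice

namespace DMP

variable {S : SingData}

/-- The object of `HP` on a lattice of a meromorphic bundle with parabolic structure. -/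
def latticeHP (hS : S.ResonanceFree) (M : DMP S) {E : HolConn S} (hE : E.HasType)
    (g : FlatHom E.toFlat M.toFlat) (h : FlatHom M.toFlat E.toFlat)
    (hg : LocFree.Hom.comp g.toHom h.toHom = LocFree.Hom.id E.toFlat.bdl)
    (hh : LocFree.Hom.comp h.toHom g.toHom = LocFree.Hom.id M.bdl) : HP S where
  toHolConn := E
  hasType := hE
  fil := latticeFil M (fun x => (hE.nonempty_formalChart hS x.2).some) g
  isFiltration x := isFiltration_latticeFil
    (Function.LeftInverse.injective fun m => hat_hom_inv g h hg m)
  compatible x β := latticeFil_compatible β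
  weight_ne x k hk β hβ := by
    rw [← M.weight_ne x k hk β hβ, ← grDim_map (g.toHom.hat x ∘ₗ
      ((hE.nonempty_formalChart hS x.2).some).const) (V := ⊤) (fun γ => le_top) ?_ β]
    · congr 1
      funext γ
      exact map_latticeFil (hS.nonResonant x.2) h hh k γ
    · intro v _ hv
      exact hat_const_eq_zero (χ := fun x => (hE.nonempty_formalChart hS x.2).some)
        (Function.LeftInverse.injective fun m => hat_hom_inv g h hg m) hv
  admissible x hx β hβ := by
    rw [eq_bot_iff]
    rintro v ⟨hv, hv'⟩
    let χ := fun x : S.D => (hE.nonempty_formalChart hS x.2).some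
    by_cases h0 : ∃ k, S.fac x k = 0 ∧ S.expn x k = 0
    · obtain ⟨k, h1, h2⟩ := h0
      have hv' : v ∈ E.eigen x (S.fac x k) (S.expn x k) := by rw [h1, h2]; exact hv'
      have h3 := (mem_latticeFil_of_eigen hv').1 hv
      rw [h1, h2, M.admissible x hx β hβ, Submodule.mem_bot] at h3
      exact hat_const_eq_zero (χ := χ)
        (Function.LeftInverse.injective fun m => hat_hom_inv g h hg m) h3
    -- If no index has ξ_k = α_k = 0, the residue has no kernel and the condition is empty.
    · apply (χ x).fib.injective
      funext k
      rw [map_zero, Pi.zero_apply]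
      by_contra h1
      exact h0 ⟨k, ((χ x).mem_eigen _ _ _).1 hv' k h1⟩

/-- The hypothesis compares the structures only on the eigenspaces, that is, on ψ^{ξ_k,α_k}.
Multiplication by powers of z spreads the comparison to ψ^{ξ_k,α_k+N}, and all other ψ spaces
vanish. -/
theorem mem_par_iff_hat_mem (hS : S.ResonanceFree) {X : HP S} {M : DMP S}
    (g : FlatHom X.toFlat M.toFlat)
    (hfil : ∀ (x : S.D) k (β : ℝ), ∀ v ∈ X.eigen x (S.fac x k) (S.expn x k), v ∈ X.fil x β ↔
      g.toHom.hat x ((X.chart hS x).const v) ∈ M.par x (S.fac x k) (S.expn x k) β)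
    (x : S.D) {ξ : ℂ} (hξ : ξ ∈ S.facs x) (α : ℂ) (β : ℝ) (m : X.toFlat.bdl.Hat x) :
    m ∈ X.par hS x ξ α β ↔ m ∈ X.toFlat.psi x ξ α ∧ g.toHom.hat x m ∈ M.par x ξ α β := by
  by_cases hc : ∃ k, ∃ N : ℤ, S.fac x k = ξ ∧ α = S.expn x k + N
  · obtain ⟨k, N, rfl, rfl⟩ := hc
    rw [HP.mem_par_add]
    refine and_congr_right fun hm => ?_
    have h1 : X.toFlat.bdl.zpow x (-N) m ∈ X.toFlat.psi x (S.fac x k) (S.expn x k) := by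
      have := (X.chart hS x).zpow_mem_psi hm (-N)
      push_cast at this
      rwa [add_neg_cancel_right] at this
    have h2 : (X.chart hS x).lead N m =
        (X.chart hS x).lead 0 (X.toFlat.bdl.zpow x (-N) m) := by
      rw [FormalChart.lead_zpow, zero_sub, neg_neg]
    rw [h2, hfil x k _ _ ((X.chart hS x).lead_mem_eigen h1),
      (X.chart hS x).const_lead (hS.nonResonant x.2) h1, LocFree.Hom.hat_zpow]
    refine ⟨fun h3 => ?_, fun h3 => ?_⟩
    · have h4 := M.zpow_mem_par hξ h3 N
      rw [LocFree.zpow_zpow_neg, sub_add_cancel] at h4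
      exact h4
    · have h4 := M.zpow_mem_par hξ h3 (-N)
      push_cast at h4
      rwa [add_neg_cancel_right, ← sub_eq_add_neg] at h4
  · push Not at hc
    have h1 := (X.chart hS x).psi_eq_bot hc
    constructor
    · intro hm
      have hm1 := HP.par_le_psi hm
      refine ⟨hm1, ?_⟩
      rw [h1, Submodule.mem_bot] at hm1
      rw [hm1, map_zero]
      exact zero_mem _
    · rintro ⟨hm, -⟩
      rw [h1, Submodule.mem_bot] at hm
      rw [hm]
      exact zero_mem _

theorem nonempty_iso_toDMP (hS : S.ResonanceFree) {X : HP S} {M : DMP S}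
    (g : FlatHom X.toFlat M.toFlat) (h : FlatHom M.toFlat X.toFlat)
    (hg : LocFree.Hom.comp g.toHom h.toHom = LocFree.Hom.id X.toFlat.bdl)
    (hh : LocFree.Hom.comp h.toHom g.toHom = LocFree.Hom.id M.bdl)
    (hfil : ∀ (x : S.D) k (β : ℝ), ∀ v ∈ X.eigen x (S.fac x k) (S.expn x k), v ∈ X.fil x β ↔
      g.toHom.hat x ((X.chart hS x).const v) ∈ M.par x (S.fac x k) (S.expn x k) β) :
    Nonempty (X.toDMP hS ≅ M) := by
  have key := mem_par_iff_hat_mem hS g hfil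
  let G : DMPHom (X.toDMP hS) M := { g with
    par := by
      rintro x ξ hξ α β _ ⟨m, hm, rfl⟩
      exact ((key x hξ α β m).1 hm).2 }
  let H : DMPHom M (X.toDMP hS) := { h with
    par := by
      rintro x ξ hξ α β _ ⟨m, hm, rfl⟩
      have h1 : g.toHom.hat x (h.toHom.hat x m) ∈ M.par x ξ α β := by
        rw [hat_hom_inv h g hh]
        exact hm
      exact (key x hξ α β _).2 ⟨h.hat_mem_psi (M.par_le_psi hξ _ _ hm), h1⟩ }
  refine ⟨⟨G, H, ?_, ?_⟩⟩
  · exact DMPHom.ext (congrArg LocFree.Hom.app hg)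
  · exact DMPHom.ext (congrArg LocFree.Hom.app hh)

theorem exists_iso_toDMP (hS : S.ResonanceFree) (M : DMP S) :
    ∃ X : HP S, Nonempty (X.toDMP hS ≅ M) := by
  obtain ⟨E, hE, ⟨ψ⟩⟩ := M.exists_lattice
  have hg : LocFree.Hom.comp (FlatHom.toHom ψ.hom) (FlatHom.toHom ψ.inv) =
      LocFree.Hom.id E.toFlat.bdl := congrArg FlatHom.toHom ψ.hom_inv_id
  have hh : LocFree.Hom.comp (FlatHom.toHom ψ.inv) (FlatHom.toHom ψ.hom) =
      LocFree.Hom.id M.bdl := congrArg FlatHom.toHom ψ.inv_hom_id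
  exact ⟨M.latticeHP hS hE ψ.hom ψ.inv hg hh, nonempty_iso_toDMP hS
    (X := M.latticeHP hS hE ψ.hom ψ.inv hg hh) ψ.hom ψ.inv hg hh
    fun x k β v hv => mem_latticeFil_of_eigen
      (χ := fun x => (hE.nonempty_formalChart hS x.2).some) hv⟩

end DMP

namespace HP

variable {S : SingData} (hS : S.ResonanceFree)

theorem essSurj_toDMPFunctor : (toDMPFunctor hS).EssSurj where
  mem_essImage M := M.exists_iso_toDMP hS

/-- The equivalence of `HP` and `DMP`. -/
def equivalenceDMP : HP S ≌ DMP S :=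
  haveI : (toDMPFunctor hS).IsEquivalence :=
    { faithful := faithful_toDMPFunctor hS
      full := full_toDMPFunctor hS
      essSurj := essSurj_toDMPFunctor hS }
  (toDMPFunctor hS).asEquivalence

/-- The constant term kills zÊ, so m and the section have the same one, and the constant term of a
section is its value at x. -/
theorem isInduced_toDMP (X : HP S) : IsInduced X (X.toDMP hS) (Iso.refl X.toFlat) := by
  intro x k β s hs m hm h
  have h1 : (X.chart hS x).lead 0 m = s (pt x) := by
    have := (X.chart hS x).lead_of_mem_hatIdeal h
    rw [map_sub, (X.chart hS x).lead_germ, sub_eq_zero] at this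
    exact this
  rw [← h1]
  have h2 : (LocFree.Hom.id X.toFlat.bdl).hat x m = m := by rw [LocFree.Hom.hat_id]; rfl
  change (LocFree.Hom.id X.toFlat.bdl).hat x m ∈ X.par hS x _ _ β ↔ _
  rw [h2, mem_par_expn]
  exact ⟨fun h => h.2, fun h => ⟨hm, h⟩⟩

/-- The equivalence is compatible with the functors to meromorphic bundles with connection. -/
def toFlatIso : toFlatFunctor S ≅ (equivalenceDMP hS).functor ⋙ DMP.forget S :=
  NatIso.ofComponents (fun X => Iso.refl X.toFlat) (fun f => rfl)

end HP

/-! ### Weights of filtrations -/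

section Weights

variable {U : Type} [AddCommGroup U] [Module ℂ U]

theorem grDim_eq_zero_of_le {F : ℝ → Submodule ℂ U} {β : ℝ} (h : F β ≤ ⨆ γ > β, F γ) :
    grDim F β = 0 := by
  rw [grDim, Submodule.submoduleOf_eq_top.2 h]
  exact Module.finrank_zero_of_subsingleton

theorem finsum_mul_grDim {R : Type*} [CommSemiring R] {F : ℝ → Submodule ℂ U} {n : ℕ}
    {b : Fin n → ℝ} (hb : ∀ m, b m ∈ Set.Ico (0 : ℝ) 1)
    (hF : ∀ β, grDim F β = (Finset.univ.filter fun m => b m = β).card) (g : ℝ → R) :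
    ∑ᶠ β ∈ Set.Ico (0 : ℝ) 1, g β * grDim F β = ∑ m, g (b m) := by
  classical
  have h0 : ∀ β, β ∉ Finset.univ.image b → grDim F β = 0 := by
    intro β hβ
    rw [hF, Finset.card_eq_zero, Finset.filter_eq_empty_iff]
    intro m _ hm
    exact hβ (Finset.mem_image.2 ⟨m, Finset.mem_univ m, hm⟩)
  have h1 : ∀ β, ∑ᶠ (_ : β ∈ Set.Ico (0 : ℝ) 1), g β * (grDim F β : R) =
      g β * grDim F β := by
    intro β
    by_cases hβ : β ∈ Set.Ico (0 : ℝ) 1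
    · rw [finsum_eq_if, if_pos hβ]
    · rw [finsum_eq_if, if_neg hβ, h0 β fun h => ?_, Nat.cast_zero, mul_zero]
      obtain ⟨m, -, rfl⟩ := Finset.mem_image.1 h
      exact hβ (hb m)
  rw [finsum_congr h1, finsum_eq_sum_of_support_subset (s := Finset.univ.image b),
    Finset.sum_comp g b]
  · refine Finset.sum_congr rfl fun β _ => ?_
    rw [hF, nsmul_eq_mul, mul_comm]
  · intro β hβ
    by_contra h
    exact hβ (by simp only [h0 β h, Nat.cast_zero, mul_zero])

variable [FiniteDimensional ℂ U]

theorem grDim_add_finrank {F : ℝ → Submodule ℂ U} (hF : Antitone F) (β : ℝ) :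
    grDim F β + Module.finrank ℂ (⨆ γ > β, F γ : Submodule ℂ U) = Module.finrank ℂ (F β) := by
  have hle : (⨆ γ > β, F γ) ≤ F β := iSup₂_le fun γ hγ => hF (le_of_lt hγ)
  rw [grDim, ← Submodule.finrank_quotient_add_finrank ((⨆ γ > β, F γ).submoduleOf (F β))]
  congr 1
  exact (LinearEquiv.finrank_eq (Submodule.submoduleOfEquivOfLe hle)).symm

/-- Dimensions are bounded, so some γ > β maximises dim F^γ. By monotonicity this step contains all
the others with index above β. -/
theorem exists_eq_iSup_gt {F : ℝ → Submodule ℂ U} (hF : Antitone F) (β : ℝ) :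
    ∃ γ > β, ⨆ γ > β, F γ = F γ := by
  have hbdd : BddAbove ((fun γ => Module.finrank ℂ (F γ)) '' Set.Ioi β) :=
    ⟨Module.finrank ℂ U, by rintro _ ⟨γ, -, rfl⟩; exact Submodule.finrank_le _⟩
  obtain ⟨γ, hγ, hmax⟩ := Nat.sSup_mem (Set.Nonempty.image _ ⟨β + 1, by simp⟩) hbdd
  refine ⟨γ, hγ, le_antisymm (iSup₂_le fun δ hδ => ?_) (le_iSup₂_of_le γ hγ le_rfl)⟩
  have h1 : F γ ≤ F (min γ δ) := hF (min_le_left _ _)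
  have h2 : Module.finrank ℂ (F (min γ δ)) ≤ Module.finrank ℂ (F γ) := by
    have := le_csSup hbdd ⟨min γ δ, lt_min hγ hδ, rfl⟩
    rw [← hmax] at this
    exact this
  rw [Submodule.eq_of_le_of_finrank_le h1 h2]
  exact hF (min_le_right _ _)

theorem exists_eq_iInf_lt {F : ℝ → Submodule ℂ U} (hF : Antitone F) (β : ℝ) :
    ∃ γ < β, ⨅ γ < β, F γ = F γ := by
  obtain ⟨γ, hγ, hmin⟩ := Nat.sInf_mem (Set.Nonempty.image
    (fun γ => Module.finrank ℂ (F γ)) (s := Set.Iio β) ⟨β - 1, by simp⟩)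
  refine ⟨γ, hγ, le_antisymm (iInf₂_le γ hγ) (le_iInf₂ fun δ hδ => ?_)⟩
  have h1 : F (max γ δ) ≤ F γ := hF (le_max_left _ _)
  have h2 : Module.finrank ℂ (F γ) ≤ Module.finrank ℂ (F (max γ δ)) := by
    have : sInf ((fun γ => Module.finrank ℂ (F γ)) '' Set.Iio β) ≤ _ :=
      Nat.sInf_le ⟨max γ δ, max_lt hγ hδ, rfl⟩
    rw [← hmin] at this
    exact this
  rw [← Submodule.eq_of_le_of_finrank_le h1 h2]
  exact hF (le_max_right _ _)

/-- The list of the weights of a filtration, with multiplicities. -/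
theorem IsFiltration.exists_weights {V : Submodule ℂ U} {F : ℝ → Submodule ℂ U}
    (h : IsFiltration V 0 F) : ∃ b : Fin (Module.finrank ℂ V) → ℝ,
      (∀ m, b m ∈ Set.Ico (0 : ℝ) 1) ∧
      ∀ β, grDim F β = (Finset.univ.filter fun m => b m = β).card := by
  set d : ℝ → ℕ := fun β => Module.finrank ℂ (F β) with hd
  have hanti : Antitone d := fun β γ hβγ => Submodule.finrank_mono (h.antitone hβγ)
  have h0 : d 0 = Module.finrank ℂ V := by rw [hd]; simp only; rw [h.eq_top 0 (by simp)]
  have h1 : ∀ β ≥ 1, d β = 0 := fun β hβ => by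
    rw [hd]; simp only; rw [h.eq_bot β (by simpa using hβ), finrank_bot]
  have hn : ∀ β, d β ≤ Module.finrank ℂ V := fun β => Submodule.finrank_mono (h.le β)
  -- The weight number m is the supremum of the β with dim F^β > m. Then dim F^β counts the weights
  -- that are at least β.
  let A : Fin (Module.finrank ℂ V) → Set ℝ := fun m => {β | (m : ℕ) < d β}
  have hA0 : ∀ m, (0 : ℝ) ∈ A m := fun m => by
    change (m : ℕ) < d 0
    rw [h0]
    exact m.2
  have hA1 : ∀ m, ∀ β ∈ A m, β < 1 := fun m β hβ => by
    by_contra hc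
    have : (m : ℕ) < d β := hβ
    rw [h1 β (not_lt.1 hc)] at this
    omega
  have hbdd : ∀ m, BddAbove (A m) := fun m => ⟨1, fun β hβ => (hA1 m β hβ).le⟩
  -- Continuity from the left makes the supremum a maximum.
  have hmem : ∀ m, sSup (A m) ∈ A m := by
    intro m
    obtain ⟨γ, hγ, hγ'⟩ := exists_eq_iInf_lt h.antitone (sSup (A m))
    rw [← h.leftCont] at hγ'
    obtain ⟨β, hβ, hγβ⟩ := exists_lt_of_lt_csSup ⟨0, hA0 m⟩ hγ
    have h2 : (m : ℕ) < d β := hβ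
    have h3 : d β ≤ d γ := hanti hγβ.le
    have h4 : d γ = d (sSup (A m)) := by rw [hd]; simp only; rw [hγ']
    change (m : ℕ) < d (sSup (A m))
    omega
  have hiff : ∀ (m : Fin (Module.finrank ℂ V)) (β : ℝ), (m : ℕ) < d β ↔ β ≤ sSup (A m) := fun m β =>
    ⟨fun hβ => le_csSup (hbdd m) hβ, fun hβ => lt_of_lt_of_le (hmem m) (hanti hβ)⟩
  have hcard : ∀ β, (Finset.univ.filter fun m => β ≤ sSup (A m)).card = d β := by
    intro β
    simp only [← hiff]
    rw [Fin.card_filter_val_lt]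
    exact min_eq_right (hn β)
  refine ⟨fun m => sSup (A m), fun m => ⟨le_csSup (hbdd m) (hA0 m), hA1 m _ (hmem m)⟩,
    fun β => ?_⟩
  obtain ⟨γ, hγ, hγ'⟩ := exists_eq_iSup_gt h.antitone β
  have h2 := grDim_add_finrank h.antitone β
  rw [hγ'] at h2
  have h3 : (Finset.univ.filter fun m => β < sSup (A m)).card = d γ := by
    rw [← hcard γ]
    congr 1
    ext m
    simp only [Finset.mem_filter, Finset.mem_univ, true_and]
    refine ⟨fun hm => ?_, fun hm => lt_of_lt_of_le hγ hm⟩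
    rw [← hiff]
    refine lt_of_lt_of_le (hmem m) (Submodule.finrank_mono ?_)
    rw [← hγ']
    exact le_iSup₂_of_le _ hm le_rfl
  have h4 : (Finset.univ.filter fun m => β ≤ sSup (A m)).card =
      (Finset.univ.filter fun m => sSup (A m) = β).card +
        (Finset.univ.filter fun m => β < sSup (A m)).card := by
    rw [← Finset.card_union_of_disjoint]
    · congr 1
      ext m
      simp only [Finset.mem_filter, Finset.mem_univ, true_and, Finset.mem_union]
      rw [le_iff_eq_or_lt, eq_comm]
    · rw [Finset.disjoint_filter]
      intro m _ h5 h6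
      exact h6.ne' h5
  rw [h3, hcard] at h4
  change grDim F β + d γ = d β at h2
  change grDim F β = (Finset.univ.filter fun m => sSup (A m) = β).card
  omega

/-- The map π i is the identity on V i and kills the other V j, so the sum is direct. -/
theorem finrank_iSup_eq_sum {ι : Type*} (s : Finset ι) {V A : ι → Submodule ℂ U}
    (π : ι → U →ₗ[ℂ] U) (h1 : ∀ i, ∀ v ∈ V i, π i v = v)
    (h2 : ∀ i j, i ≠ j → ∀ v ∈ V i, π j v = 0) (hA : ∀ i, A i ≤ V i) :
    Module.finrank ℂ (⨆ i ∈ s, A i : Submodule ℂ U) = ∑ i ∈ s, Module.finrank ℂ (A i) := by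
  classical
  induction s using Finset.induction_on with
  | empty => simp
  | insert i s hi ih =>
    rw [Finset.iSup_insert, Finset.sum_insert hi, ← ih]
    have h3 : A i ⊓ (⨆ j ∈ s, A j) = ⊥ := by
      rw [eq_bot_iff]
      rintro v ⟨hv, hv'⟩
      have h4 : (⨆ j ∈ s, A j) ≤ LinearMap.ker (π i) := by
        refine iSup₂_le fun j hj v hv => ?_
        exact h2 j i (fun h => hi (h ▸ hj)) v (hA j hv)
      have h5 : π i v = 0 := h4 hv'
      rw [h1 i v (hA i hv)] at h5
      exact h5
    have h4 := Submodule.finrank_sup_add_finrank_inf_eq (A i) (⨆ j ∈ s, A j)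
    rw [h3, finrank_bot, add_zero] at h4
    exact h4

theorem grDim_iSup {ι : Type*} (s : Finset ι) {V : ι → Submodule ℂ U}
    {G : ι → ℝ → Submodule ℂ U} (π : ι → U →ₗ[ℂ] U) (h1 : ∀ i, ∀ v ∈ V i, π i v = v)
    (h2 : ∀ i j, i ≠ j → ∀ v ∈ V i, π j v = 0) (hG : ∀ i β, G i β ≤ V i)
    (hanti : ∀ i, Antitone (G i)) (β : ℝ) :
    grDim (fun γ => ⨆ i ∈ s, G i γ) β = ∑ i ∈ s, grDim (G i) β := by
  have h3 : Antitone fun γ => ⨆ i ∈ s, G i γ := fun γ δ h =>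
    iSup₂_mono fun i _ => hanti i h
  have h4 := grDim_add_finrank h3 β
  have h5 : (⨆ γ > β, ⨆ i ∈ s, G i γ) = ⨆ i ∈ s, ⨆ γ > β, G i γ := by
    refine le_antisymm (iSup₂_le fun γ hγ => iSup₂_mono fun i _ => le_iSup₂_of_le γ hγ le_rfl)
      (iSup₂_le fun i hi => iSup₂_mono fun γ _ => le_iSup₂_of_le i hi le_rfl)
  rw [h5, finrank_iSup_eq_sum s π h1 h2 (fun i => iSup₂_le fun γ _ => hG i γ),
    finrank_iSup_eq_sum s π h1 h2 (fun i => hG i β)] at h4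
  have h6 : ∑ i ∈ s, (grDim (G i) β + Module.finrank ℂ (⨆ γ > β, G i γ : Submodule ℂ U)) =
      ∑ i ∈ s, Module.finrank ℂ (G i β) :=
    Finset.sum_congr rfl fun i _ => grDim_add_finrank (hanti i) β
  rw [Finset.sum_add_distrib] at h6
  omega

end Weights

/-! ### Normal forms of matrices of meromorphic functions -/

/-- Row rank equals column rank, so s of the rows form a basis of the row space. -/
theorem exists_det_rows_ne_zero {r s : ℕ} {A : Matrix (Fin r) (Fin s) ℂ}
    (hA : LinearIndependent ℂ A.col) : ∃ I : Fin s → Fin r, (A.submatrix I id).det ≠ 0 := by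
  have h1 : A.rank = s := by
    rw [← A.rank_transpose, LinearIndependent.rank_matrix (M := A.transpose) hA, Fintype.card_fin]
  rw [A.rank_eq_finrank_span_row] at h1
  obtain ⟨f, hf, -, hf'⟩ := Submodule.exists_fun_fin_finrank_span_eq ℂ (Set.range A.row)
  choose I hI using hf
  refine ⟨I ∘ Fin.cast h1.symm, ?_⟩
  have h2 : (A.submatrix (I ∘ Fin.cast h1.symm) id).row = f ∘ Fin.cast h1.symm := by
    funext i
    exact hI _
  have h3 := Matrix.linearIndependent_rows_iff_isUnit.1
    (h2 ▸ hf'.comp _ (Fin.cast_injective h1.symm))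
  exact ((Matrix.isUnit_iff_isUnit_det _).1 h3).ne_zero

/-- A meromorphic function of non-negative order is holomorphic after a change of its value at the
point. -/
theorem exists_analyticAt_of_order_nonneg {f : ℂ → ℂ} (hf : MeromorphicAt f 0)
    (h : 0 ≤ meromorphicOrderAt f 0) : ∃ g, AnalyticAt ℂ g 0 ∧ ∀ᶠ z in 𝓝[≠] 0, f z = g z := by
  by_cases ht : meromorphicOrderAt f 0 = ⊤
  · exact ⟨fun _ => 0, analyticAt_const, meromorphicOrderAt_eq_top_iff.1 ht⟩
  · obtain ⟨n, hn⟩ := WithTop.ne_top_iff_exists.1 ht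
    rw [← hn] at h
    obtain ⟨g, hg, -, hg'⟩ := (meromorphicOrderAt_eq_int_iff hf).1 hn.symm
    lift n to ℕ using by exact_mod_cast h
    refine ⟨fun z => z ^ n * g z, (analyticAt_id.pow n).mul hg, ?_⟩
    filter_upwards [hg'] with z hz
    rw [hz, sub_zero, zpow_natCast, smul_eq_mul]

theorem meromorphicAt_det {s : ℕ} {A : Fin s → Fin s → ℂ → ℂ}
    (hA : ∀ i j, MeromorphicAt (A i j) 0) :
    MeromorphicAt (fun z => (Matrix.of fun i j => A i j z).det) 0 := by
  simp only [Matrix.det_apply]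
  refine meromorphicAt_sum _ fun σ _ => ?_
  have h : MeromorphicAt (fun z => ∏ i, A (σ i) i z) 0 := MeromorphicAt.fun_prod fun i _ => hA _ _
  exact ((MeromorphicAt.const (Equiv.Perm.sign σ : ℂ) 0).mul h).congr
    (Eventually.of_forall fun z => by simp [Units.smul_def])

/-- Among the maximal minors, choose rows I whose minor has the smallest order at 0. By Cramer's
rule, the coefficients that express row k through the rows I are quotients of a minor with one row
replaced by the chosen minor. Their order is non-negative, so they are holomorphic up to a removable
singularity. This is how sub-bundles are saturated at a singular point. -/
theorem exists_normal_columns {r s : ℕ} {F : Fin r → Fin s → ℂ → ℂ}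
    (hF : ∀ k j, MeromorphicAt (F k j) 0)
    (hind : ∀ᶠ z in 𝓝[≠] (0 : ℂ), LinearIndependent ℂ (Matrix.of fun k j => F k j z).col) :
    ∃ (I : Fin s → Fin r) (G : Fin r → Fin s → ℂ → ℂ), (∀ k j, AnalyticAt ℂ (G k j) 0) ∧
      (∀ i j z, G (I i) j z = if i = j then 1 else 0) ∧
      ∀ᶠ z in 𝓝[≠] (0 : ℂ), ∀ k j, F k j z = ∑ i, G k i z * F (I i) j z := by
  classical
  let m : (Fin s → Fin r) → ℂ → ℂ := fun I z => (Matrix.of fun i j => F (I i) j z).det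
  have hm : ∀ I, MeromorphicAt (m I) 0 := fun I => meromorphicAt_det fun i j => hF _ _
  have hex : ∃ I, meromorphicOrderAt (m I) 0 ≠ ⊤ := by
    by_contra hc
    push Not at hc
    have h1 : ∀ᶠ z in 𝓝[≠] (0 : ℂ), ∀ I, m I z = 0 :=
      eventually_all.2 fun I => meromorphicOrderAt_eq_top_iff.1 (hc I)
    obtain ⟨z, hz, hz'⟩ := (hind.and h1).exists
    obtain ⟨I, hI⟩ := exists_det_rows_ne_zero hz
    exact hI (hz' I)
  obtain ⟨I₀, hI₀⟩ := hex
  have : Nonempty (Fin s → Fin r) := ⟨I₀⟩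
  obtain ⟨I, hI⟩ := Finite.exists_min fun I => meromorphicOrderAt (m I) 0
  have hItop : meromorphicOrderAt (m I) 0 ≠ ⊤ := ne_top_of_le_ne_top hI₀ (hI I₀)
  have hIne : ∀ᶠ z in 𝓝[≠] (0 : ℂ), m I z ≠ 0 := (meromorphicOrderAt_ne_top_iff_eventually_ne_zero
    (hm I)).1 hItop
  have hinj : Function.Injective I := by
    obtain ⟨z, hz⟩ := hIne.exists
    intro i j hij
    by_contra hne
    exact hz (Matrix.det_zero_of_row_eq hne (by funext l; simp [hij]))
  have hH : ∀ k j, ∃ g, AnalyticAt ℂ g 0 ∧ ∀ᶠ z in 𝓝[≠] (0 : ℂ),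
      m (Function.update I j k) z * (m I z)⁻¹ = g z := by
    intro k j
    refine exists_analyticAt_of_order_nonneg ((hm _).mul (hm I).inv) ?_
    change 0 ≤ meromorphicOrderAt (m (Function.update I j k) * (m I)⁻¹) 0
    rw [meromorphicOrderAt_mul (hm _) (hm I).inv, meromorphicOrderAt_inv]
    have h1 := hI (Function.update I j k)
    obtain ⟨n, hn⟩ := WithTop.ne_top_iff_exists.1 hItop
    rw [← hn] at h1 ⊢
    cases h2 : meromorphicOrderAt (m (Function.update I j k)) 0 with
    | top => simp
    | coe l =>
      rw [h2] at h1
      have h1' : n ≤ l := by exact_mod_cast h1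
      have : (0 : ℤ) ≤ l + -n := by omega
      exact_mod_cast this
  choose H hHa hH using hH
  -- On the rows I the entries are set to the Kronecker delta at every z, so the identity block is
  -- exact also at 0 and away from it.
  refine ⟨I, fun k j => if h : ∃ i, I i = k then fun _ => if h.choose = j then 1 else 0
    else H k j, fun k j => ?_, fun i j z => ?_, ?_⟩
  · beta_reduce
    by_cases h : ∃ i, I i = k
    · rw [dif_pos h]
      exact analyticAt_const
    · rw [dif_neg h]
      exact hHa k j
  · have h : ∃ i', I i' = I i := ⟨i, rfl⟩
    beta_reduce
    rw [dif_pos h, hinj h.choose_spec]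
  · filter_upwards [hIne, eventually_all.2 fun k => eventually_all.2 fun j => hH k j]
      with z hz hz' k j
    by_cases h : ∃ i, I i = k
    · obtain ⟨i, rfl⟩ := h
      have h : ∃ i', I i' = I i := ⟨i, rfl⟩
      simp only [dif_pos h, hinj h.choose_spec, ite_mul, one_mul, zero_mul, Finset.sum_ite_eq,
        Finset.mem_univ, if_true]
    · simp only [dif_neg h, ← hz']
      set A : Matrix (Fin s) (Fin s) ℂ := Matrix.of fun i j => F (I i) j z with hA
      have h1 : ∀ i, m (Function.update I i k) z = A.transpose.cramer (fun j => F k j z) i := by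
        intro i
        rw [Matrix.cramer_transpose_apply]
        change Matrix.det _ = _
        congr 1
        ext a b
        by_cases hai : a = i
        · subst hai; simp
        · simp [Matrix.updateRow_ne hai, Function.update_of_ne hai, hA]
      have h2 := congrFun (Matrix.mulVec_cramer A.transpose (fun j => F k j z)) j
      rw [Matrix.det_transpose] at h2
      have h3 : A.det = m I z := rfl
      simp only [h1]
      simp only [Matrix.mulVec, dotProduct, Matrix.transpose_apply, Pi.smul_apply,
        smul_eq_mul] at h2
      rw [h3] at h2
      calc F k j z = (m I z)⁻¹ * (m I z * F k j z) := by field_simp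
        _ = _ := by
          rw [← h2, Finset.mul_sum]
          refine Finset.sum_congr rfl fun i _ => ?_
          have h4 : A i j = F (I i) j z := rfl
          rw [h4]
          ring

/-! ### Adapted frames of sub-bundles -/

/-- A frame of a sub-bundle near `x` whose matrix with respect to a frame of the bundle contains
an identity matrix. -/
structure AdaptedFrame {r : ℕ} (E : HolBundle r) (s : ℕ) (W : ∀ y, Submodule ℂ (E.fib y))
    (x : Sphere) where
  frame : Fin r → ∀ y, E.fib y
  isFrame : IsFrame E.IsSec frame x
  row : Fin s → Fin r
  mat : Fin r → Fin s → ℂ → ℂ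
  analyticAt_mat : ∀ k j, AnalyticAt ℂ (mat k j) 0
  mat_row : ∀ i j z, mat (row i) j z = if i = j then 1 else 0
  span_eq : ∀ᶠ y : Off ∅ in near ∅ x,
    Submodule.span ℂ (Set.range fun j => ∑ k, mat k j (coord x y) • frame k y) = W y

/-! ### Linear algebra of columns that contain an identity block -/

section SumLemma

variable {V : Type*} [AddCommGroup V] [Module ℂ V]

theorem sum_smul_sum_smul {ι κ : Type*} [Fintype ι] [Fintype κ] (a : κ → ℂ) (G : ι → κ → ℂ)
    (e : ι → V) : ∑ j, a j • ∑ k, G k j • e k = ∑ k, (∑ j, a j * G k j) • e k := by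
  simp only [Finset.smul_sum, Finset.sum_smul, smul_smul]
  exact Finset.sum_comm

theorem coeff_eq_of_linearIndependent {ι : Type*} [Fintype ι] {e : ι → V}
    (he : LinearIndependent ℂ e) {a b : ι → ℂ} (h : ∑ k, a k • e k = ∑ k, b k • e k) : a = b := by
  have h1 : ∑ k, (a k - b k) • e k = 0 := by
    simp only [sub_smul, Finset.sum_sub_distrib, h, sub_self]
  funext k
  exact sub_eq_zero.1 (Fintype.linearIndependent_iff.1 he _ h1 k)

variable {r s : ℕ} {e : Fin r → V} {G : Fin r → Fin s → ℂ} {I : Fin s → Fin r}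

theorem linearIndependent_columns (he : LinearIndependent ℂ e)
    (hG : ∀ i j, G (I i) j = if i = j then 1 else 0) :
    LinearIndependent ℂ fun j => ∑ k, G k j • e k := by
  rw [Fintype.linearIndependent_iff]
  intro a ha i
  rw [sum_smul_sum_smul] at ha
  have h := Fintype.linearIndependent_iff.1 he _ ha (I i)
  simpa [hG] using h

/-- The identity block lets the coefficients with respect to the columns be read off as the entries
in the rows I. -/
theorem sum_eq_sum_columns (he : LinearIndependent ℂ e)
    (hG : ∀ i j, G (I i) j = if i = j then 1 else 0) {c : Fin r → ℂ}
    (hc : ∑ k, c k • e k ∈ Submodule.span ℂ (Set.range fun j => ∑ k, G k j • e k)) :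
    ∑ k, c k • e k = ∑ j, c (I j) • ∑ k, G k j • e k := by
  obtain ⟨a, ha⟩ := (Submodule.mem_span_range_iff_exists_fun ℂ).1 hc
  have h1 := ha
  rw [sum_smul_sum_smul] at h1
  have h2 := coeff_eq_of_linearIndependent he h1
  rw [← ha]
  refine Finset.sum_congr rfl fun j _ => ?_
  rw [← h2]
  simp [hG]

end SumLemma

section SubSec

variable {D : Set Sphere} {r s : ℕ} {M : LocFree D r}

open Classical in
/-- A function with values in a sub-bundle, made from a function whose values near a point are in
the sub-bundle. -/
def subSec (W : ∀ y, Submodule ℂ (M.fib y)) (t : ∀ y, M.fib y) (y : Off D) : W y :=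
  if h : t y ∈ W y then ⟨t y, h⟩ else 0

theorem coe_subSec {W : ∀ y, Submodule ℂ (M.fib y)} {t : ∀ y, M.fib y} {y : Off D}
    (h : t y ∈ W y) : (subSec W t y : M.fib y) = t y := by
  rw [subSec, dif_pos h]

theorem linearIndependent_sub_and_span {V : Type*} [AddCommGroup V] [Module ℂ V]
    {W : Submodule ℂ V} {f : Fin s → W} {g : Fin s → V} (h : ∀ j, (f j : V) = g j)
    (h1 : LinearIndependent ℂ g) (h2 : Submodule.span ℂ (Set.range g) = W) :
    LinearIndependent ℂ f ∧ Submodule.span ℂ (Set.range f) = ⊤ := by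
  have h3 : g = fun j => W.subtype (f j) := funext fun j => (h j).symm
  constructor
  · apply LinearIndependent.of_comp W.subtype
    rw [h3] at h1
    exact h1
  · apply Submodule.map_injective_of_injective W.injective_subtype
    rw [Submodule.map_span, Submodule.map_top, Submodule.range_subtype, ← Set.range_comp]
    rw [h3] at h2
    exact h2

theorem isSubframe_subSec {W : ∀ y, Submodule ℂ (M.fib y)} {t : Fin s → ∀ y, M.fib y}
    {x : Sphere} (ht : ∀ j, M.IsSec (t j) x)
    (h : ∀ᶠ y in near D x, LinearIndependent ℂ (fun j => t j y) ∧
      Submodule.span ℂ (Set.range fun j => t j y) = W y) :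
    M.IsSubframe W (fun j => subSec W (t j)) x := by
  have hmem : ∀ᶠ y in near D x, ∀ j, (subSec W (t j) y : M.fib y) = t j y := by
    filter_upwards [h] with y hy j
    refine coe_subSec ?_
    rw [← hy.2]
    exact Submodule.subset_span ⟨j, rfl⟩
  refine ⟨fun j => (ht j).congr (hmem.mono fun y hy => hy j), ?_⟩
  filter_upwards [h, hmem] with y h1 h2
  exact linearIndependent_sub_and_span h2 h1.1 h1.2

end SubSec

namespace AdaptedFrame

variable {r s : ℕ} {E : HolBundle r} {W : ∀ y, Submodule ℂ (E.fib y)} {x : Sphere}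
  (A : AdaptedFrame E s W x)

/-- The sections that form the frame of the sub-bundle. -/
def col (j : Fin s) (y : Off ∅) : E.fib y := ∑ k, A.mat k j (coord x y) • A.frame k y

theorem isSec_col (j : Fin s) : E.IsSec (A.col j) x :=
  A.isFrame.isSec_of_hol fun k => ⟨A.mat k j, A.analyticAt_mat k j⟩

theorem span_col : ∀ᶠ y in near ∅ x, Submodule.span ℂ (Set.range fun j => A.col j y) = W y :=
  A.span_eq

theorem linearIndependent_col :
    ∀ᶠ y in near ∅ x, LinearIndependent ℂ fun j => A.col j y := by
  filter_upwards [A.isFrame.basis_near] with y hy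
  exact linearIndependent_columns hy.1 fun i j => A.mat_row i j _

theorem col_mem : ∀ᶠ y in near ∅ x, ∀ j, A.col j y ∈ W y := by
  filter_upwards [A.span_col] with y hy j
  rw [← hy]
  exact Submodule.subset_span ⟨j, rfl⟩

theorem eq_sum_col : ∀ᶠ y in near ∅ x, ∀ c : Fin r → ℂ, ∑ k, c k • A.frame k y ∈ W y →
    ∑ k, c k • A.frame k y = ∑ j, c (A.row j) • A.col j y := by
  filter_upwards [A.isFrame.basis_near, A.span_col] with y hy hy' c hc
  rw [← hy'] at hc
  exact sum_eq_sum_columns hy.1 (fun i j => A.mat_row i j _) hc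

/-- The frame, as a family of functions with values in the sub-bundle. -/
def sub (j : Fin s) : ∀ y, W y := subSec W (A.col j)

theorem coe_sub : ∀ᶠ y in near ∅ x, ∀ j, (A.sub j y : E.fib y) = A.col j y := by
  filter_upwards [A.col_mem] with y hy j
  exact coe_subSec (hy j)

theorem isSubframe : E.IsSubframe W A.sub x :=
  isSubframe_subSec A.isSec_col (A.linearIndependent_col.and A.span_col)

end AdaptedFrame

/-! ### Existence of adapted frames -/

/-- A span of s vectors has dimension at most s, so s independent vectors in it fill it. -/
theorem span_eq_of_eq_sum {V : Type*} [AddCommGroup V] [Module ℂ V] {s : ℕ} {t g : Fin s → V}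
    {B : Fin s → Fin s → ℂ} (ht : LinearIndependent ℂ t) (h : ∀ j, t j = ∑ i, B i j • g i) :
    Submodule.span ℂ (Set.range g) = Submodule.span ℂ (Set.range t) := by
  have : FiniteDimensional ℂ (Submodule.span ℂ (Set.range g)) :=
    FiniteDimensional.span_of_finite ℂ (Set.finite_range g)
  refine (Submodule.eq_of_le_of_finrank_le (Submodule.span_le.2 ?_) ?_).symm
  · rintro _ ⟨j, rfl⟩
    rw [h j]
    exact sum_mem fun i _ => Submodule.smul_mem _ _ (Submodule.subset_span ⟨i, rfl⟩)
  · rw [finrank_span_eq_card ht]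
    exact finrank_range_le_card g

theorem sum_smul_eq_of_eq_mul {V : Type*} [AddCommGroup V] [Module ℂ V] {r s : ℕ} {e : Fin r → V}
    {F G : Fin r → Fin s → ℂ} {I : Fin s → Fin r} {j : Fin s}
    (h : ∀ k, F k j = ∑ i, G k i * F (I i) j) :
    ∑ k, F k j • e k = ∑ i, F (I i) j • ∑ k, G k i • e k := by
  rw [sum_smul_sum_smul]
  refine Finset.sum_congr rfl fun k _ => ?_
  rw [h k]
  simp only [mul_comm]

theorem exists_normal_frame {r s : ℕ} {E : HolBundle r} {W : ∀ y, Submodule ℂ (E.fib y)}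
    {x : Sphere} {e : Fin r → ∀ y, E.fib y} {F : Fin r → Fin s → ℂ → ℂ}
    (hF : ∀ k j, MeromorphicAt (F k j) 0)
    (h : ∀ᶠ y in 𝓝[≠] x, LinearIndependent ℂ (fun j => ∑ k, F k j (coord x y) • e k (pt y)) ∧
      Submodule.span ℂ (Set.range fun j => ∑ k, F k j (coord x y) • e k (pt y)) = W (pt y)) :
    ∃ (I : Fin s → Fin r) (G : Fin r → Fin s → ℂ → ℂ), (∀ k j, AnalyticAt ℂ (G k j) 0) ∧
      (∀ i j z, G (I i) j z = if i = j then 1 else 0) ∧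
      (∀ᶠ z in 𝓝[≠] (0 : ℂ), ∀ k j, F k j z = ∑ i, G k i z * F (I i) j z) ∧
      ∀ᶠ y in 𝓝[≠] x,
        Submodule.span ℂ (Set.range fun j => ∑ k, G k j (coord x y) • e k (pt y)) = W (pt y) := by
  have hind : ∀ᶠ z in 𝓝[≠] (0 : ℂ), LinearIndependent ℂ (Matrix.of fun k j => F k j z).col := by
    rw [← eventually_nhdsNE_coord_iff (x := x)]
    filter_upwards [h] with y hy
    exact LinearIndependent.of_comp (Fintype.linearCombination ℂ fun k => e k (pt y)) hy.1
  obtain ⟨I, G, hG, hGI, hFG⟩ := exists_normal_columns hF hind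
  refine ⟨I, G, hG, hGI, hFG, ?_⟩
  filter_upwards [h, eventually_nhdsNE_coord_iff.2 hFG] with y hy hy'
  rw [← hy.2]
  exact span_eq_of_eq_sum (B := fun i j => F (I i) j (coord x y)) hy.1
    fun j => sum_smul_eq_of_eq_mul (F := fun k j => F k j (coord x y))
      (G := fun k j => G k j (coord x y)) fun k => hy' k j

theorem LocFree.IsSubframe.coe {D : Set Sphere} {r s : ℕ} {M : LocFree D r}
    {W : ∀ y, Submodule ℂ (M.fib y)} {f : Fin s → ∀ y, W y} {x : Sphere}
    (hf : M.IsSubframe W f x) :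
    ∀ᶠ y in near D x, LinearIndependent ℂ (fun j => (f j y : M.fib y)) ∧
      Submodule.span ℂ (Set.range fun j => (f j y : M.fib y)) = W y := by
  filter_upwards [hf.2] with y hy
  refine ⟨hy.1.map' (W y).subtype (W y).ker_subtype, ?_⟩
  have := congrArg (Submodule.map (W y).subtype) hy.2
  rw [Submodule.map_span, Submodule.map_top, Submodule.range_subtype, ← Set.range_comp] at this
  exact this

/-- The normalised columns G span W on a punctured neighbourhood. Since the original coefficients F
are holomorphic, the relation between F and G persists at x by continuity, and F has full rank
there, so G spans W at x too. -/
theorem LocFree.IsSubframe.nonempty_adaptedFrame {r s : ℕ} {E : HolBundle r}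
    {W : ∀ y, Submodule ℂ (E.fib y)} {f : Fin s → ∀ y, W y} {x : Sphere}
    (hf : E.IsSubframe W f x) : Nonempty (AdaptedFrame E s W x) := by
  obtain ⟨e, he⟩ := E.exists_frame x
  choose A hA hA0 using fun j => he.exists_hol (hf.1 j)
  have h1 := hf.coe
  have hA' : ∀ᶠ y in near ∅ x, ∀ j, (f j y : E.fib y) = ∑ k, A j k (coord x y) • e k y :=
    eventually_all.2 hA
  have h2 : ∀ᶠ y : Off ∅ in near ∅ x,
      LinearIndependent ℂ (fun j => ∑ k, A j k (coord x y) • e k y) ∧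
      Submodule.span ℂ (Set.range fun j => ∑ k, A j k (coord x y) • e k y) = W y := by
    filter_upwards [h1, hA'] with y hy hy'
    simp only [← hy']
    exact hy
  rw [eventually_near_empty_iff] at h2
  obtain ⟨I, G, hG, hGI, hFG, hspan⟩ := exists_normal_frame (F := fun k j => A j k)
    (fun k j => (A j k).analyticAt.meromorphicAt) (h2.filter_mono nhdsWithin_le_nhds)
  refine ⟨⟨e, he, I, G, hG, hGI, ?_⟩⟩
  rw [eventually_near_empty_iff, ← pure_sup_nhdsNE, eventually_sup, eventually_pure]
  refine ⟨?_, hspan⟩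
  have h3 := h2.self_of_nhds
  rw [← h3.2]
  refine span_eq_of_eq_sum (B := fun i j => A j (I i) (coord x x)) h3.1
    fun j => sum_smul_eq_of_eq_mul (F := fun k j => A j k (coord x x)) fun k => ?_
  rw [coord_self]
  refine (eventually_nhds_of_nhdsNE (A := A j k) (B := fun z => ∑ i, G k i z * A j (I i) z)
    (A j k).analyticAt.continuousAt ?_ (hFG.mono fun z hz => hz k j)).self_of_nhds
  exact tendsto_finsetSum _ fun i _ => ((hG k i).continuousAt.mul (A j (I i)).analyticAt.continuousAt)

theorem LocFree.IsSubbundle.nonempty_adaptedFrame {r s : ℕ} {E : HolBundle r}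
    {W : ∀ y, Submodule ℂ (E.fib y)} (hW : E.IsSubbundle s W) (x : Sphere) :
    Nonempty (AdaptedFrame E s W x) := by
  obtain ⟨f, hf⟩ := hW x
  exact hf.nonempty_adaptedFrame

/-! ### Extension of sub-bundles over the singular set -/

open Classical in
/-- The holomorphic sub-bundle that extends a sub-bundle of `E(*D)`. -/
def extendSub {D : Set Sphere} {r : ℕ} {E : HolBundle r}
    (W : ∀ y, Submodule ℂ ((E.star D).fib y)) (y : Off ∅) : Submodule ℂ (E.fib y) :=
  if h : (y : Sphere) ∉ D then W ⟨y, h⟩ else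
    Submodule.span ℂ {v | ∃ t, E.IsSec t y ∧ t y = v ∧
      ∀ᶠ y' : Off D in near D y, LocFree.restrict D t y' ∈ W y'}

theorem extendSub_off {D : Set Sphere} {r : ℕ} {E : HolBundle r}
    (W : ∀ y, Submodule ℂ ((E.star D).fib y)) (y : Off D) : extendSub W (pt y) = W y :=
  dif_pos y.2

theorem extendSub_mem {D : Set Sphere} {r : ℕ} {E : HolBundle r}
    (W : ∀ y, Submodule ℂ ((E.star D).fib y)) {x : Sphere} (hx : x ∈ D) :
    extendSub W (pt x) = Submodule.span ℂ {v | ∃ t, E.IsSec t x ∧ t (pt x) = v ∧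
      ∀ᶠ y' : Off D in near D x, LocFree.restrict D t y' ∈ W y'} :=
  dif_neg (not_not.2 hx)

theorem LocFree.IsSubbundle.star {r s : ℕ} {E : HolBundle r} (S : SingData)
    {W : ∀ y, Submodule ℂ (E.fib y)} (hW : E.IsSubbundle s W) :
    (E.star S.D).IsSubbundle s fun y => W (pt y) := by
  intro x
  obtain ⟨f, hf⟩ := hW x
  exact ⟨fun j y => f j (pt y), fun j => LocFree.isSec_restrict S.D (hf.1 j),
    SingData.near_of_near_empty hf.2⟩

/-- Near x ∈ D a meromorphic frame of W is normalised. The columns of G are holomorphic sections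
with values in W off `D`, so their values at x belong to the extension. Conversely, any such section
is a combination of the columns whose coefficients are its own entries in the rows I. These are
holomorphic, so the relation holds at x as well. -/
theorem isSubbundle_extendSub {S : SingData} {s : ℕ} {E : HolBundle S.r}
    {W : ∀ y, Submodule ℂ ((E.star S.D).fib y)} (hW : (E.star S.D).IsSubbundle s W) :
    E.IsSubbundle s (extendSub W) := by
  intro x
  obtain ⟨f, hf⟩ := hW x
  by_cases hx : x ∈ S.D
  · obtain ⟨e, he⟩ := E.exists_frame x
    have hes := he.star S.D
    let F : Fin S.r → Fin s → ℂ → ℂ := fun k j =>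
      hes.coef ⟨fun y => (f j y : (E.star S.D).fib y), hf.1 j⟩ k
    have hF : ∀ k j, MeromorphicAt (F k j) 0 := fun k j => hes.coef_mero _ k
    have h1 : ∀ᶠ y : Off S.D in near S.D x, ∀ j,
        ((f j y).1 : E.fib (pt y)) = ∑ k, F k j (coord x y) • e k (pt y) :=
      eventually_all.2 fun j => hes.coef_spec ⟨fun y => (f j y : (E.star S.D).fib y), hf.1 j⟩
    have h2 : ∀ᶠ y in 𝓝[≠] x, LinearIndependent ℂ
          (fun j => ∑ k, F k j (coord x y) • e k (pt y)) ∧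
        Submodule.span ℂ (Set.range fun j => ∑ k, F k j (coord x y) • e k (pt y)) =
          extendSub W (pt y) := by
      filter_upwards [(SingData.eventually_near_mem_iff hx).1 h1,
        (SingData.eventually_near_mem_iff hx).1 hf.coe, S.eventually_notMem' x] with y g1 g2 g3
      have g4 := funext (g1 g3)
      rw [← g4, extendSub_off W ⟨y, g3⟩]
      exact g2 g3
    obtain ⟨I, G, hG, hGI, -, hspan⟩ := exists_normal_frame hF h2
    refine ⟨_, (AdaptedFrame.mk e he I G hG hGI ?_).isSubframe⟩
    rw [eventually_near_empty_iff, ← pure_sup_nhdsNE, eventually_sup, eventually_pure]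
    refine ⟨?_, hspan⟩
    rw [extendSub_mem W hx]
    refine le_antisymm (Submodule.span_le.2 ?_) (Submodule.span_le.2 ?_)
    · rintro _ ⟨j, rfl⟩
      refine Submodule.subset_span ⟨fun y => ∑ k, G k j (coord x y) • e k y,
        he.isSec_of_hol fun k => ⟨G k j, hG k j⟩, rfl, ?_⟩
      rw [SingData.eventually_near_mem_iff hx]
      filter_upwards [hspan] with y hy hyD
      have g1 : (∑ k, G k j (coord x y) • e k (pt y)) ∈ extendSub W (pt y) := by
        rw [← hy]
        exact Submodule.subset_span ⟨j, rfl⟩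
      rw [extendSub_off W ⟨y, hyD⟩] at g1
      exact g1
    · rintro _ ⟨t, ht, rfl, htW⟩
      obtain ⟨A, hA, hA0⟩ := he.exists_hol ht
      rw [SetLike.mem_coe, hA0]
      have g1 : ∀ᶠ z in 𝓝[≠] (0 : ℂ), ∀ k, A k z = ∑ j, A (I j) z * G k j z := by
        rw [← eventually_nhdsNE_coord_iff (x := x)]
        filter_upwards [(SingData.eventually_near_mem_iff hx).1 htW, hspan,
          (eventually_near_empty_iff.1 hA).filter_mono nhdsWithin_le_nhds,
          (eventually_near_empty_iff.1 he.basis_near).filter_mono nhdsWithin_le_nhds,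
          S.eventually_notMem' x] with y g1 g2 g3 g4 g5
        have g6 : t (pt y) ∈ extendSub W (pt y) := by
          rw [extendSub_off W ⟨y, g5⟩]
          exact g1 g5
        rw [← g2, g3] at g6
        have g7 := sum_eq_sum_columns (G := fun k j => G k j (coord x y)) g4.1
          (fun i j => hGI i j _) g6
        rw [sum_smul_sum_smul] at g7
        exact congrFun (coeff_eq_of_linearIndependent g4.1 g7)
      have g2 : ∀ k, A k 0 = ∑ j, A (I j) 0 * G k j 0 := fun k =>
        (eventually_nhds_of_nhdsNE (A := A k) (B := fun z => ∑ j, A (I j) z * G k j z)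
          (A k).analyticAt.continuousAt (tendsto_finsetSum _ fun j _ =>
            (A (I j)).analyticAt.continuousAt.mul (hG k j).continuousAt)
          (g1.mono fun z hz => hz k)).self_of_nhds
      have g3 : ∑ k, A k 0 • e k (pt x) =
          ∑ j, A (I j) 0 • ∑ k, G k j (coord x x) • e k (pt x) := by
        rw [sum_smul_sum_smul, coord_self]
        exact Finset.sum_congr rfl fun k _ => by rw [g2 k]
      rw [g3]
      exact sum_mem fun j _ => Submodule.smul_mem _ _ (Submodule.subset_span ⟨j, rfl⟩)
  · choose N hN t ht htf using hf.1
    refine ⟨_, isSubframe_subSec ht (SingData.near_empty_of_near hx ?_)⟩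
    filter_upwards [hf.coe, eventually_all.2 htf] with y h1 h2
    have h3 : ∀ j, t j (pt y) = ((f j y).1 : E.fib (pt y)) := fun j => by
      have := h2 j
      rw [hN j hx, pow_zero] at this
      exact this.trans (one_smul ℂ _)
    rw [extendSub_off W y, funext h3]
    exact h1

/-! ### Invariant subspaces of diagonal formal connections -/

section EulerMatrix

variable {ι κ τ : Type*} [Fintype κ]

theorem map_eulerSeries_mul (A : Matrix ι κ (LaurentSeries ℂ)) (B : Matrix κ τ (LaurentSeries ℂ)) :
    (A * B).map eulerSeries = A.map eulerSeries * B + A * B.map eulerSeries := by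
  ext i j : 1
  simp only [Matrix.map_apply, Matrix.mul_apply, Matrix.add_apply, map_sum, eulerSeries_mul,
    Finset.sum_add_distrib]

variable [Fintype ι] [DecidableEq ι] [DecidableEq κ] {V : Matrix ι κ (LaurentSeries ℂ)}
  {Λ : ι → LaurentSeries ℂ} {ν T' : Matrix κ κ (LaurentSeries ℂ)} {J : κ → ι}

theorem euler_submatrix (hV : V.map eulerSeries + Matrix.diagonal Λ * V = V * ν) :
    (V.submatrix J id).map eulerSeries + Matrix.diagonal (Λ ∘ J) * V.submatrix J id =
      V.submatrix J id * ν := by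
  ext i j : 1
  have := congrFun (congrFun hV (J i)) j
  simpa [Matrix.mul_apply, Matrix.add_apply, Matrix.diagonal_apply] using this

/-- Write θ for z d/dz. The columns of V span a subspace invariant under θ + Λ, with matrix ν. The
rows J of the equation express V_J ν as θV_J + Λ_J V_J. Substituting this into the equation for V =
w V_J cancels θV_J and removes ν, which leaves θw + Λw = w Λ_J. So each column of w is an
eigenvector whose factor is one of the diagonal entries. -/
theorem euler_normalised (hV : V.map eulerSeries + Matrix.diagonal Λ * V = V * ν)
    (hT : V.submatrix J id * T' = 1) (hT' : T' * V.submatrix J id = 1) :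
    (V * T').map eulerSeries + Matrix.diagonal Λ * (V * T') =
      V * T' * Matrix.diagonal (Λ ∘ J) := by
  set T := V.submatrix J id with hTdef
  set w := V * T' with hw
  have h1 : V = w * T := by rw [hw, Matrix.mul_assoc, hT', Matrix.mul_one]
  have h2 := euler_submatrix (J := J) hV
  rw [← hTdef] at h2
  have cancel : ∀ {P Q R B : Matrix ι κ (LaurentSeries ℂ)}, P + Q + R = Q + B → P + R = B :=
    fun {P Q R B} h => add_left_cancel (a := Q) (by rw [← h]; abel)
  have h3 : (w.map eulerSeries + Matrix.diagonal Λ * w) * T = w * Matrix.diagonal (Λ ∘ J) * T := by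
    have h4 : w.map eulerSeries * T + w * T.map eulerSeries + Matrix.diagonal Λ * (w * T) =
        w * (T * ν) := by
      rw [← map_eulerSeries_mul, ← h1, hV, ← Matrix.mul_assoc, ← h1]
    rw [← h2, Matrix.mul_add] at h4
    rw [Matrix.add_mul, Matrix.mul_assoc (Matrix.diagonal Λ) w T, Matrix.mul_assoc w _ T]
    exact cancel h4
  clear_value w T
  have h4 := congrArg (· * T') h3
  simp only [Matrix.mul_assoc, hT, Matrix.mul_one] at h4
  exact h4

/-- The rows J give ν = T⁻¹ θT + T⁻¹ Λ_J T with T = V_J and θ = z d/dz, and the trace of the second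
term is invariant under conjugation. -/
theorem trace_euler (hV : V.map eulerSeries + Matrix.diagonal Λ * V = V * ν)
    (hT : V.submatrix J id * T' = 1) (hT' : T' * V.submatrix J id = 1) :
    ν.trace = (T' * (V.submatrix J id).map eulerSeries).trace + ∑ j, Λ (J j) := by
  have h2 := euler_submatrix (J := J) hV
  have h3 := congrArg (fun A => (T' * A).trace) h2
  simp only [← Matrix.mul_assoc, hT', Matrix.one_mul, Matrix.mul_add, Matrix.trace_add] at h3
  rw [← h3, Matrix.trace_mul_comm (T' * _), ← Matrix.mul_assoc, hT, Matrix.one_mul,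
    Matrix.trace_diagonal]
  rfl

end EulerMatrix

theorem powerSeries_matrix_inv {s : ℕ} {T : Matrix (Fin s) (Fin s) (PowerSeries ℂ)}
    (h : (T.map PowerSeries.constantCoeff).det ≠ 0) :
    ∃ T', T * T' = 1 ∧ T' * T = 1 := by
  have h1 : IsUnit T.det := by
    rw [PowerSeries.isUnit_iff_constantCoeff, RingHom.map_det]
    exact h.isUnit
  exact ⟨T⁻¹, Matrix.mul_nonsing_inv _ h1, Matrix.nonsing_inv_mul _ h1⟩

/-- The operator z d/dz kills constant terms, so its values on power series start in degree 1.
Consequently a holomorphic change of frame alters neither the polar part nor the constant term of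
the trace. -/
theorem trace_mul_euler_coeff {s : ℕ} (T' T : Matrix (Fin s) (Fin s) (PowerSeries ℂ)) {n : ℤ}
    (hn : n ≤ 0) : ((laurentMatrix T' * (laurentMatrix T).map eulerSeries).trace).coeff n = 0 := by
  have key : ∀ f g : PowerSeries ℂ, (HahnSeries.ofPowerSeries ℤ ℂ f *
      eulerSeries (HahnSeries.ofPowerSeries ℤ ℂ g)).coeff n = 0 := by
    intro f g
    obtain ⟨h, hh⟩ : ∃ h : PowerSeries ℂ, eulerSeries (HahnSeries.ofPowerSeries ℤ ℂ g) =
        HahnSeries.ofPowerSeries ℤ ℂ h :=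
      exists_powerSeries fun n hn => by rw [eulerSeries_coeff, ofPowerSeries_coeff_neg _ hn, mul_zero]
    have h0 : PowerSeries.constantCoeff h = 0 := by
      rw [← ofPowerSeries_coeff_zero, ← hh, eulerSeries_coeff, Int.cast_zero, zero_mul]
    rw [hh, ← map_mul]
    rcases hn.lt_or_eq with hn | rfl
    · exact ofPowerSeries_coeff_neg _ hn
    · rw [ofPowerSeries_coeff_zero, map_mul, h0, mul_zero]
  simp only [Matrix.trace, Matrix.diag_apply, Matrix.mul_apply, HahnSeries.coeff_sum]
  exact Finset.sum_eq_zero fun i _ => Finset.sum_eq_zero fun j _ => key _ _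

/-! ### Invariant sub-bundles near a point -/

section Local

variable {S : SingData} {E : HolConn S} {s : ℕ} {W : ∀ y, Submodule ℂ (E.bdl.fib y)} {x : Sphere}

namespace AdaptedFrame

/-- Invariance puts ∂_x of a column in W, and the identity block reads its coefficients off as
entries in the distinguished rows, hence as sections of 𝒪(*D). -/
theorem exists_connMatrix (A : AdaptedFrame E.bdl s W x)
    (hW : E.toFlat.Invariant fun y => W (pt y)) :
    ∃ N : Fin s → Fin s → ℂ → ℂ, (∀ i j, Coef S.D x (N i j)) ∧
      ∀ᶠ y : Off S.D in near S.D x, ∀ j,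
        E.del (A.col j) y = ∑ i, N i j (coord x y) • A.col i (pt y) := by
  have he := A.isFrame.toFlat
  choose g hg hg' using fun j => (he.isSec_iff _).1
    (E.toFlat.conn.isSec x _ (E.isSec_res (A.isSec_col j)))
  refine ⟨fun i j => g j (A.row i), fun i j => hg j _, ?_⟩
  have h1 : ∀ᶠ y : Off S.D in near S.D x, ∀ j, E.toFlat.bdl.IsSec (E.res (A.col j)) y :=
    eventually_all.2 fun j => isSec_eventually (E.isSec_res (A.isSec_col j))
  filter_upwards [eventually_all.2 hg', h1,
    eventually_near_near (SingData.near_of_near_empty A.col_mem),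
    SingData.near_of_near_empty A.eq_sum_col] with y g1 g2 g3 g4 j
  have g5 : E.del (A.col j) y ∈ W (pt y) := hW y (E.res (A.col j)) (g2 j) (g3.mono fun y' h => h j)
  have g6 : E.del (A.col j) y = ∑ k, g j k (coord x y) • A.frame k (pt y) := g1 j
  rw [g6] at g5 ⊢
  exact g4 _ g5

end AdaptedFrame

theorem mem_subHat_of_smul {M : Flat S} {W : ∀ y, Submodule ℂ (M.bdl.fib y)}
    {m : M.bdl.Hat x} (f : LaurentSeries ℂ) (hm : m ∈ M.subHat W x) : f • m ∈ M.subHat W x := by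
  induction hm using Submodule.span_induction with
  | mem m hm =>
    obtain ⟨g, t, ht, htW, rfl⟩ := hm
    exact Submodule.subset_span ⟨f * g, t, ht, htW, rfl⟩
  | zero => rw [smul_zero]; exact zero_mem _
  | add a b _ _ ha hb => rw [smul_add]; exact add_mem ha hb
  | smul c a _ ha =>
    have : f • c • a = c • f • a := smul_comm f (HahnSeries.C c : LaurentSeries ℂ) a
    rw [this]
    exact Submodule.smul_mem _ _ ha

end Local

theorem sum_diagEntry {ι : Type*} (t : Finset ι) (ξ α : ι → ℂ) :
    ∑ j ∈ t, diagEntry (ξ j) (α j) =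
      -HahnSeries.single (-1) (∑ j ∈ t, ξ j) + HahnSeries.C (∑ j ∈ t, α j) := by
  have h : ∀ j, diagEntry (ξ j) (α j) =
      -(HahnSeries.C (ξ j) * HahnSeries.single (-1) 1) + HahnSeries.C (α j) := fun j => by
    rw [diagEntry, single_eq_C_mul, map_neg, neg_mul]
  simp only [h, Finset.sum_add_distrib, Finset.sum_neg_distrib]
  rw [single_eq_C_mul (-1) (∑ j ∈ t, ξ j), map_sum, map_sum, Finset.sum_mul]

section Local

variable {S : SingData} {E : HolConn S} {s : ℕ} {W : ∀ y, Submodule ℂ (E.bdl.fib y)} {x : Sphere}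

namespace FormalChart

theorem mem_psi_of_euler (χ : FormalChart E x) {ξ α : ℂ} {m : E.toFlat.bdl.Hat x}
    (h : ∀ k, eulerSeries (χ.hat m k) + diagEntry (S.fac x k) (S.expn x k) * χ.hat m k =
      χ.hat m k * diagEntry ξ α) : m ∈ E.toFlat.psi x ξ α := by
  refine (Module.End.mem_maxGenEigenspace _ _ _).2 ⟨1, ?_⟩
  rw [pow_one]
  have h1 : E.toFlat.hatEuler x m = diagEntry ξ α • m := by
    apply χ.hat.injective
    funext k
    rw [χ.hat_euler, h, map_smul, Pi.smul_apply, smul_eq_mul, mul_comm]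
  have h2 : (E.toFlat.hatEuler x + ξ • E.toFlat.bdl.zpow x (-1) - α • 1) m =
      E.toFlat.hatEuler x m + (HahnSeries.C ξ : LaurentSeries ℂ) •
        (HahnSeries.single (-1) (1 : ℂ) : LaurentSeries ℂ) • m -
        (HahnSeries.C α : LaurentSeries ℂ) • m := rfl
  rw [h2, h1, smul_smul, ← single_eq_C_mul, ← add_smul, ← sub_smul, diagEntry]
  have h3 : (HahnSeries.single (-1) (-ξ) + HahnSeries.C α + HahnSeries.single (-1) ξ -
      HahnSeries.C α : LaurentSeries ℂ) = 0 := by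
    rw [single_eq_C_mul, single_eq_C_mul (-1) ξ, map_neg]
    ring
  exact (congrArg (· • m) h3).trans (zero_smul (LaurentSeries ℂ) m)

theorem lead_smul_const (χ : FormalChart E x) (f : LaurentSeries ℂ) (v : E.bdl.fib (pt x)) :
    χ.lead 0 (f • χ.const v) = f.coeff 0 • v := by
  apply χ.fib.injective
  funext k
  rw [fib_lead, map_smul, Pi.smul_apply, smul_eq_mul, hat_const, mul_comm, coeff_C_mul, map_smul,
    Pi.smul_apply, smul_eq_mul, mul_comm]

end FormalChart

theorem AdaptedFrame.hatEuler_col (A : AdaptedFrame E.bdl s W x) {N : Fin s → Fin s → ℂ → ℂ}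
    (hN : ∀ i j, Coef S.D x (N i j)) (hdel : ∀ᶠ y : Off S.D in near S.D x, ∀ j,
      E.del (A.col j) y = ∑ i, N i j (coord x y) • A.col i (pt y)) {g : ℂ → ℂ}
    (hg : Coef S.D x g) (hgy : ∀ y : Off S.D, eulerFactor x y = g (coord x y)) (j : Fin s) :
    E.toFlat.hatEuler x (LocFree.tmul 1 (E.germ (A.col j) (A.isSec_col j))) =
      ∑ i, laurent (fun z => g z * N i j z) •
        LocFree.tmul 1 (E.germ (A.col i) (A.isSec_col i)) := by
  have h1 : ∀ᶠ y : Off S.D in near S.D x, E.toFlat.eulerField x (E.res (A.col j)) y =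
      ∑ i, (fun z => g z * N i j z) (coord x y) • E.res (A.col i) y := by
    filter_upwards [hdel] with y hy
    have h2 : E.toFlat.eulerField x (E.res (A.col j)) y =
        eulerFactor x y • E.del (A.col j) y := rfl
    rw [h2, hy j, hgy y]
    have h3 : g (coord x y) • ∑ i, N i j (coord x y) • A.col i (pt y) =
        ∑ i, (g (coord x y) * N i j (coord x y)) • A.col i (pt y) := by
      rw [Finset.smul_sum]
      simp only [smul_smul]
    exact h3
  have h2 := tmul_germ_eq_sum (E.toFlat.isSec_eulerField (E.isSec_res (A.isSec_col j)))
    (fun i => E.isSec_res (A.isSec_col i)) (fun i => hg.1.mul (hN i j).1) h1 1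
  rw [E.germ_eq_res, Flat.hatEuler_tmul, eulerSeries_one, tmul_zero_left, zero_add, h2]
  simp only [one_mul]
  rfl

/-- Near a singular point, an invariant sub-bundle has a formal frame of eigenvectors. -/
theorem exists_localBasis (hx : x ∈ S.D) (hR : NonResonant (S.fac x) (S.expn x))
    (χ : FormalChart E x) (A : AdaptedFrame E.bdl s W x) {N : Fin s → Fin s → ℂ → ℂ}
    (hN : ∀ i j, Coef S.D x (N i j)) (hdel : ∀ᶠ y : Off S.D in near S.D x, ∀ j,
      E.del (A.col j) y = ∑ i, N i j (coord x y) • A.col i (pt y)) :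
    ∃ (J : Fin s → Fin S.r) (b : Fin s → E.bdl.fib (pt x)),
      (∀ j, b j ∈ E.eigen x (S.fac x (J j)) (S.expn x (J j))) ∧ LinearIndependent ℂ b ∧
      Submodule.span ℂ (Set.range b) = W (pt x) ∧
      (∀ j, χ.const (b j) ∈ E.toFlat.subHat (fun y => W (pt y)) x) ∧
      (∀ m ∈ E.toFlat.subHat (fun y => W (pt y)) x, ∃ c : Fin s → LaurentSeries ℂ,
        m = ∑ j, c j • χ.const (b j)) ∧
      ∃ h, AnalyticAt ℂ h 0 ∧ ∀ᶠ y : Off S.D in near S.D x,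
        eulerFactor x y * ∑ j, N j j (coord x y) =
          -(∑ j, S.fac x (J j)) * (coord x y)⁻¹ + ∑ j, S.expn x (J j) +
            coord x y * h (coord x y) := by
  obtain ⟨g, hg, hgy⟩ := Flat.coef_eulerFactor (S := S) x
  let v : Fin s → E.toFlat.bdl.Hat x := fun j =>
    LocFree.tmul 1 (E.germ (A.col j) (A.isSec_col j))
  let ν : Matrix (Fin s) (Fin s) (LaurentSeries ℂ) :=
    Matrix.of fun i j => laurent (fun z => g z * N i j z)
  have hv : ∀ j, E.toFlat.hatEuler x (v j) = ∑ i, ν i j • v i :=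
    fun j => A.hatEuler_col hN hdel hg hgy j
  choose f hf using fun (k : Fin S.r) (j : Fin s) =>
    exists_powerSeries (χ.coeff_neg (A.col j) (A.isSec_col j) k)
  let f' : Matrix (Fin S.r) (Fin s) (PowerSeries ℂ) := Matrix.of f
  let V : Matrix (Fin S.r) (Fin s) (LaurentSeries ℂ) := laurentMatrix f'
  have hVv : ∀ k j, χ.hat (v j) k = V k j := fun k j => hf k j
  have hV : V.map eulerSeries + Matrix.diagonal (fun k => diagEntry (S.fac x k) (S.expn x k)) * V =
      V * ν := by
    ext k j : 1
    rw [Matrix.add_apply, Matrix.map_apply, Matrix.diagonal_mul, Matrix.mul_apply]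
    have h1 := congrFun (congrArg χ.hat (hv j)) k
    rw [χ.hat_euler, map_sum, Finset.sum_apply] at h1
    simp only [map_smul, Pi.smul_apply, smul_eq_mul, hVv] at h1
    rw [h1]
    exact Finset.sum_congr rfl fun i _ => mul_comm _ _
  have hcol0 := (eventually_near_empty_iff.1 (A.linearIndependent_col.and A.span_col)).self_of_nhds
  have hf0 : ∀ k j, PowerSeries.constantCoeff (f k j) = χ.fib (A.col j (pt x)) k := by
    intro k j
    rw [← ofPowerSeries_coeff_zero, ← hf, χ.coeff_zero]
  -- The columns are independent at x, so some maximal minor of their constant terms is non-zero;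
  -- this minor of formal coordinates is then invertible over power series.
  obtain ⟨J, hJ⟩ := exists_det_rows_ne_zero
    (A := Matrix.of fun k j => PowerSeries.constantCoeff (f k j)) (by
      have h1 : (Matrix.of fun k j => PowerSeries.constantCoeff (f k j)).col =
          fun j => χ.fib (A.col j (pt x)) := by
        funext j k
        exact hf0 k j
      rw [h1]
      exact hcol0.1.map' χ.fib.toLinearMap χ.fib.ker)
  obtain ⟨T', hT', hT''⟩ := powerSeries_matrix_inv (T := f'.submatrix J id) hJ
  have hTl : V.submatrix J id * laurentMatrix T' = 1 := by
    rw [← laurentMatrix_one, ← hT', laurentMatrix_mul]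
    rfl
  have hTl' : laurentMatrix T' * V.submatrix J id = 1 := by
    rw [← laurentMatrix_one, ← hT'', laurentMatrix_mul]
    rfl
  have hw := euler_normalised hV hTl hTl'
  -- By `euler_normalised` the columns of w are formal eigenvectors with the exponents of the rows
  -- J. Non-resonance makes their coordinates constant, so they are determined by their values at x,
  -- which span W_x.
  set w := V * laurentMatrix T' with hwdef
  have hwV : w * V.submatrix J id = V := by
    rw [hwdef, Matrix.mul_assoc, hTl', Matrix.mul_one]
  let m : Fin s → E.toFlat.bdl.Hat x := fun j => χ.hat.symm fun k => w k j
  have hm : ∀ j k, χ.hat (m j) k = w k j := fun j k => by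
    change χ.hat (χ.hat.symm _) k = _
    rw [LinearEquiv.apply_symm_apply]
  have hmpsi : ∀ j, m j ∈ E.toFlat.psi x (S.fac x (J j)) (S.expn x (J j)) := by
    intro j
    refine χ.mem_psi_of_euler fun k => ?_
    have h1 := congrFun (congrFun hw k) j
    rw [Matrix.add_apply, Matrix.map_apply, Matrix.diagonal_mul, Matrix.mul_diagonal] at h1
    rw [hm]
    exact h1
  have hmb : ∀ j, χ.const (χ.lead 0 (m j)) = m j := fun j => χ.const_lead hR (hmpsi j)
  have hvm : ∀ j, v j = ∑ i, V (J i) j • m i := by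
    intro j
    apply χ.hat.injective
    funext k
    rw [hVv, map_sum, Finset.sum_apply, ← hwV, Matrix.mul_apply]
    refine Finset.sum_congr rfl fun i _ => ?_
    rw [map_smul, Pi.smul_apply, smul_eq_mul, hm, hwV]
    exact mul_comm _ _
  have hmv : ∀ i, m i = ∑ j, laurentMatrix T' j i • v j := by
    intro i
    apply χ.hat.injective
    funext k
    rw [hm, map_sum, Finset.sum_apply, hwdef, Matrix.mul_apply]
    refine Finset.sum_congr rfl fun j _ => ?_
    rw [map_smul, Pi.smul_apply, smul_eq_mul, hVv]
    exact mul_comm _ _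
  have hcolb : ∀ j, A.col j (pt x) = ∑ i, (V (J i) j).coeff 0 • χ.lead 0 (m i) := by
    intro j
    rw [← χ.lead_germ (A.isSec_col j)]
    change χ.lead 0 (v j) = _
    rw [hvm, map_sum]
    refine Finset.sum_congr rfl fun i _ => ?_
    rw [← hmb i, χ.lead_smul_const, hmb i]
  have hspan : Submodule.span ℂ (Set.range fun j => χ.lead 0 (m j)) = W (pt x) := by
    rw [← hcol0.2]
    exact span_eq_of_eq_sum (B := fun i j => (V (J i) j).coeff 0) hcol0.1 hcolb
  have hvU : ∀ j, v j ∈ E.toFlat.subHat (fun y => W (pt y)) x := fun j =>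
    Submodule.subset_span ⟨1, E.res (A.col j), E.isSec_res (A.isSec_col j),
      (SingData.near_of_near_empty A.col_mem).mono fun y hy => hy j, rfl⟩
  refine ⟨J, fun j => χ.lead 0 (m j), fun j => χ.lead_mem_eigen (hmpsi j), ?_, hspan, ?_, ?_, ?_⟩
  · rw [linearIndependent_iff_card_eq_finrank_span, Set.finrank, hspan, ← hcol0.2,
      finrank_span_eq_card hcol0.1]
  · intro j
    rw [hmb, hmv]
    exact sum_mem fun i _ => mem_subHat_of_smul _ (hvU i)
  · intro u hu
    simp only [hmb]
    induction hu using Submodule.span_induction with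
    | mem u hu =>
      obtain ⟨q, t, ht, htW, rfl⟩ := hu
      obtain ⟨c, hc, hc'⟩ := (A.isFrame.toFlat.isSec_iff t).1 ht
      have h1 : ∀ᶠ y : Off S.D in near S.D x, t y =
          ∑ j, c (A.row j) (coord x y) • E.res (A.col j) y := by
        filter_upwards [hc', htW, SingData.near_of_near_empty A.eq_sum_col] with y g1 g2 g3
        have g4 : (t y : E.bdl.fib (pt y)) = ∑ k, c k (coord x y) • A.frame k (pt y) := g1
        refine g4.trans (g3 _ ?_)
        rw [← g4]
        exact g2
      have h2 := tmul_germ_eq_sum ht (fun j => E.isSec_res (A.isSec_col j))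
        (fun j => (hc (A.row j)).1) h1 q
      refine ⟨fun i => ∑ j, (q * laurent (c (A.row j))) * V (J i) j, h2.trans ?_⟩
      have h3 : ∀ j, LocFree.tmul 1 (LocFree.germ (E.res (A.col j))
          (E.isSec_res (A.isSec_col j))) = ∑ i, V (J i) j • m i := hvm
      simp only [h3, Finset.smul_sum, Finset.sum_smul, smul_smul]
      exact Finset.sum_comm
    | zero => exact ⟨0, (Finset.sum_eq_zero fun j _ =>
        zero_smul (LaurentSeries ℂ) (m j)).symm⟩
    | add a b _ _ ha hb =>
      obtain ⟨c, rfl⟩ := ha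
      obtain ⟨d, rfl⟩ := hb
      exact ⟨c + d, by simp only [Pi.add_apply, add_smul, Finset.sum_add_distrib]⟩
    | smul a u _ hu =>
      obtain ⟨c, rfl⟩ := hu
      refine ⟨fun j => HahnSeries.C a * c j, ?_⟩
      rw [hat_C_smul, Finset.smul_sum]
      simp only [smul_smul]
  -- The trace of z∂_z on W is the sum of the -ξ_j/z + α_j over the rows J, up to terms of positive
  -- degree.
  · have htr := trace_euler hV hTl hTl'
    have hNm : ∀ i j, MeromorphicAt (fun z => g z * N i j z) 0 := fun i j => hg.1.mul (hN i j).1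
    have hτ : MeromorphicAt (fun z => ∑ j, g z * N j j z) 0 := meromorphicAt_sum _ fun j _ => hNm j j
    have hm1 : MeromorphicAt (fun z : ℂ => (∑ j, S.fac x (J j)) * z⁻¹ + -∑ j, S.expn x (J j)) 0 :=
      (meromorphicAt_const_mul_inv _).add (MeromorphicAt.const _ _)
    have hl : laurent (fun z => (∑ j, g z * N j j z) +
        ((∑ j, S.fac x (J j)) * z⁻¹ + -∑ j, S.expn x (J j))) =
        (laurentMatrix T' * (V.submatrix J id).map eulerSeries).trace := by
      rw [laurent_add hτ hm1, laurent_sum _ fun j _ => hNm j j,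
        laurent_add (meromorphicAt_const_mul_inv _) (MeromorphicAt.const _ _),
        laurent_const_mul_inv, laurent_const]
      have h1 : ∑ j, laurent (fun z => g z * N j j z) = ν.trace := rfl
      rw [h1, htr]
      rw [sum_diagEntry, map_neg]
      ring
    have hq : MeromorphicAt (fun z => (∑ j, g z * N j j z) +
        ((∑ j, S.fac x (J j)) * z⁻¹ + -∑ j, S.expn x (J j))) 0 := hτ.add hm1
    -- The remainder has no coefficient in degree ≤ 0, so it stays regular after division by z.
    obtain ⟨B, hB⟩ := exists_hol_of_laurent (g := fun z => z⁻¹ * ((∑ j, g z * N j j z) +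
        ((∑ j, S.fac x (J j)) * z⁻¹ + -∑ j, S.expn x (J j))))
      (meromorphicAt_inv.mul hq) (by
        intro n hn
        rw [laurent_mul meromorphicAt_inv hq, hl, laurent_inv_id, single_mul_coeff]
        exact trace_mul_euler_coeff T' (f'.submatrix J id) (by omega))
    refine ⟨B, B.analyticAt, ?_⟩
    filter_upwards [(SingData.eventually_near_coord_iff hx).2 hB, near_coord_ne hx] with y h1 h2
    rw [← h1, hgy y, Finset.mul_sum]
    field_simp
    ring

end Local

/-! ### The derivative of a determinant -/

/-- Jacobi's formula: the determinant is multilinear in the rows, and a determinant with one row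
replaced is a Cramer expression in the adjugate. -/
theorem hasDerivAt_det {s : ℕ} {C : ℂ → Matrix (Fin s) (Fin s) ℂ} {C' : Matrix (Fin s) (Fin s) ℂ}
    {z : ℂ} (h : ∀ i j, HasDerivAt (fun z => C z i j) (C' i j) z) :
    HasDerivAt (fun z => (C z).det) (C' * (C z).adjugate).trace z := by
  let f : ContinuousMultilinearMap ℂ (fun _ : Fin s => Fin s → ℂ) ℂ :=
    { (Matrix.detRowAlternating (R := ℂ) (n := Fin s)).toMultilinearMap with
      cont := Continuous.matrix_det (A := fun M : Matrix (Fin s) (Fin s) ℂ => M) continuous_id }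
  have h1 : HasDerivAt (fun z i => C z i) (fun i => C' i) z :=
    hasDerivAt_pi.2 fun i => hasDerivAt_pi.2 fun j => h i j
  have h2 := (f.hasFDerivAt (x := fun i => C z i)).comp_hasDerivAt z h1
  refine HasDerivAt.congr_deriv (f := fun z => (C z).det) h2 ?_
  symm
  rw [ContinuousMultilinearMap.linearDeriv_apply, Matrix.trace]
  refine Finset.sum_congr rfl fun i _ => ?_
  have h3 : f (Function.update (fun i => C z i) i (C' i)) = ((C z).updateRow i (C' i)).det := rfl
  rw [h3, ← Matrix.cramer_transpose_apply, Matrix.cramer_eq_adjugate_mulVec,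
    ← Matrix.adjugate_transpose, Matrix.diag_apply, Matrix.mul_apply]
  exact Finset.sum_congr rfl fun j _ => mul_comm _ _

/-- The matrix C B - A C is the derivative of a transition matrix C between two frames with
connection matrices B and A. With Jacobi's formula, det C then satisfies an equation of rank one. -/
theorem trace_mul_adjugate {s : ℕ} (C A B : Matrix (Fin s) (Fin s) ℂ) :
    ((C * B - A * C) * C.adjugate).trace = (B.trace - A.trace) * C.det := by
  rw [Matrix.sub_mul, Matrix.trace_sub, Matrix.mul_assoc A, Matrix.mul_adjugate,
    Matrix.trace_mul_comm (C * B), ← Matrix.mul_assoc, Matrix.adjugate_mul]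
  simp only [Matrix.smul_mul, Matrix.one_mul, Matrix.mul_smul, Matrix.mul_one, Matrix.trace_smul,
    smul_eq_mul]
  ring

/-! ### Linear differential equations of rank one -/

theorem exists_primitive {q : ℂ → ℂ} {a : ℂ} (hq : AnalyticAt ℂ q a) :
    ∃ H : ℂ → ℂ, AnalyticAt ℂ H a ∧ ∀ᶠ z in 𝓝 a, HasDerivAt H (q z) z := by
  obtain ⟨ε, hε, h⟩ := Metric.eventually_nhds_iff_ball.1 hq.eventually_analyticAt
  obtain ⟨H, hH⟩ := DifferentiableOn.isExactOn_ball (f := q) (c := a) (r := ε)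
    fun z hz => (h z hz).differentiableAt.differentiableWithinAt
  refine ⟨H, ?_, Filter.mem_of_superset (Metric.ball_mem_nhds a hε) hH⟩
  exact DifferentiableOn.analyticAt
    (fun z hz => (hH z hz).differentiableAt.differentiableWithinAt) (Metric.ball_mem_nhds a hε)

theorem exists_nonvanishing_solution {q : ℂ → ℂ} {a : ℂ} (hq : AnalyticAt ℂ q a) :
    ∃ k : ℂ → ℂ, AnalyticAt ℂ k a ∧ (∀ z, k z ≠ 0) ∧
      ∀ᶠ z in 𝓝 a, HasDerivAt k (q z * k z) z := by
  obtain ⟨H, hH, hH'⟩ := exists_primitive hq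
  refine ⟨fun z => Complex.exp (H z), hH.cexp, fun z => Complex.exp_ne_zero _, ?_⟩
  filter_upwards [hH'] with z hz
  rw [mul_comm]
  exact hz.cexp

/-- A single-valued solution of an equation with a regular singularity has an integral exponent. -/
theorem order_of_regular_singular {k k' h : ℂ → ℂ} {ν : ℂ} (hh : AnalyticAt ℂ h 0)
    (hk : ∀ᶠ z in 𝓝[≠] (0 : ℂ), HasDerivAt k (k' z) z ∧ k z ≠ 0 ∧
      z * k' z = (ν + z * h z) * k z) :
    ∃ n : ℤ, ν = n ∧ MeromorphicAt k 0 ∧ meromorphicOrderAt k 0 = (n : WithTop ℤ) := by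
  obtain ⟨H, hH, hH'⟩ := exists_primitive hh
  -- Multiplication by exp(-H), with H a primitive of h, removes the holomorphic part and leaves zK'
  -- = νK.
  have hall : ∀ᶠ z in 𝓝[≠] (0 : ℂ),
      HasDerivAt (fun z => k z * Complex.exp (-H z)) (ν / z * (k z * Complex.exp (-H z))) z ∧
      k z ≠ 0 := by
    filter_upwards [hk, hH'.filter_mono nhdsWithin_le_nhds, self_mem_nhdsWithin] with z h1 h2 h3
    have h3 : z ≠ 0 := h3
    refine ⟨?_, h1.2.1⟩
    refine (h1.1.fun_mul h2.fun_neg.cexp).congr_deriv ?_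
    have h5 : k' z = (ν + z * h z) * k z / z := by
      rw [eq_div_iff h3, mul_comm, h1.2.2]
    rw [h5]
    field_simp
    ring
  obtain ⟨ε, hε, hball⟩ := Metric.mem_nhdsWithin_iff.1 hall
  set K : ℂ → ℂ := fun z => k z * Complex.exp (-H z) with hK
  have hexp : ∀ w : ℂ, w.re < Real.log ε → Complex.exp w ∈ Metric.ball (0 : ℂ) ε ∩ {0}ᶜ := by
    intro w hw
    refine ⟨?_, Complex.exp_ne_zero w⟩
    rw [Metric.mem_ball, dist_zero_right, Complex.norm_exp]
    exact (Real.lt_log_iff_exp_lt hε).1 hw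
  -- The equation is pulled back by the exponential map to a left half-plane, where z^{-ν} becomes
  -- the single-valued function exp(-νw). The function φ has derivative zero and is constant.
  let φ : ℂ → ℂ := fun w => K (Complex.exp w) * Complex.exp (-(ν * w))
  have hφ : ∀ w : ℂ, w.re < Real.log ε → HasDerivAt φ 0 w := by
    intro w hw
    have h1 := (hball (hexp w hw)).1
    have h2 := h1.comp w (Complex.hasDerivAt_exp w)
    have h3 : HasDerivAt (fun w => -(ν * w)) (-(ν * 1)) w :=
      ((hasDerivAt_id w).const_mul ν).fun_neg
    refine (h2.fun_mul h3.cexp).congr_deriv ?_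
    have := Complex.exp_ne_zero w
    simp only [Function.comp]
    field_simp
    ring
  have hconv : Convex ℝ {w : ℂ | w.re < Real.log ε} := convex_halfSpace_re_lt _
  have hopen : IsOpen {w : ℂ | w.re < Real.log ε} := isOpen_lt Complex.continuous_re continuous_const
  have hconst : ∀ w w' : ℂ, w.re < Real.log ε → w'.re < Real.log ε → φ w = φ w' := by
    intro w w' hw hw'
    exact hopen.is_const_of_deriv_eq_zero hconv.isPreconnected
      (fun u hu => (hφ u hu).differentiableAt.differentiableWithinAt)
      (fun u hu => (hφ u hu).deriv) hw hw'
  let w₀ : ℂ := ((Real.log ε - 1 : ℝ) : ℂ)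
  have hw₀ : w₀.re < Real.log ε := by
    change Real.log ε - 1 < Real.log ε
    linarith
  have hc : φ w₀ ≠ 0 := mul_ne_zero (mul_ne_zero (hball (hexp w₀ hw₀)).2 (Complex.exp_ne_zero _))
    (Complex.exp_ne_zero _)
  -- K(exp w) is 2πi-periodic and φ is a non-zero constant, so exp(-2πiν) = 1.
  have hint : ∃ n : ℤ, ν = n := by
    have h1 : φ (w₀ + 2 * Real.pi * Complex.I) = φ w₀ := by
      refine hconst _ _ ?_ hw₀
      simpa using hw₀
    have h2 : Complex.exp (w₀ + 2 * Real.pi * Complex.I) = Complex.exp w₀ :=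
      Complex.exp_periodic w₀
    have h3 : Complex.exp (-(ν * (w₀ + 2 * Real.pi * Complex.I))) =
        Complex.exp (-(ν * w₀)) * Complex.exp (-(ν * (2 * Real.pi * Complex.I))) := by
      rw [← Complex.exp_add]
      congr 1
      ring
    change K (Complex.exp (w₀ + 2 * Real.pi * Complex.I)) * _ = _ at h1
    rw [h2, h3, ← mul_assoc] at h1
    have h4 : Complex.exp (-(ν * (2 * Real.pi * Complex.I))) = 1 := mul_left_cancel₀ hc (by
      rw [mul_one]; exact h1)
    obtain ⟨n, hn⟩ := Complex.exp_eq_one_iff.1 h4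
    refine ⟨-n, ?_⟩
    have h5 : (2 * Real.pi * Complex.I : ℂ) ≠ 0 := by simp [Real.pi_ne_zero]
    apply mul_right_cancel₀ h5
    push_cast
    linear_combination -hn
  obtain ⟨n, rfl⟩ := hint
  have hkz : ∀ z ∈ Metric.ball (0 : ℂ) ε ∩ {0}ᶜ,
      k z = (z - 0) ^ n • (φ w₀ * Complex.exp (H z)) := by
    rintro z ⟨hz, hz0⟩
    have hz0 : z ≠ 0 := hz0
    have h1 : (Complex.log z).re < Real.log ε := by
      rw [Complex.log_re]
      exact Real.log_lt_log (norm_pos_iff.2 hz0) (by simpa using hz)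
    have h2 := hconst _ _ h1 hw₀
    have h3 : φ (Complex.log z) = k z * Complex.exp (-H z) * (z ^ n)⁻¹ := by
      change K (Complex.exp (Complex.log z)) * _ = _
      rw [Complex.exp_log hz0, Complex.exp_neg, Complex.exp_int_mul, Complex.exp_log hz0]
    rw [← h2, h3, sub_zero, smul_eq_mul, Complex.exp_neg]
    have := zpow_ne_zero n hz0
    have := Complex.exp_ne_zero (H z)
    field_simp
  have hev : ∀ᶠ z in 𝓝[≠] (0 : ℂ), k z = (z - 0) ^ n • (φ w₀ * Complex.exp (H z)) := by
    refine Filter.mem_of_superset (Metric.mem_nhdsWithin_iff.2 ⟨ε, hε, ?_⟩)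
      (fun z (hz : z ∈ Metric.ball (0 : ℂ) ε ∩ {0}ᶜ) => hkz z hz)
    exact subset_rfl
  have hg : AnalyticAt ℂ (fun z => φ w₀ * Complex.exp (H z)) 0 := analyticAt_const.mul hH.cexp
  have hmero : MeromorphicAt k 0 := by
    refine MeromorphicAt.congr (f := fun z => (z - 0) ^ n • (φ w₀ * Complex.exp (H z))) ?_
      (hev.mono fun z hz => hz.symm)
    exact (((MeromorphicAt.id 0).sub (MeromorphicAt.const 0 0)).zpow n).smul hg.meromorphicAt
  exact ⟨n, rfl, hmero, (meromorphicOrderAt_eq_int_iff hmero).2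
    ⟨_, hg, mul_ne_zero hc (Complex.exp_ne_zero _), hev⟩⟩

/-! ### Gluing local solutions over the plane -/

/-- On the set `s`, the function `U` is a non-vanishing locally constant multiple of the functions
`u a`, which are given on the balls of radius `r a`. -/
def IsLocalMultiple (r : ℂ → ℝ) (u : ℂ → ℂ → ℂ) (s : Set ℂ) (U : ℂ → ℂ) : Prop :=
  ∀ x ∈ s, U x ≠ 0 ∧ ∀ a, x ∈ Metric.ball a (r a) → ∀ᶠ y in 𝓝 x, U y * u a x = U x * u a y

namespace IsLocalMultiple

variable {r : ℂ → ℝ} {u : ℂ → ℂ → ℂ} {s t : Set ℂ} {U V : ℂ → ℂ}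

theorem mono (h : IsLocalMultiple r u s U) (hst : t ⊆ s) : IsLocalMultiple r u t U :=
  fun x hx => h x (hst hx)

theorem const_mul (h : IsLocalMultiple r u s U) {c : ℂ} (hc : c ≠ 0) :
    IsLocalMultiple r u s fun x => c * U x := by
  refine fun x hx => ⟨mul_ne_zero hc (h x hx).1, fun a ha => ?_⟩
  filter_upwards [(h x hx).2 a ha] with y hy
  rw [mul_assoc, hy, mul_assoc]

theorem congr_at {x : ℂ} (h : IsLocalMultiple r u {x} U) (hUV : V =ᶠ[𝓝 x] U) :
    IsLocalMultiple r u {x} V := by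
  rintro _ rfl
  obtain ⟨h1, h2⟩ := h _ rfl
  have h3 := hUV.eq_of_nhds
  refine ⟨h3 ▸ h1, fun a ha => ?_⟩
  filter_upwards [h2 a ha, hUV] with y h4 h5
  rw [h5, h4, h3]

theorem at_iff : IsLocalMultiple r u s U ↔ ∀ x ∈ s, IsLocalMultiple r u {x} U :=
  ⟨fun h x hx => h.mono (Set.singleton_subset_iff.2 hx), fun h x hx => h x hx x rfl⟩

/-- Both functions are locally constant multiples of the same local solution, so their quotient is
locally constant, and it is constant on a connected open set. -/
theorem eqOn (hr : ∀ a, 0 < r a) (hs : IsOpen s) (hs' : IsPreconnected s)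
    (hu : ∀ a, u a a ≠ 0)
    (hU : IsLocalMultiple r u s U) (hV : IsLocalMultiple r u s V) {x₀ : ℂ} (hx₀ : x₀ ∈ s)
    (h₀ : U x₀ = V x₀) : Set.EqOn U V s := by
  have hd : ∀ x ∈ s, HasDerivAt (fun y => U y / V y) 0 x := by
    intro x hx
    have h1 : (fun y => U y / V y) =ᶠ[𝓝 x] fun _ => U x / V x := by
      filter_upwards [(hU x hx).2 x (Metric.mem_ball_self (hr x)),
        (hV x hx).2 x (Metric.mem_ball_self (hr x)), hs.mem_nhds hx] with y h1 h2 h3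
      rw [div_eq_div_iff (hV y h3).1 (hV x hx).1]
      apply mul_right_cancel₀ (hu x)
      linear_combination V x * h1 - U x * h2
    exact (hasDerivAt_const x _).congr_of_eventuallyEq h1
  intro x hx
  have h1 : U x / V x = U x₀ / V x₀ := hs.is_const_of_deriv_eq_zero hs'
    (fun y hy => (hd y hy).differentiableAt.differentiableWithinAt)
    (fun y hy => (hd y hy).deriv) hx hx₀
  rw [h₀, div_self (hV x₀ hx₀).1] at h1
  exact (div_eq_one_iff_eq (hV x hx).1).1 h1

/-- The circle of radius `ρ`: the radial projection is closer than the excess of the norm. -/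
theorem norm_sub_radial {ρ : ℝ} (hρ : 0 < ρ) {x : ℂ} (hx : ρ ≤ ‖x‖) :
    ‖((ρ / ‖x‖ : ℝ) : ℂ) * x‖ = ρ ∧ ‖x - ((ρ / ‖x‖ : ℝ) : ℂ) * x‖ = ‖x‖ - ρ := by
  have hx0 : 0 < ‖x‖ := hρ.trans_le hx
  constructor
  · rw [norm_mul, Complex.norm_real, Real.norm_of_nonneg (by positivity)]
    field_simp
  · have : x - ((ρ / ‖x‖ : ℝ) : ℂ) * x = ((1 - ρ / ‖x‖ : ℝ) : ℂ) * x := by push_cast; ring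
    rw [this, norm_mul, Complex.norm_real, Real.norm_of_nonneg]
    · field_simp
    · rw [sub_nonneg, div_le_one hx0]
      exact hx

/-- At each c on the circle of radius ρ, a local solution on the ball of radius δ is scaled to agree
with U inside the disc. A point x beyond the disc uses the solution belonging to its radial
projection. The margin δ/2 ensures that solutions used near the same point belong to overlapping
balls, and these agree because they agree with U at a common point. -/
theorem extend (hr : ∀ a, 0 < r a) (hu : ∀ a x, x ∈ Metric.ball a (r a) → u a x ≠ 0)
    (huu : ∀ a b x, x ∈ Metric.ball a (r a) → x ∈ Metric.ball b (r b) →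
      ∀ᶠ y in 𝓝 x, u a y * u b x = u a x * u b y) {ρ δ : ℝ} (hρ : 0 < ρ) (hδ : 0 < δ)
    (hδ' : ∀ c : ℂ, ‖c‖ = ρ → ∃ a, Metric.ball c δ ⊆ Metric.ball a (r a))
    (hU : IsLocalMultiple r u (Metric.ball 0 ρ) U) :
    ∃ V, IsLocalMultiple r u (Metric.ball 0 (ρ + δ / 2)) V := by
  have hu' : ∀ a, u a a ≠ 0 := fun a => hu a a (Metric.mem_ball_self (hr a))
  have hua : ∀ a, IsLocalMultiple r u (Metric.ball a (r a)) (u a) :=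
    fun a x hx => ⟨hu a x hx, fun b hb => huu a b x hx hb⟩
  have hloc : ∀ c : ℂ, ∃ V, ‖c‖ = ρ → IsLocalMultiple r u (Metric.ball c δ) V ∧
      Set.EqOn V U (Metric.ball c δ ∩ Metric.ball 0 ρ) := by
    intro c
    by_cases hc : ‖c‖ = ρ
    · obtain ⟨a, ha⟩ := hδ' c hc
      have hne : (Metric.ball c δ ∩ Metric.ball 0 ρ).Nonempty := by
        have h1 : c ∈ closure (Metric.ball (0 : ℂ) ρ) := by
          rw [closure_ball _ hρ.ne']
          simp [hc]
        exact mem_closure_iff_nhds.1 h1 _ (Metric.ball_mem_nhds c hδ)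
      obtain ⟨m, hm1, hm2⟩ := hne
      have hc' : U m / u a m ≠ 0 := div_ne_zero (hU m hm2).1 (hu a m (ha hm1))
      refine ⟨fun x => U m / u a m * u a x, fun _ => ?_⟩
      have h2 := ((hua a).mono ha).const_mul hc'
      refine ⟨h2, eqOn hr (Metric.isOpen_ball.inter Metric.isOpen_ball)
        ((convex_ball c δ).inter (convex_ball 0 ρ)).isPreconnected hu'
        (h2.mono Set.inter_subset_left) (hU.mono Set.inter_subset_right) ⟨hm1, hm2⟩ ?_⟩
      exact div_mul_cancel₀ _ (hu a m (ha hm1))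
    · exact ⟨0, fun h => (hc h).elim⟩
  choose V hV using hloc
  have hVV : ∀ c c' : ℂ, ‖c‖ = ρ → ‖c'‖ = ρ → ∀ y ∈ Metric.ball c (δ / 2),
      y ∈ Metric.ball c' (δ / 2) → V c y = V c' y := by
    intro c c' hc hc' y hy hy'
    by_cases hcc : c = c'
    · rw [hcc]
    have hd : dist c c' < δ := by
      calc dist c c' ≤ dist y c + dist y c' := dist_triangle_left _ _ _
        _ < δ / 2 + δ / 2 := add_lt_add hy hy'
        _ = δ := by ring
    -- Strict convexity of the norm puts the midpoint of two distinct points of the circle inside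
    -- the open disc, where both solutions equal U.
    have hm0 : midpoint ℝ c c' ∈ Metric.ball (0 : ℂ) ρ := by
      rw [mem_ball_zero_iff, midpoint_eq_smul_add, norm_smul]
      have h1 := (norm_add_lt_of_not_sameRay (x := c) (y := c')
        (by rwa [not_sameRay_iff_of_norm_eq (hc.trans hc'.symm)]))
      rw [hc, hc'] at h1
      norm_num
      linarith
    have hm1 : midpoint ℝ c c' ∈ Metric.ball c δ := by
      rw [Metric.mem_ball, dist_midpoint_left]
      norm_num
      linarith
    have hm2 : midpoint ℝ c c' ∈ Metric.ball c' δ := by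
      rw [Metric.mem_ball, dist_midpoint_right]
      norm_num
      linarith
    refine eqOn hr (Metric.isOpen_ball.inter Metric.isOpen_ball)
        ((convex_ball c δ).inter (convex_ball c' δ)).isPreconnected hu'
        ((hV c hc).1.mono Set.inter_subset_left) ((hV c' hc').1.mono Set.inter_subset_right)
        (x₀ := midpoint ℝ c c') ⟨hm1, hm2⟩ ?_ ⟨?_, ?_⟩
    · rw [(hV c hc).2 ⟨hm1, hm0⟩, (hV c' hc').2 ⟨hm2, hm0⟩]
    · exact Metric.ball_subset_ball (by linarith) hy
    · exact Metric.ball_subset_ball (by linarith) hy'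
  let pr : ℂ → ℂ := fun x => ((ρ / ‖x‖ : ℝ) : ℂ) * x
  have hpr : ∀ x : ℂ, ρ ≤ ‖x‖ → ‖x‖ < ρ + δ / 2 → ‖pr x‖ = ρ ∧ x ∈ Metric.ball (pr x) (δ / 2) := by
    intro x h1 h2
    refine ⟨(norm_sub_radial hρ h1).1, ?_⟩
    rw [mem_ball_iff_norm, (norm_sub_radial hρ h1).2]
    linarith
  refine ⟨fun x => if ‖x‖ < ρ then U x else V (pr x) x, at_iff.2 fun x hx => ?_⟩
  rw [mem_ball_zero_iff] at hx
  by_cases hxρ : ‖x‖ < ρ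
  · refine (at_iff.1 hU x (by simpa using hxρ)).congr_at ?_
    filter_upwards [continuous_norm.continuousAt.eventually_lt_const hxρ] with y hy
    exact if_pos hy
  · obtain ⟨h1, h2⟩ := hpr x (not_lt.1 hxρ) hx
    have h3 : x ∈ Metric.ball (pr x) δ := Metric.ball_subset_ball (by linarith) h2
    refine (at_iff.1 (hV _ h1).1 x h3).congr_at ?_
    filter_upwards [continuous_norm.continuousAt.eventually_lt_const hx,
      Metric.isOpen_ball.mem_nhds h2] with y hy1 hy2
    split_ifs with hy3
    · exact ((hV _ h1).2 ⟨Metric.ball_subset_ball (by linarith) hy2, by simpa using hy3⟩).symm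
    · obtain ⟨h4, h5⟩ := hpr y (not_lt.1 hy3) hy1
      exact hVV _ _ h4 h1 y h5 hy2

/-- Local solutions that agree up to locally constant factors glue to a global one. -/
theorem exists_univ (hr : ∀ a, 0 < r a) (hu : ∀ a x, x ∈ Metric.ball a (r a) → u a x ≠ 0)
    (huu : ∀ a b x, x ∈ Metric.ball a (r a) → x ∈ Metric.ball b (r b) →
      ∀ᶠ y in 𝓝 x, u a y * u b x = u a x * u b y) :
    ∃ U, IsLocalMultiple r u Set.univ U := by
  have hu' : ∀ a, u a a ≠ 0 := fun a => hu a a (Metric.mem_ball_self (hr a))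
  have hgood : ∀ R : ℝ, 0 < R → ∃ U, IsLocalMultiple r u (Metric.ball 0 R) U := by
    intro R hR
    -- A Lebesgue number of the cover of the closed disc of radius R gives one δ for all circles in
    -- it, so finitely many extensions by δ/2 reach radius R.
    obtain ⟨δ, hδ, hL⟩ := lebesgue_number_lemma_of_metric
      (isCompact_closedBall (0 : ℂ) R) (c := fun a : ℂ => Metric.ball a (r a))
      (fun a => Metric.isOpen_ball)
      (fun x _ => Set.mem_iUnion.2 ⟨x, Metric.mem_ball_self (hr x)⟩)
    have hn : ∀ n : ℕ, ∃ U, IsLocalMultiple r u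
        (Metric.ball 0 (min (r 0 + n * (δ / 2)) R)) U := by
      intro n
      induction n with
      | zero =>
        refine ⟨u 0, fun x hx => ?_⟩
        have hx' : x ∈ Metric.ball 0 (r 0) := Metric.ball_subset_ball (by simp) hx
        exact ⟨hu 0 x hx', fun b hb => huu 0 b x hx' hb⟩
      | succ n ih =>
        obtain ⟨U, hU⟩ := ih
        obtain ⟨V, hV⟩ := hU.extend hr hu huu
          (lt_min (by have := hr 0; positivity) hR) hδ (fun c hc => hL c (by
            rw [mem_closedBall_zero_iff, hc]; exact min_le_right _ _))
        refine ⟨V, hV.mono (Metric.ball_subset_ball ?_)⟩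
        rw [min_add]
        refine min_le_min (le_of_eq ?_) (by linarith)
        push_cast
        ring
    obtain ⟨n, hn'⟩ := exists_nat_gt (R / (δ / 2))
    obtain ⟨U, hU⟩ := hn n
    refine ⟨U, hU.mono (Metric.ball_subset_ball (le_min ?_ le_rfl))⟩
    rw [div_lt_iff₀ (by positivity)] at hn'
    have := hr 0
    linarith
  -- The normalisation U(0) = 1 makes the solutions on different discs agree, so a global one may
  -- use a disc that depends on the point.
  have hnorm : ∀ R : ℝ, ∃ U, 0 < R → IsLocalMultiple r u (Metric.ball 0 R) U ∧ U 0 = 1 := by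
    intro R
    by_cases hR : 0 < R
    · obtain ⟨U, hU⟩ := hgood R hR
      have h0 := (hU 0 (Metric.mem_ball_self hR)).1
      exact ⟨fun x => (U 0)⁻¹ * U x, fun _ => ⟨hU.const_mul (inv_ne_zero h0), inv_mul_cancel₀ h0⟩⟩
    · exact ⟨0, fun h => (hR h).elim⟩
  choose V hV using hnorm
  refine ⟨fun x => V (‖x‖ + 1) x, at_iff.2 fun x _ => ?_⟩
  have h1 : 0 < ‖x‖ + 1 := by positivity
  have h2 : x ∈ Metric.ball (0 : ℂ) (‖x‖ + 1) := by simp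
  refine (at_iff.1 (hV _ h1).1 x h2).congr_at ?_
  filter_upwards [Metric.isOpen_ball.mem_nhds h2] with y hy
  have h3 : 0 < ‖y‖ + 1 := by positivity
  have h4 : y ∈ Metric.ball (0 : ℂ) (‖y‖ + 1) := by simp
  refine eqOn hr (Metric.isOpen_ball.inter Metric.isOpen_ball)
    ((convex_ball 0 (‖y‖ + 1)).inter (convex_ball 0 (‖x‖ + 1))).isPreconnected hu'
    ((hV _ h3).1.mono Set.inter_subset_left) ((hV _ h1).1.mono Set.inter_subset_right)
    (x₀ := 0) ⟨Metric.mem_ball_self h3, Metric.mem_ball_self h1⟩ ?_ ⟨h4, hy⟩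
  rw [(hV _ h3).2, (hV _ h1).2]

end IsLocalMultiple

/-! ### Meromorphic functions on the Riemann sphere -/

/-- If the order at infinity is non-negative, G has a finite limit there and is constant by
Liouville's theorem, hence of order 0. Otherwise the same argument applies to 1/G. -/
theorem order_eq_zero_of_entire {G : ℂ → ℂ} (hG : Differentiable ℂ G) (hG0 : ∀ z, G z ≠ 0)
    {m : ℤ} (hm : MeromorphicAt (fun z => G z⁻¹) 0)
    (ho : meromorphicOrderAt (fun z => G z⁻¹) 0 = m) : m = 0 := by
  have key : ∀ {F : ℂ → ℂ}, Differentiable ℂ F → (∀ z, F z ≠ 0) →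
      MeromorphicAt (fun z => F z⁻¹) 0 → 0 ≤ meromorphicOrderAt (fun z => F z⁻¹) 0 →
      meromorphicOrderAt (fun z => F z⁻¹) 0 = 0 := by
    intro F hF hF0 hF1 hF2
    obtain ⟨c, hc⟩ := tendsto_nhds_of_meromorphicOrderAt_nonneg hF1 hF2
    have h1 : Tendsto F (cocompact ℂ) (𝓝 c) := by
      rw [← Metric.cobounded_eq_cocompact]
      refine (hc.comp tendsto_inv₀_cobounded').congr fun z => ?_
      simp
    have h2 : ∀ z, F z = c := fun z => hF.apply_eq_of_tendsto_cocompact z h1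
    have h3 : (fun z : ℂ => F z⁻¹) = fun _ => c := funext fun z => h2 _
    rw [h3, meromorphicOrderAt_const, if_neg]
    rw [← h2 0]
    exact hF0 0
  rcases le_total 0 m with h | h
  · have := key hG hG0 hm (by rw [ho]; exact_mod_cast h)
    rw [ho] at this
    exact_mod_cast this
  · have h1 : meromorphicOrderAt (fun z => (G z⁻¹)⁻¹) 0 = ((-m : ℤ) : WithTop ℤ) := by
      change meromorphicOrderAt (fun z => G z⁻¹)⁻¹ 0 = _
      rw [meromorphicOrderAt_inv, ho]
      rfl
    have := key (F := fun z => (G z)⁻¹) (hG.inv hG0) (fun z => inv_ne_zero (hG0 z)) hm.inv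
      (by rw [h1]; exact_mod_cast neg_nonneg.2 h)
    rw [h1] at this
    have : -m = 0 := by exact_mod_cast this
    omega

/-- Passing to the meromorphic normal form repairs the values at isolated points; order zero at
every point then means holomorphic and non-vanishing. -/
theorem exists_entire {F : ℂ → ℂ} (hF : ∀ a, MeromorphicAt F a ∧ meromorphicOrderAt F a = 0)
    (hF' : MeromorphicAt (fun z => F z⁻¹) 0) :
    ∃ G : ℂ → ℂ, Differentiable ℂ G ∧ (∀ z, G z ≠ 0) ∧
      (fun z => G z⁻¹) =ᶠ[𝓝[≠] 0] fun z => F z⁻¹ := by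
  have hF1 : MeromorphicOn F Set.univ := fun a _ => (hF a).1
  have hN := meromorphicNFOn_toMeromorphicNFOn F Set.univ
  have ho : ∀ a, meromorphicOrderAt (toMeromorphicNFOn F Set.univ) a = 0 := fun a => by
    rw [meromorphicOrderAt_toMeromorphicNFOn hF1 (Set.mem_univ a), (hF a).2]
  have han : ∀ a, AnalyticAt ℂ (toMeromorphicNFOn F Set.univ) a := fun a =>
    (hN (Set.mem_univ a)).meromorphicOrderAt_nonneg_iff_analyticAt.1 (ho a).ge
  refine ⟨toMeromorphicNFOn F Set.univ, fun a => (han a).differentiableAt, fun a =>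
    (hN (Set.mem_univ a)).meromorphicOrderAt_eq_zero_iff.1 (ho a), ?_⟩
  -- Near infinity F is already analytic off ∞. It agrees with its normal form on punctured
  -- neighbourhoods, hence at the point itself by continuity.
  filter_upwards [hF'.eventually_analyticAt, self_mem_nhdsWithin] with z hz hz0
  have hz0 : z ≠ 0 := hz0
  have h1 : Tendsto (fun w : ℂ => w⁻¹) (𝓝[≠] z) (𝓝[≠] z⁻¹) :=
    ((continuousAt_inv₀ hz0).continuousWithinAt).tendsto_nhdsWithin
      (fun w (hw : w ≠ z) (h : w⁻¹ = z⁻¹) => hw (inv_injective h))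
  have h2 := h1.eventually (hF1.toMeromorphicNFOn_eq_self_on_nhdsNE (Set.mem_univ z⁻¹))
  have h3 : ContinuousAt (fun w : ℂ => toMeromorphicNFOn F Set.univ w⁻¹) z :=
    (han z⁻¹).continuousAt.comp (f := fun w : ℂ => w⁻¹) (continuousAt_inv₀ hz0)
  exact tendsto_nhds_unique
    ((h3.tendsto.mono_left nhdsWithin_le_nhds).congr' h2)
    (hz.continuousAt.tendsto.mono_left nhdsWithin_le_nhds)

theorem meromorphicOrderAt_zpow_sub (a b : ℂ) (n : ℤ) :
    MeromorphicAt (fun z : ℂ => (z - a) ^ n) b ∧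
      meromorphicOrderAt (fun z : ℂ => (z - a) ^ n) b = ((if b = a then n else 0 : ℤ) : WithTop ℤ) := by
  have hm : MeromorphicAt (fun z : ℂ => (z - a) ^ n) b :=
    ((MeromorphicAt.id b).sub (MeromorphicAt.const a b)).zpow n
  refine ⟨hm, ?_⟩
  split_ifs with h
  · subst h
    exact meromorphicOrderAt_zpow_id_sub_const
  · rw [meromorphicOrderAt_eq_int_iff hm]
    refine ⟨fun z => (z - a) ^ n, ?_, zpow_ne_zero _ (sub_ne_zero.2 h), by simp⟩
    exact (analyticAt_id.sub analyticAt_const).zpow (sub_ne_zero.2 h)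

theorem meromorphicOrderAt_zpow_inv_sub (a : ℂ) (n : ℤ) :
    MeromorphicAt (fun z : ℂ => (z⁻¹ - a) ^ n) 0 ∧
      meromorphicOrderAt (fun z : ℂ => (z⁻¹ - a) ^ n) 0 = ((-n : ℤ) : WithTop ℤ) := by
  have hm : MeromorphicAt (fun z : ℂ => (z⁻¹ - a) ^ n) 0 :=
    ((MeromorphicAt.id (0 : ℂ)).inv.sub (MeromorphicAt.const a 0)).zpow n
  refine ⟨hm, (meromorphicOrderAt_eq_int_iff hm).2
    ⟨fun z => (1 - a * z) ^ n, ?_, by simp, ?_⟩⟩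
  · exact (analyticAt_const.sub (analyticAt_const.mul analyticAt_id)).zpow (by simp)
  · filter_upwards [self_mem_nhdsWithin] with z hz
    have hz : z ≠ 0 := hz
    have h1 : z⁻¹ - a = z⁻¹ * (1 - a * z) := by field_simp
    rw [h1, mul_zpow, sub_zero, smul_eq_mul, inv_zpow']

/-- The divisor of the function `q` on the sphere is `v`. -/
def HasDivisor (q : Sphere → ℂ) (v : Sphere →₀ ℤ) : Prop :=
  ∀ x, MeromorphicAt (fun z => q (param x z)) 0 ∧
    meromorphicOrderAt (fun z => q (param x z)) 0 = (v x : WithTop ℤ)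

theorem finsupp_sum_sphere (v : Sphere →₀ ℤ) : (v.sum fun _ k => k) =
    v OnePoint.infty + ∑ a ∈ v.support.preimage (fun z : ℂ => (z : Sphere))
      OnePoint.coe_injective.injOn, v (a : Sphere) := by
  classical
  have h1 : (v.sum fun _ k => k) = ∑ x ∈ insert OnePoint.infty v.support, v x :=
    Finset.sum_subset (Finset.subset_insert _ _) fun x _ hx => Finsupp.notMem_support_iff.1 hx
  rw [h1, ← Finset.add_sum_erase _ _ (Finset.mem_insert_self _ _)]
  congr 1
  symm
  refine Finset.sum_bij (fun a _ => (a : Sphere)) ?_ ?_ ?_ ?_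
  · intro a ha
    simp only [Finset.mem_preimage] at ha
    simp [ha]
  · intro a _ b _ h
    exact OnePoint.coe_injective h
  · intro x hx
    rw [Finset.mem_erase, Finset.mem_insert] at hx
    obtain ⟨a, rfl⟩ := OnePoint.ne_infty_iff_exists.1 hx.1
    refine ⟨a, ?_, rfl⟩
    simpa using hx.2.resolve_left hx.1
  · intro a _
    rfl

/-- The divisor of a meromorphic function on the sphere has degree zero. -/
theorem HasDivisor.sum_eq_zero {q : Sphere → ℂ} {v : Sphere →₀ ℤ} (h : HasDivisor q v) :
    (v.sum fun _ k => k) = 0 := by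
  classical
  set A : Finset ℂ := v.support.preimage (fun z : ℂ => (z : Sphere))
    OnePoint.coe_injective.injOn with hA
  let f : ℂ → ℂ := fun z => q (z : Sphere)
  have hf : ∀ a : ℂ, MeromorphicAt f a ∧ meromorphicOrderAt f a = (v (a : Sphere) : WithTop ℤ) := by
    intro a
    obtain ⟨h1, h2⟩ := h (a : Sphere)
    have h3 : (fun z => q (param (a : Sphere) z)) = fun z => f (z + a) := by
      funext z
      rw [add_comm]
      rfl
    rw [h3] at h1 h2
    constructor
    · have h4 : MeromorphicAt (fun z => f (z + a)) (a - a) := by rwa [sub_self]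
      have h5 : AnalyticAt ℂ (fun z : ℂ => z - a) a := analyticAt_id.sub analyticAt_const
      have h6 := MeromorphicAt.comp_analyticAt (g := fun z : ℂ => z - a) h4 h5
      simpa [Function.comp_def] using h6
    · rw [← h2, meromorphicOrderAt_fun_comp_add_const_eq_meromorphicOrderAt, zero_add]
  have hinf : MeromorphicAt (fun z => f z⁻¹) 0 ∧
      meromorphicOrderAt (fun z => f z⁻¹) 0 = (v OnePoint.infty : WithTop ℤ) := by
    obtain ⟨h1, h2⟩ := h OnePoint.infty
    have h3 : (fun z => q (param OnePoint.infty z)) =ᶠ[𝓝[≠] 0] fun z => f z⁻¹ := by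
      filter_upwards [self_mem_nhdsWithin] with z hz
      exact congrArg q (if_neg hz)
    exact ⟨h1.congr h3, by rw [← h2, meromorphicOrderAt_congr h3]⟩
  -- This rational factor cancels all finite zeros and poles. It turns the order at infinity into
  -- the total degree of the divisor.
  let Q : ℂ → ℂ := fun z => ∏ a ∈ A, (z - a) ^ (-v (a : Sphere))
  have hQ : ∀ b : ℂ, MeromorphicAt Q b ∧
      meromorphicOrderAt Q b = ((-v (b : Sphere) : ℤ) : WithTop ℤ) := by
    intro b
    have h1 : ∀ a ∈ A, MeromorphicAt (fun z : ℂ => (z - a) ^ (-v (a : Sphere))) b :=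
      fun a _ => (meromorphicOrderAt_zpow_sub a b _).1
    refine ⟨MeromorphicAt.fun_prod h1, ?_⟩
    rw [meromorphicOrderAt_fun_prod h1,
      Finset.sum_congr rfl fun a _ => (meromorphicOrderAt_zpow_sub a b _).2, ← WithTop.coe_sum]
    congr 1
    rw [Finset.sum_ite_eq]
    split_ifs with hb
    · rfl
    · rw [hA, Finset.mem_preimage, Finsupp.notMem_support_iff] at hb
      rw [hb, neg_zero]
  have hQinf : MeromorphicAt (fun z => Q z⁻¹) 0 ∧ meromorphicOrderAt (fun z => Q z⁻¹) 0 =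
      ((∑ a ∈ A, v (a : Sphere) : ℤ) : WithTop ℤ) := by
    have h1 : ∀ a ∈ A, MeromorphicAt (fun z : ℂ => (z⁻¹ - a) ^ (-v (a : Sphere))) 0 :=
      fun a _ => (meromorphicOrderAt_zpow_inv_sub a _).1
    refine ⟨MeromorphicAt.fun_prod h1, ?_⟩
    change meromorphicOrderAt (fun z => ∏ a ∈ A, (z⁻¹ - a) ^ (-v (a : Sphere))) 0 = _
    rw [meromorphicOrderAt_fun_prod h1,
      Finset.sum_congr rfl fun a _ => (meromorphicOrderAt_zpow_inv_sub a _).2, ← WithTop.coe_sum]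
    simp only [neg_neg]
  have hF : ∀ a, MeromorphicAt (f * Q) a ∧ meromorphicOrderAt (f * Q) a = 0 := by
    intro a
    refine ⟨(hf a).1.mul (hQ a).1, ?_⟩
    rw [meromorphicOrderAt_mul (hf a).1 (hQ a).1, (hf a).2, (hQ a).2, ← WithTop.coe_add]
    simp
  have hF' : MeromorphicAt (fun z => (f * Q) z⁻¹) 0 := hinf.1.mul hQinf.1
  obtain ⟨G, hG1, hG2, hG3⟩ := exists_entire hF hF'
  have hG4 : meromorphicOrderAt (fun z => G z⁻¹) 0 =
      ((v OnePoint.infty + ∑ a ∈ A, v (a : Sphere) : ℤ) : WithTop ℤ) := by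
    rw [meromorphicOrderAt_congr hG3]
    change meromorphicOrderAt ((fun z => f z⁻¹) * fun z => Q z⁻¹) 0 = _
    rw [meromorphicOrderAt_mul hinf.1 hQinf.1, hinf.2, hQinf.2, ← WithTop.coe_add]
  rw [finsupp_sum_sphere]
  exact order_eq_zero_of_entire hG1 hG2 (hF'.congr hG3.symm) hG4

/-! ### Top forms in different frames -/

theorem alternatingMap_sum_smul {V : Type*} [AddCommGroup V] [Module ℂ V] {s : ℕ}
    (ω : V [⋀^Fin s]→ₗ[ℂ] ℂ) (e : Fin s → V) (C : Fin s → Fin s → ℂ) :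
    ω (fun j => ∑ i, C i j • e i) = (Matrix.of C).det * ω e := by
  let L : (Fin s → ℂ) →ₗ[ℂ] V := Fintype.linearCombination ℂ e
  have h1 := congrArg (fun η : (Fin s → ℂ) [⋀^Fin s]→ₗ[ℂ] ℂ => η fun j i => C i j)
    ((ω.compLinearMap L).eq_smul_basis_det (Pi.basisFun ℂ (Fin s)))
  have h2 : (ω.compLinearMap L) (Pi.basisFun ℂ (Fin s)) = ω e := by
    rw [AlternatingMap.compLinearMap_apply]
    congr 1
    funext j
    simp [L, Fintype.linearCombination_apply_single]
  have h3 : (Pi.basisFun ℂ (Fin s)).det (fun j i => C i j) = (Matrix.of C).det := by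
    rw [Pi.basisFun_det_apply, ← Matrix.det_transpose]
    rfl
  simp only [AlternatingMap.smul_apply] at h1
  rw [h2, h3, smul_eq_mul, mul_comm, AlternatingMap.compLinearMap_apply] at h1
  exact h1

theorem exists_topForm {V : Type*} [AddCommGroup V] [Module ℂ V] {s : ℕ} {e : Fin s → V}
    (h : LinearIndependent ℂ e ∧ Submodule.span ℂ (Set.range e) = ⊤) :
    ∃ ω : V [⋀^Fin s]→ₗ[ℂ] ℂ, ω e = 1 := by
  let b := Module.Basis.mk h.1 h.2.ge
  refine ⟨b.det, ?_⟩
  have : e = b := (Module.Basis.coe_mk _ _).symm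
  rw [this, b.det_self]

theorem topForm_ne_zero {V : Type*} [AddCommGroup V] [Module ℂ V] {s : ℕ} {e f : Fin s → V}
    (he : LinearIndependent ℂ e ∧ Submodule.span ℂ (Set.range e) = ⊤)
    {ω : V [⋀^Fin s]→ₗ[ℂ] ℂ} (h : ω f ≠ 0) : ω e ≠ 0 := by
  intro h0
  let b := Module.Basis.mk he.1 he.2.ge
  have hb : ∀ j, b j = e j := fun j => by rw [Module.Basis.mk_apply]
  apply h
  have h1 : f = fun j => ∑ i, b.repr (f j) i • e i := by
    funext j
    simp only [← hb]
    exact (b.sum_repr (f j)).symm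
  rw [h1, alternatingMap_sum_smul ω e fun i j => b.repr (f j) i, h0, mul_zero]

theorem eventually_nhdsNE_of_near_empty {x : Sphere} {p : Off ∅ → Prop}
    (h : ∀ᶠ y in near ∅ x, p y) : ∀ᶠ y in 𝓝[≠] x, p (pt y) :=
  (eventually_near_empty_iff.1 h).filter_mono nhdsWithin_le_nhds

namespace AdaptedFrame

variable {r s : ℕ} {E : HolBundle r} {W : ∀ y, Submodule ℂ (E.fib y)} {x : Sphere}
  (A : AdaptedFrame E s W x)

theorem exists_transition {f : Fin s → ∀ y, W y} (hf : E.IsSubframe W f x) :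
    ∃ C : Fin s → Fin s → ℂ → ℂ, (∀ i j, AnalyticAt ℂ (C i j) 0) ∧
      ∀ᶠ y : Off ∅ in near ∅ x, ∀ j, f j y = ∑ i, C i j (coord x y) • A.sub i y := by
  choose a ha _ using fun j => A.isFrame.exists_hol (hf.1 j)
  refine ⟨fun i j => a j (A.row i), fun i j => (a j (A.row i)).analyticAt, ?_⟩
  filter_upwards [eventually_all.2 ha, A.eq_sum_col, A.coe_sub] with y h1 h2 h3 j
  apply Subtype.ext
  have h4 := (f j y).2
  rw [h1 j] at h4 ⊢
  rw [h2 _ h4, AddSubmonoidClass.coe_finsetSum]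
  exact Finset.sum_congr rfl fun i _ => by rw [← h3]; rfl

/-- The factor is the determinant of the transition matrix. It is non-zero at x because the frame is
a basis of the fibre there. -/
theorem exists_factor {f : Fin s → ∀ y, W y} (hf : E.IsSubframe W f x) :
    ∃ c : ℂ → ℂ, AnalyticAt ℂ c 0 ∧ c 0 ≠ 0 ∧ ∀ᶠ y : Off ∅ in near ∅ x,
      ∀ ω : W y [⋀^Fin s]→ₗ[ℂ] ℂ, ω (fun j => f j y) = c (coord x y) * ω fun j => A.sub j y := by
  obtain ⟨C, hC, hCy⟩ := A.exists_transition hf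
  refine ⟨fun z => (Matrix.of fun i j => C i j z).det, ?_, ?_, ?_⟩
  · simp only [Matrix.det_apply]
    refine Finset.analyticAt_fun_sum _ fun σ _ => ?_
    refine AnalyticAt.const_smul ?_
    exact Finset.analyticAt_fun_prod _ fun i _ => hC _ _
  · have h1 := (eventually_near_empty_iff.1 hCy).self_of_nhds
    obtain ⟨ω, hω⟩ := exists_topForm (eventually_near_empty_iff.1 hf.2).self_of_nhds
    simp only [coord_self] at h1
    have h2 : (fun j => f j (pt x)) = fun j => ∑ i, C i j 0 • A.sub i (pt x) := funext h1
    rw [h2, alternatingMap_sum_smul ω _ fun i j => C i j 0] at hω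
    exact left_ne_zero_of_mul_eq_one hω
  · filter_upwards [hCy] with y hy ω
    have h2 : (fun j => f j y) = fun j => ∑ i, C i j (coord x y) • A.sub i y := funext hy
    rw [h2, alternatingMap_sum_smul ω _ fun i j => C i j (coord x y)]

end AdaptedFrame

namespace LocFree

theorem meromorphicOrder_ratio {h h' c : ℂ → ℂ} {m m' : ℤ} {q : ℂ → ℂ} (hh : MeromorphicAt h 0)
    (hh' : MeromorphicAt h' 0) (hm : meromorphicOrderAt h 0 = m) (hm' : meromorphicOrderAt h' 0 = m')
    (hc : AnalyticAt ℂ c 0) (hc0 : c 0 ≠ 0) (hq : q =ᶠ[𝓝[≠] 0] c * h * h'⁻¹) :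
    MeromorphicAt q 0 ∧ meromorphicOrderAt q 0 = ((m - m' : ℤ) : WithTop ℤ) := by
  have h1 : MeromorphicAt (c * h) 0 := hc.meromorphicAt.mul hh
  have h2 : meromorphicOrderAt c 0 = 0 := by
    rw [hc.meromorphicOrderAt_eq, hc.analyticOrderAt_eq_zero.2 hc0]
    rfl
  refine ⟨(h1.mul hh'.inv).congr hq.symm, ?_⟩
  rw [meromorphicOrderAt_congr hq, meromorphicOrderAt_mul h1 hh'.inv,
    meromorphicOrderAt_mul hc.meromorphicAt hh, meromorphicOrderAt_inv, hm, hm', h2, zero_add]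
  rfl

/-- The degree of a sub-bundle is well defined. -/
theorem IsDegree.unique {r s : ℕ} {E : HolBundle r} {W : ∀ y, Submodule ℂ (E.fib y)} {d d' : ℤ}
    (hd : E.IsDegree s W d) (hd' : E.IsDegree s W d') : d = d' := by
  obtain ⟨ω, v, hω, rfl⟩ := hd
  obtain ⟨ω', v', hω', rfl⟩ := hd'
  have hA : ∀ x, Nonempty (AdaptedFrame E s W x) := fun x => by
    obtain ⟨f, hf, -⟩ := hω x
    exact hf.nonempty_adaptedFrame
  let A := fun x => (hA x).some
  let e : ∀ y : Sphere, Fin s → W (pt y) := fun y j => (A y).sub j (pt y)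
  have he : ∀ y, LinearIndependent ℂ (e y) ∧ Submodule.span ℂ (Set.range (e y)) = ⊤ :=
    fun y => (eventually_near_empty_iff.1 (A y).isSubframe.2).self_of_nhds
  -- The top exterior power is a line, so the quotient of two volume forms does not depend on the
  -- basis on which they are evaluated. It is a meromorphic function on the sphere with divisor v -
  -- v'.
  let q : Sphere → ℂ := fun y => ω (pt y) (e y) * (ω' (pt y) (e y))⁻¹
  have hq : ∀ (y : Sphere) (f : Fin s → W (pt y)),
      LinearIndependent ℂ f ∧ Submodule.span ℂ (Set.range f) = ⊤ →
      q y = ω (pt y) f * (ω' (pt y) f)⁻¹ := by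
    intro y f hf
    let b := Module.Basis.mk hf.1 hf.2.ge
    have hb : ∀ j, b j = f j := fun j => by rw [Module.Basis.mk_apply]
    have h1 : e y = fun j => ∑ i, b.repr (e y j) i • f i := by
      funext j
      simp only [← hb]
      exact (b.sum_repr (e y j)).symm
    have h2 : (Matrix.of fun i j => b.repr (e y j) i).det ≠ 0 := by
      obtain ⟨η, hη⟩ := exists_topForm (he y)
      rw [h1, alternatingMap_sum_smul η f fun i j => b.repr (e y j) i] at hη
      intro h
      rw [h, zero_mul] at hη
      exact zero_ne_one hη
    change ω (pt y) (e y) * (ω' (pt y) (e y))⁻¹ = _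
    rw [h1, alternatingMap_sum_smul _ f fun i j => b.repr (e y j) i,
      alternatingMap_sum_smul _ f fun i j => b.repr (e y j) i, mul_inv]
    field_simp
  have hdiv : HasDivisor q (v - v') := by
    intro x
    obtain ⟨f, hf, h, hh, ho, hfh⟩ := hω x
    obtain ⟨f', hf', h', hh', ho', hfh'⟩ := hω' x
    obtain ⟨c, hc, hc0, hcy⟩ := (A x).exists_factor hf
    obtain ⟨c', hc', hc0', hcy'⟩ := (A x).exists_factor hf'
    have hcc : AnalyticAt ℂ (fun z => c' z * (c z)⁻¹) 0 := hc'.mul (hc.inv hc0)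
    have hne : ∀ᶠ y in 𝓝 x, c (coord x y) ≠ 0 ∧ c' (coord x y) ≠ 0 :=
      eventually_nhds_coord_iff.2 ((hc.continuousAt.eventually_ne hc0).and
        (hc'.continuousAt.eventually_ne hc0'))
    have key : ∀ᶠ y in 𝓝[≠] x, q y = c' (coord x y) * (c (coord x y))⁻¹ * h (coord x y) *
        (h' (coord x y))⁻¹ := by
      filter_upwards [hfh, hfh', eventually_nhdsNE_of_near_empty hcy,
        eventually_nhdsNE_of_near_empty hcy',
        eventually_nhdsNE_of_near_empty (A x).isSubframe.2,
        hne.filter_mono nhdsWithin_le_nhds] with y h1 h2 h3 h4 h5 h6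
      rw [hq y _ h5, ← h1, ← h2, h3, h4]
      have := h6.1
      have := h6.2
      field_simp
    refine meromorphicOrder_ratio hh hh' ho ho' hcc (mul_ne_zero hc0' (inv_ne_zero hc0)) ?_
    filter_upwards [eventually_nhdsNE_iff_param.1 key] with z hz
    rw [hz, coord_param]
    rfl
  have h0 := hdiv.sum_eq_zero
  rw [Finsupp.sum_sub_index (by intros; rfl)] at h0
  omega

theorem IsDegree.degree_eq {r s : ℕ} {E : HolBundle r} {W : ∀ y, Submodule ℂ (E.fib y)} {d : ℤ}
    (hd : E.IsDegree s W d) : E.degree s W = d := by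
  have h : ∃ d, E.IsDegree s W d := ⟨d, hd⟩
  rw [LocFree.degree, dif_pos h]
  exact h.choose_spec.unique hd

end LocFree

/-! ### The connection on the determinant of an invariant sub-bundle -/

theorem eventually_coe_of_nhds {a : ℂ} {p : Sphere → Prop} (h : ∀ᶠ y in 𝓝 (a : Sphere), p y) :
    ∀ᶠ t : ℂ in 𝓝 a, p (t : Sphere) :=
  (OnePoint.continuous_coe.tendsto a).eventually h

section ConnAt

variable {S : SingData} {E : HolConn S} {s : ℕ} {W : ∀ y, Submodule ℂ (E.bdl.fib y)}

variable (E) in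
/-- Near `y`, the functions `f` form a frame of `W`, and `M` is the matrix of the connection at
`y`. -/
def IsConnAt (f : Fin s → ∀ y, W y) (M : Matrix (Fin s) (Fin s) ℂ) (y : Off S.D) : Prop :=
  E.bdl.IsSubframe W f y ∧ ∀ j, E.del (fun y' => (f j y' : E.bdl.fib y')) y =
    ∑ i, M i j • (f i (pt y) : E.bdl.fib (pt y))

theorem isSec_of_star {t : ∀ y, E.bdl.fib y} {y : Sphere} (hy : y ∉ S.D)
    (h : E.toFlat.bdl.IsSec (E.res t) y) : E.bdl.IsSec t y := by
  obtain ⟨N, hN, t', ht', h'⟩ := h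
  refine ht'.congr (SingData.near_empty_of_near hy ?_)
  filter_upwards [h'] with y' h1
  rw [hN hy, pow_zero] at h1
  exact (h1.trans (one_smul ℂ (t (pt y')))).symm

theorem AdaptedFrame.eventually_isConnAt {x : Sphere} (A : AdaptedFrame E.bdl s W x)
    {N : Fin s → Fin s → ℂ → ℂ} (hdel : ∀ᶠ y : Off S.D in near S.D x, ∀ j,
      E.del (A.col j) y = ∑ i, N i j (coord x y) • A.col i (pt y)) :
    ∀ᶠ y : Off S.D in near S.D x,
      IsConnAt E A.sub (Matrix.of fun i j => N i j (coord x y)) y := by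
  have h1 : ∀ᶠ y : Off S.D in near S.D x, ∀ j,
      E.toFlat.bdl.IsSec (E.res fun y' => (A.sub j y' : E.bdl.fib y')) y :=
    eventually_all.2 fun j => isSec_eventually (E.isSec_res (A.isSubframe.1 j))
  have h1' : ∀ᶠ y : Off S.D in near S.D x, ∀ j, E.toFlat.bdl.IsSec (E.res (A.col j)) y :=
    eventually_all.2 fun j => isSec_eventually (E.isSec_res (A.isSec_col j))
  filter_upwards [hdel, h1, h1', SingData.near_of_near_empty (eventually_near_near A.isSubframe.2),
    SingData.near_of_near_empty A.coe_sub,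
    eventually_near_near (SingData.near_of_near_empty A.coe_sub)] with y g1 g2 g3 g4 g5 g6
  refine ⟨⟨fun j => isSec_of_star y.2 (g2 j), g4⟩, fun j => ?_⟩
  have h2 : E.del (fun y' => (A.sub j y' : E.bdl.fib y')) y = E.del (A.col j) y :=
    E.toFlat.del_congr (g3 j) (g6.mono fun y' h => h j)
  rw [h2, g1]
  exact Finset.sum_congr rfl fun i _ => by rw [g5]; rfl

/-- If the frame f is B times C, differentiating the relation gives C' = CM - M'C. Jacobi's formula
turns this into (det C)' = (tr M - tr M') det C. -/
theorem IsConnAt.hasDerivAt_factor {f : Fin s → ∀ y, W y} {M M' : Matrix (Fin s) (Fin s) ℂ}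
    {y : Off S.D} (hf : IsConnAt E f M y) (B : AdaptedFrame E.bdl s W y)
    (hB : IsConnAt E B.sub M' y) :
    ∃ c : ℂ → ℂ, c 0 ≠ 0 ∧ (∀ᶠ y' : Off ∅ in near ∅ (y : Sphere),
      ∀ ω : W y' [⋀^Fin s]→ₗ[ℂ] ℂ, ω (fun j => f j y') =
        c (coord y y') * ω fun j => B.sub j y') ∧
      HasDerivAt c ((M.trace - M'.trace) * c 0) 0 := by
  obtain ⟨C, hC, hCy⟩ := B.exists_transition hf.1
  have hCself := (eventually_near_empty_iff.1 hCy).self_of_nhds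
  simp only [coord_self] at hCself
  refine ⟨fun z => (Matrix.of fun i j => C i j z).det, ?_, ?_, ?_⟩
  · obtain ⟨ω, hω⟩ := exists_topForm (eventually_near_empty_iff.1 hf.1.2).self_of_nhds
    have h2 : (fun j => f j (pt y)) = fun j => ∑ i, C i j 0 • B.sub i (pt y) := funext hCself
    rw [h2, alternatingMap_sum_smul ω _ fun i j => C i j 0] at hω
    exact left_ne_zero_of_mul_eq_one hω
  · filter_upwards [hCy] with y' hy ω
    have h2 : (fun j => f j y') = fun j => ∑ i, C i j (coord y y') • B.sub i y' := funext hy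
    rw [h2, alternatingMap_sum_smul ω _ fun i j => C i j (coord y y')]
  · let C0 : Matrix (Fin s) (Fin s) ℂ := Matrix.of fun i j => C i j 0
    let C1 : Matrix (Fin s) (Fin s) ℂ := Matrix.of fun i j => deriv (C i j) 0
    have hd : HasDerivAt (fun z => (Matrix.of fun i j => C i j z).det)
        (C1 * C0.adjugate).trace 0 :=
      hasDerivAt_det (C := fun z => Matrix.of fun i j => C i j z) fun i j =>
        (hC i j).differentiableAt.hasDerivAt
    have hC1 : C1 = C0 * M - M' * C0 := by
      rw [eq_sub_iff_add_eq]
      ext l j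
      have h1 : E.del (fun y' => (f j y' : E.bdl.fib y')) y =
          ∑ i, (deriv (C i j) 0 • (B.sub i (pt y) : E.bdl.fib (pt y)) +
            C i j 0 • E.del (fun y' => (B.sub i y' : E.bdl.fib y')) y) := by
        have h2 := E.toFlat.del_sum_smul Finset.univ (y := y)
          (t := fun i => E.res fun y' => (B.sub i y' : E.bdl.fib y'))
          (fun i _ => E.isSec_res (hB.1.1 i)) (g := fun i => C i j) (fun i _ => hC i j)
        refine Eq.trans ?_ h2
        have hfy : ∀ᶠ y' : Off S.D in near S.D y, (f j (pt y') : E.bdl.fib (pt y')) =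
            ∑ i, C i j (coord y y') • (B.sub i (pt y') : E.bdl.fib (pt y')) := by
          filter_upwards [SingData.near_of_near_empty hCy] with y' hy'
          rw [hy', AddSubmonoidClass.coe_finsetSum]
          rfl
        have h3 : E.toFlat.bdl.IsSec (fun y' : Off S.D => ∑ i, C i j (coord y y') •
            E.res (fun y' => (B.sub i y' : E.bdl.fib y')) y') y := by
          refine (E.isSec_res (hf.1.1 j)).congr ?_
          filter_upwards [hfy] with y' hy'
          exact hy'.symm
        refine E.toFlat.del_congr h3 ?_
        filter_upwards [hfy] with y' hy'
        exact hy'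
      rw [hf.2] at h1
      have h4 : LinearIndependent ℂ fun i => (B.sub i (pt y) : E.bdl.fib (pt y)) :=
        (eventually_near_empty_iff.1 hB.1.2).self_of_nhds.1.map' (W (pt y)).subtype
          (W (pt y)).ker_subtype
      have h5 : ∑ i, M i j • (f i (pt y) : E.bdl.fib (pt y)) =
          ∑ l, (C0 * M) l j • (B.sub l (pt y) : E.bdl.fib (pt y)) := by
        have h6 : ∀ i, (f i (pt y) : E.bdl.fib (pt y)) =
            ∑ l, C l i 0 • (B.sub l (pt y) : E.bdl.fib (pt y)) := fun i => by
          rw [hCself, AddSubmonoidClass.coe_finsetSum]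
          rfl
        simp only [h6, sum_smul_sum_smul]
        refine Finset.sum_congr rfl fun l _ => ?_
        rw [Matrix.mul_apply]
        congr 1
        exact Finset.sum_congr rfl fun i _ => mul_comm _ _
      have h7 : ∑ i, (deriv (C i j) 0 • (B.sub i (pt y) : E.bdl.fib (pt y)) +
            C i j 0 • E.del (fun y' => (B.sub i y' : E.bdl.fib y')) y) =
          ∑ l, (C1 + M' * C0) l j • (B.sub l (pt y) : E.bdl.fib (pt y)) := by
        simp only [hB.2]
        rw [Finset.sum_add_distrib, sum_smul_sum_smul (fun i => C i j 0) (fun l i => M' l i) _,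
          ← Finset.sum_add_distrib]
        refine Finset.sum_congr rfl fun l _ => ?_
        rw [← add_smul, Matrix.add_apply, Matrix.mul_apply]
        congr 2
        exact Finset.sum_congr rfl fun i _ => mul_comm _ _
      rw [h5, h7] at h1
      exact (congrFun (coeff_eq_of_linearIndependent h4 h1) l).symm
    rw [hC1, trace_mul_adjugate] at hd
    exact hd

/-- The quotient of the values of a volume form on two frames satisfies the differential equation
given by the difference of the traces. -/
theorem IsConnAt.hasDerivAt_div {f g : Fin s → ∀ y, W y} {M M' : Matrix (Fin s) (Fin s) ℂ} {t : ℂ}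
    {ht : (t : Sphere) ∉ S.D} (hf : IsConnAt E f M ⟨t, ht⟩) (hg : IsConnAt E g M' ⟨t, ht⟩)
    (hI : E.toFlat.Invariant fun y => W (pt y)) (vol : ∀ y, (W y) [⋀^Fin s]→ₗ[ℂ] ℂ)
    (hvol : ∀ y (b : Fin s → W y), LinearIndependent ℂ b ∧ Submodule.span ℂ (Set.range b) = ⊤ →
      vol y b ≠ 0) :
    HasDerivAt (fun t : ℂ => vol (pt t) (fun j => f j (pt t)) / vol (pt t) (fun j => g j (pt t)))
      ((M.trace - M'.trace) *
        (vol (pt t) (fun j => f j (pt t)) / vol (pt t) (fun j => g j (pt t)))) t := by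
  -- The forms `vol` are chosen fibre by fibre and have no regularity. Comparison with an auxiliary
  -- frame B expresses the quotient by determinants alone, in which `vol` and the trace for B
  -- cancel.
  obtain ⟨B⟩ := hf.1.nonempty_adaptedFrame
  obtain ⟨N, -, hdel⟩ := B.exists_connMatrix hI
  have hB : IsConnAt E B.sub (Matrix.of fun i j => N i j (coord t t)) ⟨t, ht⟩ :=
    (eventually_near_iff.1 (B.eventually_isConnAt hdel)).self_of_nhds ht
  obtain ⟨c, hc0, hc, hc'⟩ := hf.hasDerivAt_factor B hB
  obtain ⟨d, hd0, hd, hd'⟩ := hg.hasDerivAt_factor B hB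
  have h1 : (fun t : ℂ => vol (pt t) (fun j => f j (pt t)) / vol (pt t) (fun j => g j (pt t)))
      =ᶠ[𝓝 t] fun t' => c (t' - t) / d (t' - t) := by
    filter_upwards [eventually_coe_of_nhds (eventually_near_empty_iff.1 hc),
      eventually_coe_of_nhds (eventually_near_empty_iff.1 hd),
      eventually_coe_of_nhds (eventually_near_empty_iff.1 hB.1.2)] with t' h1 h2 h3
    rw [h1, h2, mul_div_mul_right _ _ (hvol _ _ h3)]
    rfl
  have h2 := h1.eq_of_nhds
  simp only [sub_self] at h2
  rw [h2]
  refine HasDerivAt.congr_of_eventuallyEq ?_ h1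
  set T := (Matrix.of fun i j => N i j (coord t t)).trace
  have hc2 : HasDerivAt (fun t' => c (t' - t)) ((M.trace - T) * c 0) t :=
    HasDerivAt.comp_sub_const t t (by rw [sub_self]; exact hc')
  have hd2 : HasDerivAt (fun t' => d (t' - t)) ((M'.trace - T) * d 0) t :=
    HasDerivAt.comp_sub_const t t (by rw [sub_self]; exact hd')
  refine (hc2.fun_div hd2 (by rw [sub_self]; exact hd0)).congr_deriv ?_
  rw [sub_self]
  field_simp
  ring

end ConnAt

/-! ### The degree of an invariant sub-bundle -/

/-- The rational function with the polar parts `e p / (t - p)` at `p ∈ P` and the value `f` at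
infinity. -/
def rationalPart (S : SingData) (e : Sphere → ℂ) (f t : ℂ) : ℂ :=
  f + ∑ p ∈ S.P, e (p : Sphere) / (t - p)

section Degree

variable {S : SingData}

theorem analyticAt_sum_div (Q : Finset ℂ) (e : Sphere → ℂ) {a : ℂ} (ha : a ∉ Q) :
    AnalyticAt ℂ (fun z : ℂ => ∑ p ∈ Q, e (p : Sphere) / (a + z - p)) 0 := by
  refine Finset.analyticAt_fun_sum _ fun p hp => ?_
  refine analyticAt_const.div ((analyticAt_const.add analyticAt_id).sub analyticAt_const) ?_
  intro h
  have h : a + 0 - p = 0 := h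
  rw [add_zero, sub_eq_zero] at h
  exact ha (h ▸ hp)

/-- At a ∈ P the simple pole of τ is cancelled by the summand of the rational part with p = a. The
other summands are holomorphic at a. -/
theorem exists_regular_part {a : ℂ} {τ : ℂ → ℂ} (hτ : Coef S.D a τ) (e : Sphere → ℂ) (f : ℂ)
    (h : (a : Sphere) ∈ S.D → ∃ h, AnalyticAt ℂ h 0 ∧ ∀ᶠ y : Off S.D in near S.D (a : Sphere),
      coord a y * τ (coord a y) = e a + coord a y * h (coord a y)) :
    ∃ q, AnalyticAt ℂ q 0 ∧ ∀ᶠ y : Off S.D in near S.D (a : Sphere),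
      τ (coord a y) - rationalPart S e f (aff y) = q (coord a y) := by
  by_cases ha : (a : Sphere) ∈ S.D
  · obtain ⟨g, hg, hy⟩ := h ha
    have haP := S.coe_mem_iff.1 ha
    refine ⟨fun z => g z - f - ∑ p ∈ S.P.erase a, e (p : Sphere) / (a + z - p),
      (hg.sub analyticAt_const).sub (analyticAt_sum_div _ e (by simp)), ?_⟩
    filter_upwards [hy, near_coord_ne ha] with y h1 h2
    have h3 : aff y - a = coord a y := rfl
    have h4 : τ (coord a y) = e a / coord a y + g (coord a y) := by
      field_simp
      rw [mul_comm, h1, mul_comm]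
    rw [rationalPart, ← Finset.add_sum_erase _ _ haP, h3, h4, ← h3]
    have h5 : a + (aff y - a) = aff y := by ring
    rw [h5]
    ring
  · have haP : a ∉ S.P := fun h => ha (S.coe_mem h)
    refine ⟨fun z => τ z - (f + ∑ p ∈ S.P, e (p : Sphere) / (a + z - p)),
      (hτ.2 ha).sub (analyticAt_const.add (analyticAt_sum_div _ e haP)), ?_⟩
    refine Eventually.of_forall fun y => ?_
    have h5 : a + coord a y = aff y := by
      change a + (aff y - a) = aff y
      ring
    change _ = τ (coord a y) - (f + ∑ p ∈ S.P, e (p : Sphere) / (a + coord a y - p))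
    rw [h5]
    rfl

variable {E : HolConn S} {s : ℕ} {W : ∀ y, Submodule ℂ (E.bdl.fib y)}

/-- Once the rational part is subtracted, the trace of the connection is regular at a, also when a ∈
P, so the equation of rank one has a solution k without zeros. The radius is small enough that a is
the only point of `D` the disc may contain. -/
theorem AdaptedFrame.exists_local {a : ℂ} (A : AdaptedFrame E.bdl s W (a : Sphere))
    {N : Fin s → Fin s → ℂ → ℂ} (hN : ∀ i j, Coef S.D a (N i j))
    (hdel : ∀ᶠ y : Off S.D in near S.D (a : Sphere), ∀ j,
      E.del (A.col j) y = ∑ i, N i j (coord a y) • A.col i (pt y)) (e : Sphere → ℂ) (f : ℂ)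
    (h : (a : Sphere) ∈ S.D → ∃ h, AnalyticAt ℂ h 0 ∧ ∀ᶠ y : Off S.D in near S.D (a : Sphere),
      coord a y * ∑ j, N j j (coord a y) = e a + coord a y * h (coord a y)) :
    ∃ (k : ℂ → ℂ) (ρ : ℝ), 0 < ρ ∧ AnalyticAt ℂ k 0 ∧ (∀ z, k z ≠ 0) ∧
      ∀ t ∈ Metric.ball a ρ,
        (LinearIndependent ℂ (fun j => A.sub j (pt t)) ∧
          Submodule.span ℂ (Set.range fun j => A.sub j (pt t)) = ⊤) ∧
        ((t : Sphere) ∈ S.D → t = a) ∧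
        ∀ ht : (t : Sphere) ∉ S.D,
          IsConnAt E A.sub (Matrix.of fun i j => N i j (t - a)) ⟨t, ht⟩ ∧
          HasDerivAt k ((∑ j, N j j (t - a) - rationalPart S e f t) * k (t - a)) (t - a) := by
  have hτ : Coef S.D a (fun z => ∑ j, N j j z) := by
    refine ⟨meromorphicAt_sum _ fun j _ => (hN j j).1, fun ha => ?_⟩
    exact Finset.analyticAt_fun_sum _ fun j _ => (hN j j).2 ha
  obtain ⟨q, hq, hqy⟩ := exists_regular_part hτ e f h
  obtain ⟨k, hk, hk0, hkd⟩ := exists_nonvanishing_solution hq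
  have h1 := eventually_coe_of_nhds (eventually_near_iff.1 (A.eventually_isConnAt hdel))
  have h2 := eventually_coe_of_nhds (eventually_near_iff.1 hqy)
  have h3 := eventually_coe_of_nhds (a := a) (eventually_nhds_coord_iff.2 hkd)
  have h4 := eventually_coe_of_nhds (eventually_near_empty_iff.1 A.isSubframe.2)
  have h5 := eventually_coe_of_nhds (eventually_nhdsWithin_iff.1 (S.eventually_notMem' (a : Sphere)))
  obtain ⟨ρ, hρ, hball⟩ := Metric.eventually_nhds_iff_ball.1
    (((h1.and h2).and (h3.and h4)).and h5)
  refine ⟨k, ρ, hρ, hk, hk0, fun t ht => ?_⟩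
  obtain ⟨⟨⟨g1, g2⟩, g3, g4⟩, g5⟩ := hball t ht
  refine ⟨g4, fun hD => ?_, fun hD => ⟨g1 hD, ?_⟩⟩
  · by_contra hne
    exact g5 (fun h => hne (OnePoint.coe_injective h)) hD
  · have g6 : HasDerivAt k (q (t - a) * k (t - a)) (t - a) := g3
    have g7 : ∑ j, N j j (t - a) - rationalPart S e f t = q (t - a) := g2 hD
    rw [g7]
    exact g6

theorem eventually_eq_of_deriv_eq_zero {φ : ℂ → ℂ} {x : ℂ}
    (h : ∀ᶠ y in 𝓝 x, HasDerivAt φ 0 y) : ∀ᶠ y in 𝓝 x, φ y = φ x := by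
  obtain ⟨ε, hε, hb⟩ := Metric.eventually_nhds_iff_ball.1 h
  filter_upwards [Metric.ball_mem_nhds x hε] with y hy
  exact Metric.isOpen_ball.is_const_of_deriv_eq_zero (convex_ball x ε).isPreconnected
    (fun z hz => (hb z hz).differentiableAt.differentiableWithinAt)
    (fun z hz => (hb z hz).deriv) hy (Metric.mem_ball_self hε)

/-- A residue theorem for det W. The form is built so that its value on a local frame has
logarithmic derivative tr N minus the rational part. It has neither zeros nor poles on ℂ, so the
degree of W is minus its order at infinity. That order is the exponent of the equation there, the
sum of the residues `e` over all points of `D`. -/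
theorem exists_isDegree (hI : E.toFlat.Invariant fun y => W (pt y))
    (A : ∀ x, AdaptedFrame E.bdl s W x) (N : Sphere → Fin s → Fin s → ℂ → ℂ)
    (hN : ∀ x i j, Coef S.D x (N x i j))
    (hdel : ∀ x, ∀ᶠ y : Off S.D in near S.D x, ∀ j,
      E.del ((A x).col j) y = ∑ i, N x i j (coord x y) • (A x).col i (pt y))
    (e : Sphere → ℂ) (f : ℂ)
    (hfin : ∀ a : ℂ, (a : Sphere) ∈ S.D → ∃ h, AnalyticAt ℂ h 0 ∧
      ∀ᶠ y : Off S.D in near S.D (a : Sphere),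
        coord a y * ∑ j, N a j j (coord a y) = e a + coord a y * h (coord a y))
    (hinf : ∃ h, AnalyticAt ℂ h 0 ∧ ∀ᶠ y : Off S.D in near S.D OnePoint.infty,
      -aff y * ∑ j, N OnePoint.infty j j (aff y)⁻¹ =
        -f * aff y + e OnePoint.infty + (aff y)⁻¹ * h (aff y)⁻¹) :
    ∃ n : ℤ, e OnePoint.infty + ∑ p ∈ S.P, e (p : Sphere) = n ∧ E.bdl.IsDegree s W (-n) := by
  have hbas : ∀ y : Off ∅, LinearIndependent ℂ (fun j => (A y).sub j y) ∧
      Submodule.span ℂ (Set.range fun j => (A y).sub j y) = ⊤ :=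
    fun y => (eventually_near_empty_iff.1 (A y).isSubframe.2).self_of_nhds
  choose vol hvol1 using fun y : Off ∅ => exists_topForm (hbas y)
  have hvol : ∀ y (b : Fin s → W y), LinearIndependent ℂ b ∧ Submodule.span ℂ (Set.range b) = ⊤ →
      vol y b ≠ 0 := fun y b hb => topForm_ne_zero hb (by rw [hvol1]; exact one_ne_zero)
  choose k ρ hρ hk hk0 hloc using fun a : ℂ =>
    (A a).exists_local (hN a) (hdel a) e f (hfin a)
  let V : Sphere → ℂ → ℂ := fun x t => vol (pt t) fun j => (A x).sub j (pt t)
  let τ : Sphere → ℂ → ℂ := fun x z => ∑ j, N x j j z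
  have hV : ∀ a : ℂ, ∀ t ∈ Metric.ball a (ρ a), V a t ≠ 0 := fun a t ht => hvol _ _ (hloc a t ht).1
  -- The form `u a t • vol` has the value k_a on the frame attached to a. For two centres these
  -- forms satisfy the same equation of rank one, hence differ by locally constant factors.
  let u : ℂ → ℂ → ℂ := fun a t => k a (t - a) / V a t
  have hu : ∀ a t, t ∈ Metric.ball a (ρ a) → u a t ≠ 0 :=
    fun a t ht => div_ne_zero (hk0 a _) (hV a t ht)
  have huu : ∀ a b x, x ∈ Metric.ball a (ρ a) → x ∈ Metric.ball b (ρ b) →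
      ∀ᶠ y in 𝓝 x, u a y * u b x = u a x * u b y := by
    intro a b x hxa hxb
    -- A ball contains at most its own centre from `D`, so two balls that share a point of `D` have
    -- the same centre.
    by_cases hx : (x : Sphere) ∈ S.D
    · have h1 := (hloc a x hxa).2.1 hx
      have h2 := (hloc b x hxb).2.1 hx
      rw [← h1, ← h2]
      exact Eventually.of_forall fun y => mul_comm _ _
    · have hd : ∀ᶠ y in 𝓝 x, HasDerivAt
          (fun t => k a (t - a) / k b (t - b) * (V b t / V a t)) 0 y := by
        filter_upwards [Metric.isOpen_ball.mem_nhds hxa, Metric.isOpen_ball.mem_nhds hxb,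
          eventually_coe_of_nhds (S.eventually_notMem hx)] with y hya hyb hy
        obtain ⟨hca, hda⟩ := (hloc a y hya).2.2 hy
        obtain ⟨hcb, hdb⟩ := (hloc b y hyb).2.2 hy
        have h1 : HasDerivAt (fun t => V b t / V a t) (_ * (V b y / V a y)) y :=
          hcb.hasDerivAt_div hca hI vol hvol
        refine (((hda.comp_sub_const y a).fun_div (hdb.comp_sub_const y b)
          (hk0 b _)).fun_mul h1).congr_deriv ?_
        have h2 := hk0 b (y - b)
        have h3 := hV a y hya
        simp only [Matrix.trace, Matrix.diag_apply, Matrix.of_apply]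
        field_simp
        ring
      filter_upwards [eventually_eq_of_deriv_eq_zero hd, Metric.isOpen_ball.mem_nhds hxa,
        Metric.isOpen_ball.mem_nhds hxb] with y hy hya hyb
      have h1 := hk0 b (x - b)
      have h2 := hk0 b (y - b)
      have h3 := hV a x hxa
      have h4 := hV a y hya
      have h5 := hV b x hxb
      have h6 := hV b y hyb
      simp only [u]
      field_simp
      field_simp at hy
      linear_combination hy
  obtain ⟨U, hU⟩ := IsLocalMultiple.exists_univ hρ hu huu
  have hUloc : ∀ a : ℂ, ∃ c : ℂ, c ≠ 0 ∧ ∀ᶠ t in 𝓝 a, U t = c * (k a (t - a) / V a t) := by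
    intro a
    have ha := Metric.mem_ball_self (x := a) (hρ a)
    refine ⟨U a / u a a, div_ne_zero (hU a trivial).1 (hu a a ha), ?_⟩
    filter_upwards [(hU a trivial).2 a ha] with t ht
    have := hu a a ha
    change U t = U a / u a a * u a t
    field_simp
    exact ht
  let ω : ∀ y, (W y) [⋀^Fin s]→ₗ[ℂ] ℂ := fun y => U (aff y) • vol y
  -- the value of the form on the frame at infinity
  let K : ℂ → ℂ := fun t => U t * V OnePoint.infty t
  have hK : ∀ᶠ t : ℂ in cocompact ℂ, K t ≠ 0 ∧
      HasDerivAt K ((τ OnePoint.infty t⁻¹ - rationalPart S e f t) * K t) t := by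
    have hcoe : Tendsto (fun t : ℂ => (t : Sphere)) (cocompact ℂ) (𝓝 OnePoint.infty) := by
      rw [← coclosedCompact_eq_cocompact]
      exact OnePoint.tendsto_coe_infty
    have h0 : ∀ᶠ t : ℂ in cocompact ℂ, (t : Sphere) ∉ S.D := by
      have := eventually_nhdsWithin_iff.1 (S.eventually_notMem' OnePoint.infty)
      filter_upwards [hcoe.eventually this] with t ht
      exact ht (OnePoint.coe_ne_infty t)
    filter_upwards [h0, hcoe.eventually (eventually_near_empty_iff.1 (A OnePoint.infty).isSubframe.2),
      hcoe.eventually (eventually_near_iff.1 ((A OnePoint.infty).eventually_isConnAt (hdel _)))]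
      with t ht h1 h2
    obtain ⟨c, hc, hct⟩ := hUloc t
    have htt := Metric.mem_ball_self (x := t) (hρ t)
    obtain ⟨hca, hda⟩ := (hloc t t htt).2.2 ht
    refine ⟨mul_ne_zero (hU t trivial).1 (hvol _ _ h1), ?_⟩
    have h3 := (h2 ht).hasDerivAt_div hca hI vol hvol
    have h4 : K =ᶠ[𝓝 t] fun t' => c * (k t (t' - t) * (V OnePoint.infty t' / V t t')) := by
      filter_upwards [hct] with t' h
      change U t' * V OnePoint.infty t' = _
      rw [h]
      ring
    rw [h4.eq_of_nhds]
    refine HasDerivAt.congr_of_eventuallyEq ?_ h4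
    refine (((hda.comp_sub_const t t).fun_mul h3).const_mul c).congr_deriv ?_
    change c * (_ + _ * (_ * (V OnePoint.infty t / V t t))) = _
    simp only [Matrix.trace, Matrix.diag_apply, Matrix.of_apply]
    change c * (_ + _ * ((∑ j, N OnePoint.infty j j t⁻¹ - _) * _)) = _
    ring
  obtain ⟨g, hg, hgy⟩ := hinf
  have hgt : ∀ᶠ z : ℂ in 𝓝[≠] 0, -z⁻¹ * τ OnePoint.infty z =
      -f * z⁻¹ + e OnePoint.infty + z * g z := by
    have h1 := (SingData.eventually_near_coord_iff S.infty_mem (p := fun z =>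
      -z⁻¹ * τ OnePoint.infty z = -f * z⁻¹ + e OnePoint.infty + z * g z)).1
    apply h1
    filter_upwards [hgy] with y hy
    have h2 : coord OnePoint.infty y = (aff y)⁻¹ := rfl
    rw [h2, inv_inv]
    exact hy
  have hinv : Tendsto (fun z : ℂ => z⁻¹) (𝓝[≠] 0) (cocompact ℂ) := by
    rw [← Metric.cobounded_eq_cocompact]
    exact tendsto_inv₀_nhdsNE_zero
  -- With z = 1/t one has t/(t - p) = 1 + z p/(1 - pz). The 1 contributes `e p` to the exponent, and
  -- the rest goes into the holomorphic remainder.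
  let h : ℂ → ℂ := fun z => g z + ∑ p ∈ S.P, e (p : Sphere) * p / (1 - p * z)
  have hh : AnalyticAt ℂ h 0 := by
    refine hg.add (Finset.analyticAt_fun_sum _ fun p _ => ?_)
    exact analyticAt_const.div (analyticAt_const.sub (analyticAt_const.mul analyticAt_id)) (by simp)
  have hpz : ∀ᶠ z : ℂ in 𝓝[≠] 0, ∀ p ∈ S.P, 1 - p * z ≠ 0 := by
    refine (Filter.eventually_all_finset S.P).2 fun p _ => ?_
    have : ContinuousAt (fun z : ℂ => 1 - p * z) 0 := by fun_prop
    exact (this.eventually_ne (by simp)).filter_mono nhdsWithin_le_nhds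
  -- Here z d/dz = -t d/dt. The irregular terms -f t of the connection and +f t of the rational part
  -- cancel, which leaves a regular singularity with the sum of all residues as exponent.
  obtain ⟨n, hn, hnm, hno⟩ := order_of_regular_singular (k := fun z => K z⁻¹)
    (k' := fun z => (τ OnePoint.infty z - rationalPart S e f z⁻¹) * K z⁻¹ * -(z ^ 2)⁻¹)
    (ν := e OnePoint.infty + ∑ p ∈ S.P, e (p : Sphere)) hh (by
      filter_upwards [hinv.eventually hK, hgt, hpz, self_mem_nhdsWithin] with z h1 h2 h3 h4
      have h4 : z ≠ 0 := h4
      refine ⟨?_, h1.1, ?_⟩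
      · have h5 := h1.2
        rw [inv_inv] at h5
        exact h5.comp z (hasDerivAt_inv h4)
      · have h5 : z⁻¹ * ∑ p ∈ S.P, e (p : Sphere) / (z⁻¹ - p) =
            ∑ p ∈ S.P, e (p : Sphere) + z * ∑ p ∈ S.P, e (p : Sphere) * p / (1 - p * z) := by
          rw [Finset.mul_sum, Finset.mul_sum, ← Finset.sum_add_distrib]
          refine Finset.sum_congr rfl fun p hp => ?_
          have h6 := h3 p hp
          have h7 : z⁻¹ - p = z⁻¹ * (1 - p * z) := by field_simp
          rw [h7]
          obtain ⟨q, hq⟩ : ∃ q, q = 1 - p * z := ⟨_, rfl⟩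
          rw [← hq] at h6 ⊢
          field_simp
          rw [hq]
          ring
        have h6 : z * -(z ^ 2)⁻¹ = -z⁻¹ := by field_simp
        change z * ((_ - (f + _)) * _ * _) = (_ + z * (g z + _)) * _
        linear_combination (τ OnePoint.infty z - (f + ∑ p ∈ S.P, e (p : Sphere) / (z⁻¹ - p))) *
          K z⁻¹ * h6 + K z⁻¹ * h2 + K z⁻¹ * h5)
  refine ⟨n, hn, ω, Finsupp.single OnePoint.infty n, fun x => ⟨(A x).sub, (A x).isSubframe, ?_⟩, ?_⟩
  · induction x using OnePoint.rec with
    | infty =>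
      refine ⟨fun z => K z⁻¹, hnm, by rw [hno]; simp, ?_⟩
      rw [eventually_nhdsWithin_iff]
      refine Eventually.of_forall fun y hy => ?_
      obtain ⟨t, rfl⟩ := OnePoint.ne_infty_iff_exists.1 hy
      change U t * V OnePoint.infty t = K (t⁻¹)⁻¹
      rw [inv_inv]
    | coe a =>
      obtain ⟨c, hc, hct⟩ := hUloc a
      have hka : AnalyticAt ℂ (fun z => c * k a z) 0 := analyticAt_const.mul (hk a)
      refine ⟨fun z => c * k a z, hka.meromorphicAt, ?_, ?_⟩
      · rw [hka.meromorphicOrderAt_eq,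
          hka.analyticOrderAt_eq_zero.2 (mul_ne_zero hc (hk0 a 0)),
          Finsupp.single_eq_of_ne (OnePoint.coe_ne_infty a)]
        rfl
      · refine Filter.Eventually.filter_mono nhdsWithin_le_nhds ?_
        rw [OnePoint.nhds_coe_eq, eventually_map]
        filter_upwards [hct, Metric.isOpen_ball.mem_nhds (Metric.mem_ball_self (hρ a))] with t h1 h2
        change U t * V a t = c * k a (t - a)
        rw [h1]
        have := hV a t h2
        field_simp
  · rw [Finsupp.sum_single_index rfl]

end Degree

/-! ### Parabolic weights of a sub-bundle at a singular point -/

theorem finsum_mem_sum_grDim {R ι : Type*} [CommSemiring R] {U : Type} [AddCommGroup U]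
    [Module ℂ U] (s : Finset ι) {F : ι → ℝ → Submodule ℂ U}
    (hF : ∀ i ∈ s, {β | grDim (F i) β ≠ 0}.Finite) (g : ℝ → R) (I : Set ℝ) :
    ∑ᶠ β ∈ I, g β * ((∑ i ∈ s, grDim (F i) β : ℕ) : R) =
      ∑ i ∈ s, ∑ᶠ β ∈ I, g β * (grDim (F i) β : R) := by
  classical
  simp only [finsum_mem_def, Nat.cast_sum, Finset.mul_sum]
  rw [← finsum_sum_comm]
  · refine finsum_congr fun β => ?_
    by_cases h : β ∈ I
    · simp only [Set.indicator_of_mem h]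
    · simp only [Set.indicator_of_notMem h, Finset.sum_const_zero]
  · intro i hi
    refine (hF i hi).subset fun β hβ h0 => hβ ?_
    by_cases h : β ∈ I
    · simp only [Set.indicator_of_mem h, h0, Nat.cast_zero, mul_zero]
    · exact Set.indicator_of_notMem h _

theorem sum_finsum_eq_sum {R : Type*} [AddCommMonoid R] (P : Finset (ℂ × ℂ)) (Q : Finset ℂ)
    (hPQ : ∀ q ∈ P, q.1 ∈ Q) (T : ℂ → ℂ → R) (hT : ∀ ξ ∈ Q, ∀ α, (ξ, α) ∉ P → T ξ α = 0) :
    ∑ ξ ∈ Q, ∑ᶠ α, T ξ α = ∑ q ∈ P, T q.1 q.2 := by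
  classical
  have h1 : ∀ ξ ∈ Q, ∑ᶠ α, T ξ α = ∑ α ∈ P.image Prod.snd, T ξ α := by
    intro ξ hξ
    refine finsum_eq_sum_of_support_subset _ fun α hα => ?_
    by_contra h
    refine hα (hT ξ hξ α fun h' => h ?_)
    exact Finset.mem_coe.2 (Finset.mem_image.2 ⟨_, h', rfl⟩)
  rw [Finset.sum_congr rfl h1, ← Finset.sum_product' Q _ T]
  symm
  refine Finset.sum_subset (fun q hq => ?_) fun q hq hq' => ?_
  · exact Finset.mem_product.2 ⟨hPQ q hq, Finset.mem_image.2 ⟨q, hq, rfl⟩⟩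
  · exact hT q.1 (Finset.mem_product.1 hq).1 q.2 hq'

theorem IsFiltration.inf {U : Type} [AddCommGroup U] [Module ℂ U] {V : Submodule ℂ U} {k : ℤ}
    {F : ℝ → Submodule ℂ U} (h : IsFiltration V k F) (W : Submodule ℂ U) :
    IsFiltration (V ⊓ W) k fun γ => F γ ⊓ W where
  antitone β γ hβ := inf_le_inf_right _ (h.antitone hβ)
  leftCont β := by
    refine le_antisymm (le_iInf₂ fun γ hγ => inf_le_inf_right _ (h.antitone hγ.le)) ?_
    refine le_inf ?_ ?_
    · rw [h.leftCont β]
      exact iInf₂_mono fun γ _ => inf_le_left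
    · exact (iInf₂_le (β - 1) (by linarith)).trans inf_le_right
  eq_top β hβ := by rw [h.eq_top β hβ]
  eq_bot β hβ := by rw [h.eq_bot β hβ, bot_inf_eq]

/-- For k ≠ 0 the intervals [k, k + 1[ and [0, 1[ are disjoint. If k < 0 the step at β is zero
already, and if k > 0 the filtration is still constant beyond β. -/
theorem IsFiltration.grDim_eq_zero {U : Type} [AddCommGroup U] [Module ℂ U] {V : Submodule ℂ U}
    {k : ℤ} {F : ℝ → Submodule ℂ U} (h : IsFiltration V k F) (hk : k ≠ 0) {β : ℝ}
    (hβ : β ∈ Set.Ico (0 : ℝ) 1) : grDim F β = 0 := by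
  apply grDim_eq_zero_of_le
  rcases lt_or_gt_of_ne hk with hk | hk
  · have : (k : ℝ) + 1 ≤ 0 := by exact_mod_cast hk
    rw [h.eq_bot β (this.trans hβ.1)]
    exact bot_le
  · have : (1 : ℝ) ≤ k := by exact_mod_cast hk
    rw [h.eq_top β (hβ.2.le.trans this), ← h.eq_top k le_rfl]
    exact le_iSup₂_of_le (k : ℝ) (hβ.2.trans_le this) le_rfl

namespace FormalChart

variable {S : SingData} {E : HolConn S} {x : Sphere} (χ : FormalChart E x)

theorem proj_mem_of_le {V : Submodule ℂ (E.bdl.fib (pt x))}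
    (hV : V ≤ ⨆ k, V ⊓ E.eigen x (S.fac x k) (S.expn x k)) (ξ α : ℂ) {v : E.bdl.fib (pt x)}
    (hv : v ∈ V) : χ.proj ξ α v ∈ V := by
  suffices h : (⨆ k, V ⊓ E.eigen x (S.fac x k) (S.expn x k)) ≤ V.comap (χ.proj ξ α) from
    h (hV hv)
  refine iSup_le fun k w hw => ?_
  by_cases h : S.fac x k = ξ ∧ S.expn x k = α
  · have h1 := hw.2
    rw [h.1, h.2] at h1
    rw [Submodule.mem_comap, χ.proj_eq_self h1]
    exact hw.1
  · rw [Submodule.mem_comap, χ.proj_eq_zero hw.2 h]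
    exact zero_mem V

theorem eq_iSup_classes {V : Submodule ℂ (E.bdl.fib (pt x))}
    (hV : ∀ ξ α, ∀ v ∈ V, χ.proj ξ α v ∈ V) :
    V = ⨆ q ∈ S.classes x, V ⊓ E.eigen x q.1 q.2 := by
  refine le_antisymm (fun v hv => ?_) (iSup₂_le fun _ _ => inf_le_left)
  rw [← χ.sum_proj v]
  refine sum_mem fun q hq => ?_
  exact (le_iSup₂_of_le (f := fun (q : ℂ × ℂ) (_ : q ∈ S.classes x) => V ⊓ E.eigen x q.1 q.2)
    q hq le_rfl) ⟨hV _ _ v hv, χ.proj_mem_eigen _ _ _⟩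

open Classical in
theorem finrank_inf_eigen (χ : FormalChart E x) {s : ℕ} {J : Fin s → Fin S.r} {b : Fin s → E.bdl.fib (pt x)}
    (hb : ∀ j, b j ∈ E.eigen x (S.fac x (J j)) (S.expn x (J j))) (hli : LinearIndependent ℂ b)
    (q : ℂ × ℂ) :
    Module.finrank ℂ (Submodule.span ℂ (Set.range b) ⊓ E.eigen x q.1 q.2 :
      Submodule ℂ (E.bdl.fib (pt x))) =
      (Finset.univ.filter fun j => (S.fac x (J j), S.expn x (J j)) = q).card := by
  let K := {j : Fin s // (S.fac x (J j), S.expn x (J j)) = q}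
  have h1 : Submodule.span ℂ (Set.range b) ⊓ E.eigen x q.1 q.2 =
      Submodule.span ℂ (Set.range fun j : K => b j) := by
    apply le_antisymm
    · rintro v ⟨h1, h2⟩
      obtain ⟨a, rfl⟩ := (Submodule.mem_span_range_iff_exists_fun ℂ).1 h1
      rw [← χ.proj_eq_self h2, map_sum]
      refine sum_mem fun j _ => ?_
      rw [map_smul]
      refine Submodule.smul_mem _ _ ?_
      by_cases hj : S.fac x (J j) = q.1 ∧ S.expn x (J j) = q.2
      · have h3 := hb j
        rw [hj.1, hj.2] at h3
        rw [χ.proj_eq_self h3]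
        exact Submodule.subset_span ⟨⟨j, Prod.ext hj.1 hj.2⟩, rfl⟩
      · rw [χ.proj_eq_zero (hb j) hj]
        exact zero_mem _
    · rw [Submodule.span_le]
      rintro _ ⟨⟨j, hj⟩, rfl⟩
      refine ⟨Submodule.subset_span ⟨j, rfl⟩, ?_⟩
      have h3 := hb j
      subst hj
      exact h3
  have h2 : LinearIndependent ℂ fun j : K => b j := hli.comp _ Subtype.val_injective
  rw [h1, finrank_span_eq_card h2, Fintype.card_subtype]

end FormalChart

namespace HP

variable {S : SingData} {hS : S.ResonanceFree} {X : HP S} {x : S.D}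
  {W : ∀ y, Submodule ℂ (X.bdl.fib y)} {s : ℕ}

theorem fil_proj_mem (β : ℝ) (ξ α : ℂ) {v : X.bdl.fib (pt x)} (hv : v ∈ X.fil x β) :
    (X.chart hS x).proj ξ α v ∈ X.fil x β :=
  (X.chart hS x).proj_mem_of_le (X.compatible x β).le ξ α hv

variable (hS X W x) in
/-- The induced parabolic structure on the restriction of a sub-bundle. -/
def subPar (ξ α : ℂ) (β : ℝ) : Submodule ℂ (X.toFlat.bdl.Hat x) :=
  X.par hS x ξ α β ⊓ X.toFlat.subHat (fun y => W (pt y)) x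

/-- The numerical data of an invariant sub-bundle at a singular point. -/
theorem exists_local_weights (hx : (x : Sphere) ∈ S.D) (A : AdaptedFrame X.bdl s W x)
    {N : Fin s → Fin s → ℂ → ℂ} (hN : ∀ i j, Coef S.D x (N i j))
    (hdel : ∀ᶠ y : Off S.D in near S.D x, ∀ j,
      X.del (A.col j) y = ∑ i, N i j (coord x y) • A.col i (pt y)) :
    ∃ (J : Fin s → Fin S.r) (w : ℝ),
      (∃ h, AnalyticAt ℂ h 0 ∧ ∀ᶠ y : Off S.D in near S.D (x : Sphere),
        eulerFactor x y * ∑ j, N j j (coord x y) =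
          -(∑ j, S.fac x (J j)) * (coord x y)⁻¹ + ∑ j, S.expn x (J j) +
            coord x y * h (coord x y)) ∧
      ∑ᶠ β ∈ Set.Ico (0 : ℝ) 1, β * grDim (fun γ => X.fil x γ ⊓ W (pt x)) β = w ∧
      (∑ ξ ∈ S.facs x, ∑ᶠ α : ℂ, ∑ᶠ β ∈ Set.Ico (0 : ℝ) 1,
        α * grDim (subPar hS X x W ξ α) β) = ∑ j, S.expn x (J j) ∧
      (∑ ξ ∈ S.facs x, ∑ᶠ α : ℂ, ∑ᶠ β ∈ Set.Ico (0 : ℝ) 1,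
        (β : ℂ) * grDim (subPar hS X x W ξ α) β) = w := by
  classical
  set χ := X.chart hS x with hχ
  have : FiniteDimensional ℂ (X.bdl.fib (pt x)) := Module.Finite.equiv χ.fib.symm
  obtain ⟨J, b, hb, hli, hspan, hconst, hsub, htr⟩ :=
    exists_localBasis hx (hS.nonResonant hx) χ A hN hdel
  let G : ℂ × ℂ → ℝ → Submodule ℂ (X.bdl.fib (pt x)) := fun q γ =>
    X.fil x γ ⊓ (W (pt x) ⊓ X.eigen x q.1 q.2)
  -- W_x is spanned by eigenvectors, so it is stable under the projections to the eigenspaces, and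
  -- the induced filtration splits over the classes (ξ, α).
  have hWproj : ∀ ξ α, ∀ v ∈ W (pt x), χ.proj ξ α v ∈ W (pt x) := by
    intro ξ α v hv
    refine χ.proj_mem_of_le ?_ ξ α hv
    conv_lhs => rw [← hspan]
    rw [Submodule.span_le]
    rintro _ ⟨j, rfl⟩
    refine (le_iSup (fun k => W (pt x) ⊓ X.eigen x (S.fac x k) (S.expn x k)) (J j)) ⟨?_, hb j⟩
    rw [← hspan]
    exact Submodule.subset_span ⟨j, rfl⟩
  have hfilt : ∀ q, IsFiltration (W (pt x) ⊓ X.eigen x q.1 q.2) 0 (G q) := fun q => by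
    have := (X.isFiltration x).inf (W (pt x) ⊓ X.eigen x q.1 q.2)
    rwa [top_inf_eq] at this
  choose bw hbw hgr using fun q => (hfilt q).exists_weights
  have hsum : ∀ β, grDim (fun γ => X.fil x γ ⊓ W (pt x)) β = ∑ q ∈ S.classes x, grDim (G q) β := by
    intro β
    rw [← grDim_iSup (S.classes x) (V := fun q => X.eigen x q.1 q.2) (G := G)
      (fun q => χ.proj q.1 q.2) (fun q v hv => χ.proj_eq_self hv)
      (fun q q' hq v hv => χ.proj_eq_zero hv fun h => hq (Prod.ext h.1 h.2))
      (fun q γ => inf_le_right.trans inf_le_right) (fun q => (hfilt q).antitone) β]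
    congr 1
    funext γ
    refine (χ.eq_iSup_classes fun ξ α v hv => ?_).trans (by simp only [G, inf_assoc])
    exact ⟨fil_proj_mem γ ξ α hv.1, hWproj ξ α v hv.2⟩
  have hfin : ∀ q, {β | grDim (G q) β ≠ 0}.Finite := by
    intro q
    refine (Set.finite_range (bw q)).subset fun β hβ => ?_
    by_contra h
    refine hβ ?_
    rw [hgr, Finset.card_eq_zero, Finset.filter_eq_empty_iff]
    intro m _ hm
    exact h ⟨m, hm⟩
  have hclass : ∀ k, grDim (subPar hS X x W (S.fac x k) (S.expn x k)) =
      grDim (G (S.fac x k, S.expn x k)) := by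
    intro k
    funext β
    rw [← grDim_map (χ.lead 0) (F := subPar hS X x W _ _)
      (fun γ => inf_le_left.trans par_le_psi) (lead_injOn_psi k) β]
    congr 1
    funext γ
    apply le_antisymm
    · rintro _ ⟨m, ⟨hm1, hm2⟩, rfl⟩
      have h1 : χ.lead 0 m ∈ X.fil x γ ⊓ X.eigen x (S.fac x k) (S.expn x k) := by
        rw [← map_lead_par (hS := hS)]
        exact ⟨m, hm1, rfl⟩
      refine ⟨h1.1, ?_, h1.2⟩
      obtain ⟨c, hc⟩ := hsub m hm2
      rw [hc, map_sum, ← hspan]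
      refine sum_mem fun j _ => ?_
      rw [χ.lead_smul_const]
      exact Submodule.smul_mem _ _ (Submodule.subset_span ⟨j, rfl⟩)
    · rintro v ⟨h1, h2, h3⟩
      refine ⟨χ.const v, ⟨mem_par_expn.2 ⟨χ.const_mem_psi h3, ?_⟩, ?_⟩, χ.lead_const v⟩
      · rw [← hχ, χ.lead_const v]
        exact h1
      · rw [← hspan] at h2
        obtain ⟨a, rfl⟩ := (Submodule.mem_span_range_iff_exists_fun ℂ).1 h2
        rw [map_sum]
        refine sum_mem fun j _ => ?_
        rw [map_smul]
        exact Submodule.smul_mem _ _ (hconst j)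
  have hclass' : ∀ q ∈ S.classes x,
      grDim (subPar hS X x W q.1 q.2) = grDim (G q) := by
    intro q hq
    obtain ⟨k, -, rfl⟩ := Finset.mem_image.1 hq
    exact hclass k
  -- An α that is not an exponent contributes nothing in [0, 1[: if α = α_k + n with n ≠ 0, the
  -- weights lie in [n, n + 1[, and otherwise ψ vanishes.
  have hzero : ∀ ξ ∈ S.facs x, ∀ α, (ξ, α) ∉ S.classes x → ∀ β ∈ Set.Ico (0 : ℝ) 1,
      grDim (subPar hS X x W ξ α) β = 0 := by
    intro ξ _ α hα β hβ
    by_cases h : ∃ k, ∃ n : ℤ, S.fac x k = ξ ∧ α = S.expn x k + n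
    · obtain ⟨k, n, rfl, rfl⟩ := h
      refine ((isFiltration_par_add (hS := hS) (X := X) (x := x) k n).inf
        (X.toFlat.subHat (fun y => W (pt y)) x)).grDim_eq_zero ?_ hβ
      rintro rfl
      refine hα (Finset.mem_image.2 ⟨k, Finset.mem_univ k, ?_⟩)
      simp
    · push Not at h
      apply grDim_eq_zero_of_le
      have h1 : subPar hS X x W ξ α β ≤ ⊥ := by
        rw [← χ.psi_eq_bot h]
        exact inf_le_left.trans par_le_psi
      exact h1.trans bot_le
  have hfacs : ∀ q ∈ S.classes x, q.1 ∈ S.facs x := by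
    intro q hq
    obtain ⟨k, -, rfl⟩ := Finset.mem_image.1 hq
    exact Finset.mem_image_of_mem _ (Finset.mem_univ k)
  have key : ∀ g : ℂ → ℝ → ℂ, (∑ ξ ∈ S.facs x, ∑ᶠ α : ℂ, ∑ᶠ β ∈ Set.Ico (0 : ℝ) 1,
      g α β * grDim (subPar hS X x W ξ α) β) =
      ∑ q ∈ S.classes x, ∑ m, g q.2 (bw q m) := by
    intro g
    rw [sum_finsum_eq_sum (S.classes x) (S.facs x) hfacs (fun ξ α => ∑ᶠ β ∈ Set.Ico (0 : ℝ) 1,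
      g α β * (grDim (subPar hS X x W ξ α) β : ℂ))]
    · refine Finset.sum_congr rfl fun q hq => ?_
      rw [hclass' q hq]
      exact finsum_mul_grDim (hbw q) (hgr q) (g q.2)
    · intro ξ hξ α hα
      refine finsum_mem_eq_zero_of_forall_eq_zero fun β hβ => ?_
      rw [hzero ξ hξ α hα β hβ, Nat.cast_zero, mul_zero]
  refine ⟨J, ∑ q ∈ S.classes x, ∑ m, bw q m, htr, ?_, ?_, ?_⟩
  · simp only [hsum]
    rw [finsum_mem_sum_grDim (S.classes x) (fun q _ => hfin q) (fun β => β)]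
    exact Finset.sum_congr rfl fun q _ => finsum_mul_grDim (hbw q) (hgr q) fun β => β
  · rw [key fun α _ => α]
    -- The number of weights in a class is the dimension of that part of W_x, hence the number of
    -- basis eigenvectors in the class.
    have h1 : ∀ q : ℂ × ℂ, ∑ _m : Fin (Module.finrank ℂ
        (W (pt x) ⊓ X.eigen x q.1 q.2 : Submodule ℂ (X.bdl.fib (pt x)))), q.2 =
        ∑ j ∈ Finset.univ.filter fun j => (S.fac x (J j), S.expn x (J j)) = q,
          S.expn x (J j) := by
      intro q
      rw [Finset.sum_const, Finset.card_univ, Fintype.card_fin, ← hspan,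
        χ.finrank_inf_eigen hb hli q, ← Finset.sum_const]
      refine Finset.sum_congr rfl fun j hj => ?_
      rw [← (Finset.mem_filter.1 hj).2]
    rw [Finset.sum_congr rfl fun q _ => h1 q]
    exact Finset.sum_fiberwise_of_maps_to
      (fun j _ => Finset.mem_image.2 ⟨J j, Finset.mem_univ _, rfl⟩) _
  · rw [key fun _ β => (β : ℂ)]
    push_cast
    rfl

end HP

/-! ### The parabolic degrees agree -/

theorem SingData.finsum_D (S : SingData) (g : Sphere → ℂ) :
    ∑ᶠ x : S.D, g x = g OnePoint.infty + ∑ p ∈ S.P, g (p : Sphere) := by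
  have hD : S.D = insert OnePoint.infty ((fun p : ℂ => (p : Sphere)) '' (S.P : Set ℂ)) := by
    ext x
    constructor
    · rintro (rfl | ⟨p, hp, rfl⟩)
      · exact Set.mem_insert _ _
      · exact Set.mem_insert_of_mem _ ⟨p, hp, rfl⟩
    · rintro (rfl | ⟨p, hp, rfl⟩)
      · exact S.infty_mem
      · exact S.coe_mem hp
  rw [finsum_set_coe_eq_finsum_mem (f := g) S.D, hD, finsum_mem_insert,
    finsum_mem_image OnePoint.coe_injective.injOn, finsum_mem_coe_finset]
  · rintro ⟨p, -, h⟩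
    exact OnePoint.coe_ne_infty p h
  · exact S.P.finite_toSet.image _

namespace HP

variable {S : SingData} {hS : S.ResonanceFree} {X : HP S}
  {W : ∀ y, Submodule ℂ (X.bdl.fib y)} {s : ℕ}

/-- The α-part of the degree on `DMP` is minus the sum of the exponents of W, which is the degree of
W by `exists_isDegree`. The β-parts agree point by point by `exists_local_weights`. -/
theorem pdeg_toDMP (hW : X.bdl.IsSubbundle s W) (hI : X.toFlat.Invariant fun y => W (pt y)) :
    (X.toDMP hS).pdeg (fun y => W (pt y)) = (X.pdeg s W : ℂ) := by
  classical
  let A := fun x => (hW.nonempty_adaptedFrame x).some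
  choose N hN hdel using fun x => (A x).exists_connMatrix hI
  choose J w h1 h2 h3 h4 using fun x : S.D =>
    exists_local_weights (hS := hS) x.2 (A x) (hN x) (hdel x)
  let e : Sphere → ℂ := fun x => if h : x ∈ S.D then ∑ j, S.expn x (J ⟨x, h⟩ j) else 0
  have he : ∀ x : S.D, e x = ∑ j, S.expn x (J x j) := fun x => dif_pos x.2
  -- At points of P all ξ vanish, so the trace has only a simple pole. At infinity the irregular
  -- term is given by the sum of the ξ that occur in W.
  obtain ⟨n, hn, hdeg⟩ := exists_isDegree hI A N hN hdel e
    (∑ j, S.fac OnePoint.infty (J ⟨_, S.infty_mem⟩ j)) (by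
      intro a ha
      obtain ⟨h, hh, hy⟩ := h1 ⟨a, ha⟩
      refine ⟨h, hh, ?_⟩
      filter_upwards [hy] with y hy
      have h5 : ∀ j, S.fac (a : Sphere) j = 0 := fun _ => rfl
      simp only [h5, Finset.sum_const_zero, neg_zero, zero_mul, zero_add] at hy
      rw [he ⟨a, ha⟩]
      exact hy) (by
      obtain ⟨h, hh, hy⟩ := h1 ⟨OnePoint.infty, S.infty_mem⟩
      refine ⟨h, hh, ?_⟩
      filter_upwards [hy] with y hy
      have h5 : coord OnePoint.infty y = (aff y)⁻¹ := rfl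
      simp only [h5, inv_inv] at hy
      rw [he ⟨OnePoint.infty, S.infty_mem⟩]
      exact hy)
  have hd : (X.toDMP hS).degree (fun y => W (pt y)) = ((X.bdl.degree s W : ℤ) : ℂ) := by
    rw [hdeg.degree_eq]
    push_cast
    rw [← hn, ← S.finsum_D]
    exact congrArg Neg.neg (finsum_congr fun x => (h3 x).trans (he x).symm)
  have hw : (∑ᶠ x : S.D, ∑ ξ ∈ S.facs x, ∑ᶠ α : ℂ, ∑ᶠ β ∈ Set.Ico (0 : ℝ) 1,
      (β : ℂ) * grDim (subPar hS X x W ξ α) β) = ((∑ᶠ x : S.D, w x : ℝ) : ℂ) := by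
    have : ((∑ᶠ x : S.D, w x : ℝ) : ℂ) = ∑ᶠ x : S.D, (w x : ℂ) :=
      AddMonoidHom.map_finsum Complex.ofRealHom.toAddMonoidHom (Set.toFinite _)
    rw [this]
    exact finsum_congr h4
  have hX : X.pdeg s W = (X.bdl.degree s W : ℝ) + ∑ᶠ x : S.D, w x := by
    rw [HP.pdeg]
    congr 1
    exact finsum_congr h2
  rw [hX]
  push_cast
  exact congrArg₂ (· + ·) hd hw

theorem isSubbundle_top (E : HolBundle S.r) : E.IsSubbundle S.r fun _ => ⊤ := by
  intro x
  obtain ⟨e, he⟩ := E.exists_frame x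
  refine ⟨fun j y => ⟨e j y, trivial⟩, fun j => he.isSec j, ?_⟩
  filter_upwards [he.basis_near] with y hy
  exact linearIndependent_sub_and_span (fun j => rfl) hy.1 hy.2

theorem pdeg_top : (X.toDMP hS).pdeg (fun _ => ⊤) = (X.pdeg S.r (fun _ => ⊤) : ℂ) :=
  pdeg_toDMP (W := fun _ => ⊤) (isSubbundle_top X.bdl) fun y t _ _ =>
    Submodule.mem_top (R := ℂ) (M := X.bdl.fib (pt y)) (x := X.toFlat.conn.del t y)

/-- Invariant sub-bundles pass from E to E(*D) by restriction and back by `extendSub`, with the same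
rank and, by `pdeg_toDMP`, the same parabolic degree. -/
theorem stable_toDMP_iff : (X.toDMP hS).Stable ↔ X.Stable := by
  constructor
  · intro h s W hW hI h0 hr
    have h1 := h s (fun y => W (pt y)) (hW.star S) hI h0 hr
    have h2 := pdeg_toDMP (hS := hS) hW hI
    rw [pdeg_top] at h1
    have h3 : ((X.toDMP hS).pdeg fun y => W (pt y)).re = X.pdeg s W := by
      rw [h2, Complex.ofReal_re]
    rw [h3, Complex.ofReal_re] at h1
    exact h1
  · intro h s W hW hI h0 hr
    let W' : ∀ y, Submodule ℂ (X.bdl.fib y) := extendSub (D := S.D) W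
    have hW' : (fun y : Off S.D => W' (pt y)) = W := funext fun y => extendSub_off W y
    have hI' : X.toFlat.Invariant fun y => W' (pt y) := by
      have : X.toFlat.Invariant W := hI
      rwa [← hW'] at this
    have hsub := isSubbundle_extendSub (S := S) (E := X.bdl) hW
    have h1 := h s W' hsub hI' h0 hr
    have h2 := pdeg_toDMP (hS := hS) hsub hI'
    have h3 : ((X.toDMP hS).pdeg W).re = X.pdeg s W' := by
      rw [← Complex.ofReal_re (X.pdeg s W'), ← h2]
      exact congrArg (fun V => ((X.toDMP hS).pdeg V).re) hW'.symm
    rw [pdeg_top, Complex.ofReal_re, h3]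
    exact h1

theorem stableDMP_toDMP_iff : stableDMP S (X.toDMP hS) ↔ stableHP S X := by
  refine and_congr stable_toDMP_iff ?_
  rw [pdeg_top]
  exact Complex.ofReal_eq_zero

end HP

/-! ### Invariance under isomorphisms -/

namespace DMP

variable {S : SingData} {M N : DMP S} {f : DMPHom M N} {g : DMPHom N M}

theorem app_app (h : LocFree.Hom.comp f.toHom g.toHom = LocFree.Hom.id M.bdl) (y : Off S.D)
    (v : M.bdl.fib y) : g.app y (f.app y v) = v :=
  LinearMap.congr_fun (congrFun (congrArg LocFree.Hom.app h) y) v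

theorem map_hat_subHat {W : ∀ y, Submodule ℂ (M.bdl.fib y)} {V : ∀ y, Submodule ℂ (N.bdl.fib y)}
    (h : ∀ y, ∀ v ∈ W y, f.app y v ∈ V y) (x : Sphere) :
    (M.subHat W x).map (f.toHom.hat x) ≤ N.subHat V x := by
  rw [Flat.subHat, Submodule.map_span, Submodule.span_le]
  rintro _ ⟨_, ⟨q, t, ht, htW, rfl⟩, rfl⟩
  rw [LocFree.Hom.hat_tmul]
  exact Submodule.subset_span ⟨q, _, _, htW.mono fun y hy => h y _ hy, rfl⟩

theorem map_hat_subPar (h : LocFree.Hom.comp g.toHom f.toHom = LocFree.Hom.id N.bdl)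
    (V : ∀ y, Submodule ℂ (N.bdl.fib y)) (x : S.D) {ξ : ℂ} (hξ : ξ ∈ S.facs x) (α : ℂ) (β : ℝ) :
    (M.subPar (fun y => (V y).comap (f.app y)) x ξ α β).map (f.toHom.hat x) =
      N.subPar V x ξ α β := by
  apply le_antisymm
  · rintro _ ⟨m, ⟨h1, h2⟩, rfl⟩
    exact ⟨f.par x ξ hξ α β ⟨m, h1, rfl⟩,
      map_hat_subHat (f := f) (V := V) (fun y v hv => hv) x ⟨m, h2, rfl⟩⟩
  · rintro m ⟨h1, h2⟩
    refine ⟨g.toHom.hat x m, ⟨g.par x ξ hξ α β ⟨m, h1, rfl⟩, ?_⟩,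
      hat_hom_inv g.toFlatHom f.toFlatHom h m⟩
    refine map_hat_subHat (f := g) (W := V) (fun y v hv => ?_) x ⟨m, h2, rfl⟩
    rw [Submodule.mem_comap, app_app h]
    exact hv

theorem grDim_subPar_comap (hfg : LocFree.Hom.comp f.toHom g.toHom = LocFree.Hom.id M.bdl)
    (hgf : LocFree.Hom.comp g.toHom f.toHom = LocFree.Hom.id N.bdl)
    (V : ∀ y, Submodule ℂ (N.bdl.fib y)) (x : S.D) {ξ : ℂ}
    (hξ : ξ ∈ S.facs x) (α : ℂ) (β : ℝ) :
    grDim (M.subPar (fun y => (V y).comap (f.app y)) x ξ α) β = grDim (N.subPar V x ξ α) β := by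
  rw [← grDim_map (f.toHom.hat x) (V := ⊤) (fun _ => le_top) (fun u _ hu => by
    rw [← hat_hom_inv f.toFlatHom g.toFlatHom hfg u, hu, map_zero]) β]
  congr 1
  funext γ
  exact map_hat_subPar hgf V x hξ α γ

theorem pdeg_comap (hfg : LocFree.Hom.comp f.toHom g.toHom = LocFree.Hom.id M.bdl)
    (hgf : LocFree.Hom.comp g.toHom f.toHom = LocFree.Hom.id N.bdl)
    (V : ∀ y, Submodule ℂ (N.bdl.fib y)) :
    M.pdeg (fun y => (V y).comap (f.app y)) = N.pdeg V := by
  have key : ∀ q : ℂ → ℝ → ℂ, (∑ᶠ x : S.D, ∑ ξ ∈ S.facs x, ∑ᶠ α : ℂ, ∑ᶠ β ∈ Set.Ico (0 : ℝ) 1,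
      q α β * grDim (M.subPar (fun y => (V y).comap (f.app y)) x ξ α) β) =
      ∑ᶠ x : S.D, ∑ ξ ∈ S.facs x, ∑ᶠ α : ℂ, ∑ᶠ β ∈ Set.Ico (0 : ℝ) 1,
        q α β * grDim (N.subPar V x ξ α) β := by
    intro q
    refine finsum_congr fun x => Finset.sum_congr rfl fun ξ hξ => finsum_congr fun α => ?_
    simp only [grDim_subPar_comap hfg hgf V x hξ α]
  rw [DMP.pdeg, DMP.pdeg, DMP.degree, DMP.degree, key fun α _ => α, key fun _ β => (β : ℂ)]

theorem isSubbundle_comap (hfg : LocFree.Hom.comp f.toHom g.toHom = LocFree.Hom.id M.bdl)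
    (hgf : LocFree.Hom.comp g.toHom f.toHom = LocFree.Hom.id N.bdl) {s : ℕ}
    {V : ∀ y, Submodule ℂ (N.bdl.fib y)} (hV : N.bdl.IsSubbundle s V) :
    M.bdl.IsSubbundle s fun y => (V y).comap (f.app y) := by
  intro x
  obtain ⟨e, he, he'⟩ := hV x
  have hmem : ∀ j y, g.app y (e j y) ∈ (V y).comap (f.app y) := fun j y => by
    rw [Submodule.mem_comap, app_app hgf]
    exact (e j y).2
  refine ⟨fun j y => ⟨g.app y (e j y), hmem j y⟩, fun j => g.isSec _ x (he j), ?_⟩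
  filter_upwards [he'] with y hy
  let φ : V y ≃ₗ[ℂ] ((V y).comap (f.app y) : Submodule ℂ (M.bdl.fib y)) :=
    { toFun := fun v => ⟨g.app y v, by rw [Submodule.mem_comap, app_app hgf]; exact v.2⟩
      map_add' := fun v w => Subtype.ext (map_add (g.app y) (v : N.bdl.fib y) w)
      map_smul' := fun c v => Subtype.ext (map_smul (g.app y) c (v : N.bdl.fib y))
      invFun := fun v => ⟨f.app y v, v.2⟩
      left_inv := fun v => Subtype.ext (app_app hgf y v)
      right_inv := fun v => Subtype.ext (app_app hfg y v) }
  have h1 : (fun j => (⟨g.app y (e j y), hmem j y⟩ :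
      ((V y).comap (f.app y) : Submodule ℂ (M.bdl.fib y)))) = φ ∘ fun j => e j y := rfl
  rw [h1]
  refine ⟨hy.1.map' φ.toLinearMap φ.ker, ?_⟩
  rw [Set.range_comp]
  have h2 := Submodule.map_span φ.toLinearMap (Set.range fun j => e j y)
  rw [hy.2, Submodule.map_top, LinearEquiv.range] at h2
  exact h2.symm

theorem invariant_comap {V : ∀ y, Submodule ℂ (N.bdl.fib y)} (hV : N.Invariant V) :
    M.Invariant fun y => (V y).comap (f.app y) := by
  intro y t ht htV
  rw [Submodule.mem_comap, ← f.comm y t ht]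
  exact hV y _ (f.isSec t y ht) htV

/-- Every invariant sub-bundle of N pulls back to one of M. The formal isomorphism matches the
induced filtrations, so the slopes are equal. -/
theorem stableDMP_of_inverse (hfg : LocFree.Hom.comp f.toHom g.toHom = LocFree.Hom.id M.bdl)
    (hgf : LocFree.Hom.comp g.toHom f.toHom = LocFree.Hom.id N.bdl)
    (hM : stableDMP S M) : stableDMP S N := by
  have htop : M.pdeg (fun _ => ⊤) = N.pdeg fun _ => ⊤ := pdeg_comap hfg hgf fun _ => ⊤
  refine ⟨fun s V hV hI h0 hr => ?_, htop ▸ hM.2⟩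
  have h1 := hM.1 s _ (isSubbundle_comap hfg hgf hV) (invariant_comap hI) h0 hr
  rwa [pdeg_comap hfg hgf, htop] at h1

/-- An object of `DMP` is only isomorphic to one of the form `toDMP`, so stability has to pass along
isomorphisms before the equivalence can be restricted. -/
instance : (stableDMP S).IsClosedUnderIsomorphisms where
  of_iso {M N} i hM := by
    let f : DMPHom M N := i.hom
    let g : DMPHom N M := i.inv
    have h1 : LocFree.Hom.comp f.toHom g.toHom = LocFree.Hom.id M.bdl :=
      congrArg (fun φ : DMPHom M M => φ.toHom) i.hom_inv_id
    have h2 : LocFree.Hom.comp g.toHom f.toHom = LocFree.Hom.id N.bdl :=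
      congrArg (fun φ : DMPHom N N => φ.toHom) i.inv_hom_id
    exact stableDMP_of_inverse h1 h2 hM

end DMP

theorem HP.inverseImage_stableDMP {S : SingData} (hS : S.ResonanceFree) :
    (stableDMP S).inverseImage (HP.equivalenceDMP hS).functor = stableHP S := by
  ext X
  exact HP.stableDMP_toDMP_iff

end ParConn

end

open CategoryTheory ParConn in
/-- For resonance-free parameters, the functor that sends a holomorphic bundle with meromorphic
connection and parabolic structure to its meromorphic bundle with the induced parabolic structure
is an equivalence of `HP` and `DMP`, and it restricts to an equivalence of the full subcategories
of stable objects of parabolic degree zero. -/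
theorem proposition4p1 (S : SingData) (hS : S.ResonanceFree) :
    ∃ (e : HP S ≌ DMP S) (φ : HP.toFlatFunctor S ≅ e.functor ⋙ DMP.forget S),
      (∀ X : HP S, IsInduced X (e.functor.obj X) (φ.app X)) ∧
      ∃ e₀ : (stableHP S).FullSubcategory ≌ (stableDMP S).FullSubcategory,
        Nonempty (e₀.functor ⋙ (stableDMP S).ι ≅ (stableHP S).ι ⋙ e.functor) := by
  refine ⟨HP.equivalenceDMP hS, HP.toFlatIso hS, fun X => HP.isInduced_toDMP hS X,
    (HP.equivalenceDMP hS).congrFullSubcategory (HP.inverseImage_stableDMP hS), ⟨Iso.refl _⟩⟩
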